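/- Let $p\neq\ell$ be primes, $L/\mathbb Q_p$ a finite extension with residue field of order $q$, $G_L$ its absolute Galois group, $I_L$ the inertia subgroup, and $\widetilde P_L$ the kernel of the map from $I_L$ to its maximal pro-$\ell$ quotient. Let $\varphi\in G_L$ be a lift of the arithmetic Frobenius and $\sigma\in I_L$ a topological generator of $I_L/\widetilde P_L$. Let $E/\mathbb Q_\ell$ be a finite extension with ring of integers $\mathcal O$ and residue field $\mathbb F$. Let $n\ge 1$ and assume that $q$ is banal: $q\not\equiv 0$ and $q^i\not\equiv 1\pmod \ell$ for $i=1,\dots,n$. Let $\bar r:G_L\to \mathrm{GL}_n(\mathbb F)$ be continuous with $\bar r(\widetilde P_L)=1$ and $\bar r(\sigma)$ unipotent, and assume that all eigenvalues of $\bar r(\varphi)$ lie in $\mathbb F$. Let $R^\square(\bar r)$ be the complete Noetherian local $\mathcal O$-algebra with residue field $\mathbb F$ that pro-represents the functor of continuous lifts of $\bar r$ to Artinian local $\mathcal O$-algebras with residue field $\mathbb F$ (it exists). For an unordered partition $\underline m=(m_1,\dots,m_c)$ of $n$ let $N_{\underline m}$ be the nilpotent matrix with Jordan blocks of sizes $m_1,\dots,m_c$,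 and let $R^\square(\bar r,\mathrm{st}_{\underline m})$ be the quotient of $R^\square(\bar r)$ by the ideal of elements vanishing at all points $x:R^\square(\bar r)\to\overline E$ for which the Weil--Deligne representation of the associated $r_x:G_L\to\mathrm{GL}_n(\overline E)$ has inertial type $(\mathbf 1,N_{\underline m})$, i.e. is trivial on $I_L$ with monodromy operator conjugate to $N_{\underline m}$. Write the set of eigenvalues of $\bar r(\varphi)$ as $\bigsqcup_{\alpha=1}^d\{\bar\lambda^{(\alpha)},\bar\lambda^{(\alpha)}q,\dots,\bar\lambda^{(\alpha)}q^{k_\alpha-1}\}$ with $\bar\lambda^{(\alpha)}\neq\bar\lambda^{(\beta)}q^i$ for $\alpha\ne\beta$ and $0\le i\le k_\beta$. Let $n_i^{(\alpha)}$ be the algebraic multiplicity of $\bar\lambda^{(\alpha)}q^{k_\alpha-i}$ for $1\le i\le k_\alpha$, and put $\underline n^{(\alpha)}=(n^{(\alpha)}_1,\dots,n^{(\alpha)}_{k_\alpha})$. After a change of basis, $\bar r(\varphi)$ is block diagonal with blocks $\bar\lambda^{(\alpha)}q^{k_\alpha-i}\,\overline U_i^{(\alpha)}$, where $\overline U^{(\alpha)}_i$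 is unipotent of size $n_i^{(\alpha)}$; let $\overline N^{(\alpha)}_{i,i+1}$ be the block of $\log\bar r(\sigma)$ in this basis with rows indexed by $(\alpha,i)$ and columns by $(\alpha,i+1)$. For $\underline n=(n_1,\dots,n_k)$ let $\mathcal N^{\underline n}$ be the affine $\mathcal O$-scheme of tuples $(X_1,N_1,X_2,\dots,N_{k-1},X_k)$ with $X_i$ of size $n_i\times n_i$, $N_i$ of size $n_i\times n_{i+1}$ and $X_iN_i=N_iX_{i+1}$ for all $i$. Let $\mathscr I^{\underline n}$ be the set of arrays $P=(d_{ij})_{i\ge 1,\ j\ge 1,\ i+j\le k}$ of non-negative integers such that, putting $d_{0j}=n_j$, one has $d_{ij}\le\min(d_{i-1,j},d_{i-1,j+1})$ for all $i\geq 1$, and $d_{ij}+d_{i,j+1}\le d_{i+1,j}+d_{i-1,j+1}$ for all $i\ge 1$ and $1\le j<k-i$. Let $\mathcal N^{\underline n}(P)$ be the Zariski closure in $\mathcal N^{\underline n}$ of the set of $\overline E$-points with $\operatorname{rank}(N_jN_{j+1}\cdots N_{i+j-1})=d_{ij}$ for all $i,j$. For a partition $\underline m$ of $\sum_j n_j$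 let $\mathcal N^{\underline n}(\mathrm{st}_{\underline m})$ be the union of the $\mathcal N^{\underline n}(P)$ over those $P\in\mathscr I^{\underline n}$ with $\sum_{j=1}^{k-i}d_{ij}=\sum_a\max\{m_a-i,0\}$ for all $i\ge 0$. For a partition $\underline m$ of $n$ put $$\mathscr N^{\underline n^{(1)};\dots;\underline n^{(d)}}(\mathrm{st}_{\underline m})=\bigcup_{\bigcup_\alpha\underline m^{(\alpha)}=\underline m}\mathcal N^{\underline n^{(1)}}(\mathrm{st}_{\underline m^{(1)}})\times_{\mathcal O}\cdots\times_{\mathcal O}\mathcal N^{\underline n^{(d)}}(\mathrm{st}_{\underline m^{(d)}}),$$ where $\underline m^{(\alpha)}$ runs over partitions of $\sum_i n^{(\alpha)}_i$, and let $x=(x^{(1)},\dots,x^{(d)})$ with $$x^{(\alpha)}=\bigl(\overline U_1^{(\alpha)}-1,\overline N^{(\alpha)}_{12},\overline U_2^{(\alpha)}-1,\dots,\overline N^{(\alpha)}_{k_\alpha-1,k_\alpha},\overline U_{k_\alpha}^{(\alpha)}-1\bigr)\in\mathcal N^{\underline n^{(\alpha)}}(\mathbb F).$$ Theorem. For every unordered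 partition $\underline m$ of $n$ there is an isomorphism of $\mathcal O$-algebras $$R^\square(\bar r,\mathrm{st}_{\underline m})\;\cong\;R_x(\mathrm{st}_{\underline m})\bigl[\bigl[t_1,\dots,t_{N}\bigr]\bigr],\qquad N=n^2-\sum_\alpha\sum_i\bigl(n_i^{(\alpha)}\bigr)^2,$$ where $R_x(\mathrm{st}_{\underline m})$ is the complete local ring of $\mathscr N^{\underline n^{(1)};\dots;\underline n^{(d)}}(\mathrm{st}_{\underline m})$ at the $\mathbb F$-point $x$ (the zero ring if $x$ does not lie on it). -/

import Mathlib

open IsLocalRing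

universe u v

noncomputable section

namespace BanalModel

/-! ### `p`-adic fields, their Galois groups, inertia, Frobenius -/

section Local

variable (p : ℕ) [Fact p.Prime]

instance isAlgebraic_algebraicClosure (K : Type*) [Field K] [Algebra ℚ_[p] K]
    [Algebra.IsAlgebraic ℚ_[p] K] : Algebra.IsAlgebraic ℚ_[p] (AlgebraicClosure K) :=
  Algebra.IsAlgebraic.trans ℚ_[p] K (AlgebraicClosure K)

/-- The valuation ring `𝒪_K` of an algebraic extension `K` of `ℚ_p`: the elements of absolute value
at most `1` for the unique extension to `K` of the `p`-adic absolute value (the spectral norm). -/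
def integers (K : Type*) [Field K] [Algebra ℚ_[p] K] [Algebra.IsAlgebraic ℚ_[p] K] :
    ValuationSubring K where
  carrier := {x | spectralNorm ℚ_[p] K x ≤ 1}
  mul_mem' {x y} hx hy := by
    have h : spectralNorm ℚ_[p] K (x * y) = spectralNorm ℚ_[p] K x * spectralNorm ℚ_[p] K y :=
      map_mul (spectralMulAlgNorm ℚ_[p] K) x y
    change spectralNorm ℚ_[p] K (x * y) ≤ 1
    rw [h]
    exact mul_le_one₀ hx (spectralNorm_nonneg y) hy
  one_mem' := (spectralNorm_one (K := ℚ_[p]) (L := K)).le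
  add_mem' {x y} hx hy :=
    (isNonarchimedean_spectralNorm (K := ℚ_[p]) (L := K) x y).trans (max_le hx hy)
  zero_mem' := by
    change spectralNorm ℚ_[p] K 0 ≤ 1
    rw [spectralNorm_zero]
    exact zero_le_one
  neg_mem' {x} hx := by
    change spectralNorm ℚ_[p] K (-x) ≤ 1
    rw [spectralNorm_neg (Algebra.IsAlgebraic.isAlgebraic x)]
    exact hx
  mem_or_inv_mem' x := by
    have h : spectralNorm ℚ_[p] K x⁻¹ = (spectralNorm ℚ_[p] K x)⁻¹ :=
      map_inv₀ (spectralMulAlgNorm ℚ_[p] K) x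
    change spectralNorm ℚ_[p] K x ≤ 1 ∨ spectralNorm ℚ_[p] K x⁻¹ ≤ 1
    rw [h]
    rcases le_total (spectralNorm ℚ_[p] K x) 1 with h1 | h1
    · exact Or.inl h1
    · exact Or.inr (inv_le_one_of_one_le₀ h1)

variable (L : Type v) [Field L] [Algebra ℚ_[p] L] [Algebra.IsAlgebraic ℚ_[p] L]

/-- The order `q` of the residue field of `L`. -/
def residueCard : ℕ := Nat.card (ResidueField (integers p L))

/-- The absolute Galois group `G_L` (with the Krull topology). -/
abbrev GalGroup (L : Type v) [Field L] : Type v := AlgebraicClosure L ≃ₐ[L] AlgebraicClosure L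

/-- The inertia subgroup `I_L` of `G_L`. -/
def inertia : Subgroup (GalGroup L) :=
  ((integers p (AlgebraicClosure L)).inertiaSubgroup L).map
    ((integers p (AlgebraicClosure L)).decompositionSubgroup L).subtype

/-- The kernel of the map from `I_L` to its maximal pro-`ℓ` quotient. -/
def tildeWild (ℓ : ℕ) : Subgroup (inertia p L) :=
  sInf {H : Subgroup (inertia p L) |
    H.Normal ∧ IsOpen (H : Set (inertia p L)) ∧ ∃ k : ℕ, H.index = ℓ ^ k}

/-- `φ` is a lift to `G_L` of the arithmetic Frobenius: it acts as `x ↦ x ^ q` on the residue field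
of the algebraic closure of `L`. -/
def IsArithFrobenius (φ : GalGroup L) : Prop :=
  ∀ x ∈ integers p (AlgebraicClosure L),
    (integers p (AlgebraicClosure L)).valuation (φ x - x ^ residueCard p L) < 1

/-- `σ ∈ I_L` maps to a topological generator of the maximal pro-`ℓ` quotient of `I_L`. -/
def IsTameGenerator (ℓ : ℕ) (σ : inertia p L) : Prop :=
  (Subgroup.zpowers σ ⊔ tildeWild p L ℓ).topologicalClosure = ⊤

/-- The Weil group of `L`, generated by inertia and a Frobenius lift `φ`. -/
def weilGroup (φ : GalGroup L) : Subgroup (GalGroup L) := inertia p L ⊔ Subgroup.zpowers φ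

end Local

/-- `q` is banal (for dimension `n` and the prime `ℓ`). -/
def IsBanal (ℓ q n : ℕ) : Prop :=
  ¬ q ≡ 0 [MOD ℓ] ∧ ∀ i : ℕ, 1 ≤ i → i ≤ n → ¬ q ^ i ≡ 1 [MOD ℓ]

/-! ### Matrices -/

section Matrices

variable {K : Type*} [Field K]

/-- The truncated logarithm of a unipotent `n × n` matrix. -/
def unipLog {n : ℕ} (X : Matrix (Fin n) (Fin n) K) : Matrix (Fin n) (Fin n) K :=
  ∑ k ∈ Finset.Icc 1 n, ((-1) ^ (k - 1) * (k : K)⁻¹) • (X - 1) ^ k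

/-- The truncated exponential of a nilpotent `n × n` matrix. -/
def nilpExp {n : ℕ} (N : Matrix (Fin n) (Fin n) K) : Matrix (Fin n) (Fin n) K :=
  ∑ k ∈ Finset.range (n + 1), ((k.factorial : K)⁻¹) • N ^ k

/-- `A` and `B` are conjugate (up to the labelling of the rows and columns). -/
def Conjugate {ι κ : Type*} [Fintype ι] [Fintype κ] [DecidableEq ι] [DecidableEq κ]
    (A : Matrix ι ι K) (B : Matrix κ κ K) : Prop :=
  ∃ (S : Matrix ι κ K) (T : Matrix κ ι K), S * T = 1 ∧ T * S = 1 ∧ A = S * B * T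

/-- The nilpotent matrix `N_m`, block diagonal with one nilpotent upper triangular Jordan block for
each part of the partition `m`. -/
def jordanMatrix (K : Type*) [Field K] {n : ℕ} (m : n.Partition) :
    Matrix (Σ a : Fin (m.parts.sort (· ≥ ·)).length, Fin ((m.parts.sort (· ≥ ·)).get a))
      (Σ a : Fin (m.parts.sort (· ≥ ·)).length, Fin ((m.parts.sort (· ≥ ·)).get a)) K :=
  Matrix.blockDiagonal' fun _ => Matrix.of fun i j => if (i : ℕ) + 1 = j then 1 else 0

end Matrices

/-! ### Weil--Deligne representations and inertial types -/

section WeilDeligne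

variable (p : ℕ) [Fact p.Prime] (L : Type v) [Field L] [Algebra ℚ_[p] L]
  [Algebra.IsAlgebraic ℚ_[p] L]

/-- An `n`-dimensional Weil--Deligne representation of `L` over a field `K`. Continuity of `r` is
for the discrete topology on `K`: it means that `r` is trivial on an open subgroup of `I_L`. -/
structure WeilDeligneRep (φ : GalGroup L) (n : ℕ) (K : Type*) [Field K] where
  /-- the representation of the Weil group -/
  r : weilGroup p L φ →* Matrix.GeneralLinearGroup (Fin n) K
  /-- the monodromy operator -/
  N : Matrix (Fin n) (Fin n) K
  continuous_r : ∃ V : Subgroup (GalGroup L), IsOpen (V : Set (GalGroup L)) ∧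
    ∀ w : weilGroup p L φ, (w : GalGroup L) ∈ inertia p L → (w : GalGroup L) ∈ V → r w = 1
  nilpotent_N : IsNilpotent N
  inertia_comm : ∀ w : weilGroup p L φ, (w : GalGroup L) ∈ inertia p L →
    N * (r w : Matrix (Fin n) (Fin n) K) = r w * N
  frobenius_comm : ∀ w : weilGroup p L φ, (w : GalGroup L) = φ →
    (r w : Matrix (Fin n) (Fin n) K) * N = (residueCard p L : K) • (N * r w)

variable {p L}

/-- `D` is the Weil--Deligne representation attached to `ρ : G_L → GL_n(K)`, `K` an extension of
`ℚ_ℓ`, where `t : I_L → ℤ_ℓ` is a surjection (unique up to a unit of `ℤ_ℓ`):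
`ρ (φ ^ k u) = r (φ ^ k u) exp (t(u) N)` for `k ∈ ℤ` and `u ∈ I_L`. -/
def WeilDeligneRep.IsAttachedTo {φ : GalGroup L} {n : ℕ} {K : Type*} [Field K]
    (D : WeilDeligneRep p L φ n K) {ℓ : ℕ} [Fact ℓ.Prime] [Algebra ℚ_[ℓ] K]
    (t : inertia p L →* Multiplicative ℤ_[ℓ])
    (ρ : GalGroup L →* Matrix.GeneralLinearGroup (Fin n) K) : Prop :=
  ∀ (w : weilGroup p L φ) (k : ℤ) (u : inertia p L), (w : GalGroup L) = φ ^ k * u →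
    (ρ w : Matrix (Fin n) (Fin n) K) =
      D.r w * nilpExp (algebraMap ℚ_[ℓ] K ((t u).toAdd : ℤ_[ℓ]) • D.N)

/-- `D` has inertial type `τ_m = (𝟙, N_m)`. -/
def WeilDeligneRep.HasUnipotentType {φ : GalGroup L} {n : ℕ} {K : Type*} [Field K]
    (D : WeilDeligneRep p L φ n K) (m : n.Partition) : Prop :=
  (∀ w : weilGroup p L φ, (w : GalGroup L) ∈ inertia p L → D.r w = 1) ∧
    Conjugate D.N (jordanMatrix K m)

/-- The representation `ρ : G_L → GL_n(K)` has inertial type `τ_m`. -/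
def HasUnipotentType (φ : GalGroup L) (ℓ : ℕ) [Fact ℓ.Prime] {n : ℕ} {K : Type*} [Field K]
    [Algebra ℚ_[ℓ] K] (ρ : GalGroup L →* Matrix.GeneralLinearGroup (Fin n) K)
    (m : n.Partition) : Prop :=
  ∃ t : inertia p L →* Multiplicative ℤ_[ℓ], Continuous t ∧ Function.Surjective t ∧
    ∃ D : WeilDeligneRep p L φ n K, D.IsAttachedTo t ρ ∧ D.HasUnipotentType m

end WeilDeligne

/-! ### Framed deformation rings -/

section Deformation

variable {O : Type u} [CommRing O] [IsLocalRing O] {G : Type v} [Group G] [TopologicalSpace G]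
  {n : ℕ}

/-- The local `O`-algebra `A` has the same residue field as `O`. -/
def HasSameResidueField (O : Type u) [CommRing O] [IsLocalRing O] (A : Type u) [CommRing A]
    [IsLocalRing A] [Algebra O A] [IsLocalHom (algebraMap O A)] : Prop :=
  Function.Bijective (ResidueField.map (algebraMap O A))

/-- `r : G → GL_n(A)` is a lift of `rbar`, continuous for the `𝔪_A`-adic topology. -/
def IsContinuousLift (rbar : G →* Matrix.GeneralLinearGroup (Fin n) (ResidueField O))
    {A : Type u} [CommRing A] [IsLocalRing A] [Algebra O A] [IsLocalHom (algebraMap O A)]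
    (r : G →* Matrix.GeneralLinearGroup (Fin n) A) : Prop :=
  (Matrix.GeneralLinearGroup.map (residue A)).comp r =
      (Matrix.GeneralLinearGroup.map (ResidueField.map (algebraMap O A))).comp rbar ∧
    ∀ k : ℕ, IsOpen (((Matrix.GeneralLinearGroup.map
      (Ideal.Quotient.mk (maximalIdeal A ^ k))).comp r).ker : Set G)

/-- `R` is the framed deformation ring `R^□(rbar)`, with universal lift `ρ`: `R` is a complete
Noetherian local `O`-algebra with the residue field of `O`, and it pro-represents the functor of
continuous lifts of `rbar` on Artinian local `O`-algebras with that residue field. (An `O`-algebra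
homomorphism between such rings is automatically local.) -/
structure IsFramedDeformationRing
    (rbar : G →* Matrix.GeneralLinearGroup (Fin n) (ResidueField O))
    (R : Type u) [CommRing R] [IsLocalRing R] [Algebra O R] [IsLocalHom (algebraMap O R)]
    (ρ : G →* Matrix.GeneralLinearGroup (Fin n) R) : Prop where
  noetherian : IsNoetherianRing R
  complete : IsAdicComplete (maximalIdeal R) R
  residueField : HasSameResidueField O R
  lift : IsContinuousLift rbar ρ
  universal : ∀ (A : Type u) [CommRing A] [IsLocalRing A] [IsArtinianRing A] [Algebra O A]
    [IsLocalHom (algebraMap O A)], HasSameResidueField O A →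
    ∀ r : G →* Matrix.GeneralLinearGroup (Fin n) A, IsContinuousLift rbar r →
      ∃! f : R →ₐ[O] A, (Matrix.GeneralLinearGroup.map (f : R →+* A)).comp ρ = r

end Deformation

section FixedType

variable {p : ℕ} [Fact p.Prime] {L : Type v} [Field L] [Algebra ℚ_[p] L]
  [Algebra.IsAlgebraic ℚ_[p] L]

/-- The ideal of functions on `Spec R` that vanish at all `K`-points `x` such that `r_x` has type
`τ_m`; it defines the Zariski closure of this set of points with its reduced structure. -/
def fixedTypeIdeal (φ : GalGroup L) (ℓ : ℕ) [Fact ℓ.Prime] (O : Type u) [CommRing O]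
    (K : Type u) [Field K] [Algebra ℚ_[ℓ] K] [Algebra O K] {n : ℕ}
    {R : Type u} [CommRing R] [Algebra O R] (ρ : GalGroup L →* Matrix.GeneralLinearGroup (Fin n) R)
    (m : n.Partition) : Ideal R :=
  ⨅ x ∈ {x : R →ₐ[O] K | HasUnipotentType (p := p) φ ℓ
    ((Matrix.GeneralLinearGroup.map (x : R →+* K)).comp ρ) m}, RingHom.ker x

end FixedType

/-! ### The local models

An ordered partition `(n_1, …, n_k)` is given by `k` and `ν : ℕ → ℕ` with `n_{i+1} = ν i` for
`i < k` (the other values of `ν` are not used); all indices are shifted so as to start at `0`. -/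

section Chain

variable (k : ℕ) (ν : ℕ → ℕ)

/-- The coordinates on the space of tuples `(X_1, N_1, X_2, …, N_{k-1}, X_k)` where `X_i` is an
`n_i × n_i` matrix and `N_i` is an `n_i × n_{i+1}` matrix. -/
abbrev ChainVar : Type :=
  (Σ i : Fin k, Fin (ν i) × Fin (ν i)) ⊕ (Σ i : {i : ℕ // i + 1 < k}, Fin (ν i) × Fin (ν (i + 1)))

variable {k ν} {S : Type*} [CommRing S]

/-- The matrix `X_i` of a tuple. -/
def matX (y : ChainVar k ν → S) (i : ℕ) : Matrix (Fin (ν i)) (Fin (ν i)) S :=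
  Matrix.of fun a b => if h : i < k then y (Sum.inl ⟨⟨i, h⟩, a, b⟩) else 0

/-- The matrix `N_i` of a tuple. -/
def matN (y : ChainVar k ν → S) (i : ℕ) : Matrix (Fin (ν i)) (Fin (ν (i + 1))) S :=
  Matrix.of fun a b => if h : i + 1 < k then y (Sum.inr ⟨⟨i, h⟩, a, b⟩) else 0

/-- The tuple `y` is an `S`-point of the scheme `𝒩^n`, that is, `X_i N_i = N_i X_{i+1}` for all
`i`. -/
def IsChainPoint (y : ChainVar k ν → S) : Prop :=
  ∀ i, i + 1 < k → matX y i * matN y i = matN y i * matX y (i + 1)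

/-- The product `N_j N_{j+1} ⋯ N_{j+i-1}` of `i` matrices. -/
def chainProd (N : ∀ i : ℕ, Matrix (Fin (ν i)) (Fin (ν (i + 1))) S) (j : ℕ) :
    ∀ i : ℕ, Matrix (Fin (ν j)) (Fin (ν (j + i))) S
  | 0 => (1 : Matrix (Fin (ν j)) (Fin (ν j)) S)
  | i + 1 => chainProd N j i * N (j + i)

variable (k ν)

/-- The set `ℐ^n` of rank data `(d_{ij})`. -/
def rankData : Set (ℕ → ℕ → ℕ) :=
  {d | (∀ j, j < k → d 0 j = ν j) ∧
    (∀ i j, k ≤ j + i → d i j = 0) ∧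
    (∀ i j, d (i + 1) j ≤ min (d i j) (d i (j + 1))) ∧
    (∀ i j, j + (i + 2) < k → d (i + 1) j + d (i + 1) (j + 1) ≤ d (i + 2) j + d i (j + 1))}

/-- The set `ℐ^n(st_m)` of rank data of type `st_m` (the subtraction is truncated:
`a - i = max (a - i) 0`). -/
def rankDataOfType (m : Multiset ℕ) : Set (ℕ → ℕ → ℕ) :=
  {d ∈ rankData k ν | ∀ i, ∑ j ∈ Finset.range (k - i), d i j = (m.map fun a => a - i).sum}

variable (O : Type u) [CommRing O] (K : Type u) [Field K] [Algebra O K]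

/-- The ideal of the component `𝒩^n(P)`, the Zariski closure of the set of those `K`-points
`(X_1, N_1, …, X_k)` of `𝒩^n` with `rank (N_j ⋯ N_{j+i-1}) = d_{ij}`, where `P = (d_{ij})`. -/
def componentIdeal (P : ℕ → ℕ → ℕ) : Ideal (MvPolynomial (ChainVar k ν) O) :=
  ⨅ y ∈ {y : ChainVar k ν → K | IsChainPoint y ∧
    ∀ i j, j + i < k → (chainProd (matN y) j i).rank = P i j},
    RingHom.ker (MvPolynomial.aeval (R := O) y)

/-- The ideal of `𝒩^n(st_m)`, the union of the `𝒩^n(P)` for `P` of type `st_m`. -/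
def chainTypeIdeal (m : Multiset ℕ) : Ideal (MvPolynomial (ChainVar k ν) O) :=
  ⨅ P ∈ rankDataOfType k ν m, componentIdeal k ν O K P

end Chain

section Product

variable {d : ℕ} (k : Fin d → ℕ) (ν : Fin d → ℕ → ℕ)

/-- The coordinates on the product of the spaces of tuples attached to `n^(1), …, n^(d)`. -/
abbrev ProdVar : Type := Σ α : Fin d, ChainVar (k α) (ν α)

variable (O : Type u) [CommRing O] (K : Type u) [Field K] [Algebra O K]

/-- The ideal of `𝒩^{n^(1); …; n^(d)}(st_m)` in the coordinate ring of affine space: the union, over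
all families of partitions `m^(α)` of `n^(α)` whose union is `m`, of the products over `O` of the
schemes `𝒩^{n^(α)}(st_{m^(α)})`. -/
def modelIdeal {n : ℕ} (m : n.Partition) : Ideal (MvPolynomial (ProdVar k ν) O) :=
  ⨅ μ ∈ {μ : ∀ α, (∑ i ∈ Finset.range (k α), ν α i).Partition | ∑ α, (μ α).parts = m.parts},
    ⨆ α, (chainTypeIdeal (k α) (ν α) O K (μ α).parts).map
      (MvPolynomial.rename (R := O) (Sigma.mk (β := fun α => ChainVar (k α) (ν α)) α))

/-- The coordinate ring of `𝒩^{n^(1); …; n^(d)}(st_m)`. -/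
abbrev ModelRing {n : ℕ} (m : n.Partition) : Type u :=
  MvPolynomial (ProdVar k ν) O ⧸ modelIdeal k ν O K m

/-- The ideal of the coordinate ring of `𝒩^{n^(1); …; n^(d)}(st_m)` defining the closed point `x`
over the residue field of `O`; it is the unit ideal if `x` is not a point of the scheme. -/
def pointIdeal [IsLocalRing O] {n : ℕ} (m : n.Partition) (x : ProdVar k ν → ResidueField O) :
    Ideal (ModelRing k ν O K m) :=
  (RingHom.ker (MvPolynomial.aeval (R := O) x)).map (Ideal.Quotient.mk (modelIdeal k ν O K m))

/-- The complete local ring of `𝒩^{n^(1); …; n^(d)}(st_m)` at `x`; it is the zero ring if `x` is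
not a point of the scheme. -/
abbrev CompleteLocalRing [IsLocalRing O] {n : ℕ} (m : n.Partition)
    (x : ProdVar k ν → ResidueField O) : Type u :=
  AdicCompletion (pointIdeal k ν O K m x) (ModelRing k ν O K m)

end Product

/-! ### The point attached to a residual representation -/

/-- A decomposition of the invertible matrix `Φ` over `F` into generalized eigenspaces, after a
change of basis with matrix `T`. The eigenvalues of `Φ` are grouped into maximal chains
`lam α, lam α * q, …, lam α * q ^ (k α - 1)`; the block of index `(α, i)`, with `i` starting
at `0`, belongs to `lam α * q ^ (k α - 1 - i)` and has size `ν α i`, the algebraic multiplicity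
of this eigenvalue. -/
structure FrobeniusBlocks {F : Type*} [Field F] (q : ℕ) {n : ℕ} (Φ : Matrix (Fin n) (Fin n) F) where
  d : ℕ
  k : Fin d → ℕ
  ν : Fin d → ℕ → ℕ
  lam : Fin d → F
  k_pos : ∀ α, 0 < k α
  ν_pos : ∀ α i, i < k α → 0 < ν α i
  lam_ne_zero : ∀ α, lam α ≠ 0
  lam_separated : ∀ α β, α ≠ β → ∀ i, i ≤ k β → lam α ≠ lam β * (q : F) ^ i
  U : ∀ s : (Σ α, Fin (k α)), Matrix (Fin (ν s.1 s.2)) (Fin (ν s.1 s.2)) F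
  U_unipotent : ∀ s, IsNilpotent (U s - 1)
  T : Matrix (Fin n) (Σ s : (Σ α, Fin (k α)), Fin (ν s.1 s.2)) F
  Tinv : Matrix (Σ s : (Σ α, Fin (k α)), Fin (ν s.1 s.2)) (Fin n) F
  T_mul_Tinv : T * Tinv = 1
  Tinv_mul_T : Tinv * T = 1
  eq_conj : Φ = T * Matrix.blockDiagonal'
    (fun s => (lam s.1 * (q : F) ^ (k s.1 - 1 - (s.2 : ℕ))) • U s) * Tinv

namespace FrobeniusBlocks

variable {F : Type*} [Field F] {q n : ℕ} {Φ : Matrix (Fin n) (Fin n) F}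

/-- The point `x = (x^(1), …, x^(d))`, where `x^(α)` consists of the matrices `U_i^(α) - 1` and of
the blocks `(i, i + 1)` of the matrix `N` in the new basis. -/
def point (B : FrobeniusBlocks q Φ) (N : Matrix (Fin n) (Fin n) F) : ProdVar B.k B.ν → F
  | ⟨α, Sum.inl ⟨i, a, b⟩⟩ => (B.U ⟨α, i⟩ - 1) a b
  | ⟨α, Sum.inr ⟨i, a, b⟩⟩ => (B.Tinv * N * B.T) ⟨⟨α, ⟨i, Nat.lt_of_succ_lt i.2⟩⟩, a⟩
      ⟨⟨α, ⟨i + 1, i.2⟩⟩, b⟩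

/-- The number `n² - ∑_α ∑_i (n_i^(α))²` of power series variables. -/
def numVars (B : FrobeniusBlocks q Φ) : ℕ :=
  n ^ 2 - ∑ α, ∑ i ∈ Finset.range (B.k α), B.ν α i ^ 2

end FrobeniusBlocks

end BanalModel

end

noncomputable section

namespace BanalModel

set_option linter.unusedSectionVars false
open AddMonoidHom (toMultiplicative)
open AddSubmonoidClass (coe_finsetSum)
open AdicCompletion (evalₐ flat_of_isNoetherian isAdicComplete_self isMaximal_map_of_le map_of of_surjective_iff piEquivOfFintype)
open AdicCompletion.Ideal (mk_eq_mk)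
open AlgHom (ofLinearMap)
open Algebra (FiniteType ofId smul_def)
open Algebra.FiniteType (isNoetherianRing of_restrictScalars_finiteType)
open Algebra.IsIntegral (isIntegral)
open Algebra.TensorProduct (includeLeft includeRight lift_tmul tmul_mul_tmul)
open Dvd.dvd (mul_left)
open FaithfulSMul (algebraMap_injective)
open Finset (Icc induction_on mem_filter mem_image mem_insert mem_range mem_univ mul_sum range sum_congr sum_eq_single sum_eq_zero sum_nonneg sum_range_succ sum_range_succ' univ)
open Fintype (card card_fin linearCombination ofFinite sum_sigma)
open Function (Injective Surjective extend extend_apply')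
open Function.Injective (of_comp sumElim)
open HasEnoughRootsOfUnity (exists_primitiveRoot)
open Ideal (mem_map_of_mem map_le_iff_le_comap le_comap_pow map_mono map_span mem_comap mem_iInf mem_span_singleton_self mk_ker mul_mem_left mul_mem_mul mul_mem_right mul_top pow_le_pow_right pow_right_mono quotientMap span span_le)
open Ideal.Quotient (eq_zero_iff_mem factor factorPow factorₐ liftₐ mk_surjective mkₐ)
open IntermediateField (adjoin adjoin_le_iff finiteDimensional_adjoin fixedField mem_bot mem_fixedField_iff subset_adjoin)
open IsAbsoluteValue (abv_sum)
open IsAdicComplete (le_jacobson_bot)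
open IsHausdorff (haus)
open IsLocalRing.ResidueField (finite_of_finite residue_smul)
open IsNilpotent (isUnit_add_right_of_commute)
open IsNoetherianRing (of_finite)
open IsPrecomplete (map_algebraMap_iff prec)
open IsPrincipalIdealRing (principal)
open IsScalarTower (of_algebraMap_eq toAlgHom)
open IsUnit (of_mul_eq_one)
open LinearEquiv (comp_symm ofBijective symm_comp)
open LinearMap (range_comp range_domRestrict toMatrix' toMatrix'_comp toMatrix'_id toMatrix'_toLin')
open Matrix (adjugate_mul blockDiagonal' blockDiagonal'_apply_ne det_one diagonal_mul map_apply mulVecLin_mul mul_diagonal of_apply one_apply_ne rank_mul_le_left smul_mul toLin'_apply')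
open Module (finBasis)
open MonoidHom (comp_apply mem_ker)
open Multiplicative (ofAdd toAdd)
open Multiset (mem_sum)
open MvPolynomial (aeval aeval_C aeval_X aeval_rename algebraMap_eq comp_aeval eval eval_eq eval_eval₂ eval_map eval₂Hom eval₂Hom_C eval₂Hom_X' homogeneousComponent idealOfVars idealOfVars_fg mapAlgHom map_injective mem_support_iff rename rename_C rename_X ringHom_ext)
open MvPowerSeries (renameEquiv toAdicCompletionAlgEquiv)
open Nat (Coprime cast_ne_zero exists_eq_add_of_le le_succ lt_succ_iff one_lt_pow)
open Nat.ModEq (pow_totient)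
open PadicInt (cast_toZModPow ker_toZModPow toZModPow)
open Polynomial (coeff_map coeff_zero eval_C eval_X eval_add eval_eq_sum_range eval_finsetSum eval_mul eval_prod eval₂ eval₂_eq_sum_range map_map mem_roots)
open Ring (inverse)
open RingHom (coe_coe id_apply ker mapMatrix_apply map_det)
open SetLike (mem_coe)
open Sigma (fst)
open Subgroup (coe_mul isClosed_of_isOpen isOpen_mono zpowers zpowers_le)
open Submodule (map_comp mkQ_apply smul_mem span_induction span_mono subset_span)
open Subtype (val_injective)
open Sum (elim inl inr)
open TensorProduct (add_tmul)
open Units (inv_mul val_mul val_one val_pow_eq_pow_val)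
notation:max "Mat" ι:max => Matrix ι ι
notation "AC" => AlgebraicClosure
notation "Res(" O ", " A ")" => ResidueField.map (algebraMap O A)
notation "modId" => Ideal.Quotient.mk
notation "amap" => algebraMap
notation "maxId" => maximalIdeal
notation "ResF" => ResidueField
notation "MvPoly" => MvPolynomial
notation "AdicC" => AdicCompletion
notation:max "OpenKer " r:max => IsOpen (SetLike.coe (MonoidHom.ker r))
notation "mvX" => MvPolynomial.X
notation "mvC" => MvPolynomial.C
notation "GLmap" => Matrix.GeneralLinearGroup.map
notation "FinDim" => FiniteDimensional
notation "tower" => IsScalarTower.algebraMap_apply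
notation "peval" => Polynomial.aeval
notation "cfun" => DFunLike.congr_fun

section Completion

variable {A B : Type*} [CommRing A] [CommRing B] {I : Ideal A} {J : Ideal B}

/-- The map from the `I`-adic completion of `A` to `B / J ^ n` induced by `f : A → B`. -/
def evalMap (f : A →+* B) (hf : I ≤ J.comap f) (n : ℕ) : AdicC I A →+* B ⧸ J ^ n :=
  (quotientMap (J ^ n) f ((pow_right_mono hf n).trans (le_comap_pow f n))).comp (evalₐ I n : AdicC I A →+* A ⧸ I ^ n)

lemma factorPow_comp_evalMap (f : A →+* B) (hf : I ≤ J.comap f) {m n : ℕ} (hmn : m ≤ n) :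
    (factorPow J hmn).comp (evalMap f hf n) = evalMap f hf m := by
  ext x
  obtain ⟨x, rfl⟩ := AdicCompletion.mk_surjective I A x
  simp only [evalMap, RingHom.coe_comp, Function.comp_apply, coe_coe, AdicCompletion.evalₐ_mk, Ideal.quotientMap_mk]
  change modId (J ^ m) _ = modId (J ^ m) _
  rw [Ideal.Quotient.eq, ← map_sub]
  exact (pow_right_mono hf m).trans (le_comap_pow f m) (Ideal.Quotient.eq.1 (mk_eq_mk I hmn x))

/-- A ring homomorphism `f : A → B` with `f I ⊆ J` extends to the `I`-adic completion of `A` if `B`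
is `J`-adically complete. -/
def completionLift (f : A →+* B) (hf : I ≤ J.comap f) [IsAdicComplete J B] : AdicC I A →+* B :=
  IsAdicComplete.liftRingHom J (evalMap f hf) (factorPow_comp_evalMap f hf)

variable (f : A →+* B) (hf : I ≤ J.comap f) [IsAdicComplete J B]

@[simp]
lemma completionLift_algebraMap (x : A) : completionLift f hf (amap A (AdicC I A) x) = f x := by
  refine IsHausdorff.eq_iff_smodEq (I := J) |>.2 fun n => ?_
  rw [SModEq.sub_mem, smul_eq_mul, mul_top, ← Ideal.Quotient.eq, completionLift,
    IsAdicComplete.mk_liftRingHom, evalMap, RingHom.comp_apply]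
  exact congrArg _ ((evalₐ I n).commutes x)

/-- An element of the completion is congruent to an element of the ring modulo any power. -/
lemma exists_sub_mem_pow (hI : I.FG) (x : AdicC I A) (n : ℕ) : ∃ a : A, x - amap A _ a ∈ (I.map (amap A (AdicC I A))) ^ n := by
  obtain ⟨a, ha⟩ := mk_surjective (evalₐ I n x)
  refine ⟨a, ?_⟩
  rw [← Ideal.map_pow]
  have h := AdicCompletion.pow_smul_top_eq_ker_eval (I := I) (M := A) (n := n) hI
  have h3 : evalₐ I n (x - amap A _ a) = 0 := by
    rw [map_sub, AlgHom.commutes, ← ha]; exact sub_self _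
  have h2 : x - amap A _ a ∈ (AdicCompletion.eval I A n).ker := by
    rw [LinearMap.mem_ker, ← AdicCompletion.factor_evalₐ_eq_eval I _ (by simp), h3, map_zero]
  rwa [← h, Ideal.smul_top_eq_map] at h2

end Completion

section Noetherian

variable {A : Type*} [CommRing A] [IsNoetherianRing A] (I : Ideal A)

/-- The completion of a Noetherian ring is Noetherian. -/
lemma isNoetherianRing_adicCompletion : IsNoetherianRing (AdicC I A) := by
  obtain ⟨s, hs⟩ := (IsNoetherian.noetherian I : I.FG)
  have hcomp : IsAdicComplete (I.map (amap A (AdicC I A))) (AdicC I A) := isAdicComplete_self I (IsNoetherian.noetherian I)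
  let Ih := I.map (amap A (AdicC I A))
  let f : MvPoly s A →+* AdicC I A :=
    (amap A (AdicC I A)).comp (aeval (R := A) (fun i : s => (i : A))).toRingHom
  have hmap : (idealOfVars s A).map f = Ih := by
    rw [idealOfVars, map_span, ← Set.range_comp, show Ih = _ from congrArg (Ideal.map _) hs.symm,
      Ideal.submodule_span_eq, map_span, Set.image_eq_range]
    refine congrArg (span <| Set.range ·) (funext fun i => ?_)
    simp [f]
  have hf : idealOfVars s A ≤ Ih.comap f := by
    rw [← map_le_iff_le_comap, hmap]
  let F := completionLift f hf
  let V : Ideal (AdicC (idealOfVars s A) (MvPoly s A)) :=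
    (idealOfVars s A).map (amap (MvPoly s A) _)
  have hV : IsAdicComplete V (AdicC (idealOfVars s A) (MvPoly s A)) := isAdicComplete_self _ (idealOfVars_fg s A)
  have hVF : V.map F = Ih := by
    rw [Ideal.map_map]
    have h : F.comp (amap (MvPoly s A) _) = f := by ext a <;> simp [F]
    rw [h, hmap]
  have hsurj : Surjective F := by
    have : IsHausdorff (V.map F) (AdicC I A) := by rw [hVF]; infer_instance
    refine surjective_of_mk_map_comp_surjective (I := V) F fun y => ?_
    obtain ⟨y, rfl⟩ := mk_surjective y
    obtain ⟨a, ha⟩ := exists_sub_mem_pow (IsNoetherian.noetherian I) y 1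
    refine ⟨amap (MvPoly s A) _ (mvC a), .symm ?_⟩
    rw [RingHom.comp_apply, Ideal.Quotient.eq, hVF]
    simpa [F, f] using ha
  have h1 : IsNoetherianRing (AdicC (idealOfVars s A) (MvPoly s A)) :=
    isNoetherianRing_of_ringEquiv _ (toAdicCompletionAlgEquiv s A).toRingEquiv
  exact isNoetherianRing_of_surjective _ _ F hsurj

lemma isLocalRing_adicCompletion [I.IsMaximal] : IsLocalRing (AdicC I A) := by
  have := isMaximal_map_of_le I I le_rfl (IsNoetherian.noetherian I)
  have := isAdicComplete_self I (IsNoetherian.noetherian I)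
  exact isLocalRing_of_isAdicComplete_maximal (I.map (amap A (AdicC I A)))

lemma maximalIdeal_adicCompletion [I.IsMaximal] [IsLocalRing (AdicC I A)] : maxId (AdicC I A) = I.map (amap A (AdicC I A)) :=
  (IsLocalRing.eq_maximalIdeal (isMaximal_map_of_le I I le_rfl (IsNoetherian.noetherian I))).symm

end Noetherian

section Flat

open TensorProduct

variable {A B Q : Type*} [CommRing A] [CommRing B] [CommRing Q] [Algebra A B] [Algebra A Q]
  [Module.Flat A B]

lemma tmul_one_eq_zero_iff (J : Ideal A) {b : B} : b ⊗ₜ[A] (1 : A ⧸ J) = 0 ↔ b ∈ J.map (amap A B) := by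
  rw [← eq_zero_iff_mem, ← (Algebra.TensorProduct.quotIdealMapEquivTensorQuot B J).map_eq_zero_iff]
  rfl

/-- Over a flat algebra `B`, the ideal generated by the kernel of `A → Q` is the kernel
of `B → B ⊗ Q`. -/
lemma mem_map_ker_of_flat {b : B} (hb : b ⊗ₜ[A] (1 : Q) = 0) : b ∈ (ker (amap A Q)).map (amap A B) := by
  rw [← tmul_one_eq_zero_iff]
  refine Module.Flat.lTensor_preserves_injective_linearMap
    (Ideal.kerLiftAlg (ofId A Q)).toLinearMap (Ideal.kerLiftAlg_injective _) ?_
  exact (congrArg (b ⊗ₜ[A] ·) (map_one (Ideal.kerLiftAlg (ofId A Q)))).trans (hb.trans (map_zero _).symm)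

/-- Flat base change commutes with finite intersections of ideals. -/
lemma mem_map_iInf_of_flat {ι : Type*} [Finite ι] (J : ι → Ideal A) {b : B}
    (hb : ∀ i, b ∈ (J i).map (amap A B)) : b ∈ (⨅ i, J i).map (amap A B) := by
  classical
  have := ofFinite ι
  have hker : ker (amap A (∀ i, A ⧸ J i)) = ⨅ i, J i := by
    ext a
    rw [RingHom.mem_ker, mem_iInf, funext_iff]
    exact forall_congr' fun i => eq_zero_iff_mem
  refine hker ▸ mem_map_ker_of_flat ((TensorProduct.piRight A A B (fun i => A ⧸ J i)).injective ?_)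
  rw [map_zero]
  ext i
  rw [TensorProduct.piRight_apply, TensorProduct.piRightHom_tmul]
  exact (tmul_one_eq_zero_iff _).2 (hb i)

end Flat

section Precomplete

variable {A : Type*} [CommRing A] {I : Ideal A} {M N : Type*} [AddCommGroup M] [Module A M]
  [AddCommGroup N] [Module A N]

lemma isPrecomplete_of_surjective (f : M →ₗ[A] N) (hf : Surjective f) [IsPrecomplete I M] : IsPrecomplete I N := by
  rw [← of_surjective_iff]
  intro y
  obtain ⟨x, rfl⟩ := AdicCompletion.map_surjective I hf y
  obtain ⟨x, rfl⟩ := AdicCompletion.of_surjective I M x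
  exact ⟨f x, (map_of I f x).symm⟩

lemma isPrecomplete_pi {ι : Type*} [Finite ι] [IsPrecomplete I A] : IsPrecomplete I (ι → A) := by
  classical
  have := ofFinite ι
  rw [← of_surjective_iff]
  intro y
  choose x hx using fun j => AdicCompletion.of_surjective I A (piEquivOfFintype I (fun _ : ι => A) y j)
  refine ⟨x, (piEquivOfFintype I (fun _ : ι => A)).injective ?_⟩
  ext1 j
  rw [← hx j, AdicCompletion.piEquivOfFintype_apply]
  simp only [AdicCompletion.pi, LinearMap.pi_apply, map_of]
  rfl

end Precomplete

section Dense

variable {O S : Type*} [CommRing O] [CommRing S] [IsLocalRing S]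
  [IsNoetherianRing S] [Algebra O S]

/-- If `S` has the same residue field as `O`, then `S / 𝔪 ^ j` is a finite `O`-module. -/
lemma exists_finset_sub_mem_pow (hres : ∀ s : S, ∃ o : O, s - amap O S o ∈ maxId S)
    (j : ℕ) : ∃ G : Finset S, ∀ s : S, ∃ g ∈ Submodule.span O (G : Set S), s - g ∈ maxId S ^ j := by
  classical
  induction j with
  | zero => exact ⟨∅, fun s => ⟨0, zero_mem _, by simp⟩⟩
  | succ j ih =>
    obtain ⟨G, hG⟩ := ih
    obtain ⟨H, hH⟩ := (IsNoetherian.noetherian (maxId S ^ j) : (maxId S ^ j).FG)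
    refine ⟨G ∪ H, fun s => ?_⟩
    obtain ⟨g, hg, hg'⟩ := hG s
    obtain ⟨c, -, hc⟩ := Submodule.mem_span_finset.1 (hH.ge hg')
    choose o ho using hres
    refine ⟨g + ∑ a ∈ H, o (c a) • a, add_mem (span_mono (by simp) hg)
      (sum_mem fun a ha => smul_mem _ _ (subset_span (by simp [ha]))), ?_⟩
    rw [← sub_sub, ← hc, ← Finset.sum_sub_distrib]
    refine sum_mem fun a ha => ?_
    rw [smul_eq_mul, smul_def, ← sub_mul, pow_succ']
    exact mul_mem_mul (ho _) (hH.le (subset_span ha))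

/-- If `S / (ϖ, 𝔟)` is Artinian then `S / 𝔟` is a finite `O`-module, generated by the image of any
dense `O`-submodule. -/
lemma exists_finset_sub_mem [IsLocalRing O] [IsAdicComplete (maxId O) O] {ϖ : O}
    (hϖ : maxId O = span {ϖ}) (hloc : amap O S ϖ ∈ maxId S) (hres : ∀ s : S, ∃ o : O, s - amap O S o ∈ maxId S)
    (Λ : Submodule O S) (hΛ : ∀ (s : S) (j : ℕ), ∃ l ∈ Λ, s - l ∈ maxId S ^ j)
    (𝔟 : Ideal S) {j : ℕ} (h𝔟 : maxId S ^ j ≤ span {amap O S ϖ} ⊔ 𝔟) : ∃ G : Finset S, (G : Set S) ⊆ Λ ∧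
      ∀ s : S, ∃ g ∈ Submodule.span O (G : Set S), s - g ∈ 𝔟 := by
  classical
  by_cases htop : 𝔟 = ⊤
  · exact ⟨∅, by simp, fun s => ⟨0, zero_mem _, by simp [htop]⟩⟩
  obtain ⟨G0, hG0⟩ := exists_finset_sub_mem_pow hres j
  choose l hl hl' using fun s => hΛ s j
  let G := G0.image l
  have hGΛ : (G : Set S) ⊆ Λ := by
    intro x hx
    obtain ⟨y, -, rfl⟩ := mem_image.1 (Finset.mem_coe.1 hx)
    exact hl y
  have hG : ∀ s : S, ∃ g ∈ Submodule.span O (G : Set S), s - g ∈ maxId S ^ j := by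
    intro s
    obtain ⟨g, hg, hg'⟩ := hG0 s
    obtain ⟨c, -, rfl⟩ := Submodule.mem_span_finset.1 hg
    refine ⟨∑ a ∈ G0, c a • l a, sum_mem fun a ha => smul_mem _ _ (subset_span
      (Finset.mem_coe.2 (Finset.mem_image_of_mem l ha))), ?_⟩
    rw [← sub_add_sub_cancel]
    refine add_mem hg' ?_
    rw [← Finset.sum_sub_distrib]
    refine sum_mem fun a _ => ?_
    rw [← smul_sub, smul_def]
    exact mul_mem_left _ _ (hl' a)
  refine ⟨G, hGΛ, ?_⟩
  let g₀ : (G → O) →ₗ[O] S := linearCombination O (fun g : G => (g : S))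
  have hr : LinearMap.range g₀ = Submodule.span O G := by
    simp [g₀, Fintype.range_linearCombination]
  let f : (G → O) →ₗ[O] S ⧸ 𝔟 := (mkₐ O 𝔟).toLinearMap ∘ₗ g₀
  have : IsPrecomplete (maxId O) (G → O) := isPrecomplete_pi
  have hnt : Nontrivial (S ⧸ 𝔟) := Ideal.Quotient.nontrivial_iff.2 htop
  have hlocq : IsLocalRing (S ⧸ 𝔟) := IsLocalRing.of_surjective' (modId 𝔟) mk_surjective
  have : IsHausdorff (maxId O) (S ⧸ 𝔟) := by
    rw [← IsHausdorff.map_algebraMap_iff (S := S)]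
    refine IsHausdorff.of_le_jacobson _ _ (le_trans ?_ (IsLocalRing.jacobson_eq_maximalIdeal (⊥ : Ideal S) bot_ne_top).ge)
    rw [hϖ, map_span, Set.image_singleton, Ideal.span_singleton_le_iff_mem]
    exact hloc
  have hf : Surjective f := by
    refine surjective_of_mkQ_comp_surjective (I := maxId O) fun y => ?_
    obtain ⟨y, rfl⟩ := Submodule.mkQ_surjective _ y
    obtain ⟨s, rfl⟩ := mk_surjective y
    obtain ⟨g, hg, hg'⟩ := hG s
    obtain ⟨c, hc⟩ := hr.ge hg
    refine ⟨c, ?_⟩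
    rw [LinearMap.comp_apply, mkQ_apply, mkQ_apply, eq_comm, Submodule.Quotient.eq]
    change modId 𝔟 s - modId 𝔟 _ ∈ _
    rw [hc, ← map_sub]
    obtain ⟨a, ha, b, hb, hab⟩ := Submodule.mem_sup.1 (h𝔟 hg')
    obtain ⟨a', rfl⟩ := Ideal.mem_span_singleton'.1 ha
    rw [← hab, map_add, eq_zero_iff_mem.2 hb, add_zero, mul_comm]
    rw [show modId 𝔟 (amap O S ϖ * a') = ϖ • (modId 𝔟 a') by rw [map_mul, smul_def]; rfl]
    exact Submodule.smul_mem_smul (by rw [hϖ]; exact mem_span_singleton_self ϖ) trivial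
  intro s
  obtain ⟨c, hc⟩ := hf (modId 𝔟 s)
  exact ⟨g₀ c, hr.le ⟨c, rfl⟩, Ideal.Quotient.eq.1 hc.symm⟩

end Dense

section Nullstellensatz

/-- If a field is a finitely generated algebra over a domain `A`, then some nonzero `a : A` lies in
all nonzero primes. -/
lemma exists_ne_zero_forall_dvd_pow {A κ : Type*} [CommRing A] [IsDomain A] [Field κ]
    [Algebra A κ] [FiniteType A κ] (hinj : Injective (amap A κ)) :
    ∃ a : A, a ≠ 0 ∧ (∀ c : A, c ≠ 0 → ∃ N : ℕ, c ∣ a ^ N) ∧ Algebra.IsAlgebraic A κ := by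
  have : FaithfulSMul A κ := (faithfulSMul_iff_algebraMap_injective A κ).2 hinj
  let : Algebra (FractionRing A) κ := FractionRing.liftAlgebra A κ
  have : IsScalarTower A (FractionRing A) κ := FractionRing.isScalarTower_liftAlgebra A κ
  have : FiniteType (FractionRing A) κ := of_restrictScalars_finiteType A (FractionRing A) κ
  have : Module.Finite (FractionRing A) κ := finite_of_finite_type_of_isJacobsonRing _ _
  have halg : Algebra.IsAlgebraic A κ :=
    (IsFractionRing.comap_isAlgebraic_iff (A := A) (K := FractionRing A) (C := κ)).2 inferInstance
  obtain ⟨s, hs⟩ := (Algebra.FiniteType.out : (⊤ : Subalgebra A κ).FG)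
  obtain ⟨a, ha, hint⟩ := Algebra.IsAlgebraic.exists_integral_multiples A s
  refine ⟨a, ha, ?_, halg⟩
  have key : ∀ z : κ, ∃ N : ℕ, IsIntegral A (a ^ N • z) := by
    intro z
    have hz : z ∈ Algebra.adjoin A (s : Set κ) := by rw [hs]; trivial
    induction hz using Algebra.adjoin_induction with
    | mem x hx => exact ⟨1, by rw [pow_one]; exact hint x hx⟩
    | algebraMap r => exact ⟨0, by rw [pow_zero, one_smul]; exact isIntegral_algebraMap⟩
    | add x y _ _ hx hy =>
      obtain ⟨N, hN⟩ := hx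
      obtain ⟨N', hN'⟩ := hy
      refine ⟨N + N', ?_⟩
      rw [smul_add]
      refine IsIntegral.add ?_ ?_
      · rw [add_comm, pow_add, mul_smul]; exact hN.smul _
      · rw [pow_add, mul_smul]; exact hN'.smul _
    | mul x y _ _ hx hy =>
      obtain ⟨N, hN⟩ := hx
      obtain ⟨N', hN'⟩ := hy
      refine ⟨N + N', ?_⟩
      rw [pow_add, ← smul_mul_smul_comm]
      exact hN.mul hN'
  intro c hc
  obtain ⟨N, hN⟩ := key (amap A κ c)⁻¹
  obtain ⟨P, hP, hP0⟩ := hN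
  have hc0 : amap A κ c ≠ 0 := fun h => hc (hinj (by rw [h, map_zero]))
  refine ⟨N * P.natDegree, ?_⟩
  rw [eval₂_eq_sum_range] at hP0
  set e := P.natDegree with he
  have h1 : ∑ i ∈ range (e + 1), P.coeff i * (a ^ (N * i) * c ^ (e - i)) = 0 := by
    apply hinj
    rw [map_zero, map_sum]
    have h2 : amap A κ c ^ e * (∑ i ∈ range (e + 1), amap A κ (P.coeff i) *
        (a ^ N • (amap A κ c)⁻¹) ^ i) = 0 := by rw [hP0, mul_zero]
    rw [← h2, mul_sum]
    refine sum_congr rfl fun i hi => ?_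
    have hie : i ≤ e := lt_succ_iff.1 (mem_range.1 hi)
    obtain ⟨k, hk⟩ := exists_eq_add_of_le hie
    rw [smul_def, map_mul, map_mul, map_pow, map_pow, map_pow, mul_pow, ← pow_mul, hk, Nat.add_sub_cancel_left, pow_add, inv_pow]
    field_simp
  rw [sum_range_succ, Nat.sub_self, pow_zero, mul_one, hP.coeff_natDegree, one_mul] at h1
  rw [eq_neg_of_add_eq_zero_right h1, dvd_neg]
  refine Finset.dvd_sum fun i hi => ?_
  have hie : i < e := mem_range.1 hi
  exact mul_left (mul_left (dvd_pow_self c (by omega)) _) _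

lemma false_of_lt_minimalPrimes {A : Type*} [CommRing A] [IsDomain A] [IsNoetherianRing A]
    {p₁ p₂ : Ideal A} [p₁.IsPrime] (h1 : p₁ ≠ ⊥) (h12 : p₁ < p₂) {c : A} (h2 : p₂ ∈ (span {c}).minimalPrimes) : False := by
  have : p₂.IsPrime := h2.1.1
  have hle := Ideal.height_le_one_of_isPrincipal_of_mem_minimalPrimes (span {c}) p₂ h2
  have hb : (⊥ : Ideal A) < p₁ := bot_lt_iff_ne_bot.2 h1
  have h4 := Ideal.height_strict_mono_of_isPrime_of_isPrime hb
  rw [Order.lt_one_iff.1 ((Ideal.height_strict_mono_of_isPrime_of_isPrime h12).trans_le hle)] at h4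
  exact not_lt_zero h4

/-- A Noetherian local domain in which some nonzero element lies in all nonzero primes has dimension
at most one. -/
lemma isMaximal_of_forall_dvd_pow {A : Type*} [CommRing A] [IsDomain A] [IsNoetherianRing A]
    [IsLocalRing A] {a : A} (ha : a ≠ 0) (h : ∀ c : A, c ≠ 0 → ∃ N : ℕ, c ∣ a ^ N)
    (p : Ideal A) [hp : p.IsPrime] (hp0 : p ≠ ⊥) : p = maxId A := by
  by_contra hpm
  have hlt : p < maxId A := lt_of_le_of_ne (le_maximalIdeal hp.ne_top) hpm
  have hmem : ∀ q : Ideal A, q.IsPrime → q ≠ ⊥ → a ∈ q := by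
    intro q hq hq0
    obtain ⟨c, hc, hc0⟩ := Submodule.exists_mem_ne_zero_of_ne_bot hq0
    obtain ⟨N, hN⟩ := h c hc0
    exact hq.mem_of_pow_mem N (Ideal.mem_of_dvd _ hN hc)
  have hfin := Ideal.finite_minimalPrimes_of_isNoetherianRing A (span {a})
  have hnot : ¬ ((maxId A : Set A) ⊆ ⋃ i ∈ ((hfin.toFinset : Finset (Ideal A)) : Set (Ideal A)), (i : Set A)) := by
    rw [Ideal.subset_union_prime ⊥ ⊥ (f := fun i : Ideal A => i) (fun i hi _ _ => (hfin.mem_toFinset.1 hi).1.1)]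
    rintro ⟨i, hi, him⟩
    have hi' := hfin.mem_toFinset.1 hi
    have : i.IsPrime := hi'.1.1
    obtain rfl : i = maxId A := le_antisymm (le_maximalIdeal this.ne_top) him
    exact false_of_lt_minimalPrimes hp0 hlt hi'
  obtain ⟨b, hb, hb'⟩ := Set.not_subset.1 hnot
  simp only [Set.mem_iUnion, not_exists] at hb'
  have ham : a ∈ maxId A := hlt.le (hmem p hp hp0)
  have hb0 : b ≠ 0 := by
    rintro rfl
    obtain ⟨q, hq⟩ := (span {a}).nonempty_minimalPrimes (by
      rwa [Ne, Ideal.span_singleton_eq_top])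
    exact hb' q (by simpa using hq) (zero_mem q)
  obtain ⟨q, hq⟩ := (span {b}).nonempty_minimalPrimes (by
    rwa [Ne, Ideal.span_singleton_eq_top])
  have hqp : q.IsPrime := hq.1.1
  have hbq : b ∈ q := (Ideal.span_singleton_le_iff_mem q).1 hq.1.2
  have haq : a ∈ q := hmem q hqp (fun h0 => hb0 (h0.le hbq))
  obtain ⟨q', hq', hq'q⟩ := Ideal.exists_minimalPrimes_le ((Ideal.span_singleton_le_iff_mem q).2 haq)
  have : q'.IsPrime := hq'.1.1
  have haq' : a ∈ q' := (Ideal.span_singleton_le_iff_mem q').1 hq'.1.2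
  exact false_of_lt_minimalPrimes (p₁ := q') (fun h0 => ha (h0.le haq'))
    (lt_of_le_of_ne hq'q (by rintro rfl; exact hb' q' (by simpa using hq') hbq)) hq

variable {O S : Type*} [CommRing O] [CommRing S] [IsLocalRing S]
  [IsNoetherianRing S] [Algebra O S]

/-- A field `κ` finitely generated over a Noetherian local ring `S` in which `ϖ` does not vanish:
modulo `ϖ`, the image of `S` in `κ` is Artinian. -/
lemma exists_pow_le_of_finiteType {κ : Type*} [Field κ] [Algebra S κ] [FiniteType S κ]
    {ϖ : S} (hϖ : amap S κ ϖ ≠ 0) : (∀ z : κ, ∃ P : Polynomial S, P.map (amap S κ) ≠ 0 ∧ peval z P = 0) ∧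
    ∃ j : ℕ, maxId S ^ j ≤ span {ϖ} ⊔ ker (amap S κ) := by
  set q := ker (amap S κ) with hq
  have : q.IsPrime := RingHom.ker_isPrime _
  let A := S ⧸ q
  let : Algebra A κ := (RingHom.kerLift (amap S κ)).toAlgebra
  have : IsScalarTower S A κ := of_algebraMap_eq (fun _ => rfl)
  have hinj : Injective (amap A κ) := RingHom.kerLift_injective _
  have : FiniteType A κ := of_restrictScalars_finiteType S A κ
  have : IsLocalRing A := IsLocalRing.of_surjective' (modId q) mk_surjective
  obtain ⟨a, ha, hdvd, halg⟩ := exists_ne_zero_forall_dvd_pow hinj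
  refine ⟨fun z => ?_, ?_⟩
  · obtain ⟨P, hP, hP0⟩ := halg.isAlgebraic z
    obtain ⟨P', rfl⟩ := Polynomial.map_surjective (modId q) mk_surjective P
    refine ⟨P', ?_, ?_⟩
    · rw [show P'.map (amap S κ) = (P'.map (modId q)).map (amap A κ) by rw [map_map]; rfl, Ne, Polynomial.map_eq_zero_iff hinj]
      exact hP
    · exact (Polynomial.aeval_map_algebraMap A z P').symm.trans hP0
  have hrad : maxId S ≤ (span {ϖ} ⊔ q).radical := by
    rw [Ideal.radical_eq_sInf]
    refine le_sInf fun P ⟨hP, hPp⟩ => ?_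
    have hqP : q ≤ P := le_sup_right.trans hP
    have hϖP : ϖ ∈ P := hP (Ideal.mem_sup_left (mem_span_singleton_self _))
    have hmap : (P.map (modId q)).IsPrime := Ideal.map_isPrime_of_surjective mk_surjective (by rwa [mk_ker])
    have hne : P.map (modId q) ≠ ⊥ := fun h0 =>
      hϖ (eq_zero_iff_mem.1 (h0.le (mem_map_of_mem (modId q) hϖP)))
    have hmax := isMaximal_of_forall_dvd_pow ha hdvd (P.map (modId q)) hne
    rw [← sup_eq_left.2 hqP, ← mk_ker (I := q), ← Ideal.comap_map_of_surjective' _ mk_surjective, hmax]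
    have : IsLocalHom (modId q) := IsLocalHom.of_surjective _ mk_surjective
    exact fun x hx => map_nonunit (modId q) x hx
  exact Ideal.exists_pow_le_of_le_radical_of_fg hrad (IsNoetherian.noetherian _)

/-- A field finitely generated over a complete local `O`-algebra with the residue field of `O`, in
which `ϖ` does not vanish, is algebraic over `O`. -/
lemma isAlgebraic_of_finiteType [IsDomain O] [IsLocalRing O] [IsAdicComplete (maxId O) O]
    {ϖ : O} (hϖ : maxId O = span {ϖ}) (hloc : amap O S ϖ ∈ maxId S) (hres : ∀ s : S, ∃ o : O, s - amap O S o ∈ maxId S)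
    {κ : Type*} [Field κ] [Algebra S κ] [Algebra O κ] [IsScalarTower O S κ] [FiniteType S κ] (hinj : Injective (amap O κ))
    (hϖ0 : ϖ ≠ 0) : Algebra.IsAlgebraic O κ := by
  have h0 : amap S κ (amap O S ϖ) ≠ 0 := by
    rw [← tower]
    exact fun h => hϖ0 (hinj (by rw [h, map_zero]))
  obtain ⟨halg, j, hj⟩ := exists_pow_le_of_finiteType h0
  obtain ⟨G, -, hG⟩ := exists_finset_sub_mem hϖ hloc hres ⊤ (fun s j => ⟨s, trivial, by simp⟩) _ hj
  let A := (toAlgHom O S κ).range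
  have hfg : (Subalgebra.toSubmodule A).FG := by
    classical
    refine ⟨G.image (toAlgHom O S κ).toLinearMap, ?_⟩
    rw [Finset.coe_image, ← Submodule.map_span]
    refine le_antisymm LinearMap.map_le_range ?_
    rintro _ ⟨s, rfl⟩
    obtain ⟨g, hg, hg'⟩ := hG s
    exact ⟨g, hg, (sub_eq_zero.1 ((map_sub _ _ _).symm.trans hg')).symm⟩
  have hAint : Algebra.IsIntegral O A := ⟨fun a =>
    (isIntegral_algHom_iff A.val val_injective).1 (IsIntegral.of_mem_of_fg A hfg a a.2)⟩
  have : Algebra.IsAlgebraic A κ := ⟨fun z => by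
    obtain ⟨P, hP, hP0⟩ := halg z
    let f : S →+* A := (toAlgHom O S κ).rangeRestrict.toRingHom
    have hf : (amap A κ).comp f = amap S κ := by ext; rfl
    refine ⟨P.map f, fun h => hP ?_, ?_⟩
    · rw [← hf, ← map_map, h, Polynomial.map_zero]
    · rw [Polynomial.aeval_def, Polynomial.eval₂_map, hf]
      exact hP0⟩
  have : FaithfulSMul O κ := (faithfulSMul_iff_algebraMap_injective O κ).2 hinj
  exact Algebra.IsAlgebraic.trans O A κ

end Nullstellensatz

/-- The absolute value `N` on the algebraic extension `K` of the fraction field of the complete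
local ring `O`: its ring of integers is the integral closure of `O`, and it is a union of complete
local rings. -/
structure IsValuedClosure (O : Type*) [CommRing O] [IsLocalRing O] (K : Type*) [Field K]
    [Algebra O K] (N : AbsoluteValue K ℝ) : Prop where
  nonarch : IsNonarchimedean N
  le_one_iff : ∀ x, N x ≤ 1 ↔ IsIntegral O x
  lt_one_iff : ∀ o : O, N (amap O K o) < 1 ↔ o ∈ maxId O
  exists_complete : ∀ s : Finset K, (∀ x ∈ s, N x ≤ 1) → ∃ A : Subalgebra O K,
    (s : Set K) ⊆ A ∧ (∀ x ∈ A, N x ≤ 1) ∧ ∃ _ : IsLocalRing A, IsAdicComplete (maxId A) A ∧ ∀ x : A, x ∈ maxId A ↔ N x < 1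

section Nonarch

variable {K : Type*} [Field K] {N : AbsoluteValue K ℝ}

lemma nonarch_sum_le (hN : IsNonarchimedean N) {ι : Type*} (s : Finset ι) (f : ι → K) {B : ℝ} (hB : 0 ≤ B)
    (h : ∀ i ∈ s, N (f i) ≤ B) : N (∑ i ∈ s, f i) ≤ B := by
  classical
  induction s using induction_on with
  | empty => simpa using hB
  | insert i s his ih =>
    rw [Finset.sum_insert his]
    exact (hN _ _).trans (max_le (h i (by simp)) (ih fun j hj => h j (by simp [hj])))

lemma nonarch_sub_le (hN : IsNonarchimedean N) {x y : K} {B : ℝ} (hx : N x ≤ B) (hy : N y ≤ B) : N (x - y) ≤ B := by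
  rw [sub_eq_add_neg]
  exact (hN _ _).trans (max_le hx (by rwa [N.map_neg]))

/-- Polynomials are locally Lipschitz. -/
lemma exists_eval_sub_le (hN : IsNonarchimedean N) {τ : Type*} (g : MvPoly τ K) (w0 : τ → K) :
    ∃ C : ℝ, 1 ≤ C ∧ ∀ (δ : ℝ), 0 ≤ δ → δ ≤ 1 → ∀ w : τ → K, (∀ i, N (w i - w0 i) ≤ δ) → N (eval w g - eval w0 g) ≤ C * δ := by
  induction g using MvPolynomial.induction_on with
  | C a => exact ⟨1, le_rfl, fun δ hδ _ w _ => by simpa using hδ⟩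
  | add p q hp hq =>
    obtain ⟨C, hC, h⟩ := hp
    obtain ⟨C', hC', h'⟩ := hq
    refine ⟨max C C', hC.trans (le_max_left _ _), fun δ hδ hδ1 w hw => ?_⟩
    rw [map_add, map_add, add_sub_add_comm]
    refine (hN _ _).trans (max_le ((h δ hδ hδ1 w hw).trans ?_) ((h' δ hδ hδ1 w hw).trans ?_))
    · exact mul_le_mul_of_nonneg_right (le_max_left _ _) hδ
    · exact mul_le_mul_of_nonneg_right (le_max_right _ _) hδ
  | mul_X p i hp =>
    obtain ⟨C, hC, h⟩ := hp
    set a := N (eval w0 p)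
    set b := N (w0 i)
    have ha : 0 ≤ a := N.nonneg _
    have hb : 0 ≤ b := N.nonneg _
    refine ⟨C * (1 + b) + a, by nlinarith, fun δ hδ hδ1 w hw => ?_⟩
    rw [show eval w (p * mvX i) - eval w0 (p * mvX i) = (eval w p - eval w0 p) * w i + eval w0 p * (w i - w0 i) by
      simp only [map_mul, MvPolynomial.eval_X]; ring]
    have h2 : N (w i) ≤ 1 + b := by
      rw [← sub_add_cancel (w i) (w0 i)]
      exact (N.add_le _ _).trans (by have := hw i; change _ + b ≤ _; linarith)
    refine (N.add_le _ _).trans ?_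
    rw [N.map_mul, N.map_mul, add_mul]
    refine add_le_add ?_ (mul_le_mul_of_nonneg_left (hw i) ha)
    calc _ ≤ (C * δ) * (1 + b) := mul_le_mul (h δ hδ hδ1 w hw) h2 (N.nonneg _) (by positivity)
      _ = _ := by ring

lemma exists_eval_le (P : Polynomial K) : ∃ C : ℝ, 0 ≤ C ∧ ∀ s, N s ≤ 1 → N (P.eval s) ≤ C := by
  refine ⟨∑ i ∈ range (P.natDegree + 1), N (P.coeff i), sum_nonneg fun _ _ => N.nonneg _, fun s hs => ?_⟩
  rw [eval_eq_sum_range]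
  refine (abv_sum (abv := N) _ _).trans (Finset.sum_le_sum fun i _ => ?_)
  rw [N.map_mul, N.map_pow]
  exact mul_le_of_le_one_right (N.nonneg _) (pow_le_one₀ (N.nonneg _) hs)

/-- A polynomial that is `O(|s| ^ r)` near `0` has no terms of degree less than `r`. -/
lemma coeff_eq_zero_of_le {ϖ : K} (hϖ0 : ϖ ≠ 0) (hϖ1 : N ϖ < 1) {r : ℕ} :
    ∀ (P : Polynomial K) (C ε : ℝ), 0 < ε → (∀ s, s ≠ 0 → N s ≤ ε → N (P.eval s) ≤ C * N s ^ r) → ∀ j < r, P.coeff j = 0 := by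
  induction r with
  | zero => intro P C ε _ _ j hj; omega
  | succ r ih =>
    intro P C ε hε hP
    have hd : ∀ s, P.eval s = P.divX.eval s * s + P.coeff 0 := fun s => by
      conv_lhs => rw [← Polynomial.divX_mul_X_add P]
      simp
    have h0 : P.coeff 0 = 0 := by
      obtain ⟨C', hC', h'⟩ := exists_eval_le (N := N) P.divX
      by_contra hne
      have hpos : 0 < N (P.coeff 0) := N.pos hne
      obtain ⟨k, hk⟩ := exists_pow_lt_of_lt_one (show 0 < min (min ε 1) (N (P.coeff 0) / (|C| + C' + 1)) by positivity) hϖ1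
      rw [← N.map_pow] at hk
      set s := ϖ ^ k with hs
      have hs0 : s ≠ 0 := pow_ne_zero _ hϖ0
      have hsε : N s ≤ ε := (hk.trans_le ((min_le_left _ _).trans (min_le_left _ _))).le
      have hs1 : N s ≤ 1 := (hk.trans_le ((min_le_left _ _).trans (min_le_right _ _))).le
      have hs2 : N s < N (P.coeff 0) / (|C| + C' + 1) := hk.trans_le (min_le_right _ _)
      rw [lt_div_iff₀ (by positivity)] at hs2
      have h1 : P.coeff 0 = P.eval s - P.divX.eval s * s := by rw [hd]; ring
      have h2 : N (P.coeff 0) ≤ |C| * N s + C' * N s := by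
        rw [h1]
        refine (N.sub_le_add _ _).trans (add_le_add ((hP s hs0 hsε).trans ?_) ?_)
        · calc C * N s ^ (r + 1) ≤ |C| * N s ^ (r + 1) :=
                mul_le_mul_of_nonneg_right (le_abs_self C) (by positivity)
            _ ≤ |C| * N s := mul_le_mul_of_nonneg_left (pow_le_of_le_one (N.nonneg _) hs1 (by omega)) (abs_nonneg _)
        · rw [N.map_mul]
          exact mul_le_mul_of_nonneg_right (h' s hs1) (N.nonneg _)
      nlinarith [N.nonneg s]
    have h1 : ∀ j < r, P.divX.coeff j = 0 := by
      refine ih P.divX C ε hε fun s hs0 hsε => ?_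
      have h2 := hP s hs0 hsε
      rw [hd, h0, add_zero, N.map_mul, pow_succ, ← mul_assoc] at h2
      exact le_of_mul_le_mul_right h2 (N.pos hs0)
    intro j hj
    rcases j with _ | j
    · exact h0
    · rw [← Polynomial.coeff_divX]
      exact h1 j (by omega)

/-- A polynomial in several variables that is `O(|w - w₀| ^ r)` near `w₀` has no terms of degree
less than `r` at `w₀`. -/
lemma coeff_shift_eq_zero_of_le [Infinite K] {τ : Type*} [Finite τ] {ϖ : K} (hϖ0 : ϖ ≠ 0) (hϖ1 : N ϖ < 1) {r : ℕ}
    (g : MvPoly τ K) (w0 : τ → K) (C ε : ℝ) (hε : 0 < ε) (hC : 0 ≤ C)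
    (h : ∀ δ, 0 ≤ δ → δ ≤ ε → ∀ w : τ → K, (∀ i, N (w i - w0 i) ≤ δ) →
      N (eval w g) ≤ C * δ ^ r) (d : τ →₀ ℕ) (hd : d.degree < r) : (aeval (fun i => mvX i + mvC (w0 i)) g).coeff d = 0 := by
  have := ofFinite τ
  set G := aeval (fun i => mvX i + mvC (w0 i)) g with hG
  suffices hh : homogeneousComponent d.degree G = 0 by
    have := congrArg (MvPolynomial.coeff d) hh
    rwa [MvPolynomial.coeff_homogeneousComponent, if_pos rfl, MvPolynomial.coeff_zero] at this
  apply MvPolynomial.funext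
  intro u
  rw [map_zero]
  set B : ℝ := 1 + ∑ i, N (u i) with hB
  have hBu : ∀ i, N (u i) ≤ B := fun i =>
    (Finset.single_le_sum (f := fun i => N (u i)) (fun j _ => N.nonneg _) (mem_univ i)).trans (by rw [hB]; linarith)
  have hB1 : 1 ≤ B := by
    have : 0 ≤ ∑ i, N (u i) := sum_nonneg fun j _ => N.nonneg _
    linarith
  let P : Polynomial K := ∑ j ∈ range (G.totalDegree + 1),
    Polynomial.C (eval u (homogeneousComponent j G)) * Polynomial.X ^ j
  have hPs : ∀ s, P.eval s = eval (fun i => s * u i + w0 i) g := by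
    intro s
    have h1 : eval (fun i => s * u i + w0 i) g = eval (fun i => s * u i) G := by
      rw [hG, MvPolynomial.aeval_def, algebraMap_eq, eval_eval₂]
      rw [← MvPolynomial.eval₂_id]
      congr 1
      · ext; simp
      · ext i; simp
    rw [h1]
    conv_rhs => rw [← MvPolynomial.sum_homogeneousComponent G]
    simp only [P, eval_finsetSum, map_sum, eval_mul, eval_C, Polynomial.eval_pow, eval_X]
    refine sum_congr rfl fun j _ => ?_
    rw [mul_comm]
    have h3 : (homogeneousComponent j G).IsHomogeneous j := MvPolynomial.homogeneousComponent_isHomogeneous j G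
    rw [eval_eq, eval_eq, mul_sum]
    refine sum_congr rfl fun a ha => ?_
    have h4 : a.degree = j := by
      rw [← h3 (mem_support_iff.1 ha), Finsupp.degree_eq_weight_one]; rfl
    have h5 : s ^ j = ∏ i ∈ a.support, s ^ a i := by
      rw [← h4, Finset.prod_pow_eq_pow_sum]; rfl
    rw [h5]
    simp only [mul_pow, Finset.prod_mul_distrib]
    ring
  have hcoeff := coeff_eq_zero_of_le hϖ0 hϖ1 (r := r) P (C * B ^ r) (ε / B) (by positivity) (by
    intro s _ hs
    rw [hPs]
    have := h (N s * B) (by positivity) (by rwa [le_div_iff₀ (by positivity)] at hs) (fun i => s * u i + w0 i) (fun i => by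
        rw [add_sub_cancel_right, N.map_mul]
        exact mul_le_mul_of_nonneg_left (hBu i) (N.nonneg _))
    rw [mul_pow] at this
    calc _ ≤ _ := this
      _ = _ := by ring) d.degree hd
  by_cases hdeg : d.degree ≤ G.totalDegree
  · simp only [P, Polynomial.finsetSum_coeff, Polynomial.coeff_C_mul_X_pow] at hcoeff
    rw [Finset.sum_ite_eq, if_pos (by simpa using lt_succ_iff.2 hdeg)] at hcoeff
    exact hcoeff
  · rw [MvPolynomial.homogeneousComponent_eq_zero _ _ (not_le.1 hdeg), map_zero]

end Nonarch

section Points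

variable {O : Type*} [CommRing O] [IsLocalRing O] {K : Type*} [Field K] [Algebra O K]
  {N : AbsoluteValue K ℝ}

lemma IsValuedClosure.norm_algebraMap_le (hV : IsValuedClosure O K N) (o : O) : N (amap O K o) ≤ 1 :=
  (hV.le_one_iff _).2 isIntegral_algebraMap

section LocalAlgebra

variable {S : Type*} [CommRing S] [IsLocalRing S] [Algebra O S]

/-- `K`-points of a local `O`-algebra send the maximal ideal to elements of absolute value less
than `1`. -/
lemma IsValuedClosure.norm_lt_one (hV : IsValuedClosure O K N) (e : S →ₐ[O] K) {s : S} (hs : s ∈ maxId S) : N (e s) < 1 := by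
  by_contra! hlt
  have h0 : e s ≠ 0 := fun h => by norm_num [h] at hlt
  have hinv : N (e s)⁻¹ ≤ 1 := by
    rw [map_inv₀]
    exact inv_le_one_of_one_le₀ hlt
  obtain ⟨P, hP, hP0⟩ := (hV.le_one_iff _).1 hinv
  rw [eval₂_eq_sum_range] at hP0
  set d := P.natDegree
  let t : S := ∑ i ∈ range (d + 1), amap O S (P.coeff i) * s ^ (d - i)
  have ht : e t = (e s) ^ d * ∑ i ∈ range (d + 1), amap O K (P.coeff i) * (e s)⁻¹ ^ i := by
    rw [map_sum, mul_sum]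
    refine sum_congr rfl fun i hi => ?_
    obtain ⟨k, hk⟩ := exists_eq_add_of_le (lt_succ_iff.1 (mem_range.1 hi))
    rw [map_mul, AlgHom.commutes, map_pow, hk, Nat.add_sub_cancel_left, pow_add, inv_pow]
    field_simp
  rw [hP0, mul_zero] at ht
  refine ((isUnit_of_mem_nonunits_one_sub_self t ?_).map e).ne_zero ht
  change _ ∈ maxId S
  simp only [t]
  rw [sum_range_succ, Nat.sub_self, pow_zero, mul_one, hP.coeff_natDegree, map_one, sub_add_cancel_right]
  exact neg_mem (Ideal.sum_mem _ fun i hi => mul_mem_left _ _ (Ideal.pow_mem_of_mem _ hs _ (Nat.sub_pos_of_lt (mem_range.1 hi))))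

lemma IsValuedClosure.norm_le_one (hV : IsValuedClosure O K N)
    (hres : ∀ s : S, ∃ o : O, s - amap O S o ∈ maxId S) (e : S →ₐ[O] K) (s : S) : N (e s) ≤ 1 := by
  obtain ⟨o, ho⟩ := hres s
  rw [← sub_add_cancel s, map_add, AlgHom.commutes]
  exact (hV.nonarch _ _).trans (max_le (hV.norm_lt_one e ho).le (hV.norm_algebraMap_le o))

lemma IsValuedClosure.exists_bound [IsNoetherianRing S] (hV : IsValuedClosure O K N)
    (hres : ∀ s : S, ∃ o : O, s - amap O S o ∈ maxId S) (e : S →ₐ[O] K) :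
    ∃ c : ℝ, 0 ≤ c ∧ c < 1 ∧ ∀ (j : ℕ) (s : S), s ∈ maxId S ^ j → N (e s) ≤ c ^ j := by
  obtain ⟨G, hG⟩ := (IsNoetherian.noetherian (maxId S) : (maxId S).FG)
  obtain ⟨c, hc0, hc1, hc⟩ : ∃ c : ℝ, 0 ≤ c ∧ c < 1 ∧ ∀ g ∈ G, N (e g) ≤ c := by
    have hGm : ∀ g ∈ G, N (e g) < 1 := fun g hg => hV.norm_lt_one e (hG.le (subset_span hg))
    rcases G.eq_empty_or_nonempty with rfl | hne
    · exact ⟨0, le_rfl, one_pos, by simp⟩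
    · obtain ⟨g, hg, h⟩ := G.exists_max_image (fun g => N (e g)) hne
      exact ⟨_, N.nonneg _, hGm g hg, h⟩
  have h1 : ∀ s ∈ maxId S, N (e s) ≤ c := fun s hs => by
    rw [← hG] at hs
    induction hs using span_induction with
    | mem x h => exact hc x h
    | zero => simpa using hc0
    | add x y _ _ hx hy => rw [map_add]; exact (hV.nonarch _ _).trans (max_le hx hy)
    | smul a x _ hx =>
      rw [smul_eq_mul, map_mul, N.map_mul]
      exact (mul_le_of_le_one_left (N.nonneg _) (hV.norm_le_one hres e a)).trans hx
  refine ⟨c, hc0, hc1, fun j => ?_⟩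
  induction j with
  | zero => intro s _; simpa using hV.norm_le_one hres e s
  | succ j ih =>
    intro s hs
    rw [pow_succ] at hs
    refine Submodule.mul_induction_on hs (fun a ha b hb => ?_) (fun x y hx hy => ?_)
    · rw [map_mul, N.map_mul, pow_succ]
      exact mul_le_mul (ih a ha) (h1 b hb) (N.nonneg _) (by positivity)
    · rw [map_add]; exact (hV.nonarch _ _).trans (max_le hx hy)

end LocalAlgebra

variable [IsNoetherianRing O] {σ : Type*} [Finite σ] (𝔪 : Ideal (MvPoly σ O))

local notation "Ŝ" => AdicCompletion 𝔪 (MvPolynomial σ O)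
local notation "aX(" v ")" => algebraMap (MvPolynomial σ O) _ (MvPolynomial.X v)

lemma residue_completion [𝔪.IsMaximal] [IsLocalRing Ŝ] (hres : ∀ f, ∃ o : O, f - mvC o ∈ 𝔪) (s : Ŝ) :
    ∃ o : O, s - amap O _ o ∈ maxId Ŝ := by
  obtain ⟨a, ha⟩ := exists_sub_mem_pow (IsNoetherian.noetherian 𝔪) s 1
  obtain ⟨o, ho⟩ := hres a
  refine ⟨o, ?_⟩
  rw [maximalIdeal_adicCompletion]
  rw [pow_one] at ha
  have := Ideal.add_mem _ ha (mem_map_of_mem (amap _ _) ho)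
  rw [map_sub, sub_add_sub_cancel] at this
  rwa [tower O (MvPoly σ O), algebraMap_eq]

/-- The `K`-points of the residue disc defined by the maximal ideal `𝔪`. -/
def InDisc (N : AbsoluteValue K ℝ) (y : σ → K) : Prop := ∀ f ∈ 𝔪, N (aeval y f) < 1

variable {𝔪}

lemma InDisc.norm_le_one (hV : IsValuedClosure O K N)
    (hres : ∀ f, ∃ o : O, f - mvC o ∈ 𝔪) {y : σ → K} (hy : InDisc 𝔪 N y) (i : σ) : N (y i) ≤ 1 := by
  obtain ⟨o, ho⟩ := hres (mvX i)
  have h := hy _ ho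
  rw [map_sub, aeval_X, aeval_C] at h
  rw [← sub_add_cancel (y i)]
  exact (hV.nonarch _ _).trans (max_le h.le (hV.norm_algebraMap_le o))

lemma IsValuedClosure.aeval_sub_le (hV : IsValuedClosure O K N) {y y' : σ → K} {δ : ℝ}
    (hδ : 0 ≤ δ) (hy : ∀ i, N (y i) ≤ 1) (hy' : ∀ i, N (y' i) ≤ 1) (h : ∀ i, N (y i - y' i) ≤ δ) (p : MvPoly σ O) :
    N (aeval y p) ≤ 1 ∧ N (aeval y p - aeval y' p) ≤ δ := by
  induction p using MvPolynomial.induction_on with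
  | C a => simpa [hδ] using hV.norm_algebraMap_le a
  | add p q hp hq =>
    rw [map_add (aeval y), map_add (aeval y'), add_sub_add_comm]
    exact ⟨(hV.nonarch _ _).trans (max_le hp.1 hq.1), (hV.nonarch _ _).trans (max_le hp.2 hq.2)⟩
  | mul_X p i hp =>
    rw [map_mul (aeval y), map_mul (aeval y'), aeval_X, aeval_X]
    refine ⟨by rw [N.map_mul]; exact mul_le_one₀ hp.1 (N.nonneg _) (hy i), ?_⟩
    rw [show aeval y p * y i - aeval y' p * y' i = aeval y p * (y i - y' i) + (aeval y p - aeval y' p) * y' i by ring]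
    refine (hV.nonarch _ _).trans ?_
    rw [N.map_mul, N.map_mul]
    exact max_le ((mul_le_of_le_one_left (N.nonneg _) hp.1).trans (h i))
      ((mul_le_of_le_one_right (N.nonneg _) (hy' i)).trans hp.2)

lemma InDisc.of_sub_le (hV : IsValuedClosure O K N)
    (hres : ∀ f, ∃ o : O, f - mvC o ∈ 𝔪) {y y' : σ → K} (hy : InDisc 𝔪 N y) {δ : ℝ}
    (hδ0 : 0 ≤ δ) (hδ : δ < 1) (h : ∀ i, N (y' i - y i) ≤ δ) : InDisc 𝔪 N y' := by
  intro f hf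
  have hy1 := hy.norm_le_one hV hres
  have hy' : ∀ i, N (y' i) ≤ 1 := fun i => by
    rw [← sub_add_cancel (y' i) (y i)]
    exact (hV.nonarch _ _).trans (max_le ((h i).trans hδ.le) (hy1 i))
  have h2 := (hV.aeval_sub_le hδ0 hy' hy1 h f).2
  rw [← sub_add_cancel (aeval y' f) (aeval y f)]
  exact (hV.nonarch _ _).trans_lt (max_lt (h2.trans_lt hδ) (hy f hf))

lemma algHom_algebraMap (e : Ŝ →ₐ[O] K) (p : MvPoly σ O) : e (amap _ _ p) = aeval (fun i => e aX(i)) p := by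
  rw [show aeval (fun i => e aX(i)) = e.comp (toAlgHom O (MvPoly σ O) Ŝ) by ext i; simp]
  rfl

lemma InDisc.of_algHom [𝔪.IsMaximal] (hV : IsValuedClosure O K N) (e : Ŝ →ₐ[O] K) : InDisc 𝔪 N (fun i => e aX(i)) := by
  have := isLocalRing_adicCompletion 𝔪
  intro f hf
  rw [← algHom_algebraMap]
  apply hV.norm_lt_one e
  rw [maximalIdeal_adicCompletion]
  exact mem_map_of_mem _ hf

/-- Evaluation of elements of the completed local ring at a point of the residue disc. -/
lemma InDisc.exists_algHom (hV : IsValuedClosure O K N) (hres : ∀ f, ∃ o : O, f - mvC o ∈ 𝔪) {y : σ → K} (hy : InDisc 𝔪 N y) :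
    ∃ e : Ŝ →ₐ[O] K, ∀ i, e aX(i) = y i := by
  classical
  have := ofFinite σ
  obtain ⟨A, hA, -, hloc, hcomp, hm⟩ := hV.exists_complete (univ.image y) (by
    simpa using hy.norm_le_one hV hres)
  have hyA : ∀ i, y i ∈ A := fun i => hA (by simp)
  let f : MvPoly σ O →ₐ[O] A := aeval (fun i => ⟨y i, hyA i⟩)
  have hfy : A.val.comp f = aeval y := by ext i; simp [f]
  have hf : 𝔪 ≤ (maxId A).comap (f : MvPoly σ O →+* A) := by
    intro p hp
    rw [mem_comap, hm]
    change N ((f p : A) : K) < 1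
    exact (congrArg N (cfun hfy p)).trans_lt (hy p hp)
  let F := completionLift (f : MvPoly σ O →+* A) hf
  have hF : ∀ p, F (amap _ _ p) = f p := fun p => completionLift_algebraMap _ hf p
  refine ⟨A.val.comp { F with commutes' := fun o => ?_ }, fun i => ?_⟩
  · change F (amap O _ o) = amap O A o
    rw [tower O (MvPoly σ O), hF, AlgHom.commutes]
  · change ((F (amap _ _ (mvX i)) : A) : K) = y i
    rw [hF]
    simp [f]

/-- Functions on the residue disc with coefficients in `O` are Lipschitz. -/
lemma algHom_sub_le [𝔪.IsMaximal] (hV : IsValuedClosure O K N) (hres : ∀ f, ∃ o : O, f - mvC o ∈ 𝔪)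
    (e e' : Ŝ →ₐ[O] K) {δ : ℝ} (hδ : 0 ≤ δ) (h : ∀ i, N (e aX(i) - e' aX(i)) ≤ δ) (s : Ŝ) : N (e s - e' s) ≤ δ := by
  have := isLocalRing_adicCompletion 𝔪
  have := isNoetherianRing_adicCompletion 𝔪
  have hres' := residue_completion 𝔪 hres
  obtain ⟨c, hc0, hc1, hc⟩ := hV.exists_bound hres' e
  obtain ⟨c', hc0', hc1', hc'⟩ := hV.exists_bound hres' e'
  refine le_of_forall_pos_le_add fun η hη => ?_
  obtain ⟨j, hj⟩ := exists_pow_lt_of_lt_one hη hc1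
  obtain ⟨j', hj'⟩ := exists_pow_lt_of_lt_one hη hc1'
  obtain ⟨p, hp⟩ := exists_sub_mem_pow (IsNoetherian.noetherian 𝔪) s (j + j')
  rw [← maximalIdeal_adicCompletion] at hp
  have h1 := hc (j + j') _ hp
  have h2 := hc' (j + j') _ hp
  have h3 := (hV.aeval_sub_le hδ ((InDisc.of_algHom hV e).norm_le_one hV hres)
    ((InDisc.of_algHom hV e').norm_le_one hV hres) h p).2
  rw [← algHom_algebraMap, ← algHom_algebraMap] at h3
  rw [show e s - e' s = (e (s - amap _ _ p) - e' (s - amap _ _ p)) +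
    (e (amap _ _ p) - e' (amap _ _ p)) by rw [map_sub, map_sub]; ring]
  refine (hV.nonarch _ _).trans (max_le ?_ (h3.trans (by linarith)))
  refine (nonarch_sub_le hV.nonarch (B := η) (h1.trans ?_) (h2.trans ?_)).trans (by linarith)
  · exact (pow_le_pow_of_le_one hc0 hc1.le (by lia)).trans hj.le
  · exact (pow_le_pow_of_le_one hc0' hc1'.le (by lia)).trans hj'.le

end Points

open scoped TensorProduct

lemma exists_mul_eq_zero_of_forall_mem_pow {F K T : Type*} [Field F] [Field K] [Algebra F K]
    [CommRing T] [IsNoetherianRing T] [Algebra F T] (j : T →ₐ[F] K) {E' : Type*} [Field E'] [Algebra F E']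
    [FinDim F E'] (ι : E' →ₐ[F] K) (x : T) (hx : ∀ r : ℕ, x ⊗ₜ[F] (1 : E') ∈ (ker
      (Algebra.TensorProduct.lift j ι (fun _ _ => Commute.all _ _))) ^ r) : ∃ s : T, s * x = 0 ∧ j s ≠ 0 := by
  have : IsNoetherianRing (T ⊗[F] E') := isNoetherianRing T _
  set J := Algebra.TensorProduct.lift j ι (fun _ _ => Commute.all _ _) with hJ
  obtain ⟨r, hr⟩ := (Ideal.mem_iInf_smul_pow_eq_bot_iff (ker J) (x ⊗ₜ[F] (1 : E'))).1 (by
    simpa [Submodule.mem_iInf] using hx)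
  by_contra! hcon
  let b := finBasis F E'
  let B := Algebra.TensorProduct.basis T b
  set s := 1 - (r : T ⊗[F] E') with hs
  have h0 : x • s = 0 := by
    rw [show x • s = s * (x ⊗ₜ[F] (1 : E')) by rw [mul_comm, smul_def]; rfl, hs, sub_mul, one_mul,
      ← smul_eq_mul (r : T ⊗[F] E'), hr, sub_self]
  have h2 : ∀ i, B.repr s i * x = 0 := fun i => by
    simpa [mul_comm] using congrArg (fun y => B.repr y i) h0
  have h3 : J s = 0 := by
    rw [← B.sum_repr s, map_sum]
    refine sum_eq_zero fun i _ => ?_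
    rw [show B.repr s i • B i = (B.repr s i) ⊗ₜ[F] (b i) by simp [B, TensorProduct.smul_tmul'],
      hJ, lift_tmul, hcon _ (h2 i), zero_mul]
  rw [hs, map_sub, map_one, (RingHom.mem_ker).1 r.2, sub_zero] at h3
  exact one_ne_zero h3

section Analytic

variable {O : Type*} [CommRing O] [IsLocalRing O] {K : Type*} [Field K] [Algebra O K]
  {N : AbsoluteValue K ℝ} [IsNoetherianRing O] {σ τ : Type*} [Finite σ] 
  {𝔪 : Ideal (MvPoly σ O)}

local notation "Ŝ" => AdicCompletion 𝔪 (MvPolynomial σ O)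
local notation "aX(" v ")" => algebraMap (MvPolynomial σ O) _ (MvPolynomial.X v)

lemma exists_eval_family_sub_le (hN : IsNonarchimedean N) (ψ : σ → MvPoly τ K) (w0 : τ → K) :
    ∃ C : ℝ, 1 ≤ C ∧ ∀ (δ : ℝ), 0 ≤ δ → δ ≤ 1 → ∀ w : τ → K, (∀ i, N (w i - w0 i) ≤ δ) →
      ∀ v, N (eval w (ψ v) - eval w0 (ψ v)) ≤ C * δ := by
  have := ofFinite σ
  choose C hC h using fun v => exists_eval_sub_le hN (ψ v) w0
  refine ⟨1 + ∑ v, C v, le_add_of_nonneg_right (sum_nonneg fun v _ => zero_le_one.trans (hC v)), fun δ hδ hδ1 w hw v => ?_⟩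
  refine (h v δ hδ hδ1 w hw).trans (mul_le_mul_of_nonneg_right ?_ hδ)
  have := Finset.single_le_sum (f := C) (fun v _ => zero_le_one.trans (hC v)) (mem_univ v)
  linarith

lemma coeff_shift_aeval_eq_zero [Finite τ] [Infinite K] [𝔪.IsMaximal] (hV : IsValuedClosure O K N)
    (hres : ∀ f, ∃ o : O, f - mvC o ∈ 𝔪) {ϖ : K} (hϖ0 : ϖ ≠ 0) (hϖ1 : N ϖ < 1) (ψ : σ → MvPoly τ K) (f : Ŝ)
    (hf : ∀ (e : Ŝ →ₐ[O] K) (w : τ → K), (∀ v, e aX(v) = eval w (ψ v)) → e f = 0) (e0 : Ŝ →ₐ[O] K) (w0 : τ → K)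
    (h0 : ∀ v, e0 aX(v) = eval w0 (ψ v)) (r : ℕ) (p : MvPoly σ O)
    (hp : f - amap _ _ p ∈ ker e0 ^ r) (d : τ →₀ ℕ) (hd : d.degree < r) : (aeval (fun i => mvX i + mvC (w0 i))
      (aeval ψ p)).coeff d = 0 := by
  obtain ⟨C, hC, hCψ⟩ := exists_eval_family_sub_le hV.nonarch ψ w0
  refine coeff_shift_eq_zero_of_le hϖ0 hϖ1 (N := N) (r := r) _ w0 (C ^ r) (1 / (2 * C))
    (by positivity) (by positivity) (fun δ hδ0 hδ w hw => ?_) d hd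
  have hCδ : C * δ ≤ 1 / 2 := by
    rw [le_div_iff₀ (by positivity)] at hδ
    linarith
  have hδ1 : δ ≤ 1 := by nlinarith
  have hdist : ∀ v, N (eval w (ψ v) - e0 aX(v)) ≤ C * δ := by
    simpa only [h0] using hCψ δ hδ0 hδ1 w hw
  have hdisc : InDisc 𝔪 N (fun v => eval w (ψ v)) := InDisc.of_sub_le hV hres (InDisc.of_algHom hV e0) (by positivity)
      (hCδ.trans_lt (by norm_num)) hdist
  obtain ⟨e, he⟩ := hdisc.exists_algHom hV hres
  have hlip : ∀ s, N (e s - e0 s) ≤ C * δ := algHom_sub_le hV hres e e0 (by positivity) fun v => by rw [he]; exact hdist v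
  have hpow : ∀ (r : ℕ) (b), b ∈ ker e0 ^ r → N (e b) ≤ (C * δ) ^ r := by
    intro r
    induction r with
    | zero =>
      intro b _
      have := isLocalRing_adicCompletion 𝔪
      simpa using hV.norm_le_one (residue_completion 𝔪 hres) e b
    | succ r ih =>
      intro b hb
      rw [pow_succ] at hb
      refine Submodule.mul_induction_on hb (fun a ha b hb => ?_) (fun x y hx hy => ?_)
      · rw [map_mul, N.map_mul, pow_succ]
        refine mul_le_mul (ih a ha) ?_ (N.nonneg _) (by positivity)
        simpa [(RingHom.mem_ker).1 hb] using hlip b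
      · rw [map_add]; exact (hV.nonarch _ _).trans (max_le hx hy)
  have h1 : eval w (aeval ψ p) = - e (f - amap _ _ p) := by
    rw [map_sub, hf e w he, zero_sub, neg_neg, algHom_algebraMap]
    simp only [he]
    rw [MvPolynomial.aeval_def, eval_eval₂, MvPolynomial.aeval_def]
    congr 1
    ext o
    simp only [RingHom.comp_apply]
    rw [tower O K (MvPoly τ K), algebraMap_eq, MvPolynomial.eval_C]
  rw [h1, N.map_neg, ← mul_pow]
  exact hpow r _ hp

end Analytic

section Vanishing

variable {O : Type*} [CommRing O] [IsDomain O] [IsLocalRing O] [IsNoetherianRing O]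
  [IsAdicComplete (maxId O) O] {K : Type*} [Field K] [IsAlgClosed K] [Algebra O K]
  {N : AbsoluteValue K ℝ} {σ τ : Type*} [Finite σ] [Finite τ]
  {𝔪 : Ideal (MvPoly σ O)} [𝔪.IsMaximal] {F : Type*} [Field F] [Algebra O F] [Algebra F K] [IsScalarTower O F K]

local notation "Ŝ" => AdicCompletion 𝔪 (MvPolynomial σ O)
local notation "aX(" v ")" => algebraMap (MvPolynomial σ O) _ (MvPolynomial.X v)

lemma algebraMap_eq_zero_of_vanishing (hV : IsValuedClosure O K N) (hinj : Injective (amap O K))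
    (hres : ∀ f, ∃ o : O, f - mvC o ∈ 𝔪) {ϖ : O} (hϖ0 : ϖ ≠ 0) (hϖ : maxId O = span {ϖ}) (hϖm : mvC ϖ ∈ 𝔪)
    (ψ : σ → MvPoly τ F) (f : Ŝ) (hf : ∀ (e : Ŝ →ₐ[O] K) (w : τ → K), (∀ v, e aX(v) = aeval w (ψ v)) → e f = 0)
    {T : Type*} [CommRing T] [Algebra Ŝ T] [Algebra F T] [FiniteType Ŝ T] (θ : MvPoly τ F →ₐ[F] T)
    (hθ : ∀ p : MvPoly σ O, θ (aeval ψ p) = amap Ŝ T (amap _ _ p)) : amap Ŝ T f = 0 := by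
  have := isLocalRing_adicCompletion 𝔪
  have := isNoetherianRing_adicCompletion 𝔪
  have hres' := residue_completion 𝔪 hres
  let S := Ŝ
  have hloc : amap O S ϖ ∈ maxId S := by
    rw [maximalIdeal_adicCompletion, tower O (MvPoly σ O)]
    exact mem_map_of_mem _ hϖm
  have : IsNoetherianRing T := isNoetherianRing S T
  have hOST : ∀ o : O, amap S T (amap O S o) = amap F T (amap O F o) := by
    intro o
    rw [tower O (MvPoly σ O) S, ← hθ, AlgHom.commutes, tower O F (MvPoly τ F), AlgHom.commutes]
  by_contra hx
  set x := amap S T f with hxdef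
  obtain ⟨𝔫, h𝔫, hann⟩ := Ideal.exists_le_maximal (span {x}).annihilator (by
    intro h
    have h1 := h.ge (Submodule.mem_top (x := 1))
    rw [span, Submodule.mem_annihilator_span_singleton, one_smul] at h1
    exact hx h1)
  let : Field (T ⧸ 𝔫) := Ideal.Quotient.field 𝔫
  let : Algebra O (T ⧸ 𝔫) := ((amap F (T ⧸ 𝔫)).comp (amap O F)).toAlgebra
  have : IsScalarTower O F (T ⧸ 𝔫) := of_algebraMap_eq fun _ => rfl
  have : IsScalarTower O S (T ⧸ 𝔫) := of_algebraMap_eq fun o => by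
    change _ = modId 𝔫 (amap S T _)
    rw [hOST]; rfl
  have : FiniteType S (T ⧸ 𝔫) := Algebra.FiniteType.of_surjective (mkₐ S 𝔫) (Ideal.Quotient.mkₐ_surjective _ _)
  have hinjF : Injective (amap O F) := by
    rw [IsScalarTower.algebraMap_eq O F K] at hinj
    exact of_comp hinj
  have hinjκ : Injective (amap O (T ⧸ 𝔫)) := (amap F (T ⧸ 𝔫)).injective.comp hinjF
  have halg := isAlgebraic_of_finiteType hϖ hloc hres' hinjκ hϖ0
  have : Algebra.IsAlgebraic F (T ⧸ 𝔫) := ⟨fun z => by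
    obtain ⟨P, hP, hPz⟩ := halg.1 z
    refine ⟨P.map (amap O F), (Polynomial.map_ne_zero_iff hinjF).2 hP, ?_⟩
    rwa [Polynomial.aeval_map_algebraMap]⟩
  let j0 : (T ⧸ 𝔫) →ₐ[F] K := IsAlgClosed.lift
  let j : T →ₐ[F] K := j0.comp (mkₐ F 𝔫)
  have hjker : ∀ t, j t = 0 ↔ t ∈ 𝔫 := fun t =>
    (map_eq_zero_iff j0 j0.toRingHom.injective).trans eq_zero_iff_mem
  let e0 : S →ₐ[O] K :=
    { (j : T →+* K).comp (amap S T) with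
      commutes' := fun o => by
        change j (amap S T (amap O S o)) = _
        rw [hOST, AlgHom.commutes, ← tower] }
  have he0 : ∀ s, e0 s = j (amap S T s) := fun _ => rfl
  let w0 : τ → K := fun i => j (θ (mvX i))
  have hjθ : j.comp θ = aeval w0 := by ext i; simp [w0]
  have h0 : ∀ v, e0 aX(v) = eval w0 (MvPolynomial.map (amap F K) (ψ v)) := fun v => by
    rw [he0, ← hθ, aeval_X, eval_map, ← MvPolynomial.aeval_def]
    exact cfun hjθ _
  obtain ⟨E', _, _, _, ι, w0', hw0'⟩ : ∃ (E' : Type _) (_ : Field E') (_ : Algebra F E')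
      (_ : FinDim F E') (ι : E' →ₐ[F] K) (w0' : τ → E'), ∀ i, ι (w0' i) = w0 i :=
    ⟨adjoin F (Set.range w0), inferInstance, inferInstance, finiteDimensional_adjoin (by
        rintro _ ⟨i, rfl⟩
        exact (isIntegral (R := F) (modId 𝔫 (θ (mvX i)))).map j0), IntermediateField.val _,
      fun i => ⟨w0 i, subset_adjoin _ _ ⟨i, rfl⟩⟩, fun _ => rfl⟩
  have hkerS : ker (amap S (T ⧸ 𝔫)) = ker e0 := by
    ext s
    rw [RingHom.mem_ker, RingHom.mem_ker, he0, hjker]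
    exact eq_zero_iff_mem
  have hϖκ : amap S (T ⧸ 𝔫) (amap O S ϖ) ≠ 0 := by
    rw [← tower]
    exact fun h => hϖ0 (hinjκ (by rw [h, map_zero]))
  obtain ⟨-, j1, hj1⟩ := exists_pow_le_of_finiteType hϖκ
  rw [hkerS] at hj1
  have hϖK : amap O K ϖ ≠ 0 := fun h => hϖ0 (hinj (by rw [h, map_zero]))
  have hϖN : N (amap O K ϖ) < 1 := (hV.lt_one_iff ϖ).2 (hϖ.ge (mem_span_singleton_self _))
  obtain ⟨s, hs0, hs1⟩ := exists_mul_eq_zero_of_forall_mem_pow j ι x (by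
    intro r
    set J := Algebra.TensorProduct.lift j ι (fun _ _ => Commute.all _ _)
    have hJ1 : ∀ t : T, J (t ⊗ₜ[F] 1) = j t := fun t => by simp [J]
    obtain ⟨G, hG, hGs⟩ := exists_finset_sub_mem hϖ hloc hres' (LinearMap.range (toAlgHom O (MvPoly σ O) S).toLinearMap)
      (fun s j => by
        obtain ⟨p, hp⟩ := exists_sub_mem_pow (IsNoetherian.noetherian 𝔪) s j
        rw [← maximalIdeal_adicCompletion] at hp
        exact ⟨_, ⟨p, rfl⟩, hp⟩) (ker e0 ^ r) (j := j1 * (1 + r)) (by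
        rw [pow_mul]
        simpa using (pow_right_mono hj1 (1 + r)).trans Ideal.sup_pow_add_le_pow_sup_pow)
    obtain ⟨g, hg, hfg⟩ := hGs f
    obtain ⟨p, rfl⟩ := Submodule.span_le.2 hG hg
    change f - amap (MvPoly σ O) S p ∈ _ at hfg
    have hcoef := coeff_shift_aeval_eq_zero hV hres hϖK hϖN
      (fun v => MvPolynomial.map (amap F K) (ψ v)) f (fun e w hw => hf e w fun v => by
        rw [hw, eval_map, MvPolynomial.aeval_def]) e0 w0 h0 r p hfg
    let θ' : MvPoly τ E' →+* T ⊗[F] E' := eval₂Hom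
      (includeRight : E' →ₐ[F] T ⊗[F] E').toRingHom (fun i => θ (mvX i) ⊗ₜ 1 - 1 ⊗ₜ (w0' i))
    let g' : MvPoly τ E' := aeval
      (fun i => mvX i + mvC (w0' i)) (aeval ψ p)
    have hg' : g' ∈ idealOfVars τ E' ^ r := by
      rw [MvPolynomial.mem_pow_idealOfVars_iff']
      intro d hd
      have h1 := hcoef d hd
      have h2 : MvPolynomial.map (ι : E' →+* K) g' = (aeval (fun i => mvX i + mvC (w0 i)))
          (aeval (fun v => MvPolynomial.map (amap F K) (ψ v)) p) := by
        have hA : (mapAlgHom (σ := τ) ι).comp (aeval (fun i => mvX i + mvC (w0' i))) = ((aeval (fun i => mvX i + mvC (w0 i)) :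
              MvPoly τ K →ₐ[K] MvPoly τ K).restrictScalars F).comp (mapAlgHom (σ := τ) (ofId F K)) := by
          ext i : 1
          simp [hw0', ofId]
        have hB : (aeval (fun v => MvPolynomial.map (amap F K) (ψ v)) : MvPoly σ O →ₐ[O] MvPoly τ K) =
            ((mapAlgHom (σ := τ) (ofId F K)).restrictScalars O).comp (aeval ψ) := by
          ext i : 1
          simp [ofId]
        rw [hB]
        exact cfun hA (aeval ψ p)
      rw [← h2, MvPolynomial.coeff_map] at h1
      exact (map_eq_zero_iff _ ι.toRingHom.injective).1 h1
    have hθ'g : θ' g' = amap S T (amap (MvPoly σ O) S p) ⊗ₜ 1 := by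
      rw [← hθ]
      have : (θ'.comp (aeval (R := F) (fun i => (mvX i + mvC (w0' i) : MvPoly τ E'))).toRingHom) =
          ((includeLeft : T →ₐ[F] T ⊗[F] E').comp θ).toRingHom := by
        refine ringHom_ext (fun c => ?_) fun i => ?_
        · simp only [RingHom.comp_apply, AlgHom.toRingHom_eq_coe, coe_coe]
          rw [show (mvC c : MvPoly τ F) = amap F _ c from rfl, AlgHom.commutes, AlgHom.commutes,
            tower F E' (MvPoly τ E'), algebraMap_eq]
          simp only [θ', eval₂Hom_C]
          exact (includeRight : E' →ₐ[F] T ⊗[F] E').commutes c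
        · simp [θ']
      exact cfun this (aeval ψ p)
    have hker' : (idealOfVars τ E').map θ' ≤ ker J := by
      rw [map_span, span_le]
      rintro _ ⟨_, ⟨i, rfl⟩, rfl⟩
      rw [mem_coe, RingHom.mem_ker]
      simp [θ', J, hw0', w0]
    have hkere : (ker e0).map ((includeLeft : T →ₐ[F] T ⊗[F] E').toRingHom.comp (amap S T)) ≤
        ker J := map_le_iff_le_comap.2 fun s hs => (hJ1 _).trans hs
    rw [show x ⊗ₜ[F] (1 : E') = θ' g' + (amap S T (f - amap (MvPoly σ O) S p)) ⊗ₜ 1 by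
      rw [hθ'g, ← add_tmul, ← map_add, add_sub_cancel]]
    refine Ideal.add_mem _ (pow_right_mono hker' r ?_) (pow_right_mono hkere r ?_) <;>
      rw [← Ideal.map_pow]
    exacts [mem_map_of_mem _ hg', mem_map_of_mem _ hfg])
  refine hs1 ((hjker s).2 (hann ?_))
  rw [span, Submodule.mem_annihilator_span_singleton]
  exact hs0

/-- A function on the residue disc of `𝔪` that vanishes at the points of this disc that lie on
the image of a polynomial map `ψ` is in the ideal generated by the polynomials vanishing on the
image of `ψ`. -/
lemma mem_map_ker_aeval_of_vanishing (hV : IsValuedClosure O K N) (hinj : Injective (amap O K))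
    (hres : ∀ f, ∃ o : O, f - mvC o ∈ 𝔪) {ϖ : O} (hϖ0 : ϖ ≠ 0) (hϖ : maxId O = span {ϖ}) (hϖm : mvC ϖ ∈ 𝔪)
    [FiniteType O F] [Algebra.IsAlgebraic F K] (ψ : σ → MvPoly τ K) (h : MvPoly τ K) (hh : h ≠ 0) (f : Ŝ)
    (hf : ∀ (e : Ŝ →ₐ[O] K) (w : τ → K), eval w h ≠ 0 → (∀ v, e aX(v) = eval w (ψ v)) → e f = 0) :
    f ∈ (ker (aeval (R := O) ψ)).map (amap _ Ŝ) := by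
  classical
  have := ofFinite σ
  have := ofFinite τ
  have hϖK : amap O K ϖ ≠ 0 := fun h => hϖ0 (hinj (by rw [h, map_zero]))
  have hϖN : N (amap O K ϖ) < 1 := (hV.lt_one_iff ϖ).2 (hϖ.ge (mem_span_singleton_self _))
  have hf' : ∀ (e : Ŝ →ₐ[O] K) (w : τ → K), (∀ v, e aX(v) = eval w (ψ v)) → e f = 0 := by
    intro e w hw
    obtain ⟨u, hu⟩ : ∃ u, eval u h ≠ 0 := by
      by_contra! hcon
      exact hh (MvPolynomial.funext fun u => by rw [hcon, map_zero])
    let Ps : Polynomial K := aeval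
      (fun i => Polynomial.C (w i) + Polynomial.X * Polynomial.C (u i - w i)) h
    have hPs : ∀ s, Ps.eval s = eval (fun i => w i + s * (u i - w i)) h := fun s => by
      have : (peval s).comp (aeval (fun i => Polynomial.C (w i) + Polynomial.X * Polynomial.C (u i - w i))) =
        aeval (R := K) (fun i => w i + s * (u i - w i)) := by
        ext i; simp
      simpa [MvPolynomial.aeval_eq_eval, Polynomial.coe_aeval_eq_eval, Ps] using cfun this h
    have hPs0 : Ps ≠ 0 := fun h0 => hu (by simpa [h0] using (hPs 1).symm)
    obtain ⟨C, hC, hCψ⟩ := exists_eval_family_sub_le hV.nonarch ψ w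
    set B : ℝ := 1 + ∑ i, N (u i - w i) with hB
    have hB0 : 1 ≤ B := le_add_of_nonneg_right (sum_nonneg fun _ _ => N.nonneg _)
    have hBi : ∀ i, N (u i - w i) ≤ B := fun i => by
      have := Finset.single_le_sum (f := fun i => N (u i - w i)) (fun _ _ => N.nonneg _) (mem_univ i)
      linarith
    suffices hε : ∀ ε : ℝ, 0 < ε → ε < 1 → N (e f) ≤ ε from N.eq_zero.1 (le_antisymm (le_of_forall_gt_imp_ge_of_dense fun ε hε0 =>
        (hε (min ε (1 / 2)) (by positivity)
        ((min_le_right _ _).trans_lt (by norm_num))).trans (min_le_left _ _)) (N.nonneg _))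
    intro ε hε0 hε1
    obtain ⟨k0, hk0⟩ := exists_pow_lt_of_lt_one (show 0 < ε / (C * B) by positivity) hϖN
    have hinjpow : Injective fun k => amap O K ϖ ^ (k + k0) := fun a b hab => by
      have := (pow_right_strictAnti₀ (N.pos hϖK) hϖN).injective (a₁ := a + k0) (a₂ := b + k0)
        (by simpa [N.map_pow] using congrArg N hab)
      lia
    obtain ⟨_, ⟨k, rfl⟩, hk⟩ := (Set.infinite_range_of_injective hinjpow).exists_notMem_finite Ps.roots.toFinset.finite_toSet
    simp only [Finset.mem_coe, Multiset.mem_toFinset, mem_roots hPs0, Polynomial.IsRoot.def] at hk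
    set s := amap O K ϖ ^ (k + k0)
    rw [hPs] at hk
    have hs : N s ≤ ε / (C * B) := by
      simp only [s]
      rw [N.map_pow, pow_add]
      exact (mul_le_of_le_one_left (by positivity) (pow_le_one₀ (N.nonneg _) hϖN.le)).trans hk0.le
    have hsB : N s * B ≤ ε / C := by
      rw [le_div_iff₀ (by positivity)] at hs ⊢
      linarith
    have hεC : ε / C ≤ 1 := by
      rw [div_le_one (by positivity)]; linarith
    have hdist : ∀ v, N (eval (fun i => w i + s * (u i - w i)) (ψ v) - e aX(v)) ≤ ε := fun v => by
      rw [hw]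
      refine (hCψ (ε / C) (by positivity) hεC _ (fun i => ?_) v).trans (by
        rw [mul_div_cancel₀ _ (by positivity)])
      rw [add_sub_cancel_left, N.map_mul]
      exact (mul_le_mul_of_nonneg_left (hBi i) (N.nonneg _)).trans hsB
    have hdisc := InDisc.of_sub_le hV hres (InDisc.of_algHom hV e) hε0.le hε1 hdist
    obtain ⟨e', he'⟩ := hdisc.exists_algHom hV hres
    have h1 := algHom_sub_le hV hres e' e hε0.le (fun v => by rw [he']; exact hdist v) f
    rwa [hf e' _ hk he', zero_sub, N.map_neg] at h1
  let cf : Set K := ⋃ v, ((ψ v).coeffs : Set K)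
  have hcf : cf.Finite := Set.finite_iUnion fun v => (ψ v).coeffs.finite_toSet
  have : Finite cf := hcf
  have : FinDim F (adjoin F cf) := finiteDimensional_adjoin fun x _ => isIntegral x
  obtain ⟨F', _, _, _, _, _, _, hψ⟩ : ∃ (F' : Type _) (_ : Field F') (_ : Algebra O F')
      (_ : Algebra F' K) (_ : IsScalarTower O F' K) (_ : FiniteType O F')
      (ψ' : σ → MvPoly τ F'), ∀ v, MvPolynomial.map (amap F' K) (ψ' v) = ψ v := by
    have hmem : ∀ v, ψ v ∈ Set.range (MvPolynomial.map (σ := τ) (amap (adjoin F cf) K)) := fun v =>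
      MvPolynomial.mem_range_map_iff_coeffs_subset.2 fun c hc =>
        ⟨⟨c, subset_adjoin _ _ (Set.mem_iUnion.2 ⟨v, hc⟩)⟩, rfl⟩
    choose ψ' hψ' using hmem
    let alg : Algebra O (adjoin F cf) :=
      ((amap F (adjoin F cf)).comp (amap O F)).toAlgebra
    have : IsScalarTower O F (adjoin F cf) := of_algebraMap_eq fun _ => rfl
    exact ⟨adjoin F cf, inferInstance, alg, inferInstance, of_algebraMap_eq fun o => by rw [tower O F K]; rfl,
      Algebra.FiniteType.trans (S := F) inferInstance inferInstance, ψ', hψ'⟩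
  rename_i ψ'
  have hker : ker (aeval (R := O) ψ) = ker (aeval (R := O) ψ') := by
    ext p
    rw [RingHom.mem_ker, RingHom.mem_ker, show aeval (R := O) ψ =
      ((mapAlgHom (σ := τ) (ofId F' K)).restrictScalars O).comp (aeval (R := O) ψ') by
      ext i : 1; simp [ofId, hψ]]
    exact map_eq_zero_iff _ (map_injective _ (amap F' K).injective)
  rw [hker]
  let : Algebra (MvPoly σ O) (MvPoly τ F') :=
    (aeval (R := O) ψ').toRingHom.toAlgebra
  have : IsScalarTower O (MvPoly σ O) (MvPoly τ F') := of_algebraMap_eq fun o => ((aeval (R := O) ψ').commutes o).symm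
  have : FiniteType O (MvPoly τ F') := Algebra.FiniteType.trans (S := F') inferInstance inferInstance
  have : FiniteType (MvPoly σ O) (MvPoly τ F') := of_restrictScalars_finiteType O _ _
  have := flat_of_isNoetherian 𝔪
  refine mem_map_ker_of_flat (Q := MvPoly τ F') ?_
  obtain ⟨T, _, _, _, θ, hθ, hT⟩ : ∃ (T : Type _) (_ : CommRing T) (_ : Algebra Ŝ T) (_ : FiniteType Ŝ T)
      (θ : MvPoly τ F' →+* T), (∀ p, θ (aeval ψ' p) = amap Ŝ T (amap _ _ p)) ∧ (amap Ŝ T f = 0 →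
        f ⊗ₜ[MvPoly σ O] (1 : MvPoly τ F') = 0) := ⟨Ŝ ⊗[MvPoly σ O] MvPoly τ F', inferInstance, inferInstance, inferInstance,
      includeRight.toRingHom, fun p =>
        (includeRight.commutes p).trans (includeLeft (S := MvPoly σ O).commutes p).symm, id⟩
  let : Algebra F' T := (θ.comp mvC).toAlgebra
  refine hT (algebraMap_eq_zero_of_vanishing (T := T) hV hinj hres hϖ0 hϖ hϖm ψ' f
    (fun e w hw => hf' e w fun v => ?_) { θ with commutes' := fun _ => rfl } hθ)
  rw [hw, ← hψ, eval_map, MvPolynomial.aeval_def]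

end Vanishing

lemma isAdicComplete_of_pow_le {A : Type*} [CommRing A] {I J : Ideal A} {k : ℕ} (hk : 0 < k)
    (h : J ^ k ≤ I) (hIJ : I ≤ J) [IsAdicComplete I A] : IsAdicComplete J A where
  haus' x hx := by
    refine haus (I := I) inferInstance x fun m => ?_
    have h1 := hx (k * m)
    rw [SModEq.zero] at h1 ⊢
    simp only [smul_eq_mul, mul_top] at h1 ⊢
    rw [pow_mul] at h1
    exact pow_right_mono h m h1
  prec' f hf := by
    simp only [smul_eq_mul, mul_top, SModEq.sub_mem] at hf ⊢
    obtain ⟨L, hL⟩ := prec (I := I) (M := A) inferInstance (f := fun m => f (k * m)) (fun {m n} hmn => by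
        simp only [smul_eq_mul, mul_top, SModEq.sub_mem]
        have := hf (Nat.mul_le_mul_left k hmn)
        rw [pow_mul] at this
        exact pow_right_mono h m this)
    refine ⟨L, fun m => ?_⟩
    have h1 := hL m
    simp only [smul_eq_mul, mul_top, SModEq.sub_mem] at h1
    have h2 := hf (Nat.le_mul_of_pos_left m hk)
    have := Ideal.add_mem _ h2 (pow_right_mono hIJ m h1)
    rwa [sub_add_sub_cancel] at this

lemma isPrecomplete_of_finite {R M : Type*} [CommRing R] (I : Ideal R) [IsPrecomplete I R]
    [AddCommGroup M] [Module R M] [Module.Finite R M] : IsPrecomplete I M := by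
  obtain ⟨n, f, hf⟩ := Module.Finite.exists_fin' R M
  have := isPrecomplete_pi (I := I) (ι := Fin n)
  exact isPrecomplete_of_surjective f hf

lemma exists_pow_maximalIdeal_le {R A : Type*} [CommRing R] [IsLocalRing R] [IsNoetherianRing R]
    [CommRing A] [IsLocalRing A] [Algebra R A] [Module.Finite R A] : ∃ k, 0 < k ∧ maxId A ^ k ≤ (maxId R).map (amap R A) := by
  have : IsNoetherianRing A := of_finite R A
  have h1 : maxId A ≤ ((maxId R).map (amap R A)).radical := by
    rw [Ideal.radical_eq_sInf]
    refine le_sInf fun P ⟨hP, hPp⟩ => ?_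
    have : (P.comap (amap R A)).IsPrime := Ideal.comap_isPrime _ _
    have h2 : P.comap (amap R A) = maxId R := le_antisymm (le_maximalIdeal this.ne_top) (map_le_iff_le_comap.1 hP)
    have h3 : P.IsMaximal := Ideal.isMaximal_of_isIntegral_of_isMaximal_comap P (by
      rw [h2]; infer_instance)
    rw [eq_maximalIdeal h3]
  obtain ⟨k, hk⟩ := Ideal.exists_radical_pow_le_of_fg ((maxId R).map (amap R A)) (IsNoetherian.noetherian _)
  refine ⟨k + 1, k.succ_pos, (pow_le_pow_right k.le_succ).trans ?_⟩
  exact (pow_right_mono h1 k).trans hk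

lemma isAdicComplete_of_finite {R A : Type*} [CommRing R] [IsLocalRing R] [IsNoetherianRing R]
    [IsAdicComplete (maxId R) R] [CommRing A] [IsLocalRing A] [Algebra R A] [Module.Finite R A] : IsAdicComplete (maxId A) A := by
  have : IsNoetherianRing A := of_finite R A
  obtain ⟨k, hk, h⟩ := exists_pow_maximalIdeal_le (R := R) (A := A)
  have hle : (maxId R).map (amap R A) ≤ maxId A := by
    refine le_maximalIdeal ?_
    have : ((maxId A).comap (amap R A)).IsPrime := Ideal.comap_isPrime _ _
    have hint : ((maxId A).comap (amap R A)).IsMaximal := Ideal.isMaximal_comap_of_isIntegral_of_isMaximal _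
    have h1 := eq_maximalIdeal hint
    intro htop
    have : (maxId R).map (amap R A) ≤ maxId A := by
      rw [map_le_iff_le_comap, h1]
    rw [htop, top_le_iff] at this
    exact (maximalIdeal.isMaximal A).ne_top this
  have hp : IsPrecomplete ((maxId R).map (amap R A)) A := by
    rw [map_algebraMap_iff]
    exact isPrecomplete_of_finite _
  have hh : IsHausdorff ((maxId R).map (amap R A)) A := IsHausdorff.of_isLocalRing _ _ (fun h => (maximalIdeal.isMaximal A).ne_top
      (top_le_iff.1 (h ▸ hle)))
  have : IsAdicComplete ((maxId R).map (amap R A)) A := ⟨⟩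
  exact isAdicComplete_of_pow_le hk h hle

lemma le_one_of_isIntegralElem {R K : Type*} [CommRing R] [Field K] {N : AbsoluteValue K ℝ}
    (hN : IsNonarchimedean N) (f : R →+* K) (hf : ∀ r, N (f r) ≤ 1) {x : K} (hx : f.IsIntegralElem x) : N x ≤ 1 := by
  obtain ⟨P, hP, h0⟩ := hx
  by_contra! h1
  rw [eval₂_eq_sum_range, sum_range_succ, hP.coeff_natDegree, map_one, one_mul] at h0
  have h2 : N (x ^ P.natDegree) = N (∑ i ∈ range P.natDegree, f (P.coeff i) * x ^ i) := by
    rw [eq_neg_of_add_eq_zero_right h0, N.map_neg]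
  rcases Nat.eq_zero_or_pos P.natDegree with hd | hd
  · rw [hd] at h2
    simp at h2
  have h3 : N (∑ i ∈ range P.natDegree, f (P.coeff i) * x ^ i) ≤ N x ^ (P.natDegree - 1) := by
    refine nonarch_sum_le hN _ _ (by positivity) fun i hi => ?_
    rw [N.map_mul, N.map_pow]
    refine (mul_le_of_le_one_left (by positivity) (hf _)).trans (pow_le_pow_right₀ h1.le ?_)
    have := mem_range.1 hi
    omega
  rw [← h2, N.map_pow] at h3
  have := (pow_lt_pow_right₀ h1 (Nat.sub_lt hd one_pos)).trans_le h3
  exact lt_irrefl _ this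

section PadicAbs

variable (p : ℕ) [Fact p.Prime] (K : Type*) [Field K] [Algebra ℚ_[p] K]
  [Algebra.IsAlgebraic ℚ_[p] K]

/-- The extension of the `p`-adic absolute value to an algebraic extension of `ℚ_p`. -/
def padicAbs : AbsoluteValue K ℝ where
  toFun := spectralNorm ℚ_[p] K
  map_mul' := map_mul (spectralMulAlgNorm ℚ_[p] K)
  nonneg' := spectralNorm_nonneg
  eq_zero' _ := map_eq_zero (spectralMulAlgNorm ℚ_[p] K)
  add_le' := map_add_le_add (spectralMulAlgNorm ℚ_[p] K)

variable {K}

lemma padicAbs_nonarch : IsNonarchimedean (padicAbs p K) := isNonarchimedean_spectralNorm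

lemma padicAbs_algebraMap (x : ℚ_[p]) : padicAbs p K (amap ℚ_[p] K x) = ‖x‖ := spectralNorm_extends x

lemma mem_integers_iff {x : K} : x ∈ integers p K ↔ padicAbs p K x ≤ 1 := Iff.rfl

lemma padicAbs_le_one_iff {x : K} : padicAbs p K x ≤ 1 ↔ ((amap ℚ_[p] K).comp (amap ℤ_[p] ℚ_[p])).IsIntegralElem x := by
  refine ⟨fun h => ?_, le_one_of_isIntegralElem (padicAbs_nonarch p) _ fun r => ?_⟩
  · have hmon := minpoly.monic (isIntegral (R := ℚ_[p]) x)
    have h1 : ∀ n, ‖(minpoly ℚ_[p] x).coeff n‖ ≤ 1 := (spectralValue_le_one_iff hmon).1 h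
    have h2 : minpoly ℚ_[p] x ∈ Polynomial.lifts (amap ℤ_[p] ℚ_[p]) := by
      rw [Polynomial.lifts_iff_coeff_lifts]
      exact fun n => ⟨⟨_, h1 n⟩, rfl⟩
    obtain ⟨P, hP, -, hPm⟩ := Polynomial.lifts_and_degree_eq_and_monic h2 hmon
    refine ⟨P, hPm, ?_⟩
    rw [← Polynomial.eval₂_map, hP]
    exact minpoly.aeval ℚ_[p] x
  · rw [RingHom.comp_apply, padicAbs_algebraMap]
    exact r.2

lemma mem_maximalIdeal_integers_iff (x : integers p K) : x ∈ maxId (integers p K) ↔ padicAbs p K x < 1 := by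
  rw [mem_maximalIdeal, mem_nonunits_iff]
  constructor
  · intro h
    refine lt_of_le_of_ne x.2 fun h1 => h ?_
    have hx0 : (x : K) ≠ 0 := by
      intro h0
      change padicAbs p K x = 1 at h1
      rw [h0, map_zero] at h1
      exact zero_ne_one h1
    have hinv : (x : K)⁻¹ ∈ integers p K := by
      rw [mem_integers_iff, map_inv₀]
      exact (inv_eq_one.2 h1).le
    exact of_mul_eq_one ⟨_, hinv⟩ (Subtype.ext (mul_inv_cancel₀ hx0))
  · intro h hu
    obtain ⟨y, hy⟩ := hu.exists_right_inv
    have h1 : padicAbs p K x * padicAbs p K y = 1 := by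
      rw [← map_mul]
      have : (x : K) * y = 1 := congrArg Subtype.val hy
      rw [this, map_one]
    have h2 : padicAbs p K y ≤ 1 := y.2
    have h3 := (padicAbs p K).nonneg (x : K)
    have h4 := (padicAbs p K).nonneg (y : K)
    nlinarith

/-- Ring homomorphism from the `p`-adic integers. -/
def padicIntMap : ℤ_[p] →+* integers p K := RingHom.codRestrict ((amap ℚ_[p] K).comp (amap ℤ_[p] ℚ_[p])) (integers p K).toSubring
    fun r => by
      change padicAbs p K (amap ℚ_[p] K _) ≤ 1
      rw [padicAbs_algebraMap]
      exact r.2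

lemma finite_of_isIntegrallyClosed {F A : Type*} [Field F] [Algebra ℚ_[p] F]
    [FinDim ℚ_[p] F] [CommRing A] [Algebra ℤ_[p] A] (ι : A →+* F) (hι : Injective ι) (hcomm : ∀ r : ℤ_[p], ι (amap ℤ_[p] A r) =
      amap ℚ_[p] F r) (hrange : ∀ x : F, padicAbs p F x ≤ 1 ↔ x ∈ ι.range) : Module.Finite ℤ_[p] A := by
  let : Algebra A F := ι.toAlgebra
  let : Algebra ℤ_[p] F := ((amap ℚ_[p] F).comp (amap ℤ_[p] ℚ_[p])).toAlgebra
  have : IsScalarTower ℤ_[p] ℚ_[p] F := of_algebraMap_eq fun _ => rfl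
  have : IsScalarTower ℤ_[p] A F := of_algebraMap_eq fun r => (hcomm r).symm
  have : IsIntegralClosure A ℤ_[p] F := ⟨hι, fun {x} => (padicAbs_le_one_iff p (x := x)).symm.trans (hrange x)⟩
  exact IsIntegralClosure.finite ℤ_[p] ℚ_[p] F A

end PadicAbs

section Integers

variable (p : ℕ) [Fact p.Prime] (E : Type*) [Field E] [Algebra ℚ_[p] E]
  [FinDim ℚ_[p] E]

instance algebraPadicIntIntegers : Algebra ℤ_[p] (integers p E) := (padicIntMap p).toAlgebra

instance finite_integers : Module.Finite ℤ_[p] (integers p E) :=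
  finite_of_isIntegrallyClosed p (F := E) (integers p E).subtype val_injective (fun _ => rfl) fun x => by
      rw [← mem_integers_iff]
      exact ⟨fun h => ⟨⟨x, h⟩, rfl⟩, fun ⟨y, hy⟩ => hy ▸ y.2⟩

instance isNoetherianRing_integers : IsNoetherianRing (integers p E) := of_finite ℤ_[p] _

instance isAdicComplete_integers : IsAdicComplete (maxId (integers p E)) (integers p E) := isAdicComplete_of_finite (R := ℤ_[p])

lemma exists_uniformizer : ∃ ϖ : integers p E, ϖ ≠ 0 ∧ maxId (integers p E) = span {ϖ} := by
  have : IsPrincipalIdealRing (integers p E) := inferInstance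
  obtain ⟨ϖ, hϖ⟩ := (principal (maxId (integers p E))).1
  refine ⟨ϖ, ?_, hϖ⟩
  rintro rfl
  have h1 : (padicIntMap p (K := E) (p : ℤ_[p])) ∈ maxId (integers p E) := by
    rw [mem_maximalIdeal_integers_iff]
    change padicAbs p E (amap ℚ_[p] E ((p : ℤ_[p]) : ℚ_[p])) < 1
    rw [padicAbs_algebraMap]
    simpa using Padic.norm_p_lt_one (p := p)
  rw [hϖ, Submodule.mem_span_singleton] at h1
  obtain ⟨a, ha⟩ := h1
  rw [smul_zero] at ha
  have h2 := congrArg Subtype.val ha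
  change (0 : E) = amap ℚ_[p] E ((p : ℤ_[p]) : ℚ_[p]) at h2
  rw [eq_comm, map_eq_zero] at h2
  exact (Fact.out : p.Prime).ne_zero (by simpa using h2)

instance finiteType_integers : FiniteType (integers p E) E := by
  refine ⟨⟨{amap ℚ_[p] E (p : ℚ_[p])⁻¹}, ?_⟩⟩
  rw [eq_top_iff]
  intro x _
  have hp := (Fact.out : p.Prime)
  have hp1 : padicAbs p E (amap ℚ_[p] E (p : ℚ_[p])) < 1 := by
    rw [padicAbs_algebraMap]; exact Padic.norm_p_lt_one
  have hp0 : amap ℚ_[p] E (p : ℚ_[p]) ≠ 0 := by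
    rw [Ne, map_eq_zero]; exact_mod_cast hp.ne_zero
  obtain ⟨k, hk⟩ := exists_pow_lt_of_lt_one (show (0 : ℝ) < 1 / (1 + padicAbs p E x) by
      have := (padicAbs p E).nonneg x; positivity) hp1
  have hmem : amap ℚ_[p] E (p : ℚ_[p]) ^ k * x ∈ integers p E := by
    rw [mem_integers_iff, map_mul, map_pow]
    have h0 := (padicAbs p E).nonneg x
    rw [lt_div_iff₀ (by positivity)] at hk
    have := pow_nonneg ((padicAbs p E).nonneg (amap ℚ_[p] E (p : ℚ_[p]))) k
    nlinarith
  have hx : x = (⟨_, hmem⟩ : integers p E) • (amap ℚ_[p] E (p : ℚ_[p])⁻¹) ^ k := by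
    change x = (amap ℚ_[p] E (p : ℚ_[p]) ^ k * x) * _
    rw [map_inv₀, inv_pow, mul_right_comm, mul_inv_cancel₀ (pow_ne_zero k hp0), one_mul]
  rw [hx]
  exact Subalgebra.smul_mem _ (Subalgebra.pow_mem _ (Algebra.subset_adjoin (by simp)) _) _

instance finite_residueField_integers : Finite (ResF (integers p E)) := by
  have : Finite (ResF ℤ_[p]) := Finite.of_equiv _ (PadicInt.residueField (p := p)).symm.toEquiv
  have hloc : IsLocalHom (amap ℤ_[p] (integers p E)) := by
    refine ⟨fun r hr => ?_⟩
    by_contra hnu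
    have h1 : amap ℤ_[p] (integers p E) r ∈ maxId (integers p E) := by
      rw [mem_maximalIdeal_integers_iff]
      change padicAbs p E (amap ℚ_[p] E r) < 1
      rw [padicAbs_algebraMap]
      exact PadicInt.mem_nonunits.1 hnu
    exact h1 hr
  exact finite_of_finite this

lemma isValuedClosure_padicAbs (K : Type*) [Field K] [Algebra ℚ_[p] K] [Algebra E K]
    [IsScalarTower ℚ_[p] E K] [Algebra.IsAlgebraic ℚ_[p] K] : IsValuedClosure (integers p E) K (padicAbs p K) := by
  have hEK : ∀ x : E, padicAbs p K (amap E K x) = padicAbs p E x := by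
    intro x
    change spectralNorm ℚ_[p] K _ = spectralNorm ℚ_[p] E x
    rw [spectralNorm, spectralNorm, minpoly.algebraMap_eq (amap E K).injective]
  have hOK : ∀ o : integers p E, padicAbs p K (amap (integers p E) K o) ≤ 1 := by
    intro o
    have h1 : amap (integers p E) K o = amap E K (o : E) := rfl
    rw [h1, hEK]
    exact o.2
  refine ⟨padicAbs_nonarch p, fun x => ⟨fun h => ?_, fun h => ?_⟩, fun o => ?_, fun s hs => ?_⟩
  · obtain ⟨P, hP, h0⟩ := (padicAbs_le_one_iff p).1 h
    refine ⟨P.map (padicIntMap p), hP.map _, ?_⟩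
    rw [Polynomial.eval₂_map]
    rw [IsScalarTower.algebraMap_eq ℚ_[p] E K] at h0
    exact h0
  · exact le_one_of_isIntegralElem (padicAbs_nonarch p) (amap (integers p E) K) hOK h
  · rw [mem_maximalIdeal_integers_iff, ← hEK]; rfl
  · classical
    let b := finBasis ℚ_[p] E
    let s' : Set K := s ∪ Set.range fun i => amap E K (b i)
    have hs' : s'.Finite := s.finite_toSet.union (Set.finite_range _)
    have : Finite s' := hs'
    let E' := adjoin ℚ_[p] s'
    have : FinDim ℚ_[p] E' := finiteDimensional_adjoin fun x _ => isIntegral x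
    have hE'K : ∀ x : E', padicAbs p K (x : K) = padicAbs p E' x := by
      intro x
      change spectralNorm ℚ_[p] K (amap E' K x) = spectralNorm ℚ_[p] E' x
      rw [spectralNorm, spectralNorm, minpoly.algebraMap_eq (amap E' K).injective]
    have hEE' : ∀ x : E, amap E K x ∈ E' := by
      intro x
      rw [← b.sum_repr x, map_sum]
      refine sum_mem fun i _ => ?_
      rw [smul_def, map_mul, ← tower]
      exact mul_mem (E'.algebraMap_mem _) (subset_adjoin _ _ (Or.inr ⟨i, rfl⟩))
    let A : Subalgebra (integers p E) K :=
      { carrier := {x | x ∈ E' ∧ padicAbs p K x ≤ 1}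
        mul_mem' := fun {x y} hx hy => ⟨mul_mem hx.1 hy.1, (integers p K).mul_mem _ _ hx.2 hy.2⟩
        add_mem' := fun {x y} hx hy => ⟨add_mem hx.1 hy.1, (integers p K).add_mem _ _ hx.2 hy.2⟩
        algebraMap_mem' := fun o => ⟨hEE' _, hOK o⟩ }
    have hunit : ∀ x : A, padicAbs p K (x : K) = 1 → IsUnit x := by
      intro x hx
      have hx0 : (x : K) ≠ 0 := by
        intro h0
        rw [h0, map_zero] at hx
        exact zero_ne_one hx
      exact of_mul_eq_one (⟨(x : K)⁻¹, inv_mem x.2.1, by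
        rw [map_inv₀]; exact (inv_eq_one.2 hx).le⟩ : A) (Subtype.ext (mul_inv_cancel₀ hx0))
    have hnu : ∀ x : A, x ∈ nonunits A ↔ padicAbs p K (x : K) < 1 := by
      intro x
      refine ⟨fun h => lt_of_le_of_ne x.2.2 fun h1 => h (hunit x h1), fun h hu => ?_⟩
      obtain ⟨y, hy⟩ := hu.exists_right_inv
      have h1 : padicAbs p K (x : K) * padicAbs p K y = 1 := by
        rw [← map_mul]
        have : (x : K) * y = 1 := congrArg Subtype.val hy
        rw [this, map_one]
      have h2 : padicAbs p K (y : K) ≤ 1 := y.2.2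
      have h3 := (padicAbs p K).nonneg (x : K)
      have h4 := (padicAbs p K).nonneg (y : K)
      nlinarith
    have hloc : IsLocalRing A := IsLocalRing.of_nonunits_add fun x y hx hy => by
      rw [hnu] at hx hy ⊢
      exact (padicAbs_nonarch p _ _).trans_lt (max_lt hx hy)
    let : Algebra ℤ_[p] A := ((amap (integers p E) A).comp (padicIntMap p)).toAlgebra
    let ι : A →+* E' :=
      { toFun := fun x => ⟨x, x.2.1⟩
        map_one' := rfl
        map_mul' := fun _ _ => rfl
        map_zero' := rfl
        map_add' := fun _ _ => rfl }
    have : Module.Finite ℤ_[p] A := finite_of_isIntegrallyClosed p (F := E') ι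
      (fun x y h => Subtype.ext (congrArg (fun z : E' => (z : K)) h)) (fun r => Subtype.ext
        (tower ℚ_[p] E K (r : ℚ_[p])).symm) fun x => by
        rw [← hE'K]
        exact ⟨fun h => ⟨⟨x, x.2, h⟩, rfl⟩, fun ⟨y, hy⟩ => hy ▸ y.2.2⟩
    refine ⟨A, fun x hx => ⟨subset_adjoin _ _ (Or.inl hx), hs x hx⟩,
      fun x hx => hx.2, hloc, isAdicComplete_of_finite (R := ℤ_[p]), hnu⟩

end Integers

lemma nonarch_sum_lt {K : Type*} [Field K] {N : AbsoluteValue K ℝ} (hN : IsNonarchimedean N)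
    {ι : Type*} (s : Finset ι) (f : ι → K) {B : ℝ} (hB : 0 < B) (h : ∀ i ∈ s, N (f i) < B) : N (∑ i ∈ s, f i) < B := by
  classical
  induction s using induction_on with
  | empty => simpa using hB
  | insert i s his ih =>
    rw [Finset.sum_insert his]
    exact (hN _ _).trans_lt (max_lt (h i (by simp)) (ih fun j hj => h j (by simp [hj])))

lemma exists_lt_one_of_prod_lt_one {ι : Type*} (s : Finset ι) (f : ι → ℝ) (h : ∏ i ∈ s, f i < 1) : ∃ i ∈ s, f i < 1 := by
  by_contra! hcon
  refine absurd h (not_lt.2 ?_)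
  have := Finset.prod_le_prod (s := s) (f := fun _ => (1 : ℝ)) (fun _ _ => zero_le_one) hcon
  simpa using this

section GaloisAction

variable (p : ℕ) [Fact p.Prime] {K : Type*} [Field K] [Algebra ℚ_[p] K]
  [Algebra.IsAlgebraic ℚ_[p] K]

lemma valuation_lt_one_iff_padicAbs (y : K) : (integers p K).valuation y < 1 ↔ padicAbs p K y < 1 := by
  constructor
  · intro h
    have hy : y ∈ integers p K := ((integers p K).valuation_le_one_iff y).1 h.le
    exact (mem_maximalIdeal_integers_iff p ⟨y, hy⟩).1 (((integers p K).valuation_lt_one_iff ⟨y, hy⟩).2 h)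
  · intro h
    have hy : y ∈ integers p K := h.le
    exact ((integers p K).valuation_lt_one_iff ⟨y, hy⟩).1 ((mem_maximalIdeal_integers_iff p ⟨y, hy⟩).2 h)

lemma padicAbs_natCast {M : ℕ} (hM : ¬ p ∣ M) : padicAbs p K (M : K) = 1 := by
  have : (M : K) = amap ℚ_[p] K (M : ℚ_[p]) := by simp
  rw [this, padicAbs_algebraMap]
  rw [Padic.norm_natCast_eq_one_iff]
  exact (Nat.Prime.coprime_iff_not_dvd Fact.out).2 hM

lemma padicAbs_eq_one_of_pow_eq_one {M : ℕ} (hM : M ≠ 0) {ζ : K} (h : ζ ^ M = 1) : padicAbs p K ζ = 1 := by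
  have h1 : padicAbs p K ζ ^ M = 1 := by rw [← map_pow, h, map_one]
  exact (pow_eq_one_iff_of_nonneg ((padicAbs p K).nonneg _) hM).1 h1

lemma eq_one_of_pow_eq_one {M : ℕ} (hM : ¬ p ∣ M) {ζ : K} (h : ζ ^ M = 1) (h1 : padicAbs p K (ζ - 1) < 1) : ζ = 1 := by
  by_contra hne
  have h2 : ∑ i ∈ range M, ζ ^ i = 0 := by
    have h3 := geom_sum_mul ζ M
    rw [h, sub_self] at h3
    exact (mul_eq_zero.1 h3).resolve_right (sub_ne_zero.2 hne)
  have hM0 : M ≠ 0 := fun h => hM (h ▸ dvd_zero p)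
  have hζ := padicAbs_eq_one_of_pow_eq_one p hM0 h
  have h3 : (M : K) = - ∑ i ∈ range M, (ζ ^ i - 1) := by
    rw [Finset.sum_sub_distrib, h2]; simp
  have h4 : padicAbs p K (M : K) < 1 := by
    rw [h3, AbsoluteValue.map_neg]
    refine nonarch_sum_lt (padicAbs_nonarch p) _ _ one_pos fun i _ => ?_
    rw [← geom_sum_mul ζ i, map_mul]
    refine (mul_le_of_le_one_left ((padicAbs p K).nonneg _) ?_).trans_lt h1
    refine nonarch_sum_le (padicAbs_nonarch p) _ _ zero_le_one fun j _ => ?_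
    rw [map_pow, hζ, one_pow]
  rw [padicAbs_natCast p hM] at h4
  exact lt_irrefl _ h4

lemma eq_of_pow_eq_one {M : ℕ} (hM : ¬ p ∣ M) {ζ η : K} (h : ζ ^ M = 1) (h' : η ^ M = 1)
    (h1 : padicAbs p K (ζ - η) < 1) : ζ = η := by
  have hM0 : M ≠ 0 := fun h => hM (h ▸ dvd_zero p)
  have hη := padicAbs_eq_one_of_pow_eq_one p hM0 h'
  have hη0 : η ≠ 0 := fun h => by rw [h, map_zero] at hη; exact zero_ne_one hη
  have := eq_one_of_pow_eq_one p hM (ζ := ζ / η) (by rw [div_pow, h, h', div_one]) (by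
    have : ζ / η - 1 = (ζ - η) / η := by field_simp
    rw [this, map_div₀, hη, div_one]
    exact h1)
  rwa [div_eq_one_iff_eq hη0] at this

end GaloisAction

lemma charZero_algebraicClosure (p : ℕ) [Fact p.Prime] (L : Type*) [Field L] [Algebra ℚ_[p] L] : CharZero (AC L) :=
  charZero_of_injective_algebraMap (amap ℚ_[p] (AC L)).injective

section LocalGalois

variable (p : ℕ) [Fact p.Prime] (L : Type v) [Field L] [Algebra ℚ_[p] L]
  [FinDim ℚ_[p] L]

variable {L} in
lemma padicAbs_equiv (g : GalGroup L) (x : AC L) : padicAbs p _ (g x) = padicAbs p _ x :=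
  (spectralNorm_eq_of_equiv (K := ℚ_[p]) (g.restrictScalars ℚ_[p]) x).symm

variable {L} in
open scoped Pointwise in
lemma mem_decompositionSubgroup (g : GalGroup L) : g ∈ (integers p (AC L)).decompositionSubgroup L := by
  rw [MulAction.mem_stabilizer_iff]
  ext x
  rw [ValuationSubring.mem_pointwise_smul_iff_inv_smul_mem]
  change padicAbs p _ (g⁻¹ x) ≤ 1 ↔ padicAbs p _ x ≤ 1
  rw [padicAbs_equiv]

variable {L} in
lemma mem_inertia_iff (g : GalGroup L) : g ∈ inertia p L ↔ ∀ x, padicAbs p (AC L) x ≤ 1 → padicAbs p _ (g x - x) < 1 := by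
  set A := integers p (AC L) with hA
  let g' : A.decompositionSubgroup L := ⟨g, mem_decompositionSubgroup p g⟩
  have hmem : g ∈ inertia p L ↔ g' ∈ A.inertiaSubgroup L := by
    rw [inertia, Subgroup.mem_map]
    constructor
    · rintro ⟨y, hy, hyg⟩
      have : y = g' := Subtype.ext hyg
      exact this ▸ hy
    · intro h; exact ⟨_, h, rfl⟩
  have key : ∀ (x) (hx : x ∈ A), (g' • residue A ⟨x, hx⟩ = residue A ⟨x, hx⟩ ↔ padicAbs p _ (g x - x) < 1) := by
    intro x hx
    rw [← residue_smul, ← sub_eq_zero, ← map_sub, residue_eq_zero_iff, mem_maximalIdeal_integers_iff]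
    rfl
  rw [hmem, ValuationSubring.inertiaSubgroup, mem_ker]
  constructor
  · intro h x hx
    exact (key x hx).1 (cfun h (residue A ⟨x, hx⟩))
  · intro h
    ext y
    obtain ⟨⟨x, hx⟩, rfl⟩ := residue_surjective y
    exact (key x hx).2 (h x hx)

lemma charP_residueField : CharP (ResF (integers p L)) p := by
  have hp := (Fact.out : p.Prime)
  have h : ((p : ℕ) : ResF (integers p L)) = 0 := by
    have : ((p : ℕ) : ResF (integers p L)) = residue _ ((p : ℕ) : integers p L) := by simp
    rw [this, residue_eq_zero_iff, mem_maximalIdeal_integers_iff]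
    have h2 : (((p : ℕ) : integers p L) : L) = amap ℚ_[p] L (p : ℚ_[p]) := by simp
    rw [h2, padicAbs_algebraMap]
    exact Padic.norm_p_lt_one
  have := CharP.exists (ResF (integers p L))
  obtain ⟨c, hc⟩ := this
  have hdvd := (CharP.cast_eq_zero_iff _ c p).1 h
  rcases (Nat.dvd_prime hp).1 hdvd with rfl | rfl
  · exact absurd ((CharP.cast_eq_zero_iff (ResF (integers p L)) 1 1).2 dvd_rfl) (by rw [Nat.cast_one]; exact one_ne_zero)
  · exact hc

lemma exists_residueCard_eq : ∃ f : ℕ, 0 < f ∧ residueCard p L = p ^ f := by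
  have := charP_residueField p L
  have := ofFinite (ResF (integers p L))
  obtain ⟨n, -, hn⟩ := FiniteField.card (ResF (integers p L)) p
  exact ⟨n, n.pos, by rw [residueCard, Nat.card_eq_fintype_card, hn]⟩

lemma one_lt_residueCard : 1 < residueCard p L := by
  obtain ⟨f, hf, h⟩ := exists_residueCard_eq p L
  rw [h]
  exact one_lt_pow hf.ne' (Fact.out : p.Prime).one_lt

lemma exists_pow_sub_one_lt {x : AC L} (hx : padicAbs p _ x = 1) : ∃ M : ℕ, ¬ p ∣ M ∧ padicAbs p _ (x ^ M - 1) < 1 := by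
  let E' := adjoin ℚ_[p] {x}
  have : FinDim ℚ_[p] E' := finiteDimensional_adjoin fun x _ => isIntegral x
  have hE'K : ∀ x : E', padicAbs p (AC L) (x : AC L) = padicAbs p E' x := by
    intro x
    change spectralNorm ℚ_[p] (AC L) (amap E' (AC L) x) = spectralNorm ℚ_[p] E' x
    rw [spectralNorm, spectralNorm, minpoly.algebraMap_eq (amap E' (AC L)).injective]
  let y : E' := ⟨x, IntermediateField.mem_adjoin_simple_self _ _⟩
  have hy : padicAbs p E' y = 1 := by rw [← hE'K]; exact hx
  let z : integers p E' := ⟨y, hy.le⟩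
  have := ofFinite (ResF (integers p E'))
  obtain ⟨f, hf, hcard⟩ := exists_residueCard_eq p E'
  have hz : residue _ z ≠ 0 := by
    rw [Ne, residue_eq_zero_iff, mem_maximalIdeal_integers_iff, not_lt]
    exact hy.ge
  have h1 := FiniteField.pow_card_sub_one_eq_one _ hz
  rw [← Nat.card_eq_fintype_card] at h1
  change _ ^ (residueCard p E' - 1) = 1 at h1
  refine ⟨residueCard p E' - 1, ?_, ?_⟩
  · intro hdvd
    have h2 : p ∣ residueCard p E' := by rw [hcard]; exact dvd_pow_self p hf.ne'
    have h3 := one_lt_residueCard p E'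
    have h4 := (Nat.dvd_sub_iff_right h3.le h2).1 hdvd
    exact (Fact.out : p.Prime).one_lt.ne' (Nat.dvd_one.1 h4)
  · rw [← map_pow, ← map_one (residue (integers p E')), ← sub_eq_zero, ← map_sub,
      residue_eq_zero_iff, mem_maximalIdeal_integers_iff, ← hE'K] at h1
    exact h1

lemma mem_inertia_of_fix {g : GalGroup L} (h : ∀ M : ℕ, ¬ p ∣ M → ∀ ζ : AC L, ζ ^ M = 1 → g ζ = ζ) : g ∈ inertia p L := by
  rw [mem_inertia_iff]
  intro x hx
  rcases hx.lt_or_eq with hlt | heq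
  · rw [sub_eq_add_neg]
    refine (padicAbs_nonarch p _ _).trans_lt (max_lt ?_ ?_)
    · rwa [padicAbs_equiv]
    · rwa [AbsoluteValue.map_neg]
  obtain ⟨M, hM, h1⟩ := exists_pow_sub_one_lt p L heq
  have hM0 : 0 < M := Nat.pos_of_ne_zero fun h => hM (h ▸ dvd_zero p)
  have : NeZero M := ⟨hM0.ne'⟩
  have := charZero_algebraicClosure p L
  have : NeZero (M : AC L) := ⟨cast_ne_zero.2 hM0.ne'⟩
  obtain ⟨ζ, hζ⟩ := exists_primitiveRoot (AC L) M
  have h2 := hζ.pow_sub_pow_eq_prod_sub_mul x 1 hM0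
  rw [one_pow] at h2
  rw [h2, map_prod] at h1
  obtain ⟨η, hη, h3⟩ := exists_lt_one_of_prod_lt_one _ _ h1
  rw [mul_one] at h3
  have hη1 : η ^ M = 1 := (Polynomial.mem_nthRootsFinset hM0 _).1 hη
  have h4 : g x - x = g (x - η) - (x - η) := by
    rw [map_sub, h M hM η hη1]; ring
  rw [h4, sub_eq_add_neg]
  refine (padicAbs_nonarch p _ _).trans_lt (max_lt ?_ ?_)
  · rwa [padicAbs_equiv]
  · rwa [AbsoluteValue.map_neg]

variable {L}

lemma inertia_fix {g : GalGroup L} (hg : g ∈ inertia p L) {M : ℕ} (hM : ¬ p ∣ M)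
    {ζ : AC L} (hζ : ζ ^ M = 1) : g ζ = ζ := by
  have hM0 : M ≠ 0 := fun h => hM (h ▸ dvd_zero p)
  refine eq_of_pow_eq_one p hM (by rw [← map_pow, hζ, map_one]) hζ ?_
  exact (mem_inertia_iff p g).1 hg ζ (padicAbs_eq_one_of_pow_eq_one p hM0 hζ).le

variable {φ : GalGroup L}

lemma IsArithFrobenius.apply_root (hφ : IsArithFrobenius p L φ) {M : ℕ} (hM : ¬ p ∣ M)
    {ζ : AC L} (hζ : ζ ^ M = 1) : φ ζ = ζ ^ residueCard p L := by
  have hM0 : M ≠ 0 := fun h => hM (h ▸ dvd_zero p)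
  refine eq_of_pow_eq_one p hM (by rw [← map_pow, hζ, map_one]) (by rw [← pow_mul, mul_comm, pow_mul, hζ, one_pow]) ?_
  rw [← valuation_lt_one_iff_padicAbs]
  exact hφ ζ (padicAbs_eq_one_of_pow_eq_one p hM0 hζ).le

lemma IsArithFrobenius.pow_apply_root (hφ : IsArithFrobenius p L φ) {M : ℕ} (hM : ¬ p ∣ M)
    {ζ : AC L} (hζ : ζ ^ M = 1) (a : ℕ) : (φ ^ a) ζ = ζ ^ (residueCard p L ^ a) := by
  induction a with
  | zero => simp
  | succ a ih =>
    rw [pow_succ', AlgEquiv.mul_apply, ih, map_pow, hφ.apply_root p hM hζ, ← pow_mul, pow_succ', mul_comm]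

end LocalGalois

lemma padicAbs_tower (p : ℕ) [Fact p.Prime] {E K : Type*} [Field E] [Algebra ℚ_[p] E]
    [Algebra.IsAlgebraic ℚ_[p] E] [Field K] [Algebra ℚ_[p] K] [Algebra.IsAlgebraic ℚ_[p] K]
    [Algebra E K] [IsScalarTower ℚ_[p] E K] (x : E) : padicAbs p K (amap E K x) = padicAbs p E x := by
  change spectralNorm ℚ_[p] K _ = spectralNorm ℚ_[p] E x
  rw [spectralNorm, spectralNorm, minpoly.algebraMap_eq (amap E K).injective]

section LocalGalois

variable (p : ℕ) [Fact p.Prime] {L : Type v} [Field L] [Algebra ℚ_[p] L]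
  [FinDim ℚ_[p] L]

lemma exists_sub_lt_of_pow_residueCard {c : AC L} (hc : padicAbs p _ c ≤ 1) (h : padicAbs p _ (c ^ residueCard p L - c) < 1) :
    ∃ l : L, padicAbs p _ (c - amap L _ l) < 1 := by
  classical
  have := ofFinite (ResF (integers p L))
  let r : ResF (integers p L) → integers p L := Function.surjInv residue_surjective
  have hr : ∀ a, residue _ (r a) = a := Function.surjInv_eq _
  let R : Polynomial (integers p L) := (∏ a, (Polynomial.X - Polynomial.C (r a))) -
    (Polynomial.X ^ residueCard p L - Polynomial.X)
  have hcard : residueCard p L = card (ResF (integers p L)) := Nat.card_eq_fintype_card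
  have hR : R.map (residue _) = 0 := by
    have h1 : (∏ a : ResF (integers p L), (Polynomial.X - Polynomial.C a)) = Polynomial.X ^ residueCard p L - Polynomial.X := by
      have hq := one_lt_residueCard p L
      have := Polynomial.prod_multiset_X_sub_C_of_monic_of_roots_card_eq (p := (Polynomial.X ^ residueCard p L - Polynomial.X :
          Polynomial (ResF (integers p L)))) (by
          refine Polynomial.monic_X_pow_sub (by
            rw [Polynomial.degree_X]; exact_mod_cast hq)) (by
          rw [FiniteField.X_pow_card_sub_X_natDegree_eq _ hq, hcard, FiniteField.roots_X_pow_card_sub_X]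
          rfl)
      rw [← this, hcard, FiniteField.roots_X_pow_card_sub_X]
      rfl
    simp only [R, Polynomial.map_sub, Polynomial.map_prod, Polynomial.map_pow, Polynomial.map_X,
      Polynomial.map_C, hr, h1, sub_self]
  have hcoef : ∀ i, padicAbs p (AC L) (amap L _ (R.coeff i : L)) < 1 := by
    intro i
    have h1 : residue _ (R.coeff i) = 0 := by
      rw [← coeff_map, hR, coeff_zero]
    rw [residue_eq_zero_iff, mem_maximalIdeal_integers_iff] at h1
    rwa [padicAbs_tower]
  have h2 : padicAbs p _ (eval₂ ((amap L (AC L)).comp (integers p L).subtype) c R) < 1 := by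
    rw [eval₂_eq_sum_range]
    refine nonarch_sum_lt (padicAbs_nonarch p) _ _ one_pos fun i _ => ?_
    rw [map_mul, map_pow]
    exact (mul_le_of_le_one_right ((padicAbs p _).nonneg _) (pow_le_one₀ ((padicAbs p _).nonneg _) hc)).trans_lt (hcoef i)
  have h3 : ∏ a, padicAbs p _ (c - amap L (AC L) (r a : L)) < 1 := by
    rw [← map_prod]
    have h4 : ∏ a, (c - amap L (AC L) (r a : L)) = eval₂ ((amap L (AC L)).comp
          (integers p L).subtype) c R + (c ^ residueCard p L - c) := by
      simp only [R, Polynomial.eval₂_sub, Polynomial.eval₂_finsetProd, Polynomial.eval₂_X,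
        Polynomial.eval₂_C, Polynomial.eval₂_pow, sub_add_cancel]
      rfl
    rw [h4]
    exact (padicAbs_nonarch p _ _).trans_lt (max_lt h2 h)
  obtain ⟨a, -, ha⟩ := exists_lt_one_of_prod_lt_one _ _ h3
  exact ⟨_, ha⟩

variable {φ : GalGroup L}

lemma coprime_residueCard {M : ℕ} (hM : ¬ p ∣ M) : Coprime (residueCard p L) M := by
  obtain ⟨f, -, hf⟩ := exists_residueCard_eq p L
  rw [hf]
  exact Nat.Coprime.pow_left f ((Nat.Prime.coprime_iff_not_dvd Fact.out).2 hM)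

lemma IsArithFrobenius.exists_apply_root (hφ : IsArithFrobenius p L φ) {M : ℕ} (hM : ¬ p ∣ M)
    {ζ : AC L} (hζ : ζ ^ M = 1) (g : GalGroup L) : ∃ a : ℕ, g ζ = ζ ^ (residueCard p L ^ a) := by
  set q := residueCard p L with hq
  have hM0 : M ≠ 0 := fun h => hM (h ▸ dvd_zero p)
  have hζ1 := padicAbs_eq_one_of_pow_eq_one p hM0 hζ
  set r := Nat.totient M with hr
  have hr0 : 0 < r := Nat.totient_pos.2 (Nat.pos_of_ne_zero hM0)
  have hqr : ζ ^ (q ^ r) = ζ := by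
    have h1 : q ^ r ≡ 1 [MOD M] := pow_totient (coprime_residueCard p (L := L) hM)
    have h2 : q ^ r ≡ 1 [MOD orderOf ζ] := h1.of_dvd (orderOf_dvd_of_pow_eq_one hζ)
    have h3 : q ^ r % orderOf ζ = 1 % orderOf ζ := h2
    rw [← pow_mod_orderOf, h3, pow_mod_orderOf, pow_one]
  let z : integers p (AC L) := ⟨ζ, (mem_integers_iff p).2 hζ1.le⟩
  let P0 : Polynomial (integers p (AC L)) := ∏ j ∈ range r,
    (Polynomial.X - Polynomial.C (z ^ (q ^ j)))
  let P : Polynomial (AC L) := P0.map (integers p (AC L)).subtype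
  have hP : P = ∏ j ∈ range r, (Polynomial.X - Polynomial.C (ζ ^ (q ^ j))) := by
    simp only [P, P0, Polynomial.map_prod, Polynomial.map_sub, Polynomial.map_X, Polynomial.map_C, map_pow, Polynomial.map_pow]
    rfl
  have hPφ : P.map (φ : AC L →+* AC L) = P := by
    rw [hP]
    simp only [Polynomial.map_prod, Polynomial.map_sub, Polynomial.map_X, Polynomial.map_C]
    have h1 : ∀ j, (φ : AC L →+* AC L) (ζ ^ q ^ j) = ζ ^ (q ^ (j + 1)) := by
      intro j
      change φ _ = _
      rw [map_pow, hφ.apply_root p hM hζ, ← pow_mul, pow_succ', ← hq]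
    simp only [h1]
    obtain ⟨s, hs⟩ := Nat.exists_eq_succ_of_ne_zero hr0.ne'
    rw [hs, Nat.succ_eq_add_one] at hqr ⊢
    rw [Finset.prod_range_succ, Finset.prod_range_succ', hqr, pow_zero, pow_one]
  have hcoef : ∀ i, padicAbs p _ (P.coeff i - g (P.coeff i)) < 1 := by
    intro i
    have h1 : φ (P.coeff i) = P.coeff i := (coeff_map (φ : AC L →+* AC L) i).symm.trans (congrArg (fun Q => Q.coeff i) hPφ)
    have h2 : P.coeff i ∈ integers p (AC L) := by
      simp only [P, coeff_map]
      exact (P0.coeff i).2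
    have h3 := (valuation_lt_one_iff_padicAbs p _).1 (hφ _ h2)
    rw [h1, AbsoluteValue.map_sub] at h3
    obtain ⟨l, hl⟩ := exists_sub_lt_of_pow_residueCard p h2 h3
    have h4 : P.coeff i - g (P.coeff i) = (P.coeff i - amap L _ l) + -(g (P.coeff i - amap L _ l)) := by
      rw [map_sub, AlgEquiv.commutes]; ring
    rw [h4]
    refine (padicAbs_nonarch p _ _).trans_lt (max_lt hl ?_)
    rwa [AbsoluteValue.map_neg, padicAbs_equiv]
  have hroot : P.eval ζ = 0 := by
    rw [hP, eval_prod]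
    exact Finset.prod_eq_zero (mem_range.2 hr0) (by simp)
  have h5 : padicAbs p _ (P.eval (g ζ)) < 1 := by
    have h6 : P.eval (g ζ) = ∑ i ∈ range (P.natDegree + 1), (P.coeff i - g (P.coeff i)) * (g ζ) ^ i := by
      have h7 : ∑ i ∈ range (P.natDegree + 1), g (P.coeff i) * (g ζ) ^ i = 0 := by
        rw [← map_zero g, ← hroot, eval_eq_sum_range, map_sum]
        simp
      simp only [sub_mul]
      rw [Finset.sum_sub_distrib, h7, sub_zero, eval_eq_sum_range]
    rw [h6]
    refine nonarch_sum_lt (padicAbs_nonarch p) _ _ one_pos fun i _ => ?_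
    rw [map_mul, map_pow, padicAbs_equiv, hζ1, one_pow, mul_one]
    exact hcoef i
  rw [hP, eval_prod, map_prod] at h5
  obtain ⟨j, -, hj⟩ := exists_lt_one_of_prod_lt_one _ _ h5
  simp only [Polynomial.eval_sub, eval_X, eval_C] at hj
  exact ⟨j, eq_of_pow_eq_one p hM (by rw [← map_pow, hζ, map_one]) (by rw [← pow_mul, mul_comm, pow_mul, hζ, one_pow]) hj⟩

lemma isGalois_algebraicClosure (p : ℕ) [Fact p.Prime] (L : Type*) [Field L] [Algebra ℚ_[p] L] : IsGalois L (AC L) := by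
  have : CharZero L := charZero_of_injective_algebraMap (amap ℚ_[p] L).injective
  infer_instance

/-- An element fixed by inertia and by a Frobenius lift is in the base field. -/
lemma IsArithFrobenius.mem_range_of_fixed (hφ : IsArithFrobenius p L φ) {x : AC L}
    (hI : ∀ g ∈ inertia p L, g x = x) (hx : φ x = x) : x ∈ (amap L (AC L)).range := by
  classical
  have := isGalois_algebraicClosure p L
  have := charZero_algebraicClosure p L
  let Z : Set (AC L) := {ζ | ∃ M : ℕ, ¬ p ∣ M ∧ ζ ^ M = 1}
  have hxU : x ∈ adjoin L Z := by
    rw [← InfiniteGalois.fixedField_fixingSubgroup (adjoin L Z), mem_fixedField_iff]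
    intro g hg
    refine hI g (mem_inertia_of_fix p L fun M hM ζ hζ => ?_)
    rw [IntermediateField.mem_fixingSubgroup_iff] at hg
    exact hg ζ (subset_adjoin _ _ ⟨M, hM, hζ⟩)
  obtain ⟨T, hT, hxT⟩ := IntermediateField.exists_finset_of_mem_adjoin hxU
  have hT' : ∀ y : AC L, ∃ M : ℕ, y ∈ T → ¬ p ∣ M ∧ y ^ M = 1 := by
    intro y
    by_cases hy : y ∈ T
    · obtain ⟨M, hM⟩ := hT hy
      exact ⟨M, fun _ => hM⟩
    · exact ⟨0, fun h => absurd h hy⟩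
  choose m hm using hT'
  let M := ∏ ζ ∈ T, m ζ
  have hM : ¬ p ∣ M := by
    rw [Prime.dvd_finsetProd_iff (Nat.prime_iff.1 Fact.out)]
    rintro ⟨ζ, hζ, h⟩
    exact (hm ζ hζ).1 h
  have hM0 : M ≠ 0 := fun h => hM (h ▸ dvd_zero p)
  have : NeZero M := ⟨hM0⟩
  have : NeZero (M : AC L) := ⟨cast_ne_zero.2 hM0⟩
  obtain ⟨ζ, hζ⟩ := exists_primitiveRoot (AC L) M
  change x ∈ Set.range (amap L (AC L))
  rw [InfiniteGalois.mem_range_algebraMap_iff_fixed]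
  intro g
  obtain ⟨a, ha⟩ := hφ.exists_apply_root p hM hζ.pow_eq_one g
  have key : g x = (φ ^ a) x := by
    clear hI hx hxU
    induction hxT using IntermediateField.adjoin_induction with
    | mem y hy =>
      have hy1 : y ^ M = 1 := by
        simp only [M]
        rw [← Finset.mul_prod_erase T m hy, pow_mul, (hm y hy).2, one_pow]
      obtain ⟨i, -, rfl⟩ := hζ.eq_pow_of_pow_eq_one hy1
      rw [map_pow, map_pow, ha, hφ.pow_apply_root p hM hζ.pow_eq_one]
    | algebraMap y => rw [AlgEquiv.commutes, AlgEquiv.commutes]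
    | add y z _ _ hy hz => rw [map_add, map_add, hy, hz]
    | inv y _ hy => rw [map_inv₀, map_inv₀, hy]
    | mul y z _ _ hy hz => rw [map_mul, map_mul, hy, hz]
  rw [key]
  have : ∀ a : ℕ, (φ ^ a) x = x := by
    intro a
    induction a with
    | zero => simp
    | succ a ih => rw [pow_succ', AlgEquiv.mul_apply, ih, hx]
  exact this a

end LocalGalois

lemma modEq_of_pow_eq {K : Type*} [Field K] {n : ℕ} {ζ : K} (hζ : IsPrimitiveRoot ζ n)
    (hn : n ≠ 0) {a b : ℕ} (h : ζ ^ a = ζ ^ b) : a ≡ b [MOD n] := by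
  have h0 : ζ ≠ 0 := hζ.ne_zero hn
  wlog hab : a ≤ b generalizing a b
  · exact (this h.symm (le_of_not_ge hab)).symm
  rw [Nat.modEq_iff_dvd' hab]
  apply hζ.dvd_of_pow_eq_one
  obtain ⟨c, rfl⟩ := exists_eq_add_of_le hab
  rw [pow_add] at h
  rw [Nat.add_sub_cancel_left]
  exact (mul_right_eq_self₀.1 h.symm).resolve_right (pow_ne_zero _ h0)

section Inertia

variable (p : ℕ) [Fact p.Prime] {L : Type v} [Field L] [Algebra ℚ_[p] L]
  [FinDim ℚ_[p] L] {φ : GalGroup L}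

instance inertia_normal : (inertia p L).Normal := by
  refine ⟨fun u hu g => ?_⟩
  rw [mem_inertia_iff] at hu ⊢
  intro x hx
  have h1 := hu (g⁻¹ x) (by rwa [padicAbs_equiv])
  rw [← padicAbs_equiv p g, map_sub] at h1
  rwa [show g (g⁻¹ x) = x by rw [← AlgEquiv.mul_apply, mul_inv_cancel]; rfl] at h1

lemma isOpen_of_fixingSubgroup_le {H : Subgroup (GalGroup L)} (S : Finset (AC L))
    (h : ∀ g : GalGroup L, (∀ x ∈ S, g x = x) → g ∈ H) : IsOpen (H : Set (GalGroup L)) := by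
  have : FinDim L (adjoin L (S : Set (AC L))) := finiteDimensional_adjoin fun x _ => isIntegral x
  exact isOpen_mono (fun g hg => h g fun x hx => (IntermediateField.mem_fixingSubgroup_iff _ _).1 hg x
    (subset_adjoin _ _ hx)) (IntermediateField.fixingSubgroup_isOpen (adjoin L (S : Set (AC L))))

lemma isOpen_eqLocus {G H : Type*} [Group G] [TopologicalSpace G] [IsTopologicalGroup G] [Group H]
    {f f' : G →* H} (hf : OpenKer f) (hf' : OpenKer f') : IsOpen (f.eqLocus f' : Set G) :=
  isOpen_mono (H₁ := f.ker ⊓ f'.ker) (fun _ hg => (mem_ker.1 hg.1).trans (mem_ker.1 hg.2).symm) (hf.inter hf')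

lemma IsArithFrobenius.hom_ext (hφ : IsArithFrobenius p L φ) {H : Type*} [Group H]
    {r r' : GalGroup L →* H} (hr : OpenKer r) (hr' : OpenKer r') (hI : ∀ u ∈ inertia p L, r u = r' u)
    (h : r φ = r' φ) : r = r' := by
  have := isGalois_algebraicClosure p L
  have hclosed := isClosed_of_isOpen _ (isOpen_eqLocus hr hr')
  have h1 := InfiniteGalois.fixingSubgroup_fixedField ⟨r.eqLocus r', hclosed⟩
  have h2 : fixedField (r.eqLocus r') = (⊥ : IntermediateField L (AC L)) :=
    eq_bot_iff.2 fun x hx => mem_bot.2 (hφ.mem_range_of_fixed p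
      (fun g hg => (mem_fixedField_iff _ _).1 hx g (hI g hg)) ((mem_fixedField_iff _ _).1 hx φ h))
  ext g
  change g ∈ ((⟨r.eqLocus r', hclosed⟩ : ClosedSubgroup (GalGroup L)) : Subgroup (GalGroup L))
  rw [← h1]
  change g ∈ IntermediateField.fixingSubgroup (fixedField (r.eqLocus r'))
  rw [h2, IntermediateField.fixingSubgroup_bot]
  trivial

variable {ℓ : ℕ} [Fact ℓ.Prime]

lemma tildeWild_le_ker {H : Type*} [Group H] (f : inertia p L →* H) (hf : OpenKer f) [Finite f.range] (hH : IsPGroup ℓ f.range) :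
    tildeWild p L ℓ ≤ f.ker := by
  refine sInf_le ⟨inferInstance, hf, ?_⟩
  rw [Subgroup.index_ker]
  exact IsPGroup.iff_card.1 hH

lemma IsTameGenerator.hom_ext {σ : inertia p L} (hσ : IsTameGenerator p L ℓ σ) {H : Type*}
    [Group H] {f f' : inertia p L →* H} (hf : OpenKer f) (hf' : OpenKer f') (hk : tildeWild p L ℓ ≤ f.ker)
    (hk' : tildeWild p L ℓ ≤ f'.ker) (h : f σ = f' σ) : f = f' := by
  have h1 : (zpowers σ ⊔ tildeWild p L ℓ).topologicalClosure ≤ f.eqLocus f' :=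
     Subgroup.topologicalClosure_minimal _ (sup_le (zpowers_le.2 h) fun g hg =>
      (mem_ker.1 (hk hg)).trans (mem_ker.1 (hk' hg)).symm)
      (isClosed_of_isOpen _ (isOpen_eqLocus hf hf'))
  rw [hσ] at h1
  ext g
  exact h1 trivial

lemma IsTameGenerator.mem_zpowers {σ : inertia p L} (hσ : IsTameGenerator p L ℓ σ) {H : Type*}
    [Group H] {f : inertia p L →* H} (hf : OpenKer f) (hk : tildeWild p L ℓ ≤ f.ker) (u : inertia p L) : f u ∈ zpowers (f σ) := by
  have hle : f.ker ≤ (zpowers (f σ)).comap f := fun g hg => by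
    rw [Subgroup.mem_comap, mem_ker.1 hg]; exact one_mem _
  have h1 : (zpowers σ ⊔ tildeWild p L ℓ).topologicalClosure ≤ (zpowers (f σ)).comap f :=
    Subgroup.topologicalClosure_minimal _ (sup_le (zpowers_le.2 (Subgroup.mem_zpowers _))
      (hk.trans hle)) (isClosed_of_isOpen _ (isOpen_mono hle hf))
  rw [hσ] at h1
  exact h1 (Subgroup.mem_top u)

/-- The values of a character of inertia cut out by a radical. -/
lemma IsArithFrobenius.not_fixed_of_pow_eq (hφ : IsArithFrobenius p L φ) (hpℓ : p ≠ ℓ)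
    {π : integers p L} (hπ0 : π ≠ 0) (hπ : maxId (integers p L) = span {π})
    {y : AC L} (hy : y ^ ℓ = amap L _ (π : L)) (hfix : ∀ g ∈ inertia p L, g y = y) : False := by
  classical
  have := charZero_algebraicClosure p L
  have hℓ := (Fact.out : ℓ.Prime)
  have hpp := (Fact.out : p.Prime)
  set q := residueCard p L with hq
  have hq1 : 1 < q := one_lt_residueCard p L
  have hpnℓ : ¬ p ∣ ℓ := fun h => hpℓ ((Nat.prime_dvd_prime_iff_eq hpp hℓ).1 h)
  have hπL0 : (π : L) ≠ 0 := fun h => hπ0 (Subtype.ext h)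
  have hy0 : y ≠ 0 := fun h => hπL0 ((map_eq_zero _).1 (by
    rw [← hy, h, zero_pow hℓ.ne_zero]))
  have hε : ∀ j : ℕ, ((φ ^ j) y / y) ^ ℓ = 1 := fun j => by
    rw [div_pow, ← map_pow, hy, AlgEquiv.commutes, div_self]
    rw [Ne, map_eq_zero]; exact hπL0
  obtain ⟨M, hM0, hM⟩ : ∃ M : ℕ, 0 < M ∧ (φ ^ M) y = y := by
    have hmem : ∀ j : ℕ, (φ ^ j) y / y ∈ Polynomial.nthRootsFinset ℓ (1 : AC L) :=
      fun j => (Polynomial.mem_nthRootsFinset hℓ.pos _).2 (hε j)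
    obtain ⟨a, b, hab, h⟩ := Finite.exists_ne_map_eq_of_infinite
      (fun j : ℕ => (⟨_, hmem j⟩ : Polynomial.nthRootsFinset ℓ (1 : AC L)))
    have h1 : (φ ^ a) y = (φ ^ b) y := (div_left_inj' hy0).1 (congrArg Subtype.val h)
    wlog hlt : a < b generalizing a b
    · exact this b a hab.symm h.symm h1.symm (lt_of_le_of_ne (not_lt.1 hlt) hab.symm)
    refine ⟨b - a, Nat.sub_pos_of_lt hlt, (φ ^ a).injective ?_⟩
    rw [← AlgEquiv.mul_apply, ← pow_add, Nat.add_sub_cancel' hlt.le, h1]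
  set n := q ^ M - 1 with hn
  have hqM : 1 < q ^ M := one_lt_pow hM0.ne' hq1
  have hn0 : 0 < n := Nat.sub_pos_of_lt hqM
  have hpn : ¬ p ∣ n := by
    obtain ⟨f, hf, hqf⟩ := exists_residueCard_eq p L
    intro hdvd
    have h2 : p ∣ q ^ M := by rw [hq, hqf]; exact dvd_pow (dvd_pow_self p hf.ne') hM0.ne'
    have h4 := (Nat.dvd_sub_iff_right hqM.le h2).1 hdvd
    exact hpp.one_lt.ne' (Nat.dvd_one.1 h4)
  have : NeZero n := ⟨hn0.ne'⟩
  have : NeZero (n : AC L) := ⟨cast_ne_zero.2 hn0.ne'⟩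
  obtain ⟨ζ, hζ⟩ := exists_primitiveRoot (AC L) n
  let R := integers p (AC L)
  let e : ℕ → R := fun j => ⟨(φ ^ j) y / y, (mem_integers_iff p).2
    (padicAbs_eq_one_of_pow_eq_one p hℓ.ne_zero (hε j)).le⟩
  let z : R := ⟨ζ, (mem_integers_iff p).2
    (padicAbs_eq_one_of_pow_eq_one p hn0.ne' hζ.pow_eq_one).le⟩
  let F : Polynomial (ResF R) := ∑ j ∈ range M,
    Polynomial.C (residue R (e j)) * Polynomial.X ^ (q ^ j)
  have hF0 : F ≠ 0 := by
    intro h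
    have h1 : F.coeff 1 = 1 := by
      simp only [F, Polynomial.finsetSum_coeff, Polynomial.coeff_C_mul_X_pow]
      rw [sum_eq_single 0]
      · have he : e 0 = 1 := Subtype.ext (by simp [e, div_self hy0])
        simp [he]
      · exact fun j _ hj => if_neg (one_lt_pow hj hq1).ne
      · intro h; exact absurd (mem_range.2 hM0) h
    rw [h, coeff_zero] at h1
    exact zero_ne_one h1
  have hdeg : F.natDegree ≤ q ^ (M - 1) := by
    refine Polynomial.natDegree_sum_le_of_forall_le _ _ fun j hj => ?_
    refine (Polynomial.natDegree_C_mul_X_pow_le _ _).trans (Nat.pow_le_pow_right hq1.le ?_)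
    exact Nat.le_sub_one_of_lt (mem_range.1 hj)
  obtain ⟨i, hi⟩ : ∃ i : ℕ, F.eval (residue R (z ^ i)) ≠ 0 := by
    by_contra! hcon
    let S : Finset (ResF R) :=
      insert 0 ((range n).image fun i => residue R (z ^ i))
    have hS : S.card = n + 1 := by
      rw [Finset.card_insert_of_notMem, Finset.card_image_of_injOn, Finset.card_range]
      · intro a ha b hb hab
        have h1 : residue R (z ^ a - z ^ b) = 0 := by
          rw [map_sub, sub_eq_zero]; exact hab
        rw [residue_eq_zero_iff, mem_maximalIdeal_integers_iff] at h1
        have h2 := eq_of_pow_eq_one p hpn (by rw [← pow_mul, mul_comm, pow_mul, hζ.pow_eq_one,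
          one_pow]) (by rw [← pow_mul, mul_comm, pow_mul, hζ.pow_eq_one, one_pow]) (show padicAbs p _ (ζ ^ a - ζ ^ b) < 1 from h1)
        exact hζ.pow_inj (mem_range.1 ha) (mem_range.1 hb) h2
      · rw [mem_image]
        rintro ⟨i, -, hi⟩
        rw [residue_eq_zero_iff, mem_maximalIdeal_integers_iff] at hi
        change padicAbs p _ (ζ ^ i) < 1 at hi
        rw [map_pow, padicAbs_eq_one_of_pow_eq_one p hn0.ne' hζ.pow_eq_one, one_pow] at hi
        exact lt_irrefl _ hi
    have hle := Polynomial.card_le_degree_of_subset_roots (p := F) (Z := S) (fun a ha => by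
      rw [mem_roots hF0, Polynomial.IsRoot.def]
      rcases mem_insert.1 (show a ∈ S from ha) with rfl | h
      · simp only [F, eval_finsetSum, eval_mul, eval_C, Polynomial.eval_pow, eval_X]
        refine sum_eq_zero fun j _ => ?_
        rw [zero_pow (pow_ne_zero _ (by omega)), mul_zero]
      · obtain ⟨i, -, rfl⟩ := mem_image.1 h
        exact hcon i)
    rw [hS] at hle
    have h3 : q ^ (M - 1) < q ^ M := Nat.pow_lt_pow_right hq1 (by omega)
    omega
  set w := ∑ j ∈ range M, ((φ ^ j) y / y) * (ζ ^ i) ^ (q ^ j) with hw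
  have hw1 : padicAbs p _ w = 1 := by
    have h1 : F.eval (residue R (z ^ i)) = residue R (∑ j ∈ range M, e j * (z ^ i) ^ (q ^ j)) := by
      simp [F, eval_finsetSum]
    rw [h1, Ne, residue_eq_zero_iff, mem_maximalIdeal_integers_iff] at hi
    have h2 : ((∑ j ∈ range M, e j * (z ^ i) ^ (q ^ j) : R) : AC L) = w := by
      rw [hw]; push_cast; rfl
    have h3 := (∑ j ∈ range M, e j * (z ^ i) ^ (q ^ j) : R).2
    rw [h2] at hi h3
    exact le_antisymm h3 (not_lt.1 hi)
  have hζi : (ζ ^ i) ^ n = 1 := by rw [← pow_mul, mul_comm, pow_mul, hζ.pow_eq_one, one_pow]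
  have hT : y * w = ∑ j ∈ range M, (φ ^ j) (y * ζ ^ i) := by
    rw [hw, mul_sum]
    refine sum_congr rfl fun j _ => ?_
    rw [map_mul, hφ.pow_apply_root p hpn hζi, ← hq]
    field_simp
  have hTφ : φ (y * w) = y * w := by
    rw [hT, map_sum]
    have h1 : ∀ j, φ ((φ ^ j) (y * ζ ^ i)) = (φ ^ (j + 1)) (y * ζ ^ i) := fun j => by
      rw [pow_succ', AlgEquiv.mul_apply]
    simp only [h1]
    have h2 : (φ ^ M) (y * ζ ^ i) = (φ ^ 0) (y * ζ ^ i) := by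
      rw [map_mul, hM, hφ.pow_apply_root p hpn hζi, pow_zero, AlgEquiv.one_apply, ← hq]
      rw [show q ^ M = n + 1 by lia, pow_succ, hζi, one_mul]
    obtain ⟨s, hs⟩ := Nat.exists_eq_succ_of_ne_zero hM0.ne'
    rw [hs, Nat.succ_eq_add_one] at h2 ⊢
    rw [sum_range_succ, sum_range_succ', h2]
  have hTI : ∀ g ∈ inertia p L, g (y * w) = y * w := fun g hg => by
    rw [map_mul, hfix g hg, hw, map_sum]
    congr 1
    refine sum_congr rfl fun j _ => ?_
    rw [map_mul, inertia_fix p hg hpnℓ (hε j), map_pow, inertia_fix p hg hpn hζi]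
  obtain ⟨t, ht⟩ := hφ.mem_range_of_fixed p hTI hTφ
  have hNt : padicAbs p L t ^ ℓ = padicAbs p L (π : L) := by
    rw [← padicAbs_tower p (K := AC L) t, ht, map_mul, hw1, mul_one, ← map_pow, hy, padicAbs_tower]
  have hπ1 := (mem_maximalIdeal_integers_iff p _).1 (hπ.ge (mem_span_singleton_self π))
  have hπpos : 0 < padicAbs p L (π : L) := (padicAbs p L).pos hπL0
  have ht1 : padicAbs p L t < 1 := by
    by_contra! hcon
    exact absurd hπ1 (not_lt.2 (hNt ▸ one_le_pow₀ hcon))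
  have htm : (⟨t, ht1.le⟩ : integers p L) ∈ maxId (integers p L) := (mem_maximalIdeal_integers_iff p _).2 ht1
  rw [hπ, Ideal.mem_span_singleton'] at htm
  obtain ⟨a, ha⟩ := htm
  have hta : t = (a : L) * π := (congrArg Subtype.val ha).symm
  have hle : padicAbs p L t ≤ padicAbs p L (π : L) := by
    rw [hta, map_mul]
    exact mul_le_of_le_one_left hπpos.le a.2
  have h5 := pow_lt_self_of_lt_one₀ hπpos hπ1 hℓ.one_lt
  have h6 := pow_le_pow_left₀ ((padicAbs p L).nonneg t) hle ℓ
  rw [hNt] at h6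
  exact absurd h5 (not_lt.2 h6)

end Inertia

lemma pow_mul_conj {H : Type*} [Group H] {τ Φ : H} {q : ℕ} (h : Φ * τ * Φ⁻¹ = τ ^ q) (a c : ℕ) :
    Φ ^ a * τ ^ c = τ ^ (q ^ a * c) * Φ ^ a := by
  have h1 : ∀ c : ℕ, Φ * τ ^ c = τ ^ (q * c) * Φ := fun c => by
    rw [pow_mul, ← h, conj_pow, inv_mul_cancel_right]
  induction a generalizing c with
  | zero => simp
  | succ a ih =>
    rw [pow_succ, mul_assoc, h1, ← mul_assoc, ih, mul_assoc]
    congr 2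
    ring

lemma modEq_of_pow_modEq {q M a b : ℕ} (hq : 1 < q) (hM : 0 < M) (h : q ^ a ≡ q ^ b [MOD (q ^ M - 1)]) : a ≡ b [MOD M] := by
  wlog hab : a ≤ b generalizing a b
  · exact (this h.symm (le_of_not_ge hab)).symm
  rw [Nat.modEq_iff_dvd' hab]
  rw [Nat.modEq_iff_dvd' (Nat.pow_le_pow_right hq.le hab)] at h
  obtain ⟨c, rfl⟩ := exists_eq_add_of_le hab
  rw [Nat.add_sub_cancel_left]
  have hqM : 1 < q ^ M := one_lt_pow hM.ne' hq
  have hcop : Coprime (q ^ M - 1) (q ^ a) := .pow_right _ (.coprime_dvd_right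
    (dvd_pow_self q hM.ne') ((Nat.coprime_self_sub_left hqM.le).2 (Nat.coprime_one_left _)))
  rw [show q ^ (a + c) - q ^ a = q ^ a * (q ^ c - 1) by rw [pow_add, Nat.mul_sub, mul_one]] at h
  have h3 := Nat.gcd_eq_left (hcop.dvd_of_dvd_mul_left h)
  rw [Nat.pow_sub_one_gcd_pow_sub_one] at h3
  have h4 : 0 < q ^ M.gcd c := Nat.pow_pos (by lia)
  rw [← Nat.pow_right_injective hq (show q ^ M.gcd c = q ^ M by lia)]
  exact Nat.gcd_dvd_right _ _

lemma not_dvd_pow {p ℓ : ℕ} [Fact p.Prime] [Fact ℓ.Prime] (h : p ≠ ℓ) (s : ℕ) : ¬ p ∣ ℓ ^ s :=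
  fun h' => h ((Nat.prime_dvd_prime_iff_eq Fact.out Fact.out).1 ((Fact.out : p.Prime).dvd_of_dvd_pow h'))

section Inertia

variable (p : ℕ) [Fact p.Prime] {L : Type v} [Field L] [Algebra ℚ_[p] L]
  [FinDim ℚ_[p] L] {φ : GalGroup L} {ℓ : ℕ} [Fact ℓ.Prime] {σ : inertia p L}

lemma isOpen_inertia_of_fix_le {H : Subgroup (inertia p L)} (S : Finset (AC L))
    (h : ∀ g : inertia p L, (∀ x ∈ S, (g : GalGroup L) x = x) → g ∈ H) : IsOpen (H : Set (inertia p L)) :=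
  isOpen_mono (H₁ := (fixingSubgroup (GalGroup L) (S : Set (AC L))).subgroupOf (inertia p L))
    (fun g hg => h g ((mem_fixingSubgroup_iff _).1 hg)) ((isOpen_of_fixingSubgroup_le S fun _ hg =>
      (mem_fixingSubgroup_iff _).2 hg).preimage continuous_subtype_val)

/-- The action of the Galois group on an `ℓ ^ s`-th root of a uniformizer. -/
lemma IsArithFrobenius.exists_radical (hφ : IsArithFrobenius p L φ) (hpℓ : p ≠ ℓ) (hσ : IsTameGenerator p L ℓ σ) (s : ℕ) :
    ∃ ϖ ζ : AC L, ϖ ≠ 0 ∧ IsPrimitiveRoot ζ (ℓ ^ s) ∧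
      (σ : GalGroup L) ϖ = ζ * ϖ ∧ ∀ g : GalGroup L, ∃ c : ℕ, g ϖ = ζ ^ c * ϖ := by
  classical
  have hpnℓ := not_dvd_pow hpℓ s
  obtain ⟨π, hπ0, hπ⟩ := exists_uniformizer p L
  have hπL0 : amap L (AC L) (π : L) ≠ 0 := by
    rw [Ne, map_eq_zero]; exact fun h => hπ0 (Subtype.ext h)
  have hN0 : ℓ ^ s ≠ 0 := NeZero.ne _
  obtain ⟨ϖ, hϖ⟩ := IsAlgClosed.exists_pow_nat_eq (amap L (AC L) (π : L)) (Nat.pos_of_ne_zero hN0)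
  have hϖ0 : ϖ ≠ 0 := fun h => hπL0 (by rw [← hϖ, h, zero_pow hN0])
  have hε : ∀ g : GalGroup L, (g ϖ / ϖ) ^ (ℓ ^ s) = 1 := fun g => by
    rw [div_pow, ← map_pow, hϖ, AlgEquiv.commutes, div_self hπL0]
  let χ : inertia p L →* rootsOfUnity (ℓ ^ s) (AC L) :=
    MonoidHom.mk' (fun u => rootsOfUnity.mkOfPowEq _ (hε u)) (fun u w => by
      refine Subtype.ext (Units.ext ?_)
      simp only [rootsOfUnity.val_mkOfPowEq_coe, coe_mul, val_mul]
      have h1 := inertia_fix p u.2 hpnℓ (hε w)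
      rw [map_div₀, div_eq_iff (by rwa [Ne, map_eq_zero])] at h1
      rw [AlgEquiv.mul_apply, h1]
      field_simp)
  have hχ : ∀ u : inertia p L, (((χ u : (AC L)ˣ)) : AC L) = (u : GalGroup L) ϖ / ϖ := fun u => rfl
  have hPG : IsPGroup ℓ (rootsOfUnity (ℓ ^ s) (AC L)) := fun g => ⟨s, by
    have := g.2
    rw [mem_rootsOfUnity] at this
    exact Subtype.ext this⟩
  have hopen : ∀ f : inertia p L →* rootsOfUnity (ℓ ^ s) (AC L), (∀ u : inertia p L, (u : GalGroup L) ϖ = ϖ → f u = 1) →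
      OpenKer f := fun f hf =>
    isOpen_inertia_of_fix_le p {ϖ} fun g hg => hf g (hg ϖ (Finset.mem_singleton_self _))
  have hχ1 : ∀ u : inertia p L, (u : GalGroup L) ϖ = ϖ → χ u = 1 := fun u hu =>
    Subtype.ext (Units.ext (by rw [hχ, hu, div_self hϖ0]; rfl))
  have hζ : IsPrimitiveRoot ((σ : GalGroup L) ϖ / ϖ) (ℓ ^ s) := by
    rcases s with _ | s
    · simpa using hε σ
    · rw [IsPrimitiveRoot.iff_orderOf]
      refine orderOf_eq_prime_pow (fun h => ?_) (hε σ)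
      have h1 : χ ^ (ℓ ^ s) = 1 := by
        have ho : OpenKer (χ ^ ℓ ^ s) := hopen _ fun u hu => by
          rw [MonoidHom.pow_apply, hχ1 u hu, one_pow]
        have ho' := hopen 1 fun _ _ => rfl
        exact hσ.hom_ext p ho ho' (tildeWild_le_ker p _ ho (hPG.to_subgroup _))
          (tildeWild_le_ker p _ ho' (hPG.to_subgroup _)) (Subtype.ext (Units.ext h))
      refine hφ.not_fixed_of_pow_eq p hpℓ hπ0 hπ (y := ϖ ^ ℓ ^ s) ?_ fun g hg => ?_
      · rw [← pow_mul, ← pow_succ, hϖ]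
      · have h2 := cfun h1 ⟨g, hg⟩
        have h3 : (g ϖ / ϖ) ^ (ℓ ^ s) = 1 := congrArg (fun z : rootsOfUnity (ℓ ^ (s + 1)) (AC L) => (z.1 : AC L)) h2
        rw [div_pow, div_eq_one_iff_eq (pow_ne_zero _ hϖ0)] at h3
        rw [map_pow, h3]
  refine ⟨ϖ, _, hϖ0, hζ, (div_mul_cancel₀ _ hϖ0).symm, fun g => ?_⟩
  obtain ⟨c, -, hc⟩ := hζ.eq_pow_of_pow_eq_one (hε g)
  exact ⟨c, by rw [hc, div_mul_cancel₀ _ hϖ0]⟩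

/-- The tame character of inertia modulo `ℓ ^ s`. -/
lemma IsArithFrobenius.exists_char (hφ : IsArithFrobenius p L φ) (hpℓ : p ≠ ℓ) (hσ : IsTameGenerator p L ℓ σ) (s : ℕ) :
    ∃ c : inertia p L →* Multiplicative (ZMod (ℓ ^ s)), OpenKer c ∧ c σ = ofAdd 1 ∧
      ∀ u w : inertia p L, (w : GalGroup L) = φ * u * φ⁻¹ → c w = c u ^ residueCard p L := by
  have hpnℓ := not_dvd_pow hpℓ s
  have hN0 : ℓ ^ s ≠ 0 := NeZero.ne _
  obtain ⟨ϖ, ζ, hϖ0, hζ, hσϖ, hc⟩ := hφ.exists_radical p hpℓ hσ s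
  choose c hc using hc
  have hfix : ∀ u : inertia p L, ∀ b : ℕ, (u : GalGroup L) (ζ ^ b) = ζ ^ b := fun u b => by
    rw [map_pow, inertia_fix p u.2 hpnℓ hζ.pow_eq_one]
  have key : ∀ (g : GalGroup L) (b : ℕ), g ϖ = ζ ^ b * ϖ → (c g : ZMod (ℓ ^ s)) = b := fun g b h => by
    rw [hc] at h
    rw [ZMod.natCast_eq_natCast_iff]
    exact modEq_of_pow_eq hζ hN0 (mul_right_cancel₀ hϖ0 h)
  let f : inertia p L →* Multiplicative (ZMod (ℓ ^ s)) :=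
    MonoidHom.mk' (fun u => ofAdd (c u : ZMod (ℓ ^ s))) (fun u w => by
      rw [← ofAdd_add, ← Nat.cast_add]
      congr 1
      apply key
      rw [coe_mul, AlgEquiv.mul_apply, hc w, map_mul, hfix, hc u, pow_add]
      ring)
  refine ⟨f, ?_, ?_, ?_⟩
  · refine isOpen_inertia_of_fix_le p {ϖ} fun g hg => ?_
    rw [mem_ker]
    change ofAdd (c g : ZMod (ℓ ^ s)) = 1
    rw [key g 0 (by rw [hg ϖ (Finset.mem_singleton_self _)]; simp)]
    simp
  · change ofAdd (c σ : ZMod (ℓ ^ s)) = _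
    rw [key σ 1 (by rw [hσϖ, pow_one]), Nat.cast_one]
  · intro u w hw
    change ofAdd (c w : ZMod (ℓ ^ s)) = ofAdd (c u : ZMod (ℓ ^ s)) ^ _
    rw [← ofAdd_nsmul, nsmul_eq_mul, ← Nat.cast_mul]
    congr 1
    apply key
    rw [hw, AlgEquiv.mul_apply, AlgEquiv.mul_apply, hc φ⁻¹, map_mul, hfix, hc u]
    have h1 : φ (ζ ^ c φ⁻¹) * φ ϖ = ϖ := by
      rw [← map_mul, ← hc, ← AlgEquiv.mul_apply, mul_inv_cancel]; rfl
    rw [map_mul, map_mul, mul_left_comm, h1, map_pow, hφ.apply_root p hpnℓ hζ.pow_eq_one, pow_mul]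

lemma zmod_pow_eq_one (s : ℕ) (x : Multiplicative (ZMod (ℓ ^ s))) : x ^ (ℓ ^ s) = 1 := by
  apply toAdd.injective
  rw [toAdd_pow, nsmul_eq_mul, ZMod.natCast_self, zero_mul]; rfl

lemma tildeWild_le_ker_zmod (s : ℕ) (f : inertia p L →* Multiplicative (ZMod (ℓ ^ s)))
    (hf : OpenKer f) : tildeWild p L ℓ ≤ f.ker := by
  have : Finite (Multiplicative (ZMod (ℓ ^ s))) := inferInstanceAs (Finite (ZMod (ℓ ^ s)))
  exact tildeWild_le_ker p f hf (IsPGroup.to_subgroup (fun g => ⟨s, zmod_pow_eq_one s g⟩) _)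

lemma pow_val_toAdd_mul {H : Type*} [Group H] {x : H} {s : ℕ} (hx : x ^ (ℓ ^ s) = 1) (a b : Multiplicative (ZMod (ℓ ^ s))) :
    x ^ (a * b).toAdd.val = x ^ a.toAdd.val * x ^ b.toAdd.val := by
  rw [toAdd_mul, ZMod.val_add, ← pow_add]
  exact pow_eq_pow_of_modEq (Nat.mod_modEq _ _) hx

/-- A homomorphism with open kernel that factors through tame inertia, and whose value at the tame
generator has order a power of `ℓ`. -/
lemma IsTameGenerator.apply_eq_pow (hσ : IsTameGenerator p L ℓ σ) {H : Type*} [Group H]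
    {f : inertia p L →* H} (hf : OpenKer f) (hk : tildeWild p L ℓ ≤ f.ker) {s : ℕ} (hs : f σ ^ (ℓ ^ s) = 1)
    {c : inertia p L →* Multiplicative (ZMod (ℓ ^ s))} (hc : OpenKer c)
    (hcσ : c σ = ofAdd 1) (u : inertia p L) : f u = f σ ^ (c u).toAdd.val := by
  let f' : inertia p L →* H := MonoidHom.mk' (fun u => f σ ^ (c u).toAdd.val) 
    (fun u w => by rw [map_mul, pow_val_toAdd_mul hs])
  have hle : c.ker ≤ f'.ker := fun g hg => by
    rw [mem_ker]
    change f σ ^ (c g).toAdd.val = 1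
    rw [mem_ker.1 hg]; simp
  have : f = f' := by
    refine hσ.hom_ext p hf (isOpen_mono hle hc) hk ((tildeWild_le_ker_zmod p s c hc).trans hle) ?_
    change f σ = f σ ^ (c σ).toAdd.val
    rw [hcσ, toAdd_ofAdd]
    rw [← Nat.cast_one, ZMod.val_natCast, pow_eq_pow_of_modEq (Nat.mod_modEq _ _) hs, pow_one]
  exact cfun this u

lemma IsArithFrobenius.conj_eq_pow (hφ : IsArithFrobenius p L φ) (hpℓ : p ≠ ℓ)
    (hσ : IsTameGenerator p L ℓ σ) {H : Type*} [Group H] {r : GalGroup L →* H}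
    (hr : OpenKer r) (hk : ∀ g ∈ tildeWild p L ℓ, r g = 1) {s : ℕ}
    (hs : r σ ^ (ℓ ^ s) = 1) : r φ * r σ * (r φ)⁻¹ = r σ ^ residueCard p L := by
  obtain ⟨c, hc, hcσ, hcφ⟩ := hφ.exists_char p hpℓ hσ s
  have hopen : OpenKer (r.comp (inertia p L).subtype) := hr.preimage continuous_subtype_val
  have h := hσ.apply_eq_pow p hopen (fun g hg => mem_ker.2 (hk g hg)) hs hc hcσ ⟨φ * σ * φ⁻¹, (inertia_normal p).conj_mem _ σ.2 φ⟩
  rw [hcφ σ _ rfl, hcσ] at h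
  simp only [comp_apply, Subgroup.coe_subtype, map_mul, map_inv] at h
  rw [h, ← ofAdd_nsmul, toAdd_ofAdd]
  refine pow_eq_pow_of_modEq ?_ hs
  rw [nsmul_eq_mul, mul_one, ZMod.val_natCast]
  exact Nat.mod_modEq _ _

lemma not_dvd_residueCard_pow_sub_one {M : ℕ} (hM : 0 < M) : ¬ p ∣ residueCard p L ^ M - 1 := by
  obtain ⟨f, hf, hqf⟩ := exists_residueCard_eq p L
  have hqM : 1 < residueCard p L ^ M := one_lt_pow hM.ne' (one_lt_residueCard p L)
  intro hdvd
  have h2 : p ∣ residueCard p L ^ M := by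
    rw [hqf]; exact dvd_pow (dvd_pow_self p hf.ne') hM.ne'
  have h4 := (Nat.dvd_sub_iff_right hqM.le h2).1 hdvd
  exact (Fact.out : p.Prime).one_lt.ne' (Nat.dvd_one.1 h4)

/-- The tame quotient has the presentation `φ σ φ⁻¹ = σ ^ q`. -/
lemma IsArithFrobenius.exists_rep (hφ : IsArithFrobenius p L φ) (hpℓ : p ≠ ℓ)
    (hσ : IsTameGenerator p L ℓ σ) {H : Type*} [Group H] [Finite H] {s : ℕ} {Φ τ : H}
    (hs : τ ^ (ℓ ^ s) = 1) (h : Φ * τ * Φ⁻¹ = τ ^ residueCard p L) : ∃ r : GalGroup L →* H, OpenKer r ∧ r φ = Φ ∧ r σ = τ ∧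
      ∀ u ∈ inertia p L, ∃ c : ℕ, r u = τ ^ c := by
  classical
  have hpnℓ := not_dvd_pow hpℓ s
  have := charZero_algebraicClosure p L
  have hN0 : ℓ ^ s ≠ 0 := NeZero.ne _
  obtain ⟨ϖ, ζ, hϖ0, hζ, hσϖ, hc⟩ := hφ.exists_radical p hpℓ hσ s
  choose c hc using hc
  have hcop : Coprime (residueCard p L) (ℓ ^ s) := coprime_residueCard p (L := L) hpnℓ
  have hq1 : 1 < residueCard p L := one_lt_residueCard p L
  have hndvd := fun {M : ℕ} (hM : 0 < M) => not_dvd_residueCard_pow_sub_one p (L := L) hM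
  have hroot := fun {M : ℕ} (hM : ¬ p ∣ M) {ζ : AC L} (hζ : ζ ^ M = 1) =>
    hφ.exists_apply_root p hM hζ
  have hφroot := fun {M : ℕ} (hM : ¬ p ∣ M) {ζ : AC L} (hζ : ζ ^ M = 1) =>
    hφ.apply_root p hM hζ
  generalize residueCard p L = q at h hcop hq1 hndvd hroot hφroot
  set Φ' : H := (τ ^ c φ)⁻¹ * Φ with hΦ'
  have h' : Φ' * τ * Φ'⁻¹ = τ ^ q := by
    rw [show Φ' * τ * Φ'⁻¹ = (τ ^ c φ)⁻¹ * (Φ * τ * Φ⁻¹) * τ ^ c φ by rw [hΦ']; group, h, mul_assoc, ← pow_add, add_comm, pow_add, inv_mul_cancel_left]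
  set M := orderOf Φ' * (ℓ ^ s).totient with hM
  have hM0 : 0 < M := Nat.mul_pos (orderOf_pos _) (Nat.totient_pos.2 (Nat.pos_of_ne_zero hN0))
  have hqM : 1 < q ^ M := one_lt_pow hM0.ne' hq1
  have hpn := hndvd hM0
  have : NeZero (q ^ M - 1) := ⟨by omega⟩
  have : NeZero ((q ^ M - 1 : ℕ) : AC L) := ⟨cast_ne_zero.2 (by omega)⟩
  obtain ⟨ω, hω⟩ := exists_primitiveRoot (AC L) (q ^ M - 1)
  have hdvd : ℓ ^ s ∣ q ^ M - 1 := by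
    rw [← Nat.modEq_iff_dvd' hqM.le, hM, mul_comm, pow_mul]
    simpa using ((pow_totient hcop).pow (orderOf Φ')).symm
  obtain ⟨e, -, he⟩ := hω.eq_pow_of_pow_eq_one ((orderOf_dvd_iff_pow_eq_one).1 ((hζ.eq_orderOf).symm.dvd.trans hdvd))
  choose a ha using hroot hpn hω.pow_eq_one
  have haζ : ∀ g : GalGroup L, g ζ = ζ ^ (q ^ a g) := fun g => by
    rw [← he, map_pow, ha, ← pow_mul, ← pow_mul, mul_comm]
  have hΦM : Φ' ^ M = 1 := by rw [hM, pow_mul, pow_orderOf_eq_one, one_pow]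
  have keya : ∀ (g : GalGroup L) (b : ℕ), g ω = ω ^ (q ^ b) → Φ' ^ a g = Φ' ^ b := fun g b hg => by
    rw [ha] at hg
    exact pow_eq_pow_of_modEq (modEq_of_pow_modEq hq1 hM0 (modEq_of_pow_eq hω (by omega) hg)) hΦM
  have keyc : ∀ (g : GalGroup L) (b : ℕ), g ϖ = ζ ^ b * ϖ → τ ^ c g = τ ^ b := fun g b hg => by
    rw [hc] at hg
    exact pow_eq_pow_of_modEq (modEq_of_pow_eq hζ hN0 (mul_right_cancel₀ hϖ0 hg)) hs
  let r : GalGroup L →* H := MonoidHom.mk' (fun g => τ ^ c g * Φ' ^ a g) (fun g k => by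
    rw [mul_assoc, ← mul_assoc (Φ' ^ a g), pow_mul_conj h', mul_assoc, ← pow_add, ← mul_assoc, ← pow_add]
    congr 1
    · apply keyc
      rw [AlgEquiv.mul_apply, hc k, map_mul, map_pow, haζ, hc g, pow_add, ← pow_mul]
      ring
    · apply keya
      rw [AlgEquiv.mul_apply, ha k, map_pow, ha g, ← pow_mul, pow_add])
  refine ⟨r, isOpen_of_fixingSubgroup_le {ϖ, ω} fun g hg => ?_, ?_, ?_, fun u hu => ⟨c u, ?_⟩⟩
  · rw [mem_ker]
    change τ ^ c g * Φ' ^ a g = 1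
    rw [keyc g 0 (by rw [hg ϖ (by simp)]; simp), keya g 0 (by rw [hg ω (by simp)]; simp)]
    simp
  · change τ ^ c φ * Φ' ^ a φ = Φ
    rw [keya φ 1 (by rw [hφroot hpn hω.pow_eq_one, pow_one]), hΦ', pow_one, mul_inv_cancel_left]
  · change τ ^ c σ * Φ' ^ a σ = τ
    rw [keyc σ 1 (by rw [hσϖ, pow_one]), keya σ 0 (by
      rw [inertia_fix p σ.2 hpn hω.pow_eq_one]; simp)]
    simp
  · change τ ^ c u * Φ' ^ a u = τ ^ c u
    rw [keya u 0 (by rw [inertia_fix p hu hpn hω.pow_eq_one]; simp), pow_zero, mul_one]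

lemma IsArithFrobenius.zpow_mem_inertia (hφ : IsArithFrobenius p L φ) {k : ℤ} (hk : φ ^ k ∈ inertia p L) : k = 0 := by
  have := charZero_algebraicClosure p L
  have main : ∀ k : ℕ, φ ^ k ∈ inertia p L → k = 0 := fun k hk => by
    have hq1 := one_lt_residueCard p L
    have hpn := not_dvd_residueCard_pow_sub_one p (L := L) k.succ_pos
    have hroot := fun {M : ℕ} (hM : ¬ p ∣ M) {ζ : AC L} (hζ : ζ ^ M = 1) =>
      hφ.pow_apply_root p hM hζ
    generalize residueCard p L = q at hq1 hpn hroot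
    have hqM : 1 < q ^ (k + 1) := one_lt_pow k.succ_ne_zero hq1
    have : NeZero (q ^ (k + 1) - 1) := ⟨by omega⟩
    have : NeZero ((q ^ (k + 1) - 1 : ℕ) : AC L) := ⟨cast_ne_zero.2 (by omega)⟩
    obtain ⟨ω, hω⟩ := exists_primitiveRoot (AC L) (q ^ (k + 1) - 1)
    have h1 := inertia_fix p hk hpn hω.pow_eq_one
    rw [hroot hpn hω.pow_eq_one] at h1
    have h2 := modEq_of_pow_modEq hq1 k.succ_pos (modEq_of_pow_eq hω (by omega) (h1.trans (by simp : ω = ω ^ (q ^ 0))))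
    exact Nat.eq_zero_of_dvd_of_lt (Nat.modEq_zero_iff_dvd.1 h2) k.lt_succ_self
  obtain ⟨j, rfl | rfl⟩ := k.eq_nat_or_neg
  · rw [main j (by rwa [zpow_natCast] at hk)]; rfl
  · rw [main j (by rwa [zpow_neg, zpow_natCast, inv_mem_iff] at hk)]; rfl

lemma isClosed_inertia : IsClosed (inertia p L : Set (GalGroup L)) := by
  have := isGalois_algebraicClosure p L
  let Z : Set (AC L) := {ζ | ∃ M : ℕ, ¬ p ∣ M ∧ ζ ^ M = 1}
  have h : inertia p L = (adjoin L Z).fixingSubgroup := by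
    refine le_antisymm ((IntermediateField.le_iff_le _ _).1 (adjoin_le_iff.2 ?_)) fun g hg =>
      mem_inertia_of_fix p L fun M hM ζ hζ =>
        (IntermediateField.mem_fixingSubgroup_iff _ _).1 hg ζ (subset_adjoin _ _ ⟨M, hM, hζ⟩)
    rintro x ⟨M, hM, hx⟩
    exact (mem_fixedField_iff _ _).2 fun f hf => inertia_fix p hf hM hx
  rw [h]
  exact InfiniteGalois.fixingSubgroup_isClosed _

/-- The tame character of inertia. -/
lemma IsArithFrobenius.exists_tameChar (hφ : IsArithFrobenius p L φ) (hpℓ : p ≠ ℓ) (hσ : IsTameGenerator p L ℓ σ) :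
    ∃ t : inertia p L →* Multiplicative ℤ_[ℓ], Continuous t ∧ Surjective t ∧ t σ = ofAdd 1 := by
  have := isGalois_algebraicClosure p L
  have : CompactSpace (inertia p L) := isCompact_iff_compactSpace.1 (isClosed_inertia p).isCompact
  choose c hc hcσ _ using hφ.exists_char p hpℓ hσ
  have hcompat : ∀ s u, ZMod.castHom (pow_dvd_pow ℓ (le_succ s)) (ZMod (ℓ ^ s))
      (c (s + 1) u).toAdd = (c s u).toAdd := fun s u => by
    let d : inertia p L →* Multiplicative (ZMod (ℓ ^ s)) :=
      (toMultiplicative (ZMod.castHom (pow_dvd_pow ℓ (le_succ s)) (ZMod (ℓ ^ s))).toAddMonoidHom).comp (c (s + 1))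
    have hd : OpenKer d := isOpen_mono (fun g hg => by
      rw [mem_ker, comp_apply, mem_ker.1 hg, map_one]) (hc (s + 1))
    have : d = c s := hσ.hom_ext p hd (hc s) (tildeWild_le_ker_zmod p s d hd) (tildeWild_le_ker_zmod p s _ (hc s)) (by
        rw [hcσ, comp_apply, hcσ]
        apply toAdd.injective
        exact map_one (ZMod.castHom (pow_dvd_pow ℓ (le_succ s)) (ZMod (ℓ ^ s))))
    exact congrArg toAdd (cfun this u)
  have hex : ∀ u, ∃ z : ℤ_[ℓ], ∀ s, toZModPow s z = (c s u).toAdd := fun u => by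
    have hpre : IsPrecomplete (maxId ℤ_[ℓ]) ℤ_[ℓ] := inferInstance
    have hz : ∀ s, toZModPow s (((c s u).toAdd.val : ℕ) : ℤ_[ℓ]) = (c s u).toAdd := fun s => by
      rw [map_natCast, ZMod.natCast_zmod_val]
    have hpow : ∀ s, maxId ℤ_[ℓ] ^ s = ker (toZModPow (p := ℓ) s) := fun s => by
        rw [ker_toZModPow, PadicInt.maximalIdeal_eq_span_p, Ideal.span_singleton_pow]
    have hcompat' : ∀ s t, s ≤ t → toZModPow s (((c t u).toAdd.val : ℕ) : ℤ_[ℓ]) = (c s u).toAdd := fun s t hst => by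
      induction t, hst using Nat.le_induction with
      | base => exact hz s
      | succ t hst ih =>
        rw [← ih]
        have h1 := cast_toZModPow s t hst (((c (t + 1) u).toAdd.val : ℕ) : ℤ_[ℓ])
        have h2 := cast_toZModPow s t hst (((c t u).toAdd.val : ℕ) : ℤ_[ℓ])
        have h3 := cast_toZModPow t (t + 1) (le_succ t) (((c (t + 1) u).toAdd.val : ℕ) : ℤ_[ℓ])
        rw [hz] at h2 h3
        rw [← h1, ← h2, ← h3, ← hcompat t u, ZMod.castHom_apply]
    obtain ⟨z, hz'⟩ := hpre.prec' (fun s => (((c s u).toAdd.val : ℕ) : ℤ_[ℓ])) (fun {s t} hst => by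
      rw [SModEq.sub_mem, smul_eq_mul, mul_top, hpow, RingHom.mem_ker, map_sub, hz, hcompat' s t hst, sub_self])
    refine ⟨z, fun s => ?_⟩
    have := hz' s
    rw [SModEq.sub_mem, smul_eq_mul, mul_top, hpow, RingHom.mem_ker, map_sub, hz, sub_eq_zero] at this
    exact this.symm
  choose z hz using hex
  let t : inertia p L →* Multiplicative ℤ_[ℓ] :=
    MonoidHom.mk' (fun u => ofAdd (z u)) (fun u w => by
      rw [← ofAdd_add]
      congr 1
      refine PadicInt.ext_of_toZModPow.1 fun s => ?_
      rw [map_add, hz, hz, hz, map_mul]; rfl)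
  have ht : Continuous t := by
    apply continuous_of_continuousAt_one
    rw [ContinuousAt, map_one]
    have : Filter.Tendsto (fun u : inertia p L => z u) (nhds 1) (nhds 0) := by
      rw [Metric.tendsto_nhds]
      intro ε hε
      obtain ⟨s, hs⟩ := PadicInt.exists_pow_neg_lt ℓ hε
      filter_upwards [(hc s).mem_nhds (one_mem (c s).ker)] with u hu
      rw [dist_zero_right]
      refine lt_of_le_of_lt ?_ hs
      rw [PadicInt.norm_le_pow_iff_mem_span_pow, ← ker_toZModPow, RingHom.mem_ker, hz, mem_ker.1 hu]
      rfl
    exact this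
  have htσ : t σ = ofAdd 1 := congrArg ofAdd (PadicInt.ext_of_toZModPow.1 fun s => by
    rw [hz, hcσ, map_one (toZModPow s)]; rfl)
  refine ⟨t, ht, ?_, htσ⟩
  have hcl : IsClosed (Set.range t) := (isCompact_range ht).isClosed
  have hd : DenseRange (fun u : inertia p L => z u) := by
    refine (PadicInt.denseRange_natCast (p := ℓ)).mono ?_
    rintro _ ⟨k, rfl⟩
    refine ⟨σ ^ k, congrArg toAdd (?_ : t (σ ^ k) = ofAdd (k : ℤ_[ℓ]))⟩
    rw [map_pow, htσ, ← ofAdd_nsmul, nsmul_one]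
  have hcl' : IsClosed (Set.range (fun u : inertia p L => z u)) := hcl
  have := hd.closure_range
  rw [hcl'.closure_eq] at this
  intro y
  obtain ⟨u, hu⟩ := (Set.eq_univ_iff_forall.1 this) y.toAdd
  exact ⟨u, congrArg ofAdd hu⟩

lemma IsTameGenerator.ne_one (hσ : IsTameGenerator p L ℓ σ)
    {t : inertia p L →* Multiplicative ℤ_[ℓ]} (ht : Continuous t) (hsurj : Surjective t) : t σ ≠ 1 := by
  intro h
  let f : inertia p L →* Multiplicative (ZMod (ℓ ^ 1)) :=
    (toMultiplicative (toZModPow (p := ℓ) 1).toAddMonoidHom).comp t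
  have hopen : OpenKer f := by
    have h1 : {z : ℤ_[ℓ] | toZModPow 1 z = 0} = Metric.ball 0 1 := by
      ext z
      rw [Set.mem_ofPred_eq, ← RingHom.mem_ker, ker_toZModPow, pow_one,
        mem_ball_zero_iff, Ideal.mem_span_singleton, PadicInt.norm_lt_one_iff_dvd]
    exact (h1 ▸ Metric.isOpen_ball).preimage ht
  have h0 : IsOpen ((1 : inertia p L →* Multiplicative (ZMod (ℓ ^ 1))).ker : Set (inertia p L)) := by
    rw [MonoidHom.ker_one]; exact isOpen_univ
  have h2 : f = 1 := hσ.hom_ext p hopen h0 (tildeWild_le_ker_zmod p 1 f hopen)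
    (tildeWild_le_ker_zmod p 1 _ h0) (by rw [comp_apply, h]; simp)
  obtain ⟨u, hu⟩ := hsurj (ofAdd 1)
  have h3 := cfun h2 u
  rw [comp_apply, hu] at h3
  have h4 : toZModPow (p := ℓ) 1 1 = 0 := congrArg toAdd h3
  rw [map_one] at h4
  have : Fact (1 < ℓ ^ 1) := ⟨by rw [pow_one]; exact (Fact.out : ℓ.Prime).one_lt⟩
  exact one_ne_zero h4

end Inertia

section NilpotentMatrix

variable {A : Type*} [CommRing A]

lemma matrix_mul_mem {ι κ τ : Type*} [Fintype κ] {I J : Ideal A} {M : Matrix ι κ A}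
    {N : Matrix κ τ A} (hM : ∀ i j, M i j ∈ I) (hN : ∀ i j, N i j ∈ J) (i : ι) (j : τ) : (M * N) i j ∈ I * J := by
  rw [Matrix.mul_apply]
  exact sum_mem fun k _ => mul_mem_mul (hM i k) (hN k j)

lemma matrix_pow_mem {ι : Type*} [Fintype ι] [DecidableEq ι] {I : Ideal A} {M : Mat ι A}
    (hM : ∀ i j, M i j ∈ I) (c : ℕ) (i j : ι) : (M ^ c) i j ∈ I ^ c := by
  induction c generalizing i j with
  | zero => simp
  | succ c ih => rw [pow_succ, pow_succ]; exact matrix_mul_mem ih hM i j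

lemma isNilpotent_matrix_of_mem {ι : Type*} [Fintype ι] [DecidableEq ι] {I : Ideal A}
    (hI : IsNilpotent I) {M : Mat ι A} (hM : ∀ i j, M i j ∈ I) : IsNilpotent M := by
  obtain ⟨c, hc⟩ := hI
  exact ⟨c, Matrix.ext fun i j => hc.le (matrix_pow_mem hM c i j)⟩

lemma isNilpotent_matrix_of_map {A' : Type*} [CommRing A'] (f : A →+* A')
    (hf : IsNilpotent (ker f)) {ι : Type*} [Fintype ι] [DecidableEq ι] {M : Mat ι A}
    (hM : IsNilpotent (M.map f)) : IsNilpotent M := by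
  obtain ⟨c, hc⟩ := hM
  have h1 : IsNilpotent (M ^ c) := by
    refine isNilpotent_matrix_of_mem hf fun i j => ?_
    rw [← mapMatrix_apply, ← map_pow] at hc
    exact congrFun (congrFun hc i) j
  obtain ⟨d, hd⟩ := h1
  exact ⟨c * d, by rw [pow_mul, hd]⟩

/-- A unipotent element has order a power of `ℓ` when `ℓ` is nilpotent. -/
lemma exists_one_add_pow_eq_one {R : Type*} [Ring R] {ℓ : ℕ} [hℓ : Fact ℓ.Prime] {a : ℕ}
    (ha : (ℓ : R) ^ a = 0) {Y : R} (hY : IsNilpotent Y) : ∃ s : ℕ, (1 + Y) ^ (ℓ ^ s) = 1 := by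
  obtain ⟨c, hc⟩ := hY
  have hcY : Y ^ (ℓ ^ c) = 0 := pow_eq_zero_of_le (Nat.lt_pow_self hℓ.out.one_lt).le hc
  obtain ⟨g, hg⟩ := exists_add_pow_prime_pow_eq hℓ.out (1 : Polynomial ℤ) Polynomial.X c
  have h1 : (ℓ : Polynomial ℤ) ∣ (1 + Polynomial.X) ^ (ℓ ^ c) - Polynomial.X ^ (ℓ ^ c) - 1 :=
    ⟨1 * Polynomial.X * g, by rw [hg]; ring⟩
  obtain ⟨k, hk⟩ := dvd_sub_pow_of_dvd_sub h1 a
  refine ⟨c + a, ?_⟩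
  have h3 := congrArg (peval Y) hk
  simp only [map_sub, map_pow, map_add, map_one, Polynomial.aeval_X, map_mul, map_natCast, hcY, sub_zero, one_pow] at h3
  rw [pow_succ, ha, zero_mul, zero_mul, sub_eq_zero, ← pow_mul, ← pow_add] at h3
  exact h3

end NilpotentMatrix

section ExpLog

open Polynomial

variable (A : Type*) [CommRing A] (n : ℕ)

/-- The truncated exponential series. -/
def expPoly : A[X] := ∑ k ∈ range (n + 1), C (inverse (k.factorial : A)) * X ^ k

/-- The truncated series of `log (1 + X)`. -/
def logPoly : A[X] := ∑ k ∈ range n, C ((-1) ^ k * inverse ((k + 1 : ℕ) : A)) * X ^ (k + 1)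

variable {A n}

lemma isUnit_natCast_of_le (hn : IsUnit (n.factorial : A)) {k : ℕ} (h1 : 1 ≤ k) (h2 : k ≤ n) : IsUnit (k : A) :=
  isUnit_of_dvd_unit (Nat.cast_dvd_cast (Nat.dvd_factorial h1 h2)) hn

lemma isUnit_factorial_of_le (hn : IsUnit (n.factorial : A)) {k : ℕ} (h2 : k ≤ n) : IsUnit (k.factorial : A) :=
  isUnit_of_dvd_unit (Nat.cast_dvd_cast (Nat.factorial_dvd_factorial h2)) hn

lemma X_pow_dvd_of_derivative (hn : IsUnit (n.factorial : A)) {H u w : A[X]} (h0 : H.coeff 0 = 0)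
    (hu : u.coeff 0 = 1) (h : X ^ n ∣ derivative H * u - H * w) : X ^ (n + 1) ∣ H := by
  have key : ∀ j, j ≤ n → X ^ (j + 1) ∣ H := fun j => by
    induction j with
    | zero => exact fun _ => by rwa [zero_add, pow_one, X_dvd_iff]
    | succ i ih =>
      intro hi
      obtain ⟨g, hg⟩ := ih (by omega)
      have h1 : derivative H * u - H * w = X ^ i * (C ((i + 1 : ℕ) : A) * g * u + X * (derivative g * u - g * w)) := by
        rw [hg, derivative_mul, derivative_X_pow, Nat.add_sub_cancel]
        ring
      have h2 := X_pow_dvd_iff.1 h i (by omega)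
      rw [h1, coeff_X_pow_mul', if_pos le_rfl, Nat.sub_self, coeff_add, mul_coeff_zero,
        mul_coeff_zero, coeff_C_zero, hu, mul_one, coeff_X_mul_zero, add_zero] at h2
      have h3 := (isUnit_natCast_of_le hn (by omega : 1 ≤ i + 1) hi).mul_right_eq_zero.1 h2
      rw [hg, pow_succ X (i + 1)]
      exact mul_dvd_mul_left _ (X_dvd_iff.2 h3)
  exact key n le_rfl

lemma derivative_expPoly (hn : IsUnit (n.factorial : A)) :
    derivative (expPoly A n) = expPoly A n - C (inverse (n.factorial : A)) * X ^ n := by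
  rw [expPoly, sum_range_succ, add_sub_cancel_right, ← sum_range_succ, sum_range_succ', derivative_add, derivative_sum]
  simp only [pow_zero, mul_one, derivative_C, add_zero]
  refine sum_congr rfl fun k hk => ?_
  rw [mem_range] at hk
  rw [derivative_C_mul, derivative_X_pow, Nat.add_sub_cancel, ← mul_assoc, ← C_mul]
  congr 2
  have hu := isUnit_factorial_of_le hn (k := k + 1) (by omega)
  have hu' := isUnit_factorial_of_le hn (k := k) (by omega)
  have h1 := Ring.inverse_mul_cancel _ hu
  rw [Nat.factorial_succ, Nat.cast_mul, ← mul_assoc] at h1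
  calc _ = inverse ((k + 1).factorial : A) * ((k + 1 : ℕ) : A) *
        ((k.factorial : A) * inverse (k.factorial : A)) := by
          rw [Ring.mul_inverse_cancel _ hu', mul_one]
    _ = _ := by rw [← mul_assoc, Nat.factorial_succ, Nat.cast_mul, h1, one_mul]

lemma one_add_X_mul_derivative_logPoly (hn : IsUnit (n.factorial : A)) : (1 + X) * derivative (logPoly A n) = 1 - (-X) ^ n := by
  have h1 : derivative (logPoly A n) = ∑ k ∈ range n, (-X) ^ k := by
    rw [logPoly, derivative_sum]
    refine sum_congr rfl fun k hk => ?_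
    rw [mem_range] at hk
    have hu := isUnit_natCast_of_le hn (k := k + 1) (by omega) (by omega)
    rw [derivative_C_mul, derivative_X_pow, Nat.add_sub_cancel, ← mul_assoc, ← C_mul, mul_assoc,
      Ring.inverse_mul_cancel _ hu, mul_one, neg_pow (X : A[X]), C_pow, C_neg, C_1]
  have h2 := mul_neg_geom_sum (-X : A[X]) n
  rw [sub_neg_eq_add] at h2
  rw [h1, h2]

lemma X_dvd_logPoly : X ∣ logPoly A n := Finset.dvd_sum fun k _ => mul_left (dvd_pow_self X k.succ_ne_zero) _

lemma expPoly_coeff_zero : (expPoly A n).coeff 0 = 1 := by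
  rw [expPoly, finsetSum_coeff, sum_eq_single 0]
  · simp
  · exact fun k _ hk => by rw [coeff_C_mul, coeff_X_pow, if_neg hk.symm, mul_zero]
  · simp

lemma X_dvd_expPoly_sub_one : X ∣ expPoly A n - 1 := by
  rw [X_dvd_iff, coeff_sub, expPoly_coeff_zero, coeff_one_zero, sub_self]

lemma comp_coeff_zero {f g : A[X]} (hg : g.coeff 0 = 0) : (f.comp g).coeff 0 = f.coeff 0 := by
  rw [coeff_zero_eq_eval_zero, eval_comp, ← coeff_zero_eq_eval_zero g, hg, coeff_zero_eq_eval_zero]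

lemma X_pow_dvd_expPoly_comp_logPoly (hn : IsUnit (n.factorial : A)) :
    X ^ (n + 1) ∣ (expPoly A n).comp (logPoly A n) - (1 + X) := by
  obtain ⟨g, hg⟩ := X_dvd_logPoly (A := A) (n := n)
  have hl0 : (logPoly A n).coeff 0 = 0 := by rw [hg, coeff_X_mul_zero]
  refine X_pow_dvd_of_derivative (u := 1 + X) (w := 1) hn ?_ (by simp) ?_
  · rw [coeff_sub, comp_coeff_zero hl0, expPoly_coeff_zero]; simp
  · have h1 := one_add_X_mul_derivative_logPoly hn
    have h2 : derivative ((expPoly A n).comp (logPoly A n) - (1 + X)) * (1 + X) -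
        ((expPoly A n).comp (logPoly A n) - (1 + X)) * 1 = -((-X) ^ n * (derivative (expPoly A n)).comp (logPoly A n)) -
          C (inverse (n.factorial : A)) * (logPoly A n) ^ n := by
      have h3 : (derivative (expPoly A n)).comp (logPoly A n) = (expPoly A n).comp (logPoly A n) -
            C (inverse (n.factorial : A)) * (logPoly A n) ^ n := by
        rw [derivative_expPoly hn]; simp
      have h4 : derivative ((expPoly A n).comp (logPoly A n) - (1 + X)) * (1 + X) =
          (derivative (expPoly A n)).comp (logPoly A n) * ((1 + X) * derivative (logPoly A n)) - (1 + X) := by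
        rw [derivative_sub, derivative_comp]; simp; ring
      rw [h4, h1, mul_sub, mul_one, h3]
      ring
    rw [h2, hg]
    rw [neg_pow, mul_assoc, mul_pow]
    exact dvd_sub (Dvd.dvd.neg_right (mul_left (dvd_mul_right _ _) _)) (mul_left (dvd_mul_right _ _) _)

lemma X_pow_dvd_logPoly_comp_expPoly (hn : IsUnit (n.factorial : A)) :
    X ^ (n + 1) ∣ (logPoly A n).comp (expPoly A n - 1) - X := by
  obtain ⟨g, hg⟩ := X_dvd_logPoly (A := A) (n := n)
  obtain ⟨e, he⟩ := X_dvd_expPoly_sub_one (A := A) (n := n)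
  have he0 : (expPoly A n - 1).coeff 0 = 0 := by rw [he, coeff_X_mul_zero]
  refine X_pow_dvd_of_derivative (u := 1) (w := 0) hn ?_ (by simp) ?_
  · rw [coeff_sub, comp_coeff_zero he0, hg]; simp
  · have h1 := congrArg (fun f => f.comp (expPoly A n - 1)) (one_add_X_mul_derivative_logPoly hn)
    simp only [mul_comp, add_comp, one_comp, X_comp, sub_comp, pow_comp, neg_comp] at h1
    rw [add_sub_cancel] at h1
    have h2 : derivative ((logPoly A n).comp (expPoly A n - 1) - X) * 1 - ((logPoly A n).comp (expPoly A n - 1) - X) * 0 =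
        expPoly A n * (derivative (logPoly A n)).comp (expPoly A n - 1) - 1 - C (inverse (n.factorial : A)) * X ^ n *
          (derivative (logPoly A n)).comp (expPoly A n - 1) := by
      rw [derivative_sub, derivative_comp, derivative_sub, derivative_one, sub_zero, derivative_expPoly hn, derivative_X]
      ring
    rw [h2, h1, he, neg_pow, mul_pow, sub_sub_cancel_left, mul_assoc (C _)]
    exact dvd_sub (Dvd.dvd.neg_right (mul_left (dvd_mul_right _ _) _)) (mul_left (dvd_mul_right _ _) _)

lemma X_pow_dvd_expPoly_mul (hn : IsUnit (n.factorial : A)) (a b : A) :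
    X ^ (n + 1) ∣ (expPoly A n).comp (C a * X) * (expPoly A n).comp (C b * X) - (expPoly A n).comp (C (a + b) * X) := by
  have h0 : ∀ c : A, (C c * X).coeff 0 = 0 := fun c => by simp
  refine X_pow_dvd_of_derivative (u := 1) (w := C (a + b)) hn ?_ (by simp) ?_
  · rw [coeff_sub, mul_coeff_zero, comp_coeff_zero (h0 _), comp_coeff_zero (h0 _), comp_coeff_zero (h0 _), expPoly_coeff_zero]
    ring
  · have h1 : ∀ c : A, derivative ((expPoly A n).comp (C c * X)) = C c * (expPoly A n).comp (C c * X) -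
          X ^ n * (C c * C (inverse (n.factorial : A)) * C c ^ n) := fun c => by
      rw [derivative_comp, derivative_expPoly hn, derivative_C_mul, derivative_X]
      simp only [sub_comp, mul_comp, C_comp, pow_comp, X_comp]
      ring
    rw [derivative_sub, derivative_mul, h1, h1, h1, C_add]
    refine ⟨-(C a * C (inverse (n.factorial : A)) * C a ^ n) * (expPoly A n).comp (C b * X) -
      (C b * C (inverse (n.factorial : A)) * C b ^ n) * (expPoly A n).comp (C a * X) +
      ((C a + C b) * C (inverse (n.factorial : A)) * (C a + C b) ^ n), ?_⟩
    ring

section Eval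

variable {R : Type*} [Ring R] [Algebra A R]

lemma aeval_eq_zero_of_X_pow_dvd {f : A[X]} {c : ℕ} {Z : R} (hf : X ^ c ∣ f) (hZ : Z ^ c = 0) : peval Z f = 0 := by
  obtain ⟨g, rfl⟩ := hf
  rw [map_mul, map_pow, Polynomial.aeval_X, hZ, zero_mul]

lemma aeval_pow_eq_zero {f : A[X]} {c : ℕ} {Z : R} (hf : X ∣ f) (hZ : Z ^ c = 0) : peval Z f ^ c = 0 := by
  rw [← map_pow]
  exact aeval_eq_zero_of_X_pow_dvd (pow_dvd_pow_of_dvd hf c) hZ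

variable (A n) in
/-- The truncated exponential. -/
def truncExp (N : R) : R := peval N (expPoly A n)

variable (A n) in
/-- The truncated logarithm of `1 + Z`. -/
def truncLog (Z : R) : R := peval Z (logPoly A n)

lemma truncExp_zero : truncExp A n (0 : R) = 1 := by
  obtain ⟨e, he⟩ := X_dvd_expPoly_sub_one (A := A) (n := n)
  rw [truncExp, sub_eq_iff_eq_add.1 he]
  simp

lemma truncExp_sub_one_pow {N : R} {c : ℕ} (hN : N ^ c = 0) : (truncExp A n N - 1) ^ c = 0 := by
  rw [show truncExp A n N - 1 = peval N (expPoly A n - 1) by rw [map_sub, map_one]; rfl]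
  exact aeval_pow_eq_zero X_dvd_expPoly_sub_one hN

lemma truncLog_pow {Z : R} {c : ℕ} (hZ : Z ^ c = 0) : truncLog A n Z ^ c = 0 := aeval_pow_eq_zero X_dvd_logPoly hZ

lemma truncExp_truncLog (hn : IsUnit (n.factorial : A)) {Z : R} (hZ : Z ^ (n + 1) = 0) :
    truncExp A n (truncLog A n Z) = 1 + Z := by
  have := aeval_eq_zero_of_X_pow_dvd (X_pow_dvd_expPoly_comp_logPoly hn) hZ
  rw [map_sub, aeval_comp, map_add, map_one, Polynomial.aeval_X, sub_eq_zero] at this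
  exact this

lemma truncLog_truncExp (hn : IsUnit (n.factorial : A)) {N : R} (hN : N ^ (n + 1) = 0) :
    truncLog A n (truncExp A n N - 1) = N := by
  have := aeval_eq_zero_of_X_pow_dvd (X_pow_dvd_logPoly_comp_expPoly hn) hN
  rw [map_sub, aeval_comp, map_sub, map_one, Polynomial.aeval_X, sub_eq_zero] at this
  exact this

lemma truncExp_add_smul (hn : IsUnit (n.factorial : A)) {N : R} (hN : N ^ (n + 1) = 0) (a b : A) :
    truncExp A n ((a + b) • N) = truncExp A n (a • N) * truncExp A n (b • N) := by
  have := aeval_eq_zero_of_X_pow_dvd (X_pow_dvd_expPoly_mul hn a b) hN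
  rw [map_sub, map_mul, sub_eq_zero] at this
  simp only [aeval_comp, map_mul, Polynomial.aeval_C, Polynomial.aeval_X, ← smul_def] at this
  exact this.symm

lemma truncExp_natCast_smul (hn : IsUnit (n.factorial : A)) {N : R} (hN : N ^ (n + 1) = 0)
    (k : ℕ) : truncExp A n ((k : A) • N) = truncExp A n N ^ k := by
  induction k with
  | zero => rw [Nat.cast_zero, zero_smul, truncExp_zero, pow_zero]
  | succ k ih => rw [Nat.cast_succ, truncExp_add_smul hn hN, ih, one_smul, pow_succ]

lemma map_truncExp {R' : Type*} [Ring R'] [Algebra A R'] (f : R →ₐ[A] R') (N : R) :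
    f (truncExp A n N) = truncExp A n (f N) := (aeval_algHom_apply f N _).symm

lemma map_truncLog {R' : Type*} [Ring R'] [Algebra A R'] (f : R →ₐ[A] R') (N : R) :
    f (truncLog A n N) = truncLog A n (f N) := (aeval_algHom_apply f N _).symm

end Eval

lemma map_ringInverse {A' : Type*} [CommRing A'] (f : A →+* A') {a : A} (ha : IsUnit a) : f (inverse a) = inverse (f a) := by
  obtain ⟨v, rfl⟩ := ha
  rw [Ring.inverse_unit, show f v = (Units.map (f : A →* A') v : A'ˣ) from rfl, Ring.inverse_unit, ← map_inv]
  rfl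

lemma map_expPoly (hn : IsUnit (n.factorial : A)) {A' : Type*} [CommRing A'] (f : A →+* A') :
    (expPoly A n).map f = expPoly A' n := by
  rw [expPoly, expPoly, Polynomial.map_sum]
  refine sum_congr rfl fun k hk => ?_
  rw [mem_range] at hk
  rw [Polynomial.map_mul, Polynomial.map_pow, map_X, map_C, map_ringInverse f (isUnit_factorial_of_le hn (by omega)), map_natCast]

lemma map_logPoly (hn : IsUnit (n.factorial : A)) {A' : Type*} [CommRing A'] (f : A →+* A') :
    (logPoly A n).map f = logPoly A' n := by
  rw [logPoly, logPoly, Polynomial.map_sum]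
  refine sum_congr rfl fun k hk => ?_
  rw [mem_range] at hk
  rw [Polynomial.map_mul, Polynomial.map_pow, map_X, map_C, map_mul, map_pow, map_neg, map_one,
    map_ringInverse f (isUnit_natCast_of_le hn (k := k + 1) (by omega) (by omega)), map_natCast]

lemma aeval_map_eq {A' R R' : Type*} [CommRing A'] [Ring R] [Ring R'] [Algebra A R] [Algebra A' R'] (f : A →+* A') (F : R →+* R')
    (hF : ∀ a : A, F (amap A R a) = amap A' R' (f a)) (P : A[X]) (Z : R) : F (peval Z P) = peval (F Z) (P.map f) := by
  rw [aeval_def, aeval_def, eval₂_map, hom_eval₂]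
  congr 1
  ext a
  exact hF a

lemma ringHom_truncExp (hn : IsUnit (n.factorial : A)) {A' R R' : Type*} [CommRing A'] [Ring R]
    [Ring R'] [Algebra A R] [Algebra A' R'] (f : A →+* A') (F : R →+* R')
    (hF : ∀ a : A, F (amap A R a) = amap A' R' (f a)) (Z : R) : F (truncExp A n Z) = truncExp A' n (F Z) := by
  rw [truncExp, truncExp, aeval_map_eq f F hF, map_expPoly hn]

lemma ringHom_truncLog (hn : IsUnit (n.factorial : A)) {A' R R' : Type*} [CommRing A'] [Ring R]
    [Ring R'] [Algebra A R] [Algebra A' R'] (f : A →+* A') (F : R →+* R')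
    (hF : ∀ a : A, F (amap A R a) = amap A' R' (f a)) (Z : R) : F (truncLog A n Z) = truncLog A' n (F Z) := by
  rw [truncLog, truncLog, aeval_map_eq f F hF, map_logPoly hn]

lemma mapMatrix_algebraMap {A' ι : Type*} [CommRing A'] [Fintype ι] [DecidableEq ι] (f : A →+* A') (a : A) :
    f.mapMatrix (amap A (Mat ι A) a) = amap A' (Mat ι A') (f a) := by
  ext i j
  rw [mapMatrix_apply, map_apply, Matrix.algebraMap_matrix_apply, Matrix.algebraMap_matrix_apply]
  split_ifs
  exacts [rfl, map_zero f]

lemma nilpExp_eq_truncExp {K : Type*} [Field K] (N : Mat (Fin n) K) : nilpExp N = truncExp K n N := by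
  rw [nilpExp, truncExp, expPoly, map_sum]
  refine sum_congr rfl fun k _ => ?_
  rw [map_mul, Polynomial.aeval_C, map_pow, Polynomial.aeval_X, ← smul_def, Ring.inverse_eq_inv]

lemma unipLog_eq_truncLog {K : Type*} [Field K] (Z : Mat (Fin n) K) : unipLog Z = truncLog K n (Z - 1) := by
  rw [unipLog, truncLog, logPoly, map_sum, ← Finset.Ico_succ_right_eq_Icc, Finset.sum_Ico_eq_sum_range]
  refine sum_congr (by simp) fun k _ => ?_
  rw [map_mul, Polynomial.aeval_C, map_pow, Polynomial.aeval_X, ← smul_def, Ring.inverse_eq_inv,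
    Nat.add_sub_cancel_left, add_comm 1 k]

end ExpLog

section Blocks

variable {A : Type*} [CommRing A] {J : Type*} {κ : J → Type*}

local notation "BMat" => Mat (Σ s, κ s) A

/-- The block of index `(s, t)` of a matrix. -/
def blk (Y : BMat) (s t : J) : Matrix (κ s) (κ t) A := Matrix.of fun a b => Y ⟨s, a⟩ ⟨t, b⟩

lemma blk_apply (Y : BMat) (s t : J) (a : κ s) (b : κ t) : blk Y s t a b = Y ⟨s, a⟩ ⟨t, b⟩ := rfl

lemma blk_ext {Y Y' : BMat} (h : ∀ s t, blk Y s t = blk Y' s t) : Y = Y' := by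
  ext ⟨s, a⟩ ⟨t, b⟩
  exact congrFun (congrFun (h s t) a) b

lemma blk_sub (Y Y' : BMat) (s t : J) : blk (Y - Y') s t = blk Y s t - blk Y' s t := rfl

lemma blk_add (Y Y' : BMat) (s t : J) : blk (Y + Y') s t = blk Y s t + blk Y' s t := rfl

lemma blk_smul (c : A) (Y : BMat) (s t : J) : blk (c • Y) s t = c • blk Y s t := rfl

lemma blk_zero (s t : J) : blk (0 : BMat) s t = 0 := rfl

variable [Fintype J] [∀ s, Fintype (κ s)]

lemma blk_mul (Y Y' : BMat) (s t : J) : blk (Y * Y') s t = ∑ u, blk Y s u * blk Y' u t := by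
  ext a b
  rw [blk_apply, Matrix.mul_apply, sum_sigma, Matrix.sum_apply]
  rfl

variable [DecidableEq J] [∀ s, DecidableEq (κ s)]

lemma blk_one_self (s : J) : blk (1 : BMat) s s = 1 := by
  ext a b
  rw [blk_apply]
  by_cases h : a = b
  · subst h; simp
  · rw [one_apply_ne h, one_apply_ne (fun h' => h (by simpa using h'))]

lemma blk_one_ne {s t : J} (h : s ≠ t) : blk (1 : BMat) s t = 0 := by
  ext a b
  rw [blk_apply, one_apply_ne (fun h' => h (congrArg fst h'))]
  rfl

/-- `Y` is block diagonal. -/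
def IsBlockDiag (Y : BMat) : Prop := ∀ s t, s ≠ t → blk Y s t = 0

lemma IsBlockDiag.blk_mul_left {D : BMat} (hD : IsBlockDiag D)
    (Y : BMat) (s t : J) : blk (D * Y) s t = blk D s s * blk Y s t := by
  rw [blk_mul, sum_eq_single s]
  · intro u _ hu
    rw [hD s u hu.symm, Matrix.zero_mul]
  · intro h; exact absurd (mem_univ s) h

lemma IsBlockDiag.blk_mul_right {D : BMat} (hD : IsBlockDiag D)
    (Y : BMat) (s t : J) : blk (Y * D) s t = blk Y s t * blk D t t := by
  rw [blk_mul, sum_eq_single t]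
  · intro u _ hu
    rw [hD u t hu, Matrix.mul_zero]
  · intro h; exact absurd (mem_univ t) h

/-- `D` is block diagonal, and its block of index `s` has the single generalized eigenvalue
`w s`. -/
def IsWeighted (w : J → A) (D : BMat) : Prop := IsBlockDiag D ∧ ∀ s, IsNilpotent (blk D s s - w s • (1 : Mat (κ s) A))

lemma eq_zero_of_mul_eq_mul {ι κ : Type*} [Fintype ι] [Fintype κ] [DecidableEq ι] [DecidableEq κ]
    {P : Mat ι A} {Q : Mat κ A} {Y : Matrix ι κ A} (h : P * Y = Y * Q) (hP : IsNilpotent P) (hQ : IsUnit Q) : Y = 0 := by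
  have h1 : ∀ c : ℕ, P ^ c * Y = Y * Q ^ c := fun c => by
    induction c with
    | zero => simp
    | succ c ih => rw [pow_succ', Matrix.mul_assoc, ih, ← Matrix.mul_assoc, h, Matrix.mul_assoc, ← pow_succ']
  obtain ⟨c, hc⟩ := hP
  have h2 := h1 c
  rw [hc, Matrix.zero_mul] at h2
  obtain ⟨v, hv⟩ := hQ.pow c
  rw [show Y = Y * Q ^ c * (↑v⁻¹ : Mat κ A) by
    rw [← hv, Matrix.mul_assoc, Units.mul_inv, Matrix.mul_one], ← h2, Matrix.zero_mul]

lemma blk_eq_zero_of_commute {w : J → A} {D D' : BMat} (hD : IsWeighted w D) (hD' : IsWeighted w D') {s t : J} {c : A}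
    (hu : IsUnit (w s - c * w t)) {Y : BMat} (h : blk (D * Y) s t = c • blk (Y * D') s t) : blk Y s t = 0 := by
  rw [hD.1.blk_mul_left, hD'.1.blk_mul_right] at h
  refine eq_zero_of_mul_eq_mul (P := blk D s s - w s • (1 : Mat (κ s) A))
    (Q := c • (blk D' t t - w t • (1 : Mat (κ t) A)) - (w s - c * w t) • 1) ?_ (hD.2 s) ?_
  · rw [Matrix.sub_mul, h, smul_mul, Matrix.one_mul, Matrix.mul_sub, Matrix.mul_smul,
      Matrix.mul_smul, Matrix.mul_sub, Matrix.mul_smul, Matrix.mul_one, smul_sub, sub_smul, mul_smul]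
    abel
  · have h1 : IsNilpotent (c • (blk D' t t - w t • (1 : Mat (κ t) A))) := by
      obtain ⟨k, hk⟩ := hD'.2 t
      exact ⟨k, by rw [smul_pow, hk, smul_zero]⟩
    have h2 : IsUnit ((w s - c * w t) • (1 : Mat (κ t) A)) := by
      rw [← Algebra.algebraMap_eq_smul_one]
      exact hu.map (amap A (Mat (κ t) A))
    rw [sub_eq_add_neg]
    refine isUnit_add_right_of_commute h1 h2.neg ?_
    exact ((Commute.one_right _).smul_right _).neg_right

lemma IsWeighted.isUnit {w : J → A} {D : BMat} (hD : IsWeighted w D) (hw : ∀ s, IsUnit (w s)) : IsUnit D := by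
  have h1 : ∀ s, IsUnit (blk D s s) := fun s => by
    have h2 : IsUnit (w s • (1 : Mat (κ s) A)) := by
      rw [← Algebra.algebraMap_eq_smul_one]
      exact (hw s).map (amap A (Mat (κ s) A))
    simpa using isUnit_add_right_of_commute (hD.2 s) h2 ((Commute.one_right _).smul_right _)
  have h2 : D = blockDiagonal' fun s => blk D s s := by
    refine blk_ext fun s t => ?_
    by_cases h : s = t
    · subst h
      ext a b
      rw [blk_apply, blk_apply, Matrix.blockDiagonal'_apply_eq]; rfl
    · rw [hD.1 s t h]
      ext a b
      rw [blk_apply, blockDiagonal'_apply_ne _ _ _ h]; rfl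
  choose v hv using h1
  have h3 : D * (blockDiagonal' fun s => (↑(v s)⁻¹ : Mat (κ s) A)) = 1 := by
    rw [h2, ← Matrix.blockDiagonal'_mul]
    simp only [← hv, Units.mul_inv]
    exact Matrix.blockDiagonal'_one
  exact of_mul_eq_one _ h3

/-- A matrix whose blocks only join labels of consecutive heights is nilpotent. -/
lemma pow_eq_zero_of_height {Y : BMat} {ht : J → ℕ} {n : ℕ}
    (hn : ∀ s, ht s < n) (hY : ∀ s t, ht t ≠ ht s + 1 → blk Y s t = 0) : Y ^ n = 0 := by
  have key : ∀ c s t, ht t ≠ ht s + c → blk (Y ^ c) s t = 0 := fun c => by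
    induction c with
    | zero => exact fun s t h => by rw [pow_zero, blk_one_ne fun h' => h (by rw [h', add_zero])]
    | succ c ih =>
      intro s t h
      rw [pow_succ, blk_mul]
      refine sum_eq_zero fun u _ => ?_
      by_cases hu : ht u = ht s + c
      · rw [hY u t (by omega), Matrix.mul_zero]
      · rw [ih s u hu, Matrix.zero_mul]
  exact blk_ext fun s t => key n s t (by have := hn t; lia)

section Unipotent

open Polynomial

variable (A) in
/-- The endomorphism `f ↦ f ((1 + X) ^ q - 1)` of `A[X]`. -/
def powShift (q : ℕ) : A[X] →ₗ[A] A[X] where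
  toFun f := f.comp ((1 + X) ^ q - 1)
  map_add' _ _ := add_comp
  map_smul' c f := by rw [smul_comp, id_apply]

lemma powShift_apply (q : ℕ) (f : A[X]) : powShift A q f = f.comp ((1 + X) ^ q - 1) := rfl

lemma exists_one_add_X_pow (q : ℕ) : ∃ g : A[X], (1 + X) ^ q - 1 = X * g ∧ g.coeff 0 = q := by
  induction q with
  | zero => exact ⟨0, by simp⟩
  | succ q ih =>
    obtain ⟨g, hg, hg0⟩ := ih
    refine ⟨g + X * g + 1, ?_, ?_⟩
    · rw [pow_succ, sub_eq_iff_eq_add.1 hg]; ring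
    · rw [coeff_add, coeff_add, hg0, coeff_X_mul_zero, coeff_one_zero, add_zero, Nat.cast_succ]

lemma X_pow_succ_dvd_powShift {q j : ℕ} {f : A[X]} (hf : X ^ j ∣ f) : X ^ (j + 1) ∣ powShift A q f - C ((q : A) ^ j) * f := by
  obtain ⟨h, rfl⟩ := hf
  obtain ⟨g, hg, hg0⟩ := exists_one_add_X_pow (A := A) q
  have h1 : powShift A q (X ^ j * h) - C ((q : A) ^ j) * (X ^ j * h) =
      X ^ j * (g ^ j * h.comp (X * g) - C ((q : A) ^ j) * h) := by
    rw [powShift_apply, hg, mul_comp, pow_comp, X_comp]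
    ring
  rw [h1, pow_succ]
  refine mul_dvd_mul_left _ (X_dvd_iff.2 ?_)
  rw [coeff_sub, mul_coeff_zero, mul_coeff_zero, comp_coeff_zero (by simp), coeff_C_zero,
    coeff_zero_eq_eval_zero, eval_pow, ← coeff_zero_eq_eval_zero, hg0, sub_self]

lemma powShift_sub_of_isUnit {q : ℕ} {c : A} (hc : IsUnit ((q : A) - c)) {f h : A[X]} (hf : f = X * h) (hh : IsUnit (h.coeff 0)) :
    ∃ h', powShift A q f - C c * f = X * h' ∧ IsUnit (h'.coeff 0) := by
  obtain ⟨g, hg, hg0⟩ := exists_one_add_X_pow (A := A) q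
  refine ⟨g * h.comp (X * g) - C c * h, ?_, ?_⟩
  · rw [hf, powShift_apply, hg, mul_comp, X_comp]
    ring
  · rw [coeff_sub, mul_coeff_zero, mul_coeff_zero, comp_coeff_zero (by simp), coeff_C_zero, hg0, ← sub_mul]
    exact hc.mul hh

lemma aeval_powShift_sub {R : Type*} [Ring R] [Algebra A R] {q : ℕ} {Φ Z : R}
    (h : Φ * (1 + Z) = (1 + Z) ^ q * Φ) (c : A) (f : A[X]) :
    peval Z (powShift A q f - C c * f) * Φ = Φ * peval Z f - c • (peval Z f * Φ) := by
  have h1 : Φ * Z = ((1 + Z) ^ q - 1) * Φ := by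
    rw [mul_add, mul_one] at h
    rw [sub_mul, ← h, one_mul, add_sub_cancel_left]
  have h2 : Φ * peval Z f = peval ((1 + Z) ^ q - 1) f * Φ := by
    induction f using Polynomial.induction_on' with
    | add f g hf hg => rw [map_add, map_add, mul_add, add_mul, hf, hg]
    | monomial k a =>
      rw [aeval_monomial, aeval_monomial, ← mul_assoc, ← Algebra.commutes, mul_assoc, mul_assoc]
      congr 1
      induction k with
      | zero => simp
      | succ k ih => rw [pow_succ, ← mul_assoc, ih, mul_assoc, h1, ← mul_assoc, ← pow_succ]
  rw [map_sub, sub_mul, powShift_apply, aeval_comp, h2, map_mul, Polynomial.aeval_C, smul_def, mul_assoc]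
  simp

/-- A residually unipotent solution of `Φ (1 + Z) = (1 + Z) ^ q Φ` is unipotent of bounded order. -/
lemma pow_eq_zero_of_conj {w : J → A} {Φ Z : BMat} [IsLocalRing A] (hΦ : IsWeighted w Φ) (hw : ∀ s, IsUnit (w s))
    {q : ℕ} (h : Φ * (1 + Z) = (1 + Z) ^ q * Φ) (hZ : IsNilpotent Z)
    {ht : J → ℕ} {n : ℕ} (hn : ∀ s, ht s < n) (hht : ∀ s t, IsUnit (w s - q * w t) ∨ ht t = ht s + 1) : Z ^ n = 0 := by
  classical
  obtain ⟨r, hr⟩ := hZ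
  let T : ℕ → Module.End A A[X] := fun i => powShift A q - amap A _ ((q : A) ^ i)
  have hT : ∀ i f, T i f = powShift A q f - C ((q : A) ^ i) * f := fun i f => by
    change powShift A q f - (q : A) ^ i • f = _
    rw [smul_eq_C_mul]
  let P : Finset ℕ → A[X] := fun S => ∏ i ∈ S, (X - C ((q : A) ^ i))
  have hP : ∀ (S : Finset ℕ) (i : ℕ), i ∉ S → ∀ f, peval (powShift A q) (P (insert i S)) f =
      T i (peval (powShift A q) (P S) f) := fun S i hi f => by
    simp only [P]
    rw [Finset.prod_insert hi, map_mul, map_sub, Polynomial.aeval_X, Polynomial.aeval_C]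
    rfl
  have hall : ∀ c : ℕ, X ^ (c + 1) ∣ peval (powShift A q) (P (Icc 1 c)) (X : A[X]) := fun c => by
    induction c with
    | zero => simp [P]
    | succ c ih =>
      rw [← Finset.insert_Icc_right_eq_Icc_add_one (by omega), hP _ _ (by simp), hT]
      exact X_pow_succ_dvd_powShift ih
  let good := (Icc 1 r).filter fun i => IsUnit ((q : A) - (q : A) ^ i)
  let bad := (Icc 1 r).filter fun i => ¬ IsUnit ((q : A) - (q : A) ^ i)
  have hgood : ∀ S : Finset ℕ, (∀ i ∈ S, IsUnit ((q : A) - (q : A) ^ i)) →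
      ∃ f, peval (powShift A q) (P S) (X : A[X]) = X * f ∧ IsUnit (f.coeff 0) := by
    intro S
    induction S using induction_on with
    | empty => intro _; exact ⟨1, by simp [P], by simp⟩
    | insert i S hi ih =>
      intro hS
      obtain ⟨f, hf, hf0⟩ := ih fun j hj => hS j (Finset.mem_insert_of_mem hj)
      obtain ⟨f', hf', hf'0⟩ := powShift_sub_of_isUnit (hS i (Finset.mem_insert_self _ _)) hf hf0
      exact ⟨f', by rw [hP _ _ hi, hT, hf'], hf'0⟩
  obtain ⟨f, hf, hf0⟩ := hgood good fun i hi => (mem_filter.1 hi).2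
  have hprod : P (Icc 1 r) = P bad * P good := by
    simp only [P, good, bad]
    rw [mul_comm, Finset.prod_filter_mul_prod_filter_not]
  have hfin : peval Z (peval (powShift A q) (P bad) (X * f)) = 0 := by
    refine aeval_eq_zero_of_X_pow_dvd ((pow_dvd_pow X (le_succ r)).trans ?_) hr
    rw [← hf, ← Module.End.mul_apply, ← map_mul, ← hprod]
    exact hall r
  have hpeel : ∀ (s t : J), IsUnit (w s - q * w t) → ∀ S : Finset ℕ, (∀ i ∈ S, ¬ IsUnit ((q : A) - (q : A) ^ i)) → ∀ f : A[X],
      blk (peval Z (peval (powShift A q) (P S) f)) s t = 0 → blk (peval Z f) s t = 0 := by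
    intro s t hst S
    induction S using induction_on with
    | empty => intro _ f hf; simpa [P] using hf
    | insert i S hi ih =>
      intro hS f hf
      apply ih fun j hj => hS j (Finset.mem_insert_of_mem hj)
      rw [hP _ _ hi, hT] at hf
      have h1 := congrArg (fun Y => blk Y s t) (aeval_powShift_sub h ((q : A) ^ i) (peval (powShift A q) (P S) f))
      simp only [blk_sub, blk_smul] at h1
      rw [hΦ.1.blk_mul_right, hf, Matrix.zero_mul, eq_comm, sub_eq_zero] at h1
      refine blk_eq_zero_of_commute hΦ hΦ ?_ h1
      have h2 := hS i (Finset.mem_insert_self _ _)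
      by_contra hcon
      rw [← mem_nonunits_iff, ← mem_maximalIdeal] at h2 hcon
      rw [show w s - q * w t = (w s - q ^ i * w t) - (q - q ^ i) * w t by ring] at hst
      exact (maxId A).sub_mem hcon (mul_mem_right (w t) _ h2) hst
  have hN : (peval Z (X * f)) ^ n = 0 := by
    refine pow_eq_zero_of_height hn fun s t hst => ?_
    refine hpeel s t ((hht s t).resolve_right hst) bad (fun i hi => (mem_filter.1 hi).2) _ ?_
    rw [hfin, blk_zero]
  have hfu : IsUnit (peval Z f) := by
    obtain ⟨g, hg⟩ := X_dvd_iff.2 (show (f - C (f.coeff 0)).coeff 0 = 0 by simp)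
    rw [show peval Z f = peval Z (X * g) + amap A _ (f.coeff 0) by
      rw [← hg, map_sub, Polynomial.aeval_C, sub_add_cancel]]
    refine isUnit_add_right_of_commute ⟨r, ?_⟩ (hf0.map _) (Algebra.commute_algebraMap_right _ _)
    exact aeval_pow_eq_zero (dvd_mul_right X g) hr
  rw [map_mul, Polynomial.aeval_X, Commute.mul_pow] at hN
  · exact (hfu.pow n).mul_left_eq_zero.1 hN
  · exact (Algebra.commute_of_mem_adjoin_self (aeval_mem_adjoin_singleton A Z))

end Unipotent

end Blocks

section Decomposition

variable {A : Type*} [CommRing A] {J : Type*} {κ : J → Type*} [Fintype J] [∀ s, Fintype (κ s)]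
  [DecidableEq J] [∀ s, DecidableEq (κ s)]

local notation "BMat" => Mat (Σ s, κ s) A

lemma matrix_mul_mem_right {ι κ τ : Type*} [Fintype κ] {I : Ideal A} {M : Matrix ι κ A}
    {N : Matrix κ τ A} (hM : ∀ i j, M i j ∈ I) (i : ι) (j : τ) : (M * N) i j ∈ I := by
  rw [Matrix.mul_apply]
  exact sum_mem fun k _ => mul_mem_right _ _ (hM i k)

lemma matrix_mul_mem_left {ι κ τ : Type*} [Fintype κ] {I : Ideal A} {M : Matrix ι κ A}
    {N : Matrix κ τ A} (hN : ∀ i j, N i j ∈ I) (i : ι) (j : τ) : (M * N) i j ∈ I := by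
  rw [Matrix.mul_apply]
  exact sum_mem fun k _ => mul_mem_left _ _ (hN k j)

lemma IsWeighted.of_sub_mem {w : J → A} {D D' : BMat}
    (hD : IsWeighted w D) {I : Ideal A} (hI : IsNilpotent I) (hD' : IsBlockDiag D')
    (h : ∀ i j, (D' - D) i j ∈ I) : IsWeighted w D' := by
  refine ⟨hD', fun s => ?_⟩
  refine isNilpotent_matrix_of_map (modId I) (by rwa [mk_ker]) ?_
  have h1 : (blk D' s s - w s • (1 : Mat (κ s) A)).map (modId I) = (modId I).mapMatrix (blk D s s - w s • (1 : Mat (κ s) A)) := by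
    ext a b
    rw [mapMatrix_apply, map_apply, map_apply, Ideal.Quotient.eq]
    simpa [blk_apply] using h ⟨s, a⟩ ⟨s, b⟩
  rw [h1]
  exact (hD.2 s).map _

lemma isUnit_one_add_of_mem {ι : Type*} [Fintype ι] [DecidableEq ι] {I : Ideal A}
    (hI : IsNilpotent I) {t : Mat ι A} (ht : ∀ i j, t i j ∈ I) : IsUnit (1 + t) :=
  (isNilpotent_matrix_of_mem hI ht).isUnit_one_add

lemma decomp_unique {w : J → A} (hw : ∀ s t, s ≠ t → IsUnit (w s - w t))
    {Φ D D' g g' : BMat} (hD : IsWeighted w D) (hD' : IsWeighted w D')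
    (hg : IsUnit g) (hg' : IsUnit g') (hgs : ∀ s, blk g s s = 1) (hgs' : ∀ s, blk g' s s = 1)
    (h : Φ * g = g * D) (h' : Φ * g' = g' * D') : g = g' ∧ D = D' := by
  obtain ⟨v, rfl⟩ := hg
  obtain ⟨v', rfl⟩ := hg'
  set x : BMat := (↑v'⁻¹ : BMat) * v with hx
  have h1 : D' * x = x * D := by
    have h2 : D' = (↑v'⁻¹ : BMat) * Φ * v' := by
      rw [mul_assoc, h', Units.inv_mul_cancel_left]
    rw [h2, hx, mul_assoc, Units.mul_inv_cancel_left, mul_assoc, h, mul_assoc]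
  have h2 : IsBlockDiag x := by
    intro s t hst
    refine blk_eq_zero_of_commute hD' hD (c := 1) (by rw [one_mul]; exact hw s t hst) ?_
    rw [one_smul, h1]
  have h3 : (v : BMat) = v' * x := by
    rw [hx, Units.mul_inv_cancel_left]
  have h4 : x = 1 := by
    apply blk_ext
    intro s t
    by_cases hst : s = t
    · subst hst
      have := congrArg (fun Y => blk Y s s) h3
      simp only [h2.blk_mul_right, hgs, hgs', one_mul] at this
      rw [← this, blk_one_self]
    · rw [h2 s t hst, blk_one_ne hst]
  rw [h4, mul_one] at h3
  rw [h4, mul_one, one_mul] at h1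
  exact ⟨h3, h1.symm⟩

/-- Over a finite local ring, a matrix residually equal to a weighted one is conjugate to a
weighted one. -/
lemma exists_decomp [IsLocalRing A] [Finite A] (hm : IsNilpotent (maxId A)) {w : J → A}
    (hw : ∀ s t, s ≠ t → IsUnit (w s - w t)) {Φ D₀ : BMat} (hD₀ : IsWeighted w D₀) (hΦ : ∀ i j, (Φ - D₀) i j ∈ maxId A) :
    ∃ t D : BMat, (∀ i j, t i j ∈ maxId A) ∧ (∀ s, blk t s s = 0) ∧ IsBlockDiag D ∧ (∀ i j, (D - D₀) i j ∈ maxId A) ∧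
      Φ * (1 + t) = (1 + t) * D := by
  let off : Mat (Σ s, κ s) (maxId A) → BMat :=
    fun M => Matrix.of fun i j => if i.1 = j.1 then 0 else (M i j : A)
  let dg : Mat (Σ s, κ s) (maxId A) → BMat :=
    fun M => Matrix.of fun i j => if i.1 = j.1 then (M i j : A) else 0
  have hoff : ∀ M i j, off M i j ∈ maxId A := fun M i j => by
    change (if i.1 = j.1 then 0 else (M i j : A)) ∈ _
    split_ifs
    · exact zero_mem _
    · exact (M i j).2
  have hdg : ∀ M i j, dg M i j ∈ maxId A := fun M i j => by
    change (if i.1 = j.1 then (M i j : A) else 0) ∈ _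
    split_ifs
    · exact (M i j).2
    · exact zero_mem _
  have hoffs : ∀ M s, blk (off M) s s = 0 := fun M s => by
    ext a b
    exact if_pos rfl
  have hdgd : ∀ M, IsBlockDiag (D₀ + dg M) := fun M s t hst => by
    rw [blk_add, hD₀.1 s t hst, zero_add]
    ext a b
    exact if_neg hst
  have hdgw : ∀ M, IsWeighted w (D₀ + dg M) := fun M =>
    hD₀.of_sub_mem hm (hdgd M) fun i j => by rw [add_sub_cancel_left]; exact hdg M i j
  have hu : ∀ M, IsUnit (1 + off M) := fun M => isUnit_one_add_of_mem hm (hoff M)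
  choose v hv using hu
  have hval : ∀ M i j, ((v M : BMat) * (D₀ + dg M) * (↑(v M)⁻¹ : BMat) - D₀) i j ∈ maxId A := by
    intro M
    have h1 : (v M : BMat) * (D₀ + dg M) * (↑(v M)⁻¹ : BMat) - D₀ = (off M * D₀ - D₀ * off M + (1 + off M) * dg M) *
        (↑(v M)⁻¹ : BMat) := by
      have h2 : off M * D₀ - D₀ * off M + (1 + off M) * dg M = (v M : BMat) * (D₀ + dg M) - D₀ * v M := by
        rw [hv]; noncomm_ring
      rw [h2, sub_mul, mul_assoc D₀, Units.mul_inv, mul_one]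
    rw [h1]
    refine matrix_mul_mem_right fun i j => ?_
    rw [Matrix.add_apply, Matrix.sub_apply]
    exact add_mem (sub_mem (matrix_mul_mem_right (hoff M) i j) (matrix_mul_mem_left (hoff M) i j))
      (matrix_mul_mem_left (hdg M) i j)
  let f : Mat (Σ s, κ s) (maxId A) →
      Mat (Σ s, κ s) (maxId A) := fun M => Matrix.of fun i j => ⟨_, hval M i j⟩
  have hgs : ∀ M s, blk (v M : BMat) s s = 1 := fun M s => by
    rw [hv, blk_add, hoffs, add_zero, blk_one_self]
  have hf : Injective f := by
    intro M M' hMM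
    have h1 : (v M : BMat) * (D₀ + dg M) * (↑(v M)⁻¹ : BMat) = v M' * (D₀ + dg M') * (↑(v M')⁻¹ : BMat) := by
      apply sub_left_injective (b := D₀)
      ext i j
      exact congrArg Subtype.val (congrFun (congrFun hMM i) j)
    obtain ⟨h2, h3⟩ := decomp_unique hw (hdgw M) (hdgw M') (v M).isUnit (v M').isUnit (hgs M)
      (hgs M') (Φ := (v M : BMat) * (D₀ + dg M) * (↑(v M)⁻¹ : BMat))
      (by rw [mul_assoc, inv_mul, mul_one]) (by rw [h1, mul_assoc, inv_mul, mul_one])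
    rw [hv, hv] at h2
    have h4 : off M = off M' := add_left_cancel h2
    have h5 : dg M = dg M' := add_left_cancel h3
    ext i j
    by_cases hij : i.1 = j.1
    · have := congrFun (congrFun h5 i) j
      change (if i.1 = j.1 then (M i j : A) else 0) = if i.1 = j.1 then (M' i j : A) else 0 at this
      rwa [if_pos hij, if_pos hij] at this
    · have := congrFun (congrFun h4 i) j
      change (if i.1 = j.1 then 0 else (M i j : A)) = if i.1 = j.1 then 0 else (M' i j : A) at this
      rwa [if_neg hij, if_neg hij] at this
  have : Finite (Mat (Σ s, κ s) (maxId A)) := inferInstanceAs (Finite ((Σ s, κ s) → (Σ s, κ s) → maxId A))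
  obtain ⟨M, hM⟩ := (Finite.injective_iff_surjective.1 hf) (Matrix.of fun i j => ⟨_, hΦ i j⟩)
  refine ⟨off M, D₀ + dg M, hoff M, hoffs M, hdgd M, fun i j => ?_, ?_⟩
  · rw [add_sub_cancel_left]; exact hdg M i j
  · have h1 : (v M : BMat) * (D₀ + dg M) * (↑(v M)⁻¹ : BMat) = Φ := by
      apply sub_left_injective (b := D₀)
      ext i j
      exact congrArg Subtype.val (congrFun (congrFun hM i) j)
    rw [← hv, ← h1, mul_assoc, inv_mul, mul_one]

/-- The logarithm of a unipotent solution of `Φ τ = τ ^ q Φ`. -/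
lemma mul_truncLog_eq {R : Type*} [Ring R] [Algebra A R] {n : ℕ} (hn : IsUnit (n.factorial : A))
    {q : ℕ} {Φ Z : R} (hΦ : IsUnit Φ) (h : Φ * (1 + Z) = (1 + Z) ^ q * Φ) (hZ : Z ^ n = 0) :
    Φ * truncLog A n Z = (q : A) • (truncLog A n Z * Φ) := by
  obtain ⟨v, rfl⟩ := hΦ
  have hZ' : Z ^ (n + 1) = 0 := by rw [pow_succ, hZ, zero_mul]
  have hL : truncLog A n Z ^ (n + 1) = 0 := truncLog_pow hZ'
  let c : R →ₐ[A] R := (ofLinearMap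
    { toFun := fun x => v * x * (↑v⁻¹ : R)
      map_add' := fun x y => by rw [mul_add, add_mul]
      map_smul' := fun a x => by simp } (by simp) (fun x y => by simp [mul_assoc]))
  have hc : ∀ x, c x = v * x * (↑v⁻¹ : R) := fun x => rfl
  have h1 : c Z = truncExp A n ((q : A) • truncLog A n Z) - 1 := by
    have h0 : c Z + 1 = c (1 + Z) := by rw [map_add, map_one, add_comm]
    rw [truncExp_natCast_smul hn hL, truncExp_truncLog hn hZ', eq_sub_iff_add_eq, h0, hc, h, mul_assoc, Units.mul_inv, mul_one]
  have h2 : c (truncLog A n Z) = (q : A) • truncLog A n Z := by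
    rw [map_truncLog, h1, truncLog_truncExp hn (by rw [smul_pow, hL, smul_zero])]
  rw [← smul_mul_assoc, ← h2, hc, mul_assoc, inv_mul, mul_one]

lemma mul_truncExp_eq {R : Type*} [Ring R] [Algebra A R] {n : ℕ} (hn : IsUnit (n.factorial : A))
    {q : ℕ} {Φ N : R} (hΦ : IsUnit Φ) (h : Φ * N = (q : A) • (N * Φ)) (hN : N ^ (n + 1) = 0) :
    Φ * truncExp A n N = truncExp A n N ^ q * Φ := by
  obtain ⟨v, rfl⟩ := hΦ
  let c : R →ₐ[A] R := (ofLinearMap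
    { toFun := fun x => v * x * (↑v⁻¹ : R)
      map_add' := fun x y => by rw [mul_add, add_mul]
      map_smul' := fun a x => by simp } (by simp) (fun x y => by simp [mul_assoc]))
  have hc : ∀ x, c x = v * x * (↑v⁻¹ : R) := fun x => rfl
  have h2 : c N = (q : A) • N := by
    rw [hc, h, smul_mul_assoc, mul_assoc, Units.mul_inv, mul_one]
  rw [← truncExp_natCast_smul hn hN, ← h2, ← map_truncExp, hc, mul_assoc _ _ (v : R), inv_mul, mul_one]

end Decomposition

namespace FrobeniusBlocks

variable {F : Type*} [Field F] {q n : ℕ} {Φ : Mat (Fin n) F} (B : FrobeniusBlocks q Φ)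

/-- The labels of the blocks. -/
abbrev Lab : Type := Σ α : Fin B.d, Fin (B.k α)

/-- The index set of the rows and columns in the adapted basis. -/
abbrev Ix : Type := Σ s : B.Lab, Fin (B.ν s.1 s.2)

/-- The positions outside the diagonal blocks. -/
abbrev OffVar : Type := {e : B.Ix × B.Ix // e.1.1 ≠ e.2.1}

/-- The coordinates of the model together with those of the change of basis. -/
abbrev AllVar : Type := ProdVar B.k B.ν ⊕ B.OffVar

/-- The eigenvalue attached to a block. -/
def weight (s : B.Lab) : F := B.lam s.1 * (q : F) ^ (B.k s.1 - 1 - (s.2 : ℕ))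

/-- The label `t` follows the label `s`. -/
def Next (s t : B.Lab) : Prop := s.1 = t.1 ∧ (t.2 : ℕ) = s.2 + 1

lemma card_ix : card B.Ix = n := by
  have h := Matrix.square_of_invertible B.T B.Tinv B.T_mul_Tinv B.Tinv_mul_T
  rw [card_fin] at h
  exact h.symm

lemma k_le (α : Fin B.d) : B.k α ≤ n := by
  let f : Fin (B.k α) → B.Ix := fun i => ⟨⟨α, i⟩, ⟨0, B.ν_pos α i i.2⟩⟩
  have hf : Injective f := fun i j h => by
    have := congrArg fst h
    simpa [f] using this
  have := Fintype.card_le_of_injective f hf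
  rwa [card_fin, B.card_ix] at this

lemma pow_injective (hq0 : (q : F) ≠ 0) (hq : ∀ i, 1 ≤ i → i ≤ n → (q : F) ^ i ≠ 1)
    {a b : ℕ} (ha : a ≤ b + n) (hb : b ≤ a + n) (h : (q : F) ^ a = (q : F) ^ b) : a = b := by
  wlog hab : a ≤ b generalizing a b
  · exact (this hb ha h.symm (le_of_not_ge hab)).symm
  obtain ⟨c, rfl⟩ := exists_eq_add_of_le hab
  rw [pow_add, eq_comm, mul_eq_left₀ (pow_ne_zero _ hq0)] at h
  by_contra hc
  exact hq c (by omega) (by omega) h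

lemma eq_of_weight_eq (hq0 : (q : F) ≠ 0) (hq : ∀ i, 1 ≤ i → i ≤ n → (q : F) ^ i ≠ 1)
    {α β : Fin B.d} {a b : ℕ} (ha : a ≤ B.k α) (hb : b ≤ B.k β)
    (h : B.lam α * (q : F) ^ a = B.lam β * (q : F) ^ b) : α = β ∧ a = b := by
  have h1 : α = β := by
    by_contra hne
    rcases le_total a b with hab | hab
    · obtain ⟨c, rfl⟩ := exists_eq_add_of_le hab
      rw [pow_add, mul_comm ((q : F) ^ a), ← mul_assoc] at h
      exact B.lam_separated α β hne c (by omega) (mul_right_cancel₀ (pow_ne_zero _ hq0) h)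
    · obtain ⟨c, rfl⟩ := exists_eq_add_of_le hab
      rw [pow_add, mul_comm ((q : F) ^ b), ← mul_assoc] at h
      exact B.lam_separated β α (Ne.symm hne) c (by omega) (mul_right_cancel₀ (pow_ne_zero _ hq0) h.symm)
  subst h1
  have := B.k_le α
  exact ⟨rfl, pow_injective hq0 hq (by omega) (by omega) (mul_left_cancel₀ (B.lam_ne_zero α) h)⟩

lemma weight_injective (hq0 : (q : F) ≠ 0) (hq : ∀ i, 1 ≤ i → i ≤ n → (q : F) ^ i ≠ 1) : Injective B.weight := by
  rintro ⟨α, i⟩ ⟨β, j⟩ h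
  obtain ⟨h1, h2⟩ := B.eq_of_weight_eq hq0 hq (by omega) (by omega) h
  subst h1
  have hi := i.2
  have hj := j.2
  have : i = j := Fin.ext (by dsimp only at h2 hj; omega)
  rw [this]

lemma next_of_weight_eq (hq0 : (q : F) ≠ 0) (hq : ∀ i, 1 ≤ i → i ≤ n → (q : F) ^ i ≠ 1)
    {s t : B.Lab} (h : B.weight s = q * B.weight t) : B.Next s t := by
  obtain ⟨α, i⟩ := s
  obtain ⟨β, j⟩ := t
  have hi := i.2
  have hj := j.2
  have h' : B.lam α * (q : F) ^ (B.k α - 1 - i) = B.lam β * (q : F) ^ (B.k β - 1 - j + 1) := by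
    rw [pow_succ, ← mul_assoc, mul_comm]
    rw [mul_comm (q : F)] at h
    rw [mul_comm _ (B.lam α)]
    exact h
  obtain ⟨h1, h2⟩ := B.eq_of_weight_eq hq0 hq (by omega) (by omega) h'
  subst h1
  exact ⟨rfl, by dsimp only; omega⟩

lemma weight_ne_zero (hq0 : (q : F) ≠ 0) (s : B.Lab) : B.weight s ≠ 0 := mul_ne_zero (B.lam_ne_zero _) (pow_ne_zero _ hq0)

/-- The coordinates `X_i`. -/
abbrev XVar : Type := Σ α : Fin B.d, Σ i : Fin (B.k α), Fin (B.ν α i) × Fin (B.ν α i)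

/-- The coordinates `N_i`. -/
abbrev NVar : Type := Σ α : Fin B.d, Σ i : {i : ℕ // i + 1 < B.k α}, Fin (B.ν α i) × Fin (B.ν α (i + 1))

/-- The position of a coordinate of `X_i`. -/
def posX (v : B.XVar) : B.Ix × B.Ix := (⟨⟨v.1, v.2.1⟩, v.2.2.1⟩, ⟨⟨v.1, v.2.1⟩, v.2.2.2⟩)

/-- The position of a coordinate of `N_i`. -/
def posN (v : B.NVar) : B.Ix × B.Ix :=
  (⟨⟨v.1, ⟨v.2.1, Nat.lt_of_succ_lt v.2.1.2⟩⟩, v.2.2.1⟩, ⟨⟨v.1, ⟨v.2.1 + 1, v.2.1.2⟩⟩, v.2.2.2⟩)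

lemma posX_injective : Injective B.posX := by
  rintro ⟨α, i, a, b⟩ ⟨β, j, c, d⟩ h
  change ((⟨⟨α, i⟩, a⟩ : B.Ix), (⟨⟨α, i⟩, b⟩ : B.Ix)) = (⟨⟨β, j⟩, c⟩, ⟨⟨β, j⟩, d⟩) at h
  cases h
  rfl

lemma posN_injective : Injective B.posN := by
  rintro ⟨α, ⟨i, hi⟩, a, b⟩ ⟨β, ⟨j, hj⟩, c, d⟩ h
  change ((⟨⟨α, ⟨i, _⟩⟩, a⟩ : B.Ix), (⟨⟨α, ⟨i + 1, _⟩⟩, b⟩ : B.Ix)) = (⟨⟨β, ⟨j, _⟩⟩, c⟩, ⟨⟨β, ⟨j + 1, _⟩⟩, d⟩) at h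
  cases h
  rfl

lemma exists_posX {p p' : B.Ix} (h : p.1 = p'.1) : ∃ v, (B.posX v).1 = p ∧ (B.posX v).2 = p' := by
  obtain ⟨⟨α, i⟩, a⟩ := p
  obtain ⟨s, b⟩ := p'
  cases h
  exact ⟨⟨α, i, a, b⟩, rfl, rfl⟩

lemma exists_posN {p p' : B.Ix} (h : B.Next p.1 p'.1) : ∃ v, (B.posN v).1 = p ∧ (B.posN v).2 = p' := by
  obtain ⟨⟨α, ⟨i, hi⟩⟩, a⟩ := p
  obtain ⟨⟨β, ⟨j, hj⟩⟩, b⟩ := p'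
  obtain ⟨h1, h2⟩ := h
  dsimp only at h1 h2
  subst h1
  subst h2
  exact ⟨⟨α, ⟨i, hj⟩, a, b⟩, rfl, rfl⟩

lemma next_posN (v : B.NVar) : B.Next (B.posN v).1.1 (B.posN v).2.1 := ⟨rfl, rfl⟩

section Mats

variable {S : Type*} [CommRing S] (y : B.AllVar → S)

/-- The block diagonal matrix with blocks `X_i`. -/
def xmat : Mat B.Ix S := Matrix.of fun p p' =>
  extend B.posX (fun v => y (inl ⟨v.1, inl v.2⟩)) 0 (p, p')

/-- The matrix with blocks `N_i` above the diagonal. -/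
def nmat : Mat B.Ix S := Matrix.of fun p p' =>
  extend B.posN (fun v => y (inl ⟨v.1, inr v.2⟩)) 0 (p, p')

notation "Chain(" B ", " y ")" =>
  FrobeniusBlocks.xmat B y * FrobeniusBlocks.nmat B y = FrobeniusBlocks.nmat B y * FrobeniusBlocks.xmat B y

/-- The matrix of coordinates outside the diagonal blocks. -/
def tmat : Mat B.Ix S := Matrix.of fun p p' =>
  extend (Subtype.val : B.OffVar → B.Ix × B.Ix) (fun v => y (inr v)) 0 (p, p')

lemma xmat_posX (v : B.XVar) : B.xmat y (B.posX v).1 (B.posX v).2 = y (inl ⟨v.1, inl v.2⟩) :=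
  B.posX_injective.extend_apply (fun v => y (inl ⟨v.1, inl v.2⟩)) 0 v

lemma nmat_posN (v : B.NVar) : B.nmat y (B.posN v).1 (B.posN v).2 = y (inl ⟨v.1, inr v.2⟩) :=
  B.posN_injective.extend_apply (fun v => y (inl ⟨v.1, inr v.2⟩)) 0 v

lemma tmat_val (v : B.OffVar) : B.tmat y v.1.1 v.1.2 = y (inr v) := val_injective.extend_apply (fun v : B.OffVar => y (inr v)) 0 v

lemma xmat_eq_zero {p p' : B.Ix} (h : p.1 ≠ p'.1) : B.xmat y p p' = 0 := by
  refine extend_apply' (f := B.posX) (fun v => y (inl ⟨v.1, inl v.2⟩)) 0 (p, p') ?_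
  rintro ⟨v, hv⟩
  obtain ⟨rfl, rfl⟩ : (B.posX v).1 = p ∧ (B.posX v).2 = p' := Prod.ext_iff.1 hv
  exact h rfl

lemma nmat_eq_zero {p p' : B.Ix} (h : ¬ B.Next p.1 p'.1) : B.nmat y p p' = 0 := by
  refine extend_apply' (f := B.posN) (fun v => y (inl ⟨v.1, inr v.2⟩)) 0 (p, p') ?_
  rintro ⟨v, hv⟩
  obtain ⟨rfl, rfl⟩ : (B.posN v).1 = p ∧ (B.posN v).2 = p' := Prod.ext_iff.1 hv
  exact h (B.next_posN v)

lemma tmat_eq_zero {p p' : B.Ix} (h : p.1 = p'.1) : B.tmat y p p' = 0 := by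
  refine extend_apply' (f := (Subtype.val : B.OffVar → B.Ix × B.Ix)) (fun v => y (inr v)) 0 (p, p') ?_
  rintro ⟨v, hv⟩
  rw [Prod.ext_iff] at hv
  exact v.2 (by rw [hv.1, hv.2]; exact h)

lemma isBlockDiag_xmat : IsBlockDiag (B.xmat y) := fun _ _ h => by
  ext a b
  exact B.xmat_eq_zero y h

lemma blk_nmat_eq_zero {s t : B.Lab} (h : ¬ B.Next s t) : blk (B.nmat y) s t = 0 := by
  ext a b
  exact B.nmat_eq_zero y h

lemma blk_tmat_self (s : B.Lab) : blk (B.tmat y) s s = 0 := by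
  ext a b
  exact B.tmat_eq_zero y rfl

lemma blk_xmat_self (α : Fin B.d) (i : Fin (B.k α)) : blk (B.xmat y) ⟨α, i⟩ ⟨α, i⟩ = matX (fun v => y (inl ⟨α, v⟩)) i := by
  ext a b
  rw [matX, of_apply, dif_pos i.2]
  exact B.xmat_posX y ⟨α, i, a, b⟩

lemma blk_nmat_next (α : Fin B.d) (i : ℕ) (hi : i + 1 < B.k α) : blk (B.nmat y) ⟨α, ⟨i, Nat.lt_of_succ_lt hi⟩⟩ ⟨α, ⟨i + 1, hi⟩⟩ =
      matN (fun v => y (inl ⟨α, v⟩)) i := by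
  ext a b
  rw [matN, of_apply, dif_pos hi]
  exact B.nmat_posN y ⟨α, ⟨i, hi⟩, a, b⟩

lemma xmat_map {S' : Type*} [CommRing S'] (f : S →+* S') : (B.xmat y).map f = B.xmat (f ∘ y) := by
  ext p p'
  by_cases h : p.1 = p'.1
  · obtain ⟨v, hv⟩ := B.exists_posX h
    rw [map_apply, ← hv.1, ← hv.2, xmat_posX, xmat_posX, Function.comp_apply]
  · rw [map_apply, B.xmat_eq_zero y h, B.xmat_eq_zero _ h, map_zero]

lemma nmat_map {S' : Type*} [CommRing S'] (f : S →+* S') : (B.nmat y).map f = B.nmat (f ∘ y) := by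
  ext p p'
  by_cases h : B.Next p.1 p'.1
  · obtain ⟨v, hv⟩ := B.exists_posN h
    rw [map_apply, ← hv.1, ← hv.2, nmat_posN, nmat_posN, Function.comp_apply]
  · rw [map_apply, B.nmat_eq_zero y h, B.nmat_eq_zero _ h, map_zero]

lemma tmat_map {S' : Type*} [CommRing S'] (f : S →+* S') : (B.tmat y).map f = B.tmat (f ∘ y) := by
  ext p p'
  by_cases h : p.1 = p'.1
  · rw [map_apply, B.tmat_eq_zero y h, B.tmat_eq_zero _ h, map_zero]
  · exact (congrArg f (B.tmat_val y ⟨(p, p'), h⟩)).trans (B.tmat_val (f ∘ y) ⟨(p, p'), h⟩).symm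

lemma exists_point {X N t : Mat B.Ix S} (hX : IsBlockDiag X)
    (hN : ∀ s s', ¬ B.Next s s' → blk N s s' = 0) (ht : ∀ s, blk t s s = 0) :
    ∃ y : B.AllVar → S, B.xmat y = X ∧ B.nmat y = N ∧ B.tmat y = t := by
  let y : B.AllVar → S := elim (fun v => v.2.elim
    (fun e => X (B.posX ⟨v.1, e⟩).1 (B.posX ⟨v.1, e⟩).2)
    (fun e => N (B.posN ⟨v.1, e⟩).1 (B.posN ⟨v.1, e⟩).2)) (fun e => t e.1.1 e.1.2)
  refine ⟨y, ?_, ?_, ?_⟩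
  · ext p p'
    by_cases h : p.1 = p'.1
    · obtain ⟨v, hv⟩ := B.exists_posX h
      rw [← hv.1, ← hv.2, xmat_posX]
      rfl
    · rw [B.xmat_eq_zero y h]
      exact (congrFun (congrFun (hX _ _ h) p.2) p'.2).symm
  · ext p p'
    by_cases h : B.Next p.1 p'.1
    · obtain ⟨v, hv⟩ := B.exists_posN h
      rw [← hv.1, ← hv.2, nmat_posN]
      rfl
    · rw [B.nmat_eq_zero y h]
      exact (congrFun (congrFun (hN _ _ h) p.2) p'.2).symm
  · ext p p'
    by_cases h : p.1 = p'.1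
    · rw [B.tmat_eq_zero y h]
      obtain ⟨s, a⟩ := p
      obtain ⟨s', b⟩ := p'
      cases h
      exact (congrFun (congrFun (ht s) a) b).symm
    · exact B.tmat_val y ⟨(p, p'), h⟩

variable {y} in
lemma point_ext {y' : B.AllVar → S} (hX : B.xmat y = B.xmat y') (hN : B.nmat y = B.nmat y')
    (ht : B.tmat y = B.tmat y') : y = y' := by
  ext v
  rcases v with ⟨α, e | e⟩ | e
  · rw [← B.xmat_posX y ⟨α, e⟩, hX, B.xmat_posX]
  · rw [← B.nmat_posN y ⟨α, e⟩, hN, B.nmat_posN]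
  · rw [← B.tmat_val y e, ht, B.tmat_val]

lemma commute_iff_isChainPoint : Chain(B, y) ↔ ∀ α, IsChainPoint (fun v => y (inl ⟨α, v⟩)) := by
  have h1 : ∀ s t, blk (B.xmat y * B.nmat y) s t = blk (B.xmat y) s s * blk (B.nmat y) s t :=
    fun s t => (B.isBlockDiag_xmat y).blk_mul_left _ s t
  have h2 : ∀ s t, blk (B.nmat y * B.xmat y) s t = blk (B.nmat y) s t * blk (B.xmat y) t t :=
    fun s t => (B.isBlockDiag_xmat y).blk_mul_right _ s t
  constructor
  · intro h α i hi
    have h3 := congrArg (fun Y => blk Y ⟨α, ⟨i, Nat.lt_of_succ_lt hi⟩⟩ ⟨α, ⟨i + 1, hi⟩⟩) h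
    simp only [h1, h2, blk_nmat_next, blk_xmat_self] at h3
    exact h3
  · intro h
    apply blk_ext
    intro s t
    rw [h1, h2]
    by_cases hst : B.Next s t
    · obtain ⟨α, ⟨i, hi⟩⟩ := s
      obtain ⟨β, ⟨j, hj⟩⟩ := t
      obtain ⟨e1, e2⟩ := hst
      dsimp only at e1 e2
      subst e1
      subst e2
      rw [blk_nmat_next, blk_xmat_self, blk_xmat_self]
      exact h α i hj
    · rw [B.blk_nmat_eq_zero y hst, Matrix.mul_zero, Matrix.zero_mul]

lemma nmat_pow : B.nmat y ^ n = 0 := pow_eq_zero_of_height (ht := fun s => (s.2 : ℕ)) (fun s => s.2.2.trans_le (B.k_le _))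
    fun _ _ h => B.blk_nmat_eq_zero y fun h' => h h'.2

end Mats

lemma card_offVar : card B.OffVar = B.numVars := by
  classical
  have h1 : card (B.Ix × B.Ix) = card B.XVar + card B.OffVar := by
    rw [← Fintype.card_sum]
    refine Fintype.card_congr (Equiv.ofBijective (elim B.posX Subtype.val) ⟨?_, ?_⟩).symm
    · refine sumElim B.posX_injective val_injective fun v w h => ?_
      exact w.2 (by rw [← h]; rfl)
    · rintro ⟨p, p'⟩
      by_cases h : p.1 = p'.1
      · obtain ⟨v, hv⟩ := B.exists_posX h
        exact ⟨inl v, Prod.ext hv.1 hv.2⟩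
      · exact ⟨inr ⟨(p, p'), h⟩, rfl⟩
  have h2 : card B.XVar = ∑ α, ∑ i ∈ range (B.k α), B.ν α i ^ 2 := by
    simp only [Fintype.card_sigma, Fintype.card_prod, card_fin, Finset.sum_range, sq]
  rw [Fintype.card_prod, B.card_ix, h2] at h1
  rw [numVars, sq]
  omega

end FrobeniusBlocks

lemma conj_mul_conj {ι κ R : Type*} [Fintype ι] [Fintype κ] [DecidableEq ι] [CommRing R]
    {T : Matrix ι κ R} {T' : Matrix κ ι R} (h : T * T' = 1) (Y Y' : Mat ι R) :
    T' * Y * T * (T' * Y' * T) = T' * (Y * Y') * T := by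
  simp only [Matrix.mul_assoc]
  rw [← Matrix.mul_assoc T, h, Matrix.one_mul]

lemma conj_pow_conj {ι κ R : Type*} [Fintype ι] [Fintype κ] [DecidableEq ι] [DecidableEq κ]
    [CommRing R] {T : Matrix ι κ R} {T' : Matrix κ ι R} (h : T * T' = 1) (h' : T' * T = 1)
    (Y : Mat ι R) (c : ℕ) : (T' * Y * T) ^ c = T' * Y ^ c * T := by
  induction c with
  | zero => rw [pow_zero, pow_zero, Matrix.mul_one, h']
  | succ c ih => rw [pow_succ, ih, pow_succ, conj_mul_conj h]

lemma map_inv_eq_one {ι R S : Type*} [Fintype ι] [DecidableEq ι] [CommRing R] [CommRing S]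
    {f : R →+* S} {v : (Mat ι R)ˣ} (h : v.1.map f = 1) : (↑v⁻¹ : Mat ι R).map f = 1 := by
  have h1 : ((↑v⁻¹ : Mat ι R) * v.1).map f = 1 := by
    rw [inv_mul, Matrix.map_one _ (map_zero _) (map_one _)]
  rwa [Matrix.map_mul, h, mul_one] at h1

namespace FrobeniusBlocks

variable {O : Type*} [CommRing O] [IsLocalRing O] {q n : ℕ}
  {Φ : Mat (Fin n) (ResF O)} (B : FrobeniusBlocks q Φ)

/-- A lift to `O` of the eigenvalues and of the adapted basis. -/
structure Lift where
  lam : Fin B.d → O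
  residue_lam : ∀ α, residue O (lam α) = B.lam α
  T : Matrix (Fin n) B.Ix O
  Tinv : Matrix B.Ix (Fin n) O
  T_mul_Tinv : T * Tinv = 1
  Tinv_mul_T : Tinv * T = 1
  residue_T : T.map (residue O) = B.T
  residue_Tinv : Tinv.map (residue O) = B.Tinv

lemma isUnit_of_residue_eq_one {ι : Type*} [Fintype ι] [DecidableEq ι] {M : Mat ι O} (h : M.map (residue O) = 1) : IsUnit M := by
  rw [Matrix.isUnit_iff_isUnit_det, ← residue_ne_zero_iff_isUnit, map_det, mapMatrix_apply, h, det_one]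
  exact one_ne_zero

lemma nonempty_lift : Nonempty B.Lift := by
  choose f hf using residue_surjective (R := O)
  let T : Matrix (Fin n) B.Ix O := B.T.map f
  let T' : Matrix B.Ix (Fin n) O := B.Tinv.map f
  have hT : T.map (residue O) = B.T := by ext i j; exact hf _
  have hT' : T'.map (residue O) = B.Tinv := by ext i j; exact hf _
  have h1 : (T * T').map (residue O) = 1 := by
    rw [Matrix.map_mul, hT, hT', B.T_mul_Tinv]
  obtain ⟨v, hv⟩ := isUnit_of_residue_eq_one h1
  have h2 := map_inv_eq_one (f := residue O) (v := v) (by rw [hv, h1])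
  have h4 : T * (T' * (↑v⁻¹ : Mat (Fin n) O)) = 1 := by
    rw [← Matrix.mul_assoc, ← hv, Units.mul_inv]
  have h5 : (T' * (↑v⁻¹ : Mat (Fin n) O)).map (residue O) = B.Tinv := by
    rw [Matrix.map_mul, h2, hT', Matrix.mul_one]
  have h6 : T' * (↑v⁻¹ : Mat (Fin n) O) * T = 1 := by
    refine (isUnit_of_residue_eq_one (M := T' * (↑v⁻¹ : Mat (Fin n) O) * T) (by
      rw [Matrix.map_mul, h5, hT, B.Tinv_mul_T])).mul_left_cancel ?_
    rw [Matrix.mul_one, ← Matrix.mul_assoc, Matrix.mul_assoc _ T, h4, Matrix.mul_one]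
  exact ⟨{ lam := fun α => f (B.lam α), residue_lam := fun α => hf _, T := T
           Tinv := T' * (↑v⁻¹ : Mat (Fin n) O), T_mul_Tinv := h4, Tinv_mul_T := h6
           residue_T := hT, residue_Tinv := h5 }⟩

/-- The residual point, with the coordinates of the change of basis put equal to `0`. -/
def resPoint (N : Mat (Fin n) (ResF O)) : B.AllVar → ResF O := elim (B.point N) 0

lemma xmat_resPoint (N : Mat (Fin n) (ResF O)) (s : B.Lab) : blk (B.xmat (B.resPoint N)) s s = B.U s - 1 := by
  ext a b
  exact B.xmat_posX (B.resPoint N) ⟨s.1, s.2, a, b⟩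

lemma resPoint_inr (N : Mat (Fin n) (ResF O)) (v : B.NVar) : B.resPoint N (inl ⟨v.1, inr v.2⟩) =
      (B.Tinv * N * B.T) (B.posN v).1 (B.posN v).2 := rfl

lemma tmat_resPoint (N : Mat (Fin n) (ResF O)) : B.tmat (B.resPoint N) = 0 := by
  ext p p'
  by_cases h : p.1 = p'.1
  · rw [B.tmat_eq_zero _ h]; rfl
  · exact B.tmat_val (B.resPoint N) ⟨(p, p'), h⟩

namespace Lift

variable {B} (C : B.Lift) (A : Type*) [CommRing A] [Algebra O A]

/-- The lifted eigenvalues. -/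
def w (s : B.Lab) : A := amap O A (C.lam s.1 * (q : O) ^ (B.k s.1 - 1 - (s.2 : ℕ)))

lemma w_residueField (s : B.Lab) : C.w (ResF O) s = B.weight s := by
  rw [w, weight, ← C.residue_lam]
  change residue O _ = _
  rw [map_mul, map_pow, map_natCast]

lemma isUnit_algebraMap {a : O} (h : residue O a ≠ 0) : IsUnit (amap O A a) := ((residue_ne_zero_iff_isUnit _).1 h).map _

lemma isUnit_w (hq0 : (q : ResF O) ≠ 0) (s : B.Lab) : IsUnit (C.w A s) :=
  isUnit_algebraMap A ((C.w_residueField s).trans_ne (B.weight_ne_zero hq0 s))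

lemma isUnit_w_sub (hq0 : (q : ResF O) ≠ 0) (hq : ∀ i, 1 ≤ i → i ≤ n → (q : ResF O) ^ i ≠ 1) {s t : B.Lab} (h : s ≠ t) :
    IsUnit (C.w A s - C.w A t) := by
  rw [w, w, ← map_sub]
  refine isUnit_algebraMap A ?_
  have h1 := C.w_residueField s
  have h2 := C.w_residueField t
  change residue O _ = _ at h1 h2
  rw [map_sub, h1, h2, sub_ne_zero]
  exact fun h' => h (B.weight_injective hq0 hq h')

lemma isUnit_w_sub_mul (hq0 : (q : ResF O) ≠ 0)
    (hq : ∀ i, 1 ≤ i → i ≤ n → (q : ResF O) ^ i ≠ 1) {s t : B.Lab} (h : ¬ B.Next s t) : IsUnit (C.w A s - q * C.w A t) := by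
  rw [w, w, ← map_natCast (amap O A), ← map_mul, ← map_sub]
  refine isUnit_algebraMap A ?_
  have h1 := C.w_residueField s
  have h2 := C.w_residueField t
  change residue O _ = _ at h1 h2
  rw [map_sub, h1, map_mul, h2, map_natCast, sub_ne_zero]
  exact fun h' => h (B.next_of_weight_eq hq0 hq h')

lemma w_next {s t : B.Lab} (h : B.Next s t) : C.w A s = q * C.w A t := by
  obtain ⟨α, ⟨i, hi⟩⟩ := s
  obtain ⟨β, ⟨j, hj⟩⟩ := t
  obtain ⟨h1, h2⟩ := h
  dsimp only at h1 h2
  subst h1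
  subst h2
  rw [w, w, ← map_natCast (amap O A), ← map_mul]
  congr 1
  dsimp only
  rw [show B.k α - 1 - i = B.k α - 1 - (i + 1) + 1 by lia, pow_succ]
  ring

variable {A}

local notation "diag(" w ")" => Matrix.diagonal fun p : B.Ix => w (Sigma.fst p)

/-- The matrix of Frobenius in the adapted basis. -/
def dmat (y : B.AllVar → A) : Mat B.Ix A := diag(C.w A) * (1 + B.xmat y)

lemma isUnit_diagonal_w (hq0 : (q : ResF O) ≠ 0) : IsUnit diag(C.w A) := by
  rw [Matrix.isUnit_diagonal, Pi.isUnit_iff]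
  exact fun p => C.isUnit_w A hq0 p.1

lemma blk_diagonal_self (w : B.Lab → A) (s : B.Lab) : blk diag(w) s s = w s • (1 : Mat _ A) := by
  ext a b
  rw [blk_apply, Matrix.smul_apply, smul_eq_mul]
  by_cases h : a = b
  · subst h; simp
  · rw [one_apply_ne h, Matrix.diagonal_apply_ne _ (fun h' => h (by simpa using h')), mul_zero]

lemma isBlockDiag_diagonal (w : B.Lab → A) : IsBlockDiag diag(w) := fun s t h => by
  ext a b
  have h1 : (⟨s, a⟩ : B.Ix) ≠ ⟨t, b⟩ := fun h' => h (congrArg fst h')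
  exact Matrix.diagonal_apply_ne (fun p : B.Ix => w p.1) h1

lemma blk_dmat_self (y : B.AllVar → A) (s : B.Lab) : blk (C.dmat y) s s = C.w A s • (1 + blk (B.xmat y) s s) := by
  rw [dmat, (isBlockDiag_diagonal (C.w A)).blk_mul_left, blk_diagonal_self, blk_add, blk_one_self, smul_mul, one_mul]

lemma isBlockDiag_dmat (y : B.AllVar → A) : IsBlockDiag (C.dmat y) := fun s t h => by
  rw [dmat, (isBlockDiag_diagonal (C.w A)).blk_mul_left, blk_add, blk_one_ne h,
    B.isBlockDiag_xmat y s t h, add_zero, Matrix.mul_zero]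

lemma dmat_map {A' : Type*} [CommRing A'] [Algebra O A'] (f : A →ₐ[O] A') (y : B.AllVar → A) :
    (C.dmat y).map f = C.dmat (f ∘ y) := by
  have h := B.xmat_map y (f : A →+* A')
  have h1 : ((f : A →+* A') : A → A') = f := rfl
  rw [h1] at h
  rw [dmat, dmat, ← AlgHom.mapMatrix_apply, map_mul, map_add, map_one, AlgHom.mapMatrix_apply,
    AlgHom.mapMatrix_apply, h, Matrix.diagonal_map (map_zero f)]
  congr 2
  ext p
  exact f.commutes _

lemma dmat_resPoint (N : Mat (Fin n) (ResF O)) : C.dmat (B.resPoint N) = B.Tinv * Φ * B.T := by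
  have h : B.Tinv * Φ * B.T = blockDiagonal' (fun s : B.Lab => B.weight s • B.U s) := by
    have h1 := congrArg (fun Y => B.Tinv * Y * B.T) B.eq_conj
    refine h1.trans ?_
    rw [← Matrix.mul_assoc, ← Matrix.mul_assoc, B.Tinv_mul_T, Matrix.one_mul, Matrix.mul_assoc, B.Tinv_mul_T, mul_one]
    rfl
  rw [h]
  refine blk_ext fun s t => ?_
  by_cases hst : s = t
  · subst hst
    rw [blk_dmat_self, xmat_resPoint, add_sub_cancel, C.w_residueField]
    ext a b
    exact (Matrix.blockDiagonal'_apply_eq (fun s : B.Lab => B.weight s • B.U s) s a b).symm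
  · rw [C.isBlockDiag_dmat _ s t hst]
    ext a b
    exact (blockDiagonal'_apply_ne (fun s : B.Lab => B.weight s • B.U s) a b hst).symm

lemma mul_nmat_iff (hq0 : (q : ResF O) ≠ 0) (y : B.AllVar → A) : C.dmat y * B.nmat y = (q : A) • (B.nmat y * C.dmat y) ↔
      Chain(B, y) := by
  have h1 : (q : A) • (B.nmat y * diag(C.w A)) = diag(C.w A) * B.nmat y := by
    ext p p'
    rw [Matrix.smul_apply, mul_diagonal, diagonal_mul, smul_eq_mul]
    by_cases h : B.Next p.1 p'.1
    · rw [C.w_next A h]; ring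
    · rw [B.nmat_eq_zero y h]; ring
  have h3 : (q : A) • (B.nmat y * C.dmat y) = diag(C.w A) * (B.nmat y * (1 + B.xmat y)) := by
    rw [dmat, ← mul_assoc, ← smul_mul, h1, mul_assoc]
  rw [h3, dmat, mul_assoc, (C.isUnit_diagonal_w hq0).mul_right_inj, add_mul, mul_add, one_mul, mul_one, add_right_inj]

section Local

variable [IsLocalRing A] [IsLocalHom (amap O A)]

/-- The tuple `y` reduces to the tuple `x` over the residue field. -/
def Reduces (x : B.AllVar → ResF O) (y : B.AllVar → A) : Prop := ∀ v, residue A (y v) = Res(O, A) (x v)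

lemma Reduces.dmat_map {N : Mat (Fin n) (ResF O)} {y : B.AllVar → A} (h : Reduces (B.resPoint N) y) : (C.dmat y).map (residue A) =
      (B.Tinv * Φ * B.T).map (Res(O, A)) := by
  let f : A →ₐ[O] ResF A := { residue A with commutes' := fun _ => rfl }
  let g : ResF O →ₐ[O] ResF A := { Res(O, A) with commutes' := fun _ => rfl }
  have h1 := C.dmat_map f y
  have h2 := C.dmat_map g (B.resPoint N)
  rw [dmat_resPoint] at h2
  rwa [show f ∘ y = g ∘ B.resPoint N from funext h, ← h2] at h1

lemma Reduces.isWeighted (hm : IsNilpotent (maxId A))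
    {N : Mat (Fin n) (ResF O)} {y : B.AllVar → A} (h : Reduces (B.resPoint N) y) : IsWeighted (C.w A) (C.dmat y) := by
  refine ⟨C.isBlockDiag_dmat y, fun s => ?_⟩
  rw [blk_dmat_self, smul_add, add_sub_cancel_left]
  obtain ⟨c, hc⟩ : IsNilpotent (blk (B.xmat y) s s) := by
    refine isNilpotent_matrix_of_map (residue A) (by rwa [ker_residue]) ?_
    have h3 := B.xmat_map y (residue A)
    rw [show residue A ∘ y = Res(O, A) ∘ B.resPoint N from funext h, ← B.xmat_map] at h3
    rw [show (blk (B.xmat y) s s).map (residue A) = (Res(O, A)).mapMatrix (B.U s - 1) by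
      rw [← B.xmat_resPoint N]; exact congrArg (fun Y => blk Y s s) h3]
    exact (B.U_unipotent s).map _
  exact ⟨c, by rw [smul_pow, hc, smul_zero]⟩

lemma Reduces.tmat_mem {N : Mat (Fin n) (ResF O)} {y : B.AllVar → A}
    (h : Reduces (B.resPoint N) y) (p p' : B.Ix) : B.tmat y p p' ∈ maxId A := by
  rw [← residue_eq_zero_iff]
  have h3 := B.tmat_map y (residue A)
  rw [show residue A ∘ y = Res(O, A) ∘ B.resPoint N from funext h, ← B.tmat_map, tmat_resPoint] at h3
  exact (congrFun (congrFun h3 p) p').trans (map_zero Res(O, A))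

/-- A pair of matrices with `Φ τ = τ ^ q Φ` comes from a point of the model. -/
lemma exists_point_of_pair [Finite A] (hm : IsNilpotent (maxId A))
    (hn : IsUnit (n.factorial : A)) (hnF : IsUnit (n.factorial : ResF O))
    (hq0 : (q : ResF O) ≠ 0) (hq : ∀ i, 1 ≤ i → i ≤ n → (q : ResF O) ^ i ≠ 1)
    {τ : Mat (Fin n) (ResF O)} (hτ : (τ - 1) ^ n = 0)
    {Φ' τ' : Mat B.Ix A} (hΦ : Φ'.map (residue A) = (B.Tinv * Φ * B.T).map (Res(O, A)))
    (hτ' : τ'.map (residue A) = (B.Tinv * τ * B.T).map (Res(O, A))) (hrel : Φ' * τ' = τ' ^ q * Φ') :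
    ∃ y : B.AllVar → A, Reduces (B.resPoint (unipLog τ)) y ∧ Chain(B, y) ∧ Φ' * (1 + B.tmat y) = (1 + B.tmat y) * C.dmat y ∧
      τ' * (1 + B.tmat y) = (1 + B.tmat y) * truncExp A n (B.nmat y) := by
  obtain ⟨y₀, hy₀⟩ : ∃ y₀ : B.AllVar → A, Reduces (B.resPoint (unipLog τ)) y₀ := by
    choose f hf using residue_surjective (R := A)
    exact ⟨fun v => f _, fun v => hf _⟩
  have hD₀ := hy₀.isWeighted C hm
  have hw : ∀ s t, s ≠ t → IsUnit (C.w A s - C.w A t) := fun s t h => C.isUnit_w_sub A hq0 hq h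
  obtain ⟨t, D, htm, hts, hD, hDD, hΦt⟩ := exists_decomp hm hw hD₀ (Φ := Φ') (fun i j => by
    rw [← residue_eq_zero_iff, Matrix.sub_apply, map_sub, sub_eq_zero]
    exact congrFun (congrFun (hΦ.trans (hy₀.dmat_map C).symm) i) j)
  have hDw : IsWeighted (C.w A) D := hD₀.of_sub_mem hm hD hDD
  obtain ⟨g, hg⟩ := isUnit_one_add_of_mem hm htm
  have hDu := hDw.isUnit (C.isUnit_w A hq0)
  set Z : Mat B.Ix A := (↑g⁻¹ : Mat B.Ix A) * τ' * g - 1 with hZdef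
  have h1Z : 1 + Z = (↑g⁻¹ : Mat B.Ix A) * τ' * g := by rw [hZdef, add_sub_cancel]
  have hDg : D = (↑g⁻¹ : Mat B.Ix A) * Φ' * g := by
    rw [mul_assoc, hg, hΦt, ← hg, Units.inv_mul_cancel_left]
  have hrelZ : D * (1 + Z) = (1 + Z) ^ q * D := by
    rw [h1Z, Units.conj_pow' g τ' q, hDg]
    simp only [mul_assoc, Units.mul_inv_cancel_left]
    rw [← mul_assoc Φ', hrel, mul_assoc]
  have hgres : (g : Mat B.Ix A).map (residue A) = 1 := by
    rw [hg, ← mapMatrix_apply, map_add, map_one, mapMatrix_apply, show t.map (residue A) = 0 by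
      ext i j; exact (residue_eq_zero_iff _).2 (htm i j), add_zero]
  have hgres' := map_inv_eq_one hgres
  have hZres : Z.map (residue A) = (B.Tinv * (τ - 1) * B.T).map (Res(O, A)) := by
    rw [hZdef, ← mapMatrix_apply, map_sub, map_one, map_mul, map_mul,
      mapMatrix_apply, mapMatrix_apply, mapMatrix_apply, hgres, hgres', hτ',
      mul_one, one_mul, Matrix.mul_sub, Matrix.sub_mul, Matrix.mul_one, B.Tinv_mul_T,
      ← mapMatrix_apply, ← mapMatrix_apply, map_sub, map_one]
  have hZnil : IsNilpotent Z := by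
    refine isNilpotent_matrix_of_map (residue A) (by rwa [ker_residue]) ⟨n, ?_⟩
    rw [hZres, ← mapMatrix_apply, ← map_pow, conj_pow_conj B.T_mul_Tinv B.Tinv_mul_T, hτ, Matrix.mul_zero, Matrix.zero_mul,
      map_zero]
  have hZn : Z ^ n = 0 := pow_eq_zero_of_conj hDw (C.isUnit_w A hq0) hrelZ hZnil
    (ht := fun s => (s.2 : ℕ)) (fun s => s.2.2.trans_le (B.k_le _)) fun s t => by
      by_cases h : B.Next s t
      · exact Or.inr h.2
      · exact Or.inl (C.isUnit_w_sub_mul A hq0 hq h)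
  have hZn1 : Z ^ (n + 1) = 0 := by rw [pow_succ, hZn, zero_mul]
  set N := truncLog A n Z with hN
  have hDN : D * N = (q : A) • (N * D) := mul_truncLog_eq hn hDu hrelZ hZn
  have hNnext : ∀ s s', ¬ B.Next s s' → blk N s s' = 0 := fun s s' h =>
    blk_eq_zero_of_commute hDw hDw (C.isUnit_w_sub_mul A hq0 hq h) (by rw [hDN, blk_smul])
  obtain ⟨W, hW⟩ := C.isUnit_diagonal_w (A := A) hq0
  let w' : B.Lab → A := fun s => ((C.isUnit_w A hq0 s).unit⁻¹ : Aˣ)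
  have hWinv : diag(w') * W = 1 := by
    rw [hW, Matrix.diagonal_mul_diagonal, ← Matrix.diagonal_one]
    congr 1
    ext p
    exact (C.isUnit_w A hq0 p.1).val_inv_mul
  have hXd : IsBlockDiag (diag(w') * D - 1) := fun s s' h => by
    rw [blk_sub, (isBlockDiag_diagonal w').blk_mul_left, hD s s' h, Matrix.mul_zero, blk_one_ne h, sub_zero]
  obtain ⟨y, hyX, hyN, hyt⟩ := B.exists_point hXd hNnext hts
  have hyD : C.dmat y = D := by
    rw [dmat, hyX, add_sub_cancel, ← hW, ← mul_assoc, mul_eq_one_comm.1 hWinv, one_mul]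
  refine ⟨y, ?_, ?_, ?_, ?_⟩
  · have hNres : N.map (residue A) = (B.Tinv * unipLog τ * B.T).map (Res(O, A)) := by
      have h1 := ringHom_truncLog hn (residue A) (residue A).mapMatrix (mapMatrix_algebraMap (ι := B.Ix) (residue A)) Z
      have h2 := ringHom_truncLog hnF (Res(O, A)) (Res(O, A)).mapMatrix
        (mapMatrix_algebraMap (ι := B.Ix) _) (B.Tinv * (τ - 1) * B.T)
      rw [mapMatrix_apply, mapMatrix_apply, hZres] at h1
      rw [mapMatrix_apply, mapMatrix_apply] at h2
      rw [hN, h1, ← h2, unipLog_eq_truncLog]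
      congr 1
      let c : Mat (Fin n) (ResF O) →ₐ[ResF O] Mat B.Ix (ResF O) := ofLinearMap
        { toFun := fun Y => B.Tinv * Y * B.T
          map_add' := fun Y Y' => by rw [Matrix.mul_add, Matrix.add_mul]
          map_smul' := fun a Y => by rw [Matrix.mul_smul, smul_mul, id_apply] } (by
          change B.Tinv * (1 : Mat (Fin n) (ResF O)) * B.T = 1
          rw [Matrix.mul_one, B.Tinv_mul_T]) (fun Y Y' => (conj_mul_conj B.T_mul_Tinv Y Y').symm)
      exact (map_truncLog c (τ - 1)).symm
    have hXres : (B.xmat y).map (residue A) = (B.xmat (B.resPoint (unipLog τ))).map (Res(O, A)) := by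
      rw [B.xmat_map (B.resPoint (unipLog τ)),
        ← show residue A ∘ y₀ = Res(O, A) ∘ B.resPoint (unipLog τ) from funext hy₀, ← B.xmat_map]
      have h1 : (C.dmat y).map (residue A) = (C.dmat y₀).map (residue A) := by
        rw [hyD]
        ext i j
        rw [map_apply, map_apply, ← sub_eq_zero, ← map_sub, residue_eq_zero_iff]
        exact hDD i j
      have h2 : ∀ y : B.AllVar → A, (1 + B.xmat y) = diag(w') * C.dmat y := fun y => by
        rw [dmat, ← hW, ← mul_assoc, hWinv, one_mul]
      have h3 : (residue A).mapMatrix (1 + B.xmat y) = (residue A).mapMatrix (1 + B.xmat y₀) := by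
        rw [h2, h2, map_mul, map_mul]
        congr 1
      rw [map_add, map_add] at h3
      exact add_left_cancel h3
    intro v
    rcases v with ⟨α, e | e⟩ | e
    · rw [← B.xmat_posX y ⟨α, e⟩, ← B.xmat_posX (B.resPoint (unipLog τ)) ⟨α, e⟩]
      exact congrFun (congrFun hXres _) _
    · rw [B.resPoint_inr _ ⟨α, e⟩, ← B.nmat_posN y ⟨α, e⟩, hyN]
      exact congrFun (congrFun hNres _) _
    · rw [← B.tmat_val y e, hyt]
      change _ = Res(O, A) 0
      rw [map_zero, residue_eq_zero_iff]
      exact htm _ _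
  · rw [← C.mul_nmat_iff hq0, hyD, hyN, hDN]
  · rw [hyt, hyD, hΦt]
  · rw [hyt, hyN, hN, truncExp_truncLog hn hZn1, h1Z, ← hg, mul_assoc, Units.mul_inv_cancel_left]

lemma point_unique (hm : IsNilpotent (maxId A)) (hn : IsUnit (n.factorial : A))
    (hq0 : (q : ResF O) ≠ 0) (hq : ∀ i, 1 ≤ i → i ≤ n → (q : ResF O) ^ i ≠ 1)
    {N : Mat (Fin n) (ResF O)}
    {Φ' τ' : Mat B.Ix A} {y y' : B.AllVar → A} (hy : Reduces (B.resPoint N) y) (hy' : Reduces (B.resPoint N) y')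
    (hΦ : Φ' * (1 + B.tmat y) = (1 + B.tmat y) * C.dmat y) (hΦ' : Φ' * (1 + B.tmat y') = (1 + B.tmat y') * C.dmat y')
    (hτ : τ' * (1 + B.tmat y) = (1 + B.tmat y) * truncExp A n (B.nmat y))
    (hτ' : τ' * (1 + B.tmat y') = (1 + B.tmat y') * truncExp A n (B.nmat y')) : y = y' := by
  have hu := isUnit_one_add_of_mem hm hy.tmat_mem
  have hs : ∀ (y : B.AllVar → A) s, blk (1 + B.tmat y) s s = 1 := fun y s => by
    rw [blk_add, blk_one_self, B.blk_tmat_self, add_zero]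
  obtain ⟨h1, h2⟩ := decomp_unique (fun s t h => C.isUnit_w_sub A hq0 hq h) (hy.isWeighted C hm)
    (hy'.isWeighted C hm) hu (isUnit_one_add_of_mem hm hy'.tmat_mem) (hs y) (hs y') hΦ hΦ'
  have ht : B.tmat y = B.tmat y' := add_left_cancel h1
  have hN1 : ∀ y : B.AllVar → A, B.nmat y ^ (n + 1) = 0 := fun y => by
    rw [pow_succ, B.nmat_pow, zero_mul]
  refine B.point_ext ?_ ?_ ht
  · exact add_left_cancel ((C.isUnit_diagonal_w hq0).mul_left_cancel h2)
  · rw [← ht, hτ] at hτ'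
    have h3 := hu.mul_left_cancel hτ'
    rw [← truncLog_truncExp hn (hN1 y), h3, truncLog_truncExp hn (hN1 y')]

end Local

end Lift

end FrobeniusBlocks

section Lifts

open FrobeniusBlocks.Lift (Reduces)

/-- `r` lifts `s`, both being seen as representations over the residue field of `A`. -/
local notation "LiftOf(" O ", " A ", " r ", " s ")" =>
  MonoidHom.comp (GLmap (residue A)) r = MonoidHom.comp (GLmap (Res(O, A))) s

variable {p : ℕ} [Fact p.Prime] {ℓ : ℕ} [Fact ℓ.Prime] {L : Type v} [Field L] [Algebra ℚ_[p] L]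
  [FinDim ℚ_[p] L]

/-- A homomorphism that factors through the tame quotient is determined by its values at a
Frobenius lift and at a tame generator. -/
lemma tame_hom_ext {φ : GalGroup L} {σ : inertia p L} (hφ : IsArithFrobenius p L φ)
    (hσ : IsTameGenerator p L ℓ σ) {H : Type*} [Group H] {r r' : GalGroup L →* H} (hr : OpenKer r) (hr' : OpenKer r')
    (hk : ∀ g ∈ tildeWild p L ℓ, r g = 1) (hk' : ∀ g ∈ tildeWild p L ℓ, r' g = 1)
    (h1 : r φ = r' φ) (h2 : r σ = r' σ) : r = r' := by
  refine hφ.hom_ext p hr hr' (fun u hu => ?_) h1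
  have := hσ.hom_ext p (f := r.comp (inertia p L).subtype) (f' := r'.comp (inertia p L).subtype)
    (hr.preimage continuous_subtype_val) (hr'.preimage continuous_subtype_val)
    (fun g hg => mem_ker.2 (hk g hg)) (fun g hg => mem_ker.2 (hk' g hg)) h2
  exact cfun this ⟨u, hu⟩

variable {O : Type u} [CommRing O] [IsLocalRing O] {n : ℕ}

variable (ℓ) in
/-- The hypotheses on a residual representation. -/
structure IsTameResidual (φ : GalGroup L) (σ : inertia p L)
    (rbar : GalGroup L →* GL (Fin n) (ResF O)) : Prop where
  frob : IsArithFrobenius p L φ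
  tame : IsTameGenerator p L ℓ σ
  ne : p ≠ ℓ
  isOpen : OpenKer rbar
  wild : ∀ g ∈ tildeWild p L ℓ, rbar g = 1
  unip : ((rbar σ : Mat (Fin n) (ResF O)) - 1) ^ n = 0
  q_ne_zero : (residueCard p L : ResF O) ≠ 0
  q_pow_ne_one : ∀ i, 1 ≤ i → i ≤ n → (residueCard p L : ResF O) ^ i ≠ 1
  factorial : IsUnit (n.factorial : O)
  mem : (ℓ : O) ∈ maxId O
  finite : Finite (ResF O)

lemma natCast_matrix_pow {A : Type*} [CommRing A] {a : ℕ} (h : (ℓ : A) ^ a = 0) {ι : Type*}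
    [Fintype ι] [DecidableEq ι] : ((ℓ : ℕ) : Mat ι A) ^ a = 0 := by
  rw [← map_natCast (amap A (Mat ι A)), ← map_pow, h, map_zero]

variable {φ : GalGroup L} {σ : inertia p L}
  {rbar : GalGroup L →* GL (Fin n) (ResF O)}

namespace IsTameResidual

lemma factorial_algebra {A : Type*} [CommRing A] [Algebra O A] (H : IsTameResidual ℓ φ σ rbar) : IsUnit (n.factorial : A) := by
  rw [← map_natCast (amap O A)]
  exact H.factorial.map _

section

variable {A : Type*} [CommRing A] [IsLocalRing A] [Algebra O A] [IsLocalHom (amap O A)]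

lemma ell_pow (H : IsTameResidual ℓ φ σ rbar) (hm : IsNilpotent (maxId A)) : ∃ a, (ℓ : A) ^ a = 0 := by
  obtain ⟨c, hc⟩ := hm
  refine ⟨c, hc.le (Ideal.pow_mem_pow (?_ : _ ∈ maxId A) c)⟩
  rw [← map_natCast (amap O A)]
  exact (mem_maximalIdeal _).2 ((map_mem_nonunits_iff _ _).2 H.mem)

lemma exists_pow_residual (H : IsTameResidual ℓ φ σ rbar) : ∃ s : ℕ, rbar σ ^ (ℓ ^ s) = 1 := by
  have h0 : ((ℓ : ResF O)) ^ 1 = 0 := by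
    rw [pow_one, ← map_natCast (residue O), residue_eq_zero_iff]
    exact H.mem
  obtain ⟨s, hs⟩ := exists_one_add_pow_eq_one (ℓ := ℓ) (natCast_matrix_pow h0 (ι := Fin n)) ⟨n, H.unip⟩
  refine ⟨s, Units.ext ?_⟩
  rw [add_sub_cancel] at hs
  rw [val_pow_eq_pow_val, hs, val_one]

lemma exists_pow_of_lift (H : IsTameResidual ℓ φ σ rbar) (hm : IsNilpotent (maxId A))
    {r : GalGroup L →* GL (Fin n) A} (hres : LiftOf(O, A, r, rbar))
    {u : GalGroup L} (hu : u ∈ inertia p L) : ∃ s : ℕ, r u ^ (ℓ ^ s) = 1 := by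
  obtain ⟨a, ha⟩ := H.exists_pow_residual
  have h1 : rbar u ^ (ℓ ^ a) = 1 := by
    have h2 := H.tame.mem_zpowers p (f := rbar.comp (inertia p L).subtype) (H.isOpen.preimage continuous_subtype_val)
      (fun g hg => mem_ker.2 (H.wild g hg)) ⟨u, hu⟩
    obtain ⟨k, hk⟩ := Subgroup.mem_zpowers_iff.1 h2
    change rbar σ ^ k = rbar u at hk
    rw [← hk, ← zpow_natCast, zpow_comm, zpow_natCast, ha, one_zpow]
  have h2 : GLmap (residue A) (r u ^ (ℓ ^ a)) = 1 := by
    have h3 := cfun hres u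
    simp only [comp_apply] at h3
    rw [map_pow, h3, ← map_pow, h1, map_one]
  have h3 : IsNilpotent ((r u ^ (ℓ ^ a) : GL (Fin n) A).1 - 1) := by
    refine isNilpotent_matrix_of_mem hm fun i j => ?_
    rw [← residue_eq_zero_iff, Matrix.sub_apply, map_sub, sub_eq_zero]
    have h4 : (r u ^ (ℓ ^ a) : GL (Fin n) A).1.map (residue A) = 1 := congrArg Units.val h2
    exact (congrFun (congrFun h4 i) j).trans (by simp [Matrix.one_apply, apply_ite])
  obtain ⟨b, hb⟩ := H.ell_pow hm
  obtain ⟨s, hs⟩ := exists_one_add_pow_eq_one (ℓ := ℓ) (natCast_matrix_pow hb (ι := Fin n)) h3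
  refine ⟨a + s, Units.ext ?_⟩
  rw [add_sub_cancel] at hs
  rw [pow_add, pow_mul, val_pow_eq_pow_val, hs, val_one]

lemma wild_of_lift [Finite A] (H : IsTameResidual ℓ φ σ rbar) (hm : IsNilpotent (maxId A))
    {r : GalGroup L →* GL (Fin n) A} (hr : OpenKer r) (hres : LiftOf(O, A, r, rbar)) : ∀ g ∈ tildeWild p L ℓ, r g = 1 := by
  have : Finite (GL (Fin n) A) := inferInstanceAs (Finite (Mat (Fin n) A)ˣ)
  intro g hg
  refine mem_ker.1 (tildeWild_le_ker p (r.comp (inertia p L).subtype) (hr.preimage continuous_subtype_val) ?_ hg)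
  rintro ⟨_, u, rfl⟩
  obtain ⟨s, hs⟩ := H.exists_pow_of_lift hm hres u.2
  exact ⟨s, Subtype.ext hs⟩

end

variable (B : FrobeniusBlocks (residueCard p L)
    (rbar φ : Mat (Fin n) (ResF O))) (C : B.Lift)

/-- The point of the model attached to `rbar`. -/
abbrev basePoint (σ : inertia p L) : B.AllVar → ResF O := B.resPoint (unipLog (rbar σ : Mat (Fin n) (ResF O)))

lemma residual_relation (H : IsTameResidual ℓ φ σ rbar) : (rbar φ : Mat (Fin n) (ResF O)) * rbar σ =
      (rbar σ : Mat (Fin n) (ResF O)) ^ residueCard p L * rbar φ := by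
  obtain ⟨s, hs⟩ := H.exists_pow_residual
  have h := H.frob.conj_eq_pow p H.ne H.tame H.isOpen H.wild hs
  rw [mul_inv_eq_iff_eq_mul] at h
  exact congrArg Units.val h

lemma residual_chain (H : IsTameResidual ℓ φ σ rbar) (C : B.Lift) : Chain(B, (basePoint B σ)) ∧
    truncExp (ResF O) n (B.nmat (basePoint B σ)) = B.Tinv * (rbar σ : Mat (Fin n) (ResF O)) * B.T := by
  have := H.finite
  have hloc : IsLocalHom (amap O (ResF O)) := inferInstanceAs (IsLocalHom (residue O))
  have hmap : ∀ x : ResF O, residue (ResF O) x = Res(O, ResF O) x := fun x => by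
    obtain ⟨a, rfl⟩ := residue_surjective x
    rw [ResidueField.map_residue]; rfl
  have hmapM : ∀ Y : Mat B.Ix (ResF O), Y.map (residue (ResF O)) = Y.map (Res(O, ResF O)) := fun Y => by
    ext i j; exact hmap _
  obtain ⟨y, hy, h1, -, h3⟩ := C.exists_point_of_pair (A := ResF O) (Φ' := B.Tinv * (rbar φ : Mat (Fin n) (ResF O)) * B.T)
    (τ' := B.Tinv * (rbar σ : Mat (Fin n) (ResF O)) * B.T) ⟨1, by rw [pow_one, IsLocalRing.maximalIdeal_eq_bot]; rfl⟩
    H.factorial_algebra H.factorial_algebra H.q_ne_zero H.q_pow_ne_one H.unip (hmapM _) (hmapM _)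
    (by rw [conj_pow_conj B.T_mul_Tinv B.Tinv_mul_T, conj_mul_conj B.T_mul_Tinv, conj_mul_conj B.T_mul_Tinv, H.residual_relation])
  obtain rfl : y = basePoint B σ := funext fun v => (residue (ResF O)).injective ((hy v).trans (hmap _).symm)
  refine ⟨h1, ?_⟩
  rw [B.tmat_resPoint, add_zero, one_mul, mul_one] at h3
  exact h3.symm

variable {B}

/-- The adapted basis attached to a tuple. -/
def _root_.BanalModel.FrobeniusBlocks.Lift.frame {A : Type*} [CommRing A] [Algebra O A]
    (y : B.AllVar → A) : Matrix (Fin n) B.Ix A := C.T.map (amap O A) * (1 + B.tmat y)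

open FrobeniusBlocks.Lift (frame)

/-- The representation `r` has the matrices attached to the tuple `y`. -/
def _root_.BanalModel.FrobeniusBlocks.Lift.Matches {A : Type*} [CommRing A] [Algebra O A]
    (σ : inertia p L) (r : GalGroup L →* GL (Fin n) A) (y : B.AllVar → A) : Prop :=
  (r φ : Mat (Fin n) A) * C.frame y = C.frame y * C.dmat y ∧
    (r σ : Mat (Fin n) A) * C.frame y = C.frame y * truncExp A n (B.nmat y)

lemma frame_map {A A' : Type*} [CommRing A] [Algebra O A] [CommRing A'] [Algebra O A']
    (f : A →ₐ[O] A') (y : B.AllVar → A) : (C.frame y).map f = C.frame (f ∘ y) := by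
  have h := B.tmat_map y (f : A →+* A')
  have h1 : ((f : A →+* A') : A → A') = f := rfl
  rw [h1] at h
  have h2 : (C.T.map (amap O A)).map f = C.T.map (amap O A') := by
    ext i j; exact f.commutes _
  rw [frame, frame, Matrix.map_mul, h2, ← h, ← AlgHom.mapMatrix_apply, map_add, map_one, AlgHom.mapMatrix_apply]

lemma matches_map (H : IsTameResidual ℓ φ σ rbar) {A A' : Type*} [CommRing A] [Algebra O A]
    [CommRing A'] [Algebra O A'] (f : A →ₐ[O] A')
    {r : GalGroup L →* GL (Fin n) A} {y : B.AllVar → A} (h : C.Matches σ r y) :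
    C.Matches σ ((GLmap (f : A →+* A')).comp r) (f ∘ y) := by
  have h0 : ((f : A →+* A') : A → A') = f := rfl
  have hN := B.nmat_map y (f : A →+* A')
  rw [h0] at hN
  have h1 := congrArg (fun Y : Matrix (Fin n) B.Ix A => Y.map f) h.1
  have h2 := congrArg (fun Y : Matrix (Fin n) B.Ix A => Y.map f) h.2
  have h3 := ringHom_truncExp H.factorial_algebra (f : A →+* A') (f : A →+* A').mapMatrix
    (mapMatrix_algebraMap (ι := B.Ix) (f : A →+* A')) (B.nmat y)
  rw [mapMatrix_apply, mapMatrix_apply, h0, hN] at h3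
  simp only [Matrix.map_mul, frame_map, C.dmat_map, h3] at h1 h2
  exact ⟨h1, h2⟩

section

variable {A : Type*} [CommRing A] [IsLocalRing A] [Algebra O A] [IsLocalHom (amap O A)]

lemma Tinv_mul_frame {A : Type*} [CommRing A] [Algebra O A] (y : B.AllVar → A) :
    C.Tinv.map (amap O A) * C.frame y = 1 + B.tmat y := by
  rw [frame, ← Matrix.mul_assoc, ← Matrix.map_mul, C.Tinv_mul_T, Matrix.map_one _ (map_zero _) (map_one _), one_mul]

lemma T_mul_Tinv_map (A : Type*) [CommRing A] [Algebra O A] : C.T.map (amap O A) * C.Tinv.map (amap O A) = 1 := by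
  rw [← Matrix.map_mul, C.T_mul_Tinv, Matrix.map_one _ (map_zero _) (map_one _)]

lemma Tinv_mul_T_map (A : Type*) [CommRing A] [Algebra O A] : C.Tinv.map (amap O A) * C.T.map (amap O A) = 1 := by
  rw [← Matrix.map_mul, C.Tinv_mul_T, Matrix.map_one _ (map_zero _) (map_one _)]

lemma map_residue_T : (C.T.map (amap O A)).map (residue A) = B.T.map (Res(O, A)) := by
  rw [← C.residue_T]; rfl

lemma map_residue_Tinv : (C.Tinv.map (amap O A)).map (residue A) = B.Tinv.map (Res(O, A)) := by
  rw [← C.residue_Tinv]; rfl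

lemma matches_iff {r : GalGroup L →* GL (Fin n) A} {y : B.AllVar → A} : C.Matches σ r y ↔
      (C.Tinv.map (amap O A) * (r φ : Mat (Fin n) A) * C.T.map (amap O A)) * (1 + B.tmat y) = (1 + B.tmat y) * C.dmat y ∧
      (C.Tinv.map (amap O A) * (r σ : Mat (Fin n) A) *
        C.T.map (amap O A)) * (1 + B.tmat y) = (1 + B.tmat y) * truncExp A n (B.nmat y) := by
  have key : ∀ (Y : Mat (Fin n) A) (Z : Mat B.Ix A), Y * C.frame y = C.frame y * Z ↔ (C.Tinv.map (amap O A) * Y *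
        C.T.map (amap O A)) * (1 + B.tmat y) = (1 + B.tmat y) * Z := by
    refine fun Y Z => ⟨fun h => ?_, fun h => ?_⟩
    · have := congrArg (fun M => C.Tinv.map (amap O A) * M) h
      simp only [← Matrix.mul_assoc, Tinv_mul_frame] at this
      rw [← this, frame]
      simp only [Matrix.mul_assoc]
    · have := congrArg (fun M => C.T.map (amap O A) * M) h
      simp only [← Matrix.mul_assoc, T_mul_Tinv_map, Matrix.one_mul] at this
      rw [frame, ← this]
      simp only [Matrix.mul_assoc]
  rw [FrobeniusBlocks.Lift.Matches, key, key]

/-- The conjugate of a representation by the adapted basis. -/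
lemma map_conj_eq {r : GalGroup L →* GL (Fin n) A} (hres : LiftOf(O, A, r, rbar))
    (g : GalGroup L) : (C.Tinv.map (amap O A) * (r g : Mat (Fin n) A) * C.T.map (amap O A)).map (residue A) =
      (B.Tinv * (rbar g : Mat (Fin n) (ResF O)) * B.T).map (Res(O, A)) := by
  have h := congrArg Units.val (cfun hres g)
  change (r g : Mat (Fin n) A).map (residue A) = (rbar g : Mat (Fin n) (ResF O)).map (Res(O, A)) at h
  rw [Matrix.map_mul, Matrix.map_mul, map_residue_T, map_residue_Tinv, h, Matrix.map_mul, Matrix.map_mul]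

/-- Every lift of `rbar` comes from a point of the model. -/
lemma exists_point_of_lift [Finite A] (H : IsTameResidual ℓ φ σ rbar) (hm : IsNilpotent (maxId A))
    {r : GalGroup L →* GL (Fin n) A} (hr : OpenKer r) (hres : LiftOf(O, A, r, rbar)) :
    ∃ y : B.AllVar → A, Reduces (basePoint B σ) y ∧ Chain(B, y) ∧ C.Matches σ r y := by
  obtain ⟨s, hs⟩ := H.exists_pow_of_lift hm hres σ.2
  have h := H.frob.conj_eq_pow p H.ne H.tame hr (H.wild_of_lift hm hr hres) hs
  rw [mul_inv_eq_iff_eq_mul] at h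
  have h' := congrArg Units.val h
  rw [val_mul, val_mul, val_pow_eq_pow_val] at h'
  obtain ⟨y, hy, h1, h2, h3⟩ := C.exists_point_of_pair hm H.factorial_algebra H.factorial_algebra
    H.q_ne_zero H.q_pow_ne_one H.unip (map_conj_eq C hres φ) (map_conj_eq C hres σ)
    (by rw [conj_pow_conj (T_mul_Tinv_map C A) (Tinv_mul_T_map C A),
      conj_mul_conj (T_mul_Tinv_map C A), conj_mul_conj (T_mul_Tinv_map C A), h'])
  exact ⟨y, hy, h1, (matches_iff C).2 ⟨h2, h3⟩⟩

lemma point_unique (H : IsTameResidual ℓ φ σ rbar) (hm : IsNilpotent (maxId A))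
    {r : GalGroup L →* GL (Fin n) A} {y y' : B.AllVar → A} (hy : Reduces (basePoint B σ) y) (hy' : Reduces (basePoint B σ) y')
    (h : C.Matches σ r y) (h' : C.Matches σ r y') : y = y' := by
  rw [matches_iff] at h h'
  exact C.point_unique hm H.factorial_algebra H.q_ne_zero H.q_pow_ne_one hy hy' h.1 h'.1 h.2 h'.2

lemma lift_unique [Finite A] (H : IsTameResidual ℓ φ σ rbar) (hm : IsNilpotent (maxId A))
    {r r' : GalGroup L →* GL (Fin n) A} (hr : OpenKer r) (hr' : OpenKer r') (hres : LiftOf(O, A, r, rbar))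
    (hres' : LiftOf(O, A, r', rbar))
    {y : B.AllVar → A} (hy : Reduces (basePoint B σ) y) (h : C.Matches σ r y) (h' : C.Matches σ r' y) : r = r' := by
  obtain ⟨v, hv⟩ := isUnit_one_add_of_mem hm hy.tmat_mem
  have hinv : C.frame y * ((↑v⁻¹ : Mat B.Ix A) * C.Tinv.map (amap O A)) = 1 := by
    rw [frame, ← hv, Matrix.mul_assoc, ← Matrix.mul_assoc (v : Mat B.Ix A), Units.mul_inv, Matrix.one_mul, T_mul_Tinv_map]
  have key : ∀ Y Y' : Mat (Fin n) A, Y * C.frame y = Y' * C.frame y → Y = Y' := fun Y Y' hY => by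
    have := congrArg (fun M => M * ((↑v⁻¹ : Mat B.Ix A) * C.Tinv.map (amap O A))) hY
    simp only [Matrix.mul_assoc] at this
    rwa [hinv, mul_one, mul_one] at this
  exact tame_hom_ext H.frob H.tame hr hr' (H.wild_of_lift hm hr hres) (H.wild_of_lift hm hr' hres')
    (Units.ext (key _ _ (h.1.trans h'.1.symm))) (Units.ext (key _ _ (h.2.trans h'.2.symm)))

/-- Every point of the model gives a lift of `rbar`. -/
lemma exists_lift_of_point [Finite A] (H : IsTameResidual ℓ φ σ rbar) (hm : IsNilpotent (maxId A)) {y : B.AllVar → A}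
    (hy : Reduces (basePoint B σ) y) (hch : Chain(B, y)) : ∃ r : GalGroup L →* GL (Fin n) A, OpenKer r ∧ LiftOf(O, A, r, rbar) ∧
      C.Matches σ r y := by
  have hn : IsUnit (n.factorial : A) := H.factorial_algebra
  obtain ⟨v, hv⟩ := isUnit_one_add_of_mem hm hy.tmat_mem
  set Pi : Matrix B.Ix (Fin n) A := (↑v⁻¹ : Mat B.Ix A) * C.Tinv.map (amap O A) with hPi
  have hP1 : C.frame y * Pi = 1 := by
    rw [frame, ← hv, hPi, Matrix.mul_assoc, ← Matrix.mul_assoc (v : Mat B.Ix A), Units.mul_inv, Matrix.one_mul, T_mul_Tinv_map]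
  have hP2 : Pi * C.frame y = 1 := by
    rw [hPi, Matrix.mul_assoc, Tinv_mul_frame, ← hv, inv_mul]
  let c : Mat B.Ix A →* Mat (Fin n) A :=
    { toFun := fun Y => C.frame y * Y * Pi
      map_one' := by rw [Matrix.mul_one, hP1]
      map_mul' := fun Y Y' => by
        simp only [Matrix.mul_assoc]
        rw [← Matrix.mul_assoc Pi, hP2, Matrix.one_mul] }
  have hc : ∀ Y, c Y * C.frame y = C.frame y * Y := fun Y => by
    change C.frame y * Y * Pi * C.frame y = _
    rw [Matrix.mul_assoc, hP2, Matrix.mul_one]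
  obtain ⟨D, hD⟩ := (hy.isWeighted C hm).isUnit (C.isUnit_w A H.q_ne_zero)
  have hN1 : B.nmat y ^ (n + 1) = 0 := by rw [pow_succ, B.nmat_pow, zero_mul]
  have hEu : IsUnit (truncExp A n (B.nmat y)) := by
    simpa using IsNilpotent.isUnit_one_add ⟨_, truncExp_sub_one_pow (A := A) hN1⟩
  obtain ⟨E, hE⟩ := hEu
  have hDE : D * E = E ^ residueCard p L * D := by
    apply Units.ext
    rw [val_mul, val_mul, val_pow_eq_pow_val, hD, hE]
    refine mul_truncExp_eq hn ?_ ((C.mul_nmat_iff H.q_ne_zero y).2 hch) hN1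
    rw [← hD]
    exact D.isUnit
  obtain ⟨a, ha⟩ := H.ell_pow hm
  have hEa : E ^ (ℓ ^ a) = 1 := by
    apply Units.ext
    rw [val_pow_eq_pow_val, hE, ← truncExp_natCast_smul hn hN1, Nat.cast_pow, ha, zero_smul, truncExp_zero, val_one]
  have : Finite (GL (Fin n) A) := inferInstanceAs (Finite (Mat (Fin n) A)ˣ)
  have hEa' : (Units.map c E : GL (Fin n) A) ^ (ℓ ^ a) = 1 := by
    rw [← map_pow, hEa, map_one]
  obtain ⟨r, hr, hrφ, hrσ, hru⟩ := H.frob.exists_rep p H.ne H.tame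
    (H := GL (Fin n) A) (Φ := Units.map c D) (τ := Units.map c E) hEa' (by
      rw [← map_mul, hDE, map_mul, mul_inv_cancel_right, map_pow])
  have hmatch : C.Matches σ r y := ⟨by rw [hrφ, Units.coe_map]; rw [hc, hD], by rw [hrσ, Units.coe_map]; rw [hc, hE]⟩
  have hwild : ∀ g ∈ tildeWild p L ℓ, r g = 1 := by
    intro g hg
    refine mem_ker.1 (tildeWild_le_ker p (r.comp (inertia p L).subtype) (hr.preimage continuous_subtype_val) ?_ hg)
    rintro ⟨_, u, rfl⟩
    obtain ⟨e, he⟩ := hru u u.2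
    refine ⟨a, Subtype.ext ?_⟩
    change r u ^ (ℓ ^ a) = 1
    rw [he, ← pow_mul, mul_comm, pow_mul, hEa', one_pow]
  refine ⟨r, hr, ?_, hmatch⟩
  have hframe : (C.frame y).map (residue A) = B.T.map (Res(O, A)) := by
    have h1 : (B.tmat y).map (residue A) = 0 := by
      ext i j; exact (residue_eq_zero_iff _).2 (hy.tmat_mem i j)
    rw [frame, Matrix.map_mul, map_residue_T, ← mapMatrix_apply
      (residue A) (1 + _), map_add, map_one, mapMatrix_apply, h1, add_zero, Matrix.mul_one]
  have key : ∀ (Y : Mat (Fin n) A) (Z : Mat B.Ix A) (Y' : Mat (Fin n) (ResF O)), Y * C.frame y = C.frame y * Z →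
      Z.map (residue A) = (B.Tinv * Y' * B.T).map (Res(O, A)) → Y.map (residue A) = Y'.map (Res(O, A)) := by
    intro Y Z Y' h1 h2
    have h3 := congrArg (fun M : Matrix (Fin n) B.Ix A => M.map (residue A)) h1
    simp only [Matrix.map_mul, hframe, h2] at h3
    have h4 := congrArg (fun M => M * B.Tinv.map (Res(O, A))) h3
    simp only [Matrix.mul_assoc] at h4
    rw [← Matrix.map_mul, B.T_mul_Tinv, Matrix.map_one _ (map_zero _) (map_one _), mul_one,
      Matrix.mul_one, ← Matrix.mul_assoc, ← Matrix.map_mul, B.T_mul_Tinv,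
      Matrix.map_one _ (map_zero _) (map_one _), one_mul] at h4
    exact h4
  have hNres : (truncExp A n (B.nmat y)).map (residue A) = (B.Tinv * (rbar σ : Mat (Fin n) (ResF O)) * B.T).map (Res(O, A)) := by
    have h1 := ringHom_truncExp hn (residue A) (residue A).mapMatrix (mapMatrix_algebraMap (ι := B.Ix) (residue A)) (B.nmat y)
    have h2 := ringHom_truncExp (A := ResF O) (n := n) H.factorial_algebra (Res(O, A)) (Res(O, A)).mapMatrix
      (mapMatrix_algebraMap (ι := B.Ix) _) (B.nmat (basePoint B σ))
    have h5 : residue A ∘ y = Res(O, A) ∘ basePoint B σ := funext hy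
    rw [mapMatrix_apply, mapMatrix_apply, B.nmat_map, h5, ← B.nmat_map] at h1
    rw [mapMatrix_apply, mapMatrix_apply, (H.residual_chain B C).2] at h2
    rw [h1, h2]
  exact tame_hom_ext H.frob H.tame (isOpen_mono (fun g hg => by rw [mem_ker, comp_apply, mem_ker.1 hg, map_one]) hr)
    (isOpen_mono (fun g hg => by rw [mem_ker, comp_apply, mem_ker.1 hg, map_one]) H.isOpen)
    (fun g hg => by rw [comp_apply, hwild g hg, map_one]) (fun g hg => by rw [comp_apply, H.wild g hg, map_one])
    (Units.ext (key _ _ _ hmatch.1 (hy.dmat_map C))) (Units.ext (key _ _ _ hmatch.2 hNres))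

end

end IsTameResidual

end Lifts

section ResidueField

variable {O A : Type u} [CommRing O] [IsLocalRing O] [CommRing A] [IsLocalRing A] [Algebra O A]
  [IsLocalHom (amap O A)]

lemma hasSameResidueField_iff : HasSameResidueField O A ↔ ∀ a : A, ∃ o : O, a - amap O A o ∈ maxId A := by
  have key : ∀ (a : A) (o : O), a - amap O A o ∈ maxId A ↔ Res(O, A) (residue O o) = residue A a := fun a o => by
    rw [ResidueField.map_residue, ← residue_eq_zero_iff, map_sub, sub_eq_zero, eq_comm]
  constructor
  · intro h a
    obtain ⟨b, hb⟩ := h.2 (residue A a)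
    obtain ⟨o, rfl⟩ := residue_surjective b
    exact ⟨o, (key a o).2 hb⟩
  · intro h
    refine ⟨(Res(O, A)).injective, fun b => ?_⟩
    obtain ⟨a, rfl⟩ := residue_surjective b
    obtain ⟨o, ho⟩ := h a
    exact ⟨_, (key a o).1 ho⟩

lemma HasSameResidueField.map_mem (h : HasSameResidueField O A) {R : Type*} [CommRing R]
    [IsLocalRing R] [Algebra O R] [IsLocalHom (amap O R)] (f : R →ₐ[O] A) {r : R} (hr : r ∈ maxId R) : f r ∈ maxId A := by
  obtain ⟨o, ho⟩ := hasSameResidueField_iff.1 h (f r)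
  by_cases hu : IsUnit o
  · have h1 : IsUnit (amap O R o - r) := by
      by_contra hcon
      have := Ideal.add_mem _ hcon hr
      rw [sub_add_cancel] at this
      exact this (hu.map _)
    have h2 := h1.map f
    rw [map_sub, f.commutes, ← neg_sub, IsUnit.neg_iff] at h2
    exact (ho h2).elim
  · have h1 : amap O A o ∈ maxId A := (map_mem_nonunits_iff _ _).2 hu
    simpa using Ideal.add_mem _ ho h1

lemma HasSameResidueField.map_mem_pow (h : HasSameResidueField O A) {R : Type*} [CommRing R]
    [IsLocalRing R] [Algebra O R] [IsLocalHom (amap O R)] (f : R →ₐ[O] A) {r : R} {k : ℕ}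
    (hr : r ∈ maxId R ^ k) : f r ∈ maxId A ^ k := by
  have h1 : (maxId R).map f ≤ maxId A := map_le_iff_le_comap.2 fun r hr =>
    h.map_mem f hr
  have h2 := mem_map_of_mem f hr
  rw [Ideal.map_pow] at h2
  exact pow_right_mono h1 k h2

lemma HasSameResidueField.residue_map (h : HasSameResidueField O A) {R : Type u} [CommRing R]
    [IsLocalRing R] [Algebra O R] [IsLocalHom (amap O R)] (f : R →ₐ[O] A) {r : R} {b : ResF O} (hr : residue R r = Res(O, R) b) :
    residue A (f r) = Res(O, A) b := by
  obtain ⟨o, rfl⟩ := residue_surjective b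
  rw [ResidueField.map_residue, ← sub_eq_zero, ← map_sub, residue_eq_zero_iff] at hr ⊢
  simpa using h.map_mem f hr

instance isLocalHom_algebraMap_quotient (J : Ideal A) [IsLocalRing (A ⧸ J)] : IsLocalHom (amap O (A ⧸ J)) := by
  have : IsLocalHom (modId J) := IsLocalHom.of_surjective _ mk_surjective
  exact inferInstanceAs (IsLocalHom ((modId J).comp (amap O A)))

lemma HasSameResidueField.quotient (h : HasSameResidueField O A) (J : Ideal A)
    [IsLocalRing (A ⧸ J)] : HasSameResidueField O (A ⧸ J) := by
  rw [hasSameResidueField_iff] at h ⊢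
  have : IsLocalHom (modId J) := IsLocalHom.of_surjective _ mk_surjective
  intro a
  obtain ⟨a, rfl⟩ := mk_surjective a
  obtain ⟨o, ho⟩ := h a
  exact ⟨o, (map_mem_nonunits_iff (modId J) (a - amap O A o)).2 ho⟩

lemma HasSameResidueField.finite [Finite (ResF O)] [IsNoetherianRing A]
    (h : HasSameResidueField O A) (hm : IsNilpotent (maxId A)) : Finite A := by
  obtain ⟨c, hc⟩ := hm
  have : Finite (A ⧸ maxId A) := Finite.of_surjective (Res(O, A)) h.2
  have := Ideal.finite_quotient_pow (IsNoetherian.noetherian (maxId A)) c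
  rw [hc] at this
  exact Finite.of_injective (modId (⊥ : Ideal A)) <| by
    rw [RingHom.injective_iff_ker_eq_bot, mk_ker]

end ResidueField

section DiscRing

variable {O : Type u} [CommRing O] [IsLocalRing O] {V : Type*} (x : V → ResF O)

/-- The maximal ideal of the polynomial ring attached to a point over the residue field. -/
abbrev ptIdeal : Ideal (MvPoly V O) := ker (aeval (R := O) x)

/-- The completion of the polynomial ring at a point over the residue field. -/
abbrev DiscRing : Type _ := AdicC (ptIdeal x) (MvPoly V O)

/-- The map from the polynomial ring to its completion. -/
abbrev toDisc : MvPoly V O →+* DiscRing x := amap _ _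

lemma sub_C_mem_ptIdeal (f : MvPoly V O) : ∃ o : O, f - mvC o ∈ ptIdeal x := by
  obtain ⟨o, ho⟩ := residue_surjective (aeval (R := O) x f)
  refine ⟨o, ?_⟩
  rw [RingHom.mem_ker, map_sub, aeval_C, sub_eq_zero]
  exact ho.symm

instance isMaximal_ptIdeal : (ptIdeal x).IsMaximal := by
  refine RingHom.ker_isMaximal_of_surjective _ fun b => ?_
  obtain ⟨o, rfl⟩ := residue_surjective b
  exact ⟨mvC o, aeval_C _ _⟩

lemma C_mem_ptIdeal {o : O} (ho : o ∈ maxId O) : mvC o ∈ ptIdeal x := by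
  rw [RingHom.mem_ker, aeval_C]
  exact (residue_eq_zero_iff o).2 ho

variable [IsNoetherianRing O] [Finite V]

instance isLocalRing_discRing : IsLocalRing (DiscRing x) := isLocalRing_adicCompletion _

instance isNoetherianRing_discRing : IsNoetherianRing (DiscRing x) := isNoetherianRing_adicCompletion _

instance isAdicComplete_discRing : IsAdicComplete (maxId (DiscRing x)) (DiscRing x) := by
  rw [maximalIdeal_adicCompletion]
  exact isAdicComplete_self _ (IsNoetherian.noetherian _)

lemma algebraMap_mem_discRing {f : MvPoly V O} (hf : f ∈ ptIdeal x) : toDisc x f ∈ maxId (DiscRing x) := by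
  rw [maximalIdeal_adicCompletion]
  exact mem_map_of_mem _ hf

instance isLocalHom_discRing : IsLocalHom (amap O (DiscRing x)) := by
  refine ⟨fun o ho => ?_⟩
  by_contra hcon
  rw [tower O (MvPoly V O), algebraMap_eq] at ho
  exact algebraMap_mem_discRing x (C_mem_ptIdeal x hcon) ho

/-- A tuple reducing to `x` defines a homomorphism on the completion at `x`. -/
lemma exists_discRing_algHom {A : Type*} [CommRing A] [IsLocalRing A] [Algebra O A]
    [IsLocalHom (amap O A)] [IsAdicComplete (maxId A) A] {y : V → A} (hy : ∀ v, residue A (y v) = Res(O, A) (x v)) :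
    ∃ f : DiscRing x →ₐ[O] A, ∀ p, f (toDisc x p) = aeval y p := by
  have h1 : ptIdeal x ≤ (maxId A).comap (aeval (R := O) y).toRingHom := by
    intro p hp
    let f : A →ₐ[O] ResF A := { residue A with commutes' := fun _ => rfl }
    let g : ResF O →ₐ[O] ResF A :=
      { Res(O, A) with commutes' := fun _ => rfl }
    have h2 : f.comp (aeval y) = g.comp (aeval x) := MvPolynomial.algHom_ext fun v => by
        simp only [AlgHom.comp_apply, aeval_X]
        exact hy v
    have h3 := cfun h2 p
    rw [AlgHom.comp_apply, AlgHom.comp_apply, show aeval x p = 0 from hp, map_zero] at h3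
    exact (residue_eq_zero_iff _).1 h3
  refine ⟨{ completionLift _ h1 with commutes' := fun o => ?_ }, fun p =>
    completionLift_algebraMap _ h1 p⟩
  refine (congrArg (completionLift _ h1) (tower O (MvPoly V O) _ o)).trans ?_
  rw [completionLift_algebraMap]
  exact (aeval y).commutes o

end DiscRing

section DiscRingHom

variable {O : Type u} [CommRing O] [IsLocalRing O] {V : Type} (x : V → ResF O)
  [IsNoetherianRing O] [Finite V]

lemma hasSameResidueField_discRing : HasSameResidueField O (DiscRing x) :=
  hasSameResidueField_iff.2 (residue_completion _ (sub_C_mem_ptIdeal x))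

variable {x} in
lemma discRing_algHom_ext {A : Type u} [CommRing A] [IsLocalRing A] [Algebra O A]
    [IsLocalHom (amap O A)] [IsHausdorff (maxId A) A] (hA : HasSameResidueField O A)
    {f g : DiscRing x →ₐ[O] A} (h : ∀ v, f (toDisc x (.X v)) = g (toDisc x (.X v))) : f = g := by
  ext s
  have h0 : ∀ p, f (toDisc x p) = g (toDisc x p) := fun p => by
    have : f.comp (toAlgHom O (MvPoly V O) _) = g.comp (toAlgHom O (MvPoly V O) _) := MvPolynomial.algHom_ext fun v => h v
    exact cfun this p
  rw [← sub_eq_zero]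
  refine haus ‹_› _ fun k => ?_
  obtain ⟨p, hp⟩ := exists_sub_mem_pow (IsNoetherian.noetherian (ptIdeal x)) s k
  rw [← maximalIdeal_adicCompletion] at hp
  rw [smul_eq_mul, mul_top, SModEq.zero]
  have h1 := Ideal.sub_mem _ (hA.map_mem_pow f hp) (hA.map_mem_pow g hp)
  rwa [map_sub, map_sub, h0, sub_sub_sub_cancel_right] at h1

lemma residue_discRing_X (v : V) : residue (DiscRing x) (toDisc x (.X v)) = ResidueField.map (amap O (DiscRing x)) (x v) := by
  obtain ⟨o, ho⟩ := residue_surjective (x v)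
  rw [← ho, ResidueField.map_residue, ← sub_eq_zero, ← map_sub, residue_eq_zero_iff, tower O (MvPoly V O), ← map_sub]
  refine algebraMap_mem_discRing x ?_
  rw [RingHom.mem_ker, map_sub, aeval_X, algebraMap_eq, aeval_C, ← ho]
  exact sub_self _

end DiscRingHom

section Truncation

variable {R : Type*} [CommRing R] [IsLocalRing R]

instance isLocalRing_quotient_pow (k : ℕ) : IsLocalRing (R ⧸ maxId R ^ (k + 1)) := by
  have : Nontrivial (R ⧸ maxId R ^ (k + 1)) := Ideal.Quotient.nontrivial_iff.2 fun h =>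
    (maximalIdeal.isMaximal R).ne_top (top_le_iff.1 (h.symm.le.trans (Ideal.pow_le_self k.succ_ne_zero)))
  exact .of_surjective' _ mk_surjective

lemma isNilpotent_maximalIdeal_quotient (k : ℕ) : IsNilpotent (maxId (R ⧸ maxId R ^ (k + 1))) := by
  refine ⟨k + 1, ?_⟩
  have h : maxId (R ⧸ maxId R ^ (k + 1)) ≤ (maxId R).map (modId (maxId R ^ (k + 1))) := by
    intro a ha
    obtain ⟨a, rfl⟩ := mk_surjective a
    exact mem_map_of_mem _ fun h => ha (h.map _)
  have := pow_right_mono h (k + 1)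
  rwa [← Ideal.map_pow, Ideal.map_quotient_self, le_bot_iff] at this

instance isArtinianRing_quotient_pow [IsNoetherianRing R] (k : ℕ) : IsArtinianRing (R ⧸ maxId R ^ (k + 1)) :=
  (isArtinianRing_iff_isNilpotent_maximalIdeal _).2 (isNilpotent_maximalIdeal_quotient k)

lemma eq_of_forall_mk_eq [IsHausdorff (maxId R) R] {a b : R} (h : ∀ k, modId (maxId R ^ (k + 1)) a = modId _ b) : a = b := by
  rw [← sub_eq_zero]
  refine haus ‹_› _ fun k => ?_
  rw [smul_eq_mul, mul_top, SModEq.zero]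
  exact pow_le_pow_right k.le_succ (Ideal.Quotient.eq.1 (h k))

lemma matrix_eq_of_forall_mk_eq [IsHausdorff (maxId R) R] {ι κ : Type*} {a b : Matrix ι κ R}
    (h : ∀ k, a.map (modId (maxId R ^ (k + 1))) = b.map (modId _)) : a = b := by
  ext i j
  exact eq_of_forall_mk_eq fun k => congrFun (congrFun (h k) i) j

end Truncation

section Representations

variable {G : Type v} [Group G] {n : ℕ} {A A' : Type*} [CommRing A] [CommRing A']

/-- Base change of a representation. -/
abbrev mapGL (f : A →+* A') (r : G →* GL (Fin n) A) : G →* GL (Fin n) A' := (GLmap f).comp r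

lemma mapGL_apply (f : A →+* A') (r : G →* GL (Fin n) A) (g : G) :
    (mapGL f r g : Mat (Fin n) A') = (r g : Mat (Fin n) A).map f := rfl

lemma mapGL_ext {r r' : G →* GL (Fin n) A} (h : ∀ g, (r g : Mat (Fin n) A) = r' g) : r = r' :=
  MonoidHom.ext fun g => Units.ext (h g)

lemma mapGL_entry {A'' : Type*} [CommRing A''] {f : A →+* A'} {f' : A'' →+* A'}
    {r : G →* GL (Fin n) A} {r' : G →* GL (Fin n) A''} (h : mapGL f r = mapGL f' r') (g : G) (i j : Fin n) :
    f ((r g : Mat (Fin n) A) i j) = f' ((r' g : Mat (Fin n) A'') i j) := by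
  have h1 : (r g : Mat (Fin n) A).map f = (r' g : Mat (Fin n) A'').map f' := congrArg Units.val (cfun h g)
  exact congrFun (congrFun h1 i) j

lemma mem_ker_mapGL_iff {f : A →+* A'} {r : G →* GL (Fin n) A} {g : G} : g ∈ (mapGL f r).ker ↔ ∀ i j, (r g : Mat (Fin n) A) i j -
      (1 : Mat (Fin n) A) i j ∈ ker f := by
  rw [mem_ker, ← Units.val_inj, mapGL_apply, val_one, ← Matrix.ext_iff]
  refine forall₂_congr fun i j => ?_
  rw [RingHom.mem_ker, map_sub, sub_eq_zero, map_apply, Matrix.one_apply, Matrix.one_apply]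
  split_ifs <;> simp

variable [TopologicalSpace G] [IsTopologicalGroup G]

lemma isOpen_ker_mapGL_mono {A'' : Type*} [CommRing A''] {f : A →+* A'} {g : A →+* A''}
    (h : ker f ≤ ker g) {r : G →* GL (Fin n) A} (hr : IsOpen ((mapGL f r).ker : Set G)) : IsOpen ((mapGL g r).ker : Set G) :=
  isOpen_mono (fun _ ha => mem_ker_mapGL_iff.2 fun i j =>
    h (mem_ker_mapGL_iff.1 ha i j)) hr

end Representations

section Deformation

variable {O : Type u} [CommRing O] [IsLocalRing O] {G : Type v} [Group G] [TopologicalSpace G]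
  [IsTopologicalGroup G] {n : ℕ} {rbar : G →* GL (Fin n) (ResF O)}
  {R : Type u} [CommRing R] [IsLocalRing R] [Algebra O R] [IsLocalHom (amap O R)]
  {ρ : G →* GL (Fin n) R}
  {A : Type u} [CommRing A] [IsLocalRing A] [Algebra O A] [IsLocalHom (amap O A)]

lemma residue_mapGL (hA : HasSameResidueField O A) (f : R →ₐ[O] A) (h : mapGL (residue R) ρ = mapGL (Res(O, R)) rbar) :
    mapGL (residue A) (mapGL (f : R →+* A) ρ) = mapGL (Res(O, A)) rbar := by
  refine mapGL_ext fun g => ?_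
  ext i j
  exact hA.residue_map f (mapGL_entry h g i j)

lemma isOpen_ker_mapGL (hA : HasSameResidueField O A) (hm : IsNilpotent (maxId A)) (f : R →ₐ[O] A)
    (h : ∀ k : ℕ, IsOpen ((mapGL (modId (maxId R ^ k)) ρ).ker : Set G)) : IsOpen ((mapGL (f : R →+* A) ρ).ker : Set G) := by
  obtain ⟨c, hc⟩ := hm
  refine isOpen_ker_mapGL_mono ?_ (h c)
  intro a ha
  have := hA.map_mem_pow f (eq_zero_iff_mem.1 ha)
  rw [hc] at this
  exact this

lemma IsContinuousLift.map (hρ : IsContinuousLift rbar ρ) (hA : HasSameResidueField O A)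
    (hm : IsNilpotent (maxId A)) (f : R →ₐ[O] A) : IsContinuousLift rbar (mapGL (f : R →+* A) ρ) :=
  ⟨residue_mapGL hA f hρ.1, fun k => by
    refine isOpen_ker_mapGL_mono (f := RingHom.id A) (fun a ha => ?_) (isOpen_ker_mapGL hA hm f hρ.2)
    rw [(show a = 0 from ha)]
    exact Ideal.zero_mem _⟩

variable {R' : Type u} [CommRing R'] [IsLocalRing R'] [Algebra O R'] [IsLocalHom (amap O R')]
  {ρ' : G →* GL (Fin n) R'}

namespace IsFramedDeformationRing

lemma algHom_ext (h : IsFramedDeformationRing rbar R ρ) (hR' : HasSameResidueField O R')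
    [IsNoetherianRing R'] [IsHausdorff (maxId R') R'] (hρ' : IsContinuousLift rbar ρ')
    {f g : R →ₐ[O] R'} (hf : mapGL (f : R →+* R') ρ = ρ') (hg : mapGL (g : R →+* R') ρ = ρ') : f = g := by
  ext a
  refine eq_of_forall_mk_eq fun k => ?_
  obtain ⟨e, -, he⟩ := h.universal _ (hR'.quotient (maxId R' ^ (k + 1))) _
    (hρ'.map (hR'.quotient _) (isNilpotent_maximalIdeal_quotient k) (mkₐ O _))
  have h1 := he ((mkₐ O _).comp f) (by
    change mapGL (modId (maxId R' ^ (k + 1))) (mapGL (f : R →+* R') ρ) = _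
    rw [hf]; rfl)
  have h2 := he ((mkₐ O _).comp g) (by
    change mapGL (modId (maxId R' ^ (k + 1))) (mapGL (g : R →+* R') ρ) = _
    rw [hg]; rfl)
  exact cfun (h1.trans h2.symm) a

lemma exists_algHom (h : IsFramedDeformationRing rbar R ρ) (hR' : HasSameResidueField O R')
    [IsNoetherianRing R'] [IsAdicComplete (maxId R') R'] (hρ' : IsContinuousLift rbar ρ') :
    ∃ f : R →ₐ[O] R', mapGL (f : R →+* R') ρ = ρ' := by
  choose e he he' using fun k => h.universal _ (hR'.quotient (maxId R' ^ (k + 1))) _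
    (hρ'.map (hR'.quotient _) (isNilpotent_maximalIdeal_quotient k) (mkₐ O _))
  have hle : ∀ {k l : ℕ}, k ≤ l → maxId R' ^ l ≤ maxId R' ^ k := fun hkl => pow_le_pow_right hkl
  have hcomp : ∀ {k l : ℕ} (hkl : k ≤ l), (factorₐ O (hle (Nat.succ_le_succ hkl))).comp (e l) = e k := fun {k l} hkl => by
    refine he' k _ (mapGL_ext fun g => ?_)
    ext i j
    exact congrArg (factorₐ O (hle (Nat.succ_le_succ hkl))) (mapGL_entry (he l) g i j)
  let F : ∀ k, R →ₐ[O] R' ⧸ maxId R' ^ k := fun k =>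
    (factorₐ O (hle k.le_succ)).comp (e k)
  have hF : ∀ {k l : ℕ} (hkl : k ≤ l), (factorₐ O (hle hkl)).comp (F l) = F k := by
    intro k l hkl
    change _ = (factorₐ O (hle k.le_succ)).comp (e k)
    rw [← hcomp hkl]
    ext a
    simp only [AlgHom.comp_apply, F]
    generalize e l a = c
    obtain ⟨b, rfl⟩ := mk_surjective c
    rfl
  refine ⟨IsAdicComplete.liftAlgHom _ F hF, mapGL_ext fun g => matrix_eq_of_forall_mk_eq fun k => ?_⟩
  ext i j
  have h1 := IsAdicComplete.mk_liftAlgHom (maxId R') F hF (k + 1) ((ρ g : Mat (Fin n) R) i j)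
  refine h1.trans ?_
  have h2 : F (k + 1) = e k := hcomp k.le_succ
  rw [h2]
  exact mapGL_entry (he k) g i j

lemma exists_algEquiv (h : IsFramedDeformationRing rbar R ρ) (h' : IsFramedDeformationRing rbar R' ρ') :
    ∃ e : R ≃ₐ[O] R', mapGL (e : R →+* R') ρ = ρ' := by
  have := h.noetherian
  have := h'.noetherian
  have := h.complete
  have := h'.complete
  obtain ⟨f, hf⟩ := h.exists_algHom h'.residueField h'.lift
  obtain ⟨g, hg⟩ := h'.exists_algHom h.residueField h.lift
  refine ⟨AlgEquiv.ofAlgHom f g ?_ ?_, hf⟩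
  · refine h'.algHom_ext h'.residueField h'.lift ?_ (g := AlgHom.id O R') rfl
    change mapGL (f : R →+* R') (mapGL (g : R' →+* R) ρ') = _
    rw [hg, hf]
  · refine h.algHom_ext h.residueField h.lift ?_ (g := AlgHom.id O R) rfl
    change mapGL (g : R' →+* R) (mapGL (f : R →+* R') ρ) = _
    rw [hf, hg]

end IsFramedDeformationRing

end Deformation

lemma exists_limit_rep {G : Type*} [Group G] {n : ℕ} {R : Type*} [CommRing R] [IsLocalRing R] [IsAdicComplete (maxId R) R]
    {r : ∀ k, G →* GL (Fin n) (R ⧸ maxId R ^ (k + 1))} (hcomp : ∀ {k l : ℕ} (hkl : k ≤ l),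
      mapGL (factorPow (maxId R) (Nat.add_le_add_right hkl 1)) (r l) = r k) : ∃ ρ : G →* GL (Fin n) R,
      ∀ k, mapGL (modId (maxId R ^ (k + 1))) ρ = r k := by
  have hM : ∀ (g : G) (i j : Fin n), ∃ a : R, ∀ k,
      modId (maxId R ^ (k + 1)) a = (r k g : Mat (Fin n) (R ⧸ maxId R ^ (k + 1))) i j := by
    intro g i j
    choose a ha using fun k => mk_surjective ((r k g : Mat (Fin n) (R ⧸ maxId R ^ (k + 1))) i j)
    have hak : ∀ {k l : ℕ}, k ≤ l → modId (maxId R ^ (k + 1)) (a l) = modId _ (a k) := fun {k l} hkl => by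
      rw [ha k]
      have h1 := mapGL_entry (f' := RingHom.id _) (hcomp hkl) g i j
      rw [← ha l] at h1
      exact h1
    obtain ⟨b, hb⟩ := IsPrecomplete.prec' (I := maxId R) (M := R) a (fun {k l} hkl => by
      rw [smul_eq_mul, mul_top, SModEq.sub_mem]
      exact pow_le_pow_right k.le_succ (Ideal.Quotient.eq.1 (hak hkl).symm))
    refine ⟨b, fun k => ?_⟩
    rw [← ha, ← hak k.le_succ, eq_comm, Ideal.Quotient.eq]
    have := hb (k + 1)
    rwa [smul_eq_mul, mul_top, SModEq.sub_mem] at this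
  choose M hM' using hM
  have hMk : ∀ g k, (Matrix.of (M g)).map (modId (maxId R ^ (k + 1))) = r k g := fun g k => by ext i j; exact hM' g i j k
  let ρ : G →* GL (Fin n) R := MonoidHom.toHomUnits
    { toFun := fun g => Matrix.of (M g)
      map_one' := matrix_eq_of_forall_mk_eq fun k => by
        rw [hMk, map_one, Matrix.map_one _ (map_zero _) (map_one _), val_one]
      map_mul' := fun g g' => matrix_eq_of_forall_mk_eq fun k => by
        rw [hMk, Matrix.map_mul, hMk, hMk, map_mul, val_mul] }
  exact ⟨ρ, fun k => mapGL_ext fun g => hMk g k⟩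

instance finite_chain_index (k : ℕ) : Finite {i : ℕ // i + 1 < k} :=
  Set.Finite.to_subtype ((Set.finite_lt_nat k).subset fun _ h => Nat.lt_of_succ_lt h)

namespace IsTameResidual

variable {p : ℕ} [Fact p.Prime] {ℓ : ℕ} [Fact ℓ.Prime] {L : Type v} [Field L] [Algebra ℚ_[p] L]
  [FinDim ℚ_[p] L] {O : Type u} [CommRing O] [IsLocalRing O] {n : ℕ}
  {φ : GalGroup L} {σ : inertia p L}
  {rbar : GalGroup L →* GL (Fin n) (ResF O)}
  {B : FrobeniusBlocks (residueCard p L) (rbar φ : Mat (Fin n) (ResF O))}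

variable (σ B) in
/-- The ring `R` with the tuple `y` pro-represents the tuples which satisfy the chain relations and
reduce to the base point. -/
structure IsPointRing (R : Type u) [CommRing R] [IsLocalRing R] [Algebra O R]
    [IsLocalHom (amap O R)] (y : B.AllVar → R) : Prop where
  noetherian : IsNoetherianRing R
  complete : IsAdicComplete (maxId R) R
  residueField : HasSameResidueField O R
  reduces : FrobeniusBlocks.Lift.Reduces (basePoint B σ) y
  chain : Chain(B, y)
  universal : ∀ (A : Type u) [CommRing A] [IsLocalRing A] [IsArtinianRing A] [Algebra O A]
    [IsLocalHom (amap O A)], HasSameResidueField O A → ∀ z : B.AllVar → A,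
    FrobeniusBlocks.Lift.Reduces (basePoint B σ) z → Chain(B, z) → ∃! f : R →ₐ[O] A, ∀ v, f (y v) = z v

variable (B) in
/-- The ideal generated by the chain relations. -/
def chainIdeal : Ideal (MvPoly B.AllVar O) := span (Set.range fun e : B.Ix × B.Ix =>
    (B.xmat mvX * B.nmat mvX - B.nmat mvX * B.xmat mvX : Mat B.Ix (MvPoly B.AllVar O)) e.1 e.2)

lemma chainIdeal_le_ker_iff {A : Type*} [CommRing A] (f : MvPoly B.AllVar O →+* A) :
    chainIdeal B ≤ ker f ↔ Chain(B, (f ∘ mvX)) := by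
  rw [chainIdeal, span_le, Set.range_subset_iff, Prod.forall, ← sub_eq_zero (a := _ * _),
    ← B.xmat_map, ← B.nmat_map, ← Matrix.map_mul, ← Matrix.map_mul, ← Matrix.map_sub _ (map_sub f), ← Matrix.ext_iff]
  rfl

lemma exists_isPointRing [IsNoetherianRing O] (H : IsTameResidual ℓ φ σ rbar) (C : B.Lift) :
    ∃ (_ : IsLocalRing (DiscRing (basePoint B σ) ⧸ (chainIdeal B).map (toDisc (basePoint B σ)))) (_ : IsLocalHom (amap O
      (DiscRing (basePoint B σ) ⧸ (chainIdeal B).map (toDisc (basePoint B σ))))),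
    IsPointRing σ B (DiscRing (basePoint B σ) ⧸ (chainIdeal B).map (toDisc (basePoint B σ)))
      fun v => modId _ (toDisc _ (mvX v)) := by
  set x := basePoint B σ with hx
  set J := (chainIdeal B).map (toDisc x) with hJ
  have hJm : J ≤ maxId (DiscRing x) := by
    rw [hJ, map_le_iff_le_comap]
    intro a ha
    refine algebraMap_mem_discRing x ?_
    have h1 := (chainIdeal_le_ker_iff (B := B) (aeval (R := O) x).toRingHom).2
    have h2 : ⇑(aeval (R := O) x).toRingHom ∘ mvX = x := funext fun v => aeval_X _ v
    rw [h2] at h1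
    exact h1 (H.residual_chain B C).1 ha
  have : Nontrivial (DiscRing x ⧸ J) := Ideal.Quotient.nontrivial_iff.2 fun h =>
    (maximalIdeal.isMaximal _).ne_top (top_le_iff.1 (h.symm.le.trans hJm))
  have hloc : IsLocalRing (DiscRing x ⧸ J) := .of_surjective' _ mk_surjective
  have hlocH : IsLocalHom (amap O (DiscRing x ⧸ J)) := inferInstance
  have hsame : HasSameResidueField O (DiscRing x ⧸ J) := (hasSameResidueField_discRing x).quotient J
  have : Module.Finite (DiscRing x) (DiscRing x ⧸ J) := inferInstance
  refine ⟨hloc, hlocH, inferInstance, isAdicComplete_of_finite (R := DiscRing x), hsame,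
    fun v => hsame.residue_map (mkₐ O J) (residue_discRing_X x v), ?_, ?_⟩
  · refine (chainIdeal_le_ker_iff ((modId J).comp (toDisc x))).1 fun a ha => ?_
    exact eq_zero_iff_mem.2 (mem_map_of_mem _ ha)
  · intro A _ _ _ _ _ hA z hz hch
    obtain ⟨c, hc⟩ := (isArtinianRing_iff_isNilpotent_maximalIdeal A).1 inferInstance
    have : IsAdicComplete (maxId A) A := by
      have : IsAdicComplete (⊥ : Ideal A) A := inferInstance
      exact isAdicComplete_of_pow_le c.succ_pos (by rw [pow_succ, hc]; simp) bot_le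
    obtain ⟨f, hf⟩ := exists_discRing_algHom x hz
    have hfX : ⇑((f : DiscRing x →+* A).comp (toDisc x)) ∘ mvX = z := by
      funext v
      exact (hf _).trans (aeval_X _ v)
    have hfJ : ∀ a ∈ J, f a = 0 := by
      have h1 := (chainIdeal_le_ker_iff (B := B) ((f : DiscRing x →+* A).comp (toDisc x))).2
      rw [hfX] at h1
      have h2 : J ≤ ker (f : DiscRing x →+* A) := map_le_iff_le_comap.2 (h1 hch)
      exact fun a ha => h2 ha
    refine ⟨liftₐ J f hfJ, fun v => congrFun hfX v, fun g hg => ?_⟩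
    refine Ideal.Quotient.algHom_ext _ (discRing_algHom_ext hA fun v => ?_)
    exact (hg v).trans (congrFun hfX v).symm

variable {R : Type u} [CommRing R] [IsLocalRing R] [Algebra O R] [IsLocalHom (amap O R)]
  {y : B.AllVar → R}

lemma mapGL_eq_of_matches (C : B.Lift) (H : IsTameResidual ℓ φ σ rbar) {A : Type u} [CommRing A]
    [IsLocalRing A] [Algebra O A] [IsLocalHom (amap O A)] [Finite A] (c : R →ₐ[O] A)
    (hA : HasSameResidueField O A) (hm : IsNilpotent (maxId A)) {z : B.AllVar → A}
    (hz : ∀ v, c (y v) = z v) {r : GalGroup L →* GL (Fin n) R}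
    {s : GalGroup L →* GL (Fin n) A} (hr : OpenKer (mapGL (c : R →+* A) r)) (hs : OpenKer s)
    (hr' : mapGL (residue R) r = mapGL (Res(O, R)) rbar) (hs' : mapGL (residue A) s = mapGL (Res(O, A)) rbar)
    (hred : FrobeniusBlocks.Lift.Reduces (basePoint B σ) z)
    (h : C.Matches σ r y) (h' : C.Matches σ s z) : mapGL (c : R →+* A) r = s := by
  have h1 := matches_map C H c h
  rw [show c ∘ y = z from funext hz] at h1
  exact lift_unique C H hm hr hs (residue_mapGL hA c hr') hs' hred h1 h'

/-- A point ring is a framed deformation ring. -/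
lemma IsPointRing.exists_isFramedDeformationRing (hR : IsPointRing σ B R y) (H : IsTameResidual ℓ φ σ rbar) (C : B.Lift) :
    ∃ ρ : GalGroup L →* GL (Fin n) R, IsFramedDeformationRing rbar R ρ ∧ C.Matches σ ρ y := by
  have := H.finite
  have := hR.noetherian
  have := hR.complete
  have hn : IsUnit (n.factorial : R) := H.factorial_algebra
  let A : ℕ → Type u := fun k => R ⧸ maxId R ^ (k + 1)
  let q : ∀ k, R →ₐ[O] A k := fun k => mkₐ O _
  have hA : ∀ k, HasSameResidueField O (A k) := fun k => hR.residueField.quotient _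
  have hnil : ∀ k, IsNilpotent (maxId (A k)) := fun k => isNilpotent_maximalIdeal_quotient k
  have hfin : ∀ k, Finite (A k) := fun k => (hA k).finite (hnil k)
  have hred : ∀ {S : Type u} [CommRing S] [IsLocalRing S] [Algebra O S]
      [IsLocalHom (amap O S)], HasSameResidueField O S → ∀ (f : R →ₐ[O] S),
      FrobeniusBlocks.Lift.Reduces (basePoint B σ) (f ∘ y) := fun hS f v => hS.residue_map f (hR.reduces v)
  have hch : ∀ {S : Type u} [CommRing S] [Algebra O S] (f : R →ₐ[O] S), Chain(B, (f ∘ y)) := fun f => by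
    have := congrArg (fun M : Mat B.Ix R => M.map f.toRingHom) hR.chain
    simp only [Matrix.map_mul, B.xmat_map, B.nmat_map] at this
    exact this
  choose r hro hrr hrm using fun k =>
    H.exists_lift_of_point C (hnil k) (hred (hA k) (q k)) (hch (q k))
  have hcomp : ∀ {k l : ℕ} (hkl : k ≤ l),  mapGL (factorPow (maxId R) (Nat.add_le_add_right hkl 1)) (r l) = r k := by
    intro k l hkl
    exact mapGL_eq_of_matches C H (factorₐ O (pow_le_pow_right (Nat.add_le_add_right hkl 1)) : A l →ₐ[O] A k) (hA k) (hnil k)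
      (fun v => rfl) (isOpen_mono (fun g hg => by
        rw [mem_ker, comp_apply, mem_ker.1 hg, map_one]) (hro l)) (hro k) (hrr l) (hrr k) (hred (hA k) (q k)) (hrm l) (hrm k)
  obtain ⟨ρ, hρ⟩ := exists_limit_rep hcomp
  have hmatch : C.Matches σ ρ y := by
    have h1 : ∀ k, (C.frame y).map (modId (maxId R ^ (k + 1))) = C.frame (q k ∘ y) := fun k => frame_map C (q k) y
    have h2 : ∀ k, (C.dmat y).map (modId (maxId R ^ (k + 1))) = C.dmat (q k ∘ y) := fun k => C.dmat_map (q k) y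
    have h3 : ∀ k, (truncExp R n (B.nmat y)).map (modId (maxId R ^ (k + 1))) = truncExp (A k) n (B.nmat (q k ∘ y)) := fun k => by
      have h4 := ringHom_truncExp hn (modId (maxId R ^ (k + 1))) (modId (maxId R ^ (k + 1))).mapMatrix
        (mapMatrix_algebraMap (ι := B.Ix) _) (B.nmat y)
      rw [mapMatrix_apply, mapMatrix_apply, B.nmat_map] at h4
      exact h4
    constructor <;> refine matrix_eq_of_forall_mk_eq fun k => ?_
    · rw [Matrix.map_mul, Matrix.map_mul, h1, h2, ← (hrm k).1, ← mapGL_apply, hρ]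
    · rw [Matrix.map_mul, Matrix.map_mul, h1, h3, ← (hrm k).2, ← mapGL_apply, hρ]
  have hlift : IsContinuousLift rbar ρ := by
    constructor
    · refine mapGL_ext fun g => ?_
      ext i j
      have h1 := mapGL_entry (hrr 0) g i j
      have : IsLocalHom (modId (maxId R ^ (0 + 1))) := IsLocalHom.of_surjective _ mk_surjective
      apply (ResidueField.map (modId (maxId R ^ (0 + 1)))).injective
      refine (congrArg (residue (A 0)) (mapGL_entry (f' := RingHom.id _) (hρ 0) g i j)).trans (h1.trans ?_)
      obtain ⟨o, ho⟩ := residue_surjective ((rbar g : Mat (Fin n) (ResF O)) i j)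
      change _ = ResidueField.map _ (ResidueField.map _ ((rbar g : Mat (Fin n) (ResF O)) i j))
      rw [← ho]
      rfl
    · intro k
      refine isOpen_ker_mapGL_mono (f := modId (maxId R ^ (k + 1))) ?_ ?_
      · rw [mk_ker, mk_ker]
        exact pow_le_pow_right k.le_succ
      · rw [hρ]
        exact hro k
  refine ⟨ρ, ⟨hR.noetherian, hR.complete, hR.residueField, hlift, ?_⟩, hmatch⟩
  intro S _ _ _ _ _ hS s hs
  have hm := (isArtinianRing_iff_isNilpotent_maximalIdeal S).1 inferInstance
  have := hS.finite hm
  have hso : OpenKer s := isOpen_ker_mapGL hS hm (AlgHom.id O S) hs.2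
  obtain ⟨z, hz, hzc, hzm⟩ := H.exists_point_of_lift C hm hso hs.1
  obtain ⟨f, hf, huniq⟩ := hR.universal S hS z hz hzc
  refine ⟨f, ?_, fun f' hf' => huniq f' ?_⟩
  · exact mapGL_eq_of_matches C H f hS hm hf (isOpen_ker_mapGL hS hm f hlift.2) hso hlift.1 hs.1 hz hmatch hzm
  · have h1 := matches_map C H f' hmatch
    rw [show (GLmap (f' : R →+* S)).comp ρ = s from hf'] at h1
    exact congrFun (point_unique C H hm (hred hS f') hz h1 hzm)

end IsTameResidual

section GradedNilpotent

open Module Submodule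

variable {K : Type*} [Field K] {V V' W W' : Type*} [AddCommGroup V] [Module K V] [AddCommGroup V']
  [Module K V'] [AddCommGroup W] [Module K W] [AddCommGroup W'] [Module K W']

lemma exists_linearMap_glue {S C : Submodule K V} (h : Disjoint S C) (f g : V →ₗ[K] V') :
    ∃ e : V →ₗ[K] V', (∀ v ∈ S, e v = f v) ∧ ∀ v ∈ C, e v = g v := by
  obtain ⟨C', hC, hC'⟩ := h.exists_isCompl
  exact ⟨LinearMap.ofIsCompl hC' (f.domRestrict C') (g.domRestrict C),
    fun v hv => LinearMap.ofIsCompl_apply_left hC' (φ := f.domRestrict C') ⟨v, hC hv⟩,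
    fun v hv => LinearMap.ofIsCompl_apply_right hC' (ψ := g.domRestrict C) ⟨v, hv⟩⟩

lemma exists_relative_compl {S T : Submodule K V} (h : S ≤ T) : ∃ C ≤ T, Disjoint S C ∧ S ⊔ C = T := by
  obtain ⟨C, hC⟩ := S.exists_isCompl
  refine ⟨C ⊓ T, inf_le_right, hC.disjoint.mono_right inf_le_left, ?_⟩
  rw [← sup_inf_assoc_of_le C h, hC.sup_eq_top, top_inf_eq]

lemma finrank_map_of_injOn [FinDim K V] {S : Submodule K V} {f : V →ₗ[K] V'}
    (hf : ∀ v ∈ S, f v = 0 → v = 0) : finrank K (S.map f) = finrank K S := by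
  have h1 : Injective (f.domRestrict S) := by
    rw [injective_iff_map_eq_zero]
    exact fun v hv => Subtype.ext (hf v v.2 hv)
  have h2 := LinearMap.finrank_range_of_inj h1
  rwa [range_domRestrict] at h2

lemma finrank_map_add_inf_ker [FinDim K V] (Q : Submodule K V) (N : V →ₗ[K] W) :
    finrank K (Q.map N) + finrank K (Q ⊓ LinearMap.ker N : Submodule K V) = finrank K Q := by
  have h := LinearMap.finrank_range_add_finrank_ker (N.domRestrict Q)
  rw [range_domRestrict, LinearMap.ker_domRestrict] at h
  rw [← h, ← finrank_map_subtype_eq, map_comap_subtype]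

/-- An injective map on a subspace extends to a larger subspace. -/
lemma exists_injOn_extension [FinDim K V] [FinDim K V'] {S T : Submodule K V}
    {T' : Submodule K V'} (hST : S ≤ T) {f : V →ₗ[K] V'} (hf : ∀ v ∈ S, f v = 0 → v = 0)
    (hfT : S.map f ≤ T') (hd : finrank K T = finrank K T') :
    ∃ e : V →ₗ[K] V', (∀ v ∈ S, e v = f v) ∧ (∀ v ∈ T, e v = 0 → v = 0) ∧ T.map e ≤ T' := by
  obtain ⟨C, hCT, hC, hC'⟩ := exists_relative_compl hST
  obtain ⟨D, hDT, hD, hD'⟩ := exists_relative_compl hfT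
  have h1 := finrank_sup_add_finrank_inf_eq S C
  have h2 := finrank_sup_add_finrank_inf_eq (S.map f) D
  rw [hC', hC.eq_bot, finrank_bot] at h1
  rw [hD', hD.eq_bot, finrank_bot, finrank_map_of_injOn hf] at h2
  let e₀ : C ≃ₗ[K] D := LinearEquiv.ofFinrankEq _ _ (by omega)
  obtain ⟨g, hg⟩ := LinearMap.exists_extend (D.subtype ∘ₗ e₀.toLinearMap)
  have hg' : ∀ c : C, g c = e₀ c := fun c => cfun hg c
  obtain ⟨e, he, he'⟩ := exists_linearMap_glue hC f g
  refine ⟨e, he, fun v hv hev => ?_, ?_⟩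
  · rw [← hC', mem_sup] at hv
    obtain ⟨s, hs, c, hc, rfl⟩ := hv
    rw [map_add, he s hs, he' c hc, hg' ⟨c, hc⟩] at hev
    have h3 : f s = 0 := by
      refine disjoint_def.1 hD (f s) (Submodule.mem_map_of_mem hs) ?_
      rw [eq_neg_of_add_eq_zero_left hev]
      exact D.neg_mem (e₀ ⟨c, hc⟩).2
    rw [h3, zero_add] at hev
    have h4 : (⟨c, hc⟩ : C) = 0 := e₀.injective (by rw [map_zero]; exact Subtype.ext hev)
    rw [hf s hs h3, zero_add]
    exact congrArg Subtype.val h4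
  · rw [← hC', Submodule.map_sup, sup_le_iff]
    constructor
    · rintro _ ⟨s, hs, rfl⟩
      rw [he s hs]
      exact hfT (Submodule.mem_map_of_mem hs)
    · rintro _ ⟨c, hc, rfl⟩
      rw [he' c hc, hg' ⟨c, hc⟩]
      exact hDT (e₀ ⟨c, hc⟩).2

lemma exists_intertwining_extension [FinDim K V] [FinDim K V']
    {P Q : Submodule K V} {P' Q' : Submodule K V'} (hPQ : P ≤ Q) (hPQ' : P' ≤ Q')
    {f : V →ₗ[K] V'} {g : W →ₗ[K] W'} {N : V →ₗ[K] W} {N' : V' →ₗ[K] W'}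
    (hf : ∀ v ∈ P, f v = 0 → v = 0) (hfP : P.map f = P') (hfN : ∀ v ∈ P, N' (f v) = g (N v))
    (hg : ∀ w ∈ Q.map N, g w = 0 → w = 0) (hgQ : (Q.map N).map g = Q'.map N')
    (hd : finrank K Q = finrank K Q') (hd' : finrank K (Q.map N) = finrank K (Q'.map N')) :
    ∃ e : V →ₗ[K] V', (∀ v ∈ P, e v = f v) ∧ (∀ v ∈ Q, e v = 0 → v = 0) ∧ Q.map e = Q' ∧ ∀ v ∈ Q, N' (e v) = g (N v) := by
  have h1 := finrank_map_add_inf_ker Q N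
  have h2 := finrank_map_add_inf_ker Q' N'
  obtain ⟨e, he, heT, heT'⟩ := exists_injOn_extension (S := P ⊓ LinearMap.ker N)
    (T := Q ⊓ LinearMap.ker N) (T' := Q' ⊓ LinearMap.ker N') (inf_le_inf_right _ hPQ) (f := f) (fun v hv => hf v hv.1) (by
      rintro _ ⟨v, ⟨hv, hv'⟩, rfl⟩
      refine ⟨hPQ' (hfP ▸ Submodule.mem_map_of_mem hv), ?_⟩
      change N' (f v) = 0
      rw [hfN v hv, LinearMap.mem_ker.1 hv', map_zero]) (by omega)
  obtain ⟨C, hCT, hC, hC'⟩ := exists_relative_compl (inf_le_inf_right (LinearMap.ker N) hPQ)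
  have hPC : Disjoint P C := by
    rw [disjoint_def] at hC ⊢
    exact fun v hv hv' => hC v ⟨hv, (hCT hv').2⟩ hv'
  obtain ⟨f₁, hf₁, hf₁'⟩ := exists_linearMap_glue hPC f e
  have hf₁e : ∀ v ∈ Q ⊓ LinearMap.ker N, f₁ v = e v := by
    intro v hv
    rw [← hC', mem_sup] at hv
    obtain ⟨s, hs, c, hc, rfl⟩ := hv
    rw [map_add, map_add, hf₁ s hs.1, he s hs, hf₁' c hc]
  obtain ⟨s, hs⟩ : ∃ s : W' →ₗ[K] V', ∀ w ∈ Q'.map N', s w ∈ Q' ∧ N' (s w) = w := by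
    obtain ⟨t, ht⟩ := (N'.domRestrict Q').rangeRestrict.exists_rightInverse_of_surjective (LinearMap.range_rangeRestrict _)
    obtain ⟨t', ht'⟩ := LinearMap.exists_extend (Q'.subtype ∘ₗ t)
    refine ⟨t', fun w hw => ?_⟩
    rw [← range_domRestrict] at hw
    have h3 : t' w = t ⟨w, hw⟩ := cfun ht' ⟨w, hw⟩
    rw [h3]
    exact ⟨(t ⟨w, hw⟩).2, congrArg Subtype.val (LinearMap.congr_fun ht ⟨w, hw⟩ :)⟩
  have hPK : P ⊔ Q ⊓ LinearMap.ker N ≤ Q := sup_le hPQ inf_le_left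
  obtain ⟨D, hDQ, hD, hD'⟩ := exists_relative_compl hPK
  obtain ⟨f₂, hf₂, hf₂'⟩ := exists_linearMap_glue hD f₁ (s ∘ₗ g ∘ₗ N)
  have hsg : ∀ v ∈ Q, s (g (N v)) ∈ Q' ∧ N' (s (g (N v))) = g (N v) := fun v hv =>
    hs _ (hgQ ▸ Submodule.mem_map_of_mem (Submodule.mem_map_of_mem hv))
  have hP₂ : ∀ v ∈ P, f₂ v = f v := fun v hv =>
    (hf₂ v (mem_sup_left hv)).trans (hf₁ v hv)
  have hK₂ : ∀ v ∈ Q ⊓ LinearMap.ker N, f₂ v = e v := fun v hv =>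
    (hf₂ v (mem_sup_right hv)).trans (hf₁e v hv)
  have key : ∀ v ∈ Q, f₂ v ∈ Q' ∧ N' (f₂ v) = g (N v) := by
    intro v hv
    rw [← hD', mem_sup] at hv
    obtain ⟨a, ha, d, hd, rfl⟩ := hv
    obtain ⟨b, hb, c, hc, rfl⟩ := mem_sup.1 ha
    have hc' := heT' (Submodule.mem_map_of_mem hc)
    have hd' := hsg d (hDQ hd)
    simp only [map_add, hP₂ b hb, hK₂ c hc, hf₂' d hd, LinearMap.comp_apply]
    refine ⟨add_mem (add_mem (hPQ' (hfP ▸ Submodule.mem_map_of_mem hb)) hc'.1) hd'.1, ?_⟩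
    rw [hfN b hb, LinearMap.mem_ker.1 hc'.2, hd'.2, LinearMap.mem_ker.1 hc.2, map_zero]
  have hinj : ∀ v ∈ Q, f₂ v = 0 → v = 0 := by
    intro v hv h0
    have h3 := (key v hv).2
    rw [h0, map_zero] at h3
    have h4 : v ∈ Q ⊓ LinearMap.ker N := ⟨hv, hg _ (Submodule.mem_map_of_mem hv) h3.symm⟩
    exact heT v h4 ((hK₂ v h4).symm.trans h0)
  refine ⟨f₂, hP₂, hinj, ?_, fun v hv => (key v hv).2⟩
  refine eq_of_le_of_finrank_eq (Submodule.map_le_iff_le_comap.2 fun v hv => (key v hv).1) ?_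
  rw [finrank_map_of_injOn hinj, hd]

/-- Graded nilpotent operators with the same ranks are isomorphic. -/
lemma exists_graded_equiv {ι : Type*} {V V' : ι → Type*} [∀ j, AddCommGroup (V j)]
    [∀ j, Module K (V j)] [∀ j, FinDim K (V j)] [∀ j, AddCommGroup (V' j)]
    [∀ j, Module K (V' j)] [∀ j, FinDim K (V' j)] {p : ι → ι}
    {N : ∀ j, V j →ₗ[K] V (p j)} {N' : ∀ j, V' j →ₗ[K] V' (p j)}
    {F : ∀ j, ℕ → Submodule K (V j)} {F' : ∀ j, ℕ → Submodule K (V' j)} {M : ℕ}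
    (h0 : ∀ j, F j 0 = ⊤) (h0' : ∀ j, F' j 0 = ⊤) (hM : ∀ j, F j M = ⊥)
    (hF : ∀ j a, F j (a + 1) ≤ F j a) (hF' : ∀ j a, F' j (a + 1) ≤ F' j a) (hN : ∀ j, (N j = 0 ∧ N' j = 0) ∨
      ∀ a, (F j a).map (N j) = F (p j) (a + 1) ∧ (F' j a).map (N' j) = F' (p j) (a + 1))
    (hd : ∀ j a, finrank K (F j a) = finrank K (F' j a)) : ∃ e : ∀ j, V j ≃ₗ[K] V' j, ∀ j v, N' j (e j v) = e (p j) (N j v) := by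
  have key : ∀ b ≤ M, ∃ f : ∀ j, V j →ₗ[K] V' j, ∀ j, (∀ v ∈ F j (M - b), f j v = 0 → v = 0) ∧
      (F j (M - b)).map (f j) = F' j (M - b) ∧ ∀ v ∈ F j (M - b), N' j (f j v) = f (p j) (N j v) := by
    intro b
    induction b with
    | zero =>
      intro _
      refine ⟨fun _ => 0, fun j => ?_⟩
      have : F' j M = ⊥ := finrank_eq_zero.1 (by rw [← hd, hM, finrank_bot])
      simp [hM, this]
    | succ b ih =>
      intro hb
      obtain ⟨f, hf⟩ := ih (by omega)
      obtain ⟨a, ha⟩ : ∃ a, M - (b + 1) = a := ⟨_, rfl⟩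
      have ha' : M - b = a + 1 := by omega
      rw [ha]
      rw [ha'] at hf
      have step : ∀ j, ∃ e : V j →ₗ[K] V' j, (∀ v ∈ F j (a + 1), e v = f j v) ∧
          (∀ v ∈ F j a, e v = 0 → v = 0) ∧ (F j a).map e = F' j a ∧ ∀ v ∈ F j a, N' j (e v) = f (p j) (N j v) := by
        intro j
        rcases hN j with ⟨h1, h2⟩ | h1
        · exact exists_intertwining_extension (hF j a) (hF' j a) (hf j).1 (hf j).2.1 (hf j).2.2
            (by simp [h1]) (by simp [h1, h2]) (hd j a) (by
              rw [h1, h2, Submodule.map_zero, Submodule.map_zero, finrank_bot, finrank_bot])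
        · refine exists_intertwining_extension (hF j a) (hF' j a) (hf j).1 (hf j).2.1 (hf j).2.2 ?_ ?_ (hd j a) ?_
          · rw [(h1 a).1]
            exact (hf (p j)).1
          · rw [(h1 a).1, (h1 a).2]
            exact (hf (p j)).2.1
          · rw [(h1 a).1, (h1 a).2, hd]
      choose e he using step
      refine ⟨e, fun j => ⟨(he j).2.1, (he j).2.2.1, fun v hv => ?_⟩⟩
      rw [(he j).2.2.2 v hv]
      rcases hN j with ⟨h1, -⟩ | h1
      · simp [h1]
      · exact ((he (p j)).1 _ ((h1 a).1 ▸ Submodule.mem_map_of_mem hv)).symm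
  obtain ⟨f, hf⟩ := key M le_rfl
  rw [Nat.sub_self] at hf
  refine ⟨fun j => ofBijective (f j) ⟨?_, ?_⟩, fun j v => (hf j).2.2 v (by simp [h0])⟩
  · rw [injective_iff_map_eq_zero]
    exact fun v => (hf j).1 v (by simp [h0])
  · rw [← LinearMap.range_eq_top, LinearMap.range_eq_map, ← h0, (hf j).2.1, h0']

lemma map_range_matrix_pow {ι : Type*} [Fintype ι] [DecidableEq ι] (Y : Mat ι K) (a : ℕ) :
    ((Y ^ a).mulVecLin.range).map Y.mulVecLin = (Y ^ (a + 1)).mulVecLin.range := by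
  rw [pow_succ', mulVecLin_mul, range_comp]

lemma range_matrix_pow_le {ι : Type*} [Fintype ι] [DecidableEq ι] (Y : Mat ι K) (a : ℕ) :
    (Y ^ (a + 1)).mulVecLin.range ≤ (Y ^ a).mulVecLin.range := by
  rw [pow_succ, mulVecLin_mul]
  exact LinearMap.range_comp_le_range _ _

/-- Nilpotent matrices whose powers have the same ranks are conjugate. -/
lemma conjugate_of_rank_eq {ι κ : Type*} [Fintype ι] [Fintype κ] [DecidableEq ι] [DecidableEq κ]
    {A : Mat ι K} {B : Mat κ K} (hA : IsNilpotent A) (h : ∀ i, (A ^ i).rank = (B ^ i).rank) : Conjugate A B := by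
  obtain ⟨M, hM⟩ := hA
  obtain ⟨e, he⟩ := exists_graded_equiv (ι := Unit) (V := fun _ => κ → K) (V' := fun _ => ι → K)
    (p := id) (N := fun _ => B.mulVecLin) (N' := fun _ => A.mulVecLin)
    (F := fun _ a => (B ^ a).mulVecLin.range) (F' := fun _ a => (A ^ a).mulVecLin.range) (M := M)
    (by simp) (by simp) (fun _ => finrank_eq_zero.1 (by
      have := h M
      rw [hM, Matrix.rank_zero] at this
      exact this.symm)) (fun _ => range_matrix_pow_le B) (fun _ => range_matrix_pow_le A)
    (fun _ => Or.inr fun a => ⟨map_range_matrix_pow B a, map_range_matrix_pow A a⟩) (fun _ a => (h a).symm)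
  refine ⟨toMatrix' (e ()).toLinearMap, toMatrix' (e ()).symm.toLinearMap, ?_, ?_, ?_⟩
  · rw [← toMatrix'_comp, comp_symm, toMatrix'_id]
  · rw [← toMatrix'_comp, symm_comp, toMatrix'_id]
  · have h1 : A.mulVecLin = (e ()).toLinearMap ∘ₗ B.mulVecLin ∘ₗ (e ()).symm.toLinearMap := by
      refine LinearMap.ext fun v => ?_
      have := he () ((e ()).symm v)
      rw [LinearEquiv.apply_symm_apply] at this
      exact this
    have h2 := congrArg toMatrix' h1
    rw [toMatrix'_comp, toMatrix'_comp, ← toLin'_apply',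
      ← toLin'_apply', toMatrix'_toLin', toMatrix'_toLin', ← Matrix.mul_assoc] at h2
    exact h2

end GradedNilpotent

section Ranks

open Module Submodule

variable {K : Type*} [Field K]

lemma rank_mul_add_rank_mul_le {l m n o : Type*} [Fintype l] [Fintype m] [Fintype n] [Fintype o]
    (A : Matrix l m K) (B : Matrix m n K) (C : Matrix n o K) : (A * B).rank + (B * C).rank ≤ (A * (B * C)).rank + B.rank := by
  have h1 := finrank_map_add_inf_ker B.mulVecLin.range A.mulVecLin
  have h2 := finrank_map_add_inf_ker (B * C).mulVecLin.range A.mulVecLin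
  rw [← range_comp, ← mulVecLin_mul] at h1 h2
  have h4 := finrank_mono (inf_le_inf_right A.mulVecLin.ker
    (mulVecLin_mul B C ▸ LinearMap.range_comp_le_range C.mulVecLin B.mulVecLin))
  simp only [Matrix.rank]
  omega

/-- The projection to the coordinates in the block `s`. -/
abbrev projBlock {ι : Type*} {κ : ι → Type*} (s : ι) : ((Σ s, κ s) → K) →ₗ[K] (κ s → K) := LinearMap.funLeft K K (Sigma.mk s)

variable {ι : Type*} {κ : ι → Type*} [Fintype ι] [∀ s, Fintype (κ s)]

lemma rank_eq_sum_finrank {Y : Mat (Σ s, κ s) K} (hY : ∀ p p' c, Y p c ≠ 0 → Y p' c ≠ 0 → p.1 = p'.1) :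
    Y.rank = ∑ s, finrank K (Y.mulVecLin.range.map (projBlock s)) := by
  classical
  let f : Y.mulVecLin.range →ₗ[K] ∀ s, Y.mulVecLin.range.map (projBlock (κ := κ) s) :=
    LinearMap.pi fun s => ((projBlock s).domRestrict _).codRestrict _ fun v => Submodule.mem_map_of_mem v.2
  have hf : ∀ (v : Y.mulVecLin.range) s (a : κ s), (f v s : κ s → K) a = (v : (Σ s, κ s) → K) ⟨s, a⟩ := fun v s a => rfl
  rw [← finrank_pi_fintype, Matrix.rank]
  refine (ofBijective f ⟨fun v w h => ?_, fun g => ?_⟩).finrank_eq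
  · ext ⟨s, a⟩
    rw [← hf, h, hf]
  · have h1 : ∀ s, ∃ w, ∀ a, (Y.mulVec w) ⟨s, a⟩ = (g s : κ s → K) a := fun s => by
      obtain ⟨_, ⟨w, rfl⟩, hw⟩ := (g s).2
      exact ⟨w, fun a => congrFun hw a⟩
    choose w hw using h1
    let u : (Σ s, κ s) → K := fun c => if h : ∃ p, Y p c ≠ 0 then w h.choose.1 c else 0
    refine ⟨⟨Y.mulVec u, u, rfl⟩, ?_⟩
    ext s a
    rw [hf, ← hw]
    have h4 : ∀ c, Y ⟨s, a⟩ c * u c = Y ⟨s, a⟩ c * w s c := fun c => by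
      by_cases h : Y ⟨s, a⟩ c = 0
      · rw [h, zero_mul, zero_mul]
      · have h2 : ∃ p, Y p c ≠ 0 := ⟨_, h⟩
        have h3 := hY _ _ c h h2.choose_spec
        simp only [u, dif_pos h2, ← h3]
    exact sum_congr rfl fun c _ => h4 c

lemma projBlock_mulVec {Y : Mat (Σ s, κ s) K} {s t : ι} (h : ∀ t', t' ≠ t → blk Y s t' = 0) (w : (Σ s, κ s) → K) :
    projBlock s (Y.mulVec w) = (blk Y s t).mulVec (projBlock t w) := by
  ext a
  change ∑ c, Y ⟨s, a⟩ c * w c = ∑ b, Y ⟨s, a⟩ ⟨t, b⟩ * w ⟨t, b⟩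
  rw [sum_sigma, Fintype.sum_eq_single t]
  intro t' ht'
  refine sum_eq_zero fun b _ => ?_
  rw [show Y ⟨s, a⟩ ⟨t', b⟩ = 0 from congrFun (congrFun (h t' ht') a) b, zero_mul]

lemma map_projBlock_range {Y : Mat (Σ s, κ s) K} {s t : ι} (h : ∀ t', t' ≠ t → blk Y s t' = 0) :
    Y.mulVecLin.range.map (projBlock s) = (blk Y s t).mulVecLin.range := by
  ext v
  constructor
  · rintro ⟨_, ⟨w, rfl⟩, rfl⟩
    exact ⟨projBlock t w, (projBlock_mulVec h w).symm⟩
  · rintro ⟨w, rfl⟩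
    obtain ⟨w, rfl⟩ := LinearMap.funLeft_surjective_of_injective K K _ (sigma_mk_injective (i := t)) w
    exact ⟨_, ⟨w, rfl⟩, projBlock_mulVec h w⟩

lemma rank_blockDiagonal' [DecidableEq ι] (M : ∀ s, Mat (κ s) K) : (blockDiagonal' M).rank = ∑ s, (M s).rank := by
  have h0 : ∀ p c, blockDiagonal' M p c ≠ 0 → p.1 = c.1 := fun p c h => by
    by_contra hc
    exact h (blockDiagonal'_apply_ne M p.2 c.2 hc)
  rw [rank_eq_sum_finrank fun p p' c h h' => (h0 p c h).trans (h0 p' c h').symm]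
  refine sum_congr rfl fun s _ => ?_
  rw [map_projBlock_range (t := s) fun t' ht' => ?_]
  · rw [show blk (blockDiagonal' M) s s = M s by
      ext a b; exact Matrix.blockDiagonal'_apply_eq M s a b]
    rfl
  · ext a b
    exact blockDiagonal'_apply_ne M a b (Ne.symm ht')

lemma rank_shift_pow (a i : ℕ) : ((Matrix.of fun r c : Fin a => if (r : ℕ) + 1 = c then (1 : K)
    else 0) ^ i).rank = a - i := by
  have h1 : (Matrix.of fun r c : Fin a => if (r : ℕ) + 1 = c then (1 : K) else 0) ^ i =
      Matrix.of fun r c : Fin a => if (r : ℕ) + i = c then (1 : K) else 0 := by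
    induction i with
    | zero => ext r c; simp [Matrix.one_apply, Fin.ext_iff]
    | succ i ih =>
      rw [pow_succ, ih]
      ext r c
      simp only [Matrix.mul_apply, of_apply, ite_mul, one_mul, zero_mul]
      by_cases h : (r : ℕ) + i < a
      · rw [sum_eq_single ⟨r + i, h⟩]
        · simp [add_assoc]
        · exact fun b _ hb => if_neg fun h' => hb (Fin.ext h'.symm)
        · simp
      · rw [if_neg (by omega)]
        exact sum_eq_zero fun b _ => if_neg (by omega)
  rw [h1]
  set Y : Mat (Fin a) K := Matrix.of fun r c => if (r : ℕ) + i = c then (1 : K) else 0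
  let D : Mat (Fin a) K := Matrix.diagonal fun r => if (r : ℕ) + i < a then 1 else 0
  have hYY : Y * Y.transpose = D := by
    ext r c
    simp only [Y, D, Matrix.mul_apply, of_apply, Matrix.transpose_apply, ite_mul, one_mul, zero_mul, Matrix.diagonal_apply]
    by_cases h : (r : ℕ) + i < a
    · rw [sum_eq_single ⟨r + i, h⟩]
      · simp [h, Fin.ext_iff, eq_comm]
      · exact fun b _ hb => if_neg fun h' => hb (Fin.ext h'.symm)
      · simp
    · simp only [h, if_false, ite_self]
      exact sum_eq_zero fun b _ => if_neg (by omega)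
  have hDY : D * Y = Y := by
    ext r c
    rw [diagonal_mul]
    simp only [Y, of_apply]
    split_ifs with h2 h3 h3 <;> first | omega | simp
  have hD : D.rank = a - i := by
    classical
    rw [Matrix.rank_diagonal]
    have : ∀ r : Fin a, (if (r : ℕ) + i < a then (1 : K) else 0) ≠ 0 ↔ (r : ℕ) < a - i := fun r => by
      split_ifs with h <;> simp <;> omega
    simp only [this]
    rw [Fintype.card_subtype, Fin.card_filter_val_lt]
    omega
  rw [← hD]
  exact le_antisymm (hDY ▸ rank_mul_le_left D Y) (hYY ▸ rank_mul_le_left _ _)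

lemma rank_jordanMatrix_pow {n : ℕ} (m : n.Partition) (i : ℕ) :
    (jordanMatrix K m ^ i).rank = (m.parts.map fun a => a - i).sum := by
  rw [jordanMatrix, ← Matrix.blockDiagonal'_pow, rank_blockDiagonal']
  simp only [Pi.pow_apply, rank_shift_pow]
  conv_rhs => rw [← Multiset.sort_eq m.parts (· ≥ ·)]
  rw [Multiset.map_coe, Multiset.sum_coe, ← List.sum_ofFn]
  congr 1
  exact List.ext_get (by simp) fun j h1 h2 => by simp

lemma Conjugate.pow_rank_le {α β : Type*} [Fintype α] [Fintype β] [DecidableEq α] [DecidableEq β]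
    {A : Mat α K} {B : Mat β K} (h : Conjugate A B) (i : ℕ) : (A ^ i).rank ≤ (B ^ i).rank := by
  obtain ⟨S, T, h1, h2, rfl⟩ := h
  rw [conj_pow_conj h2 h1]
  exact (rank_mul_le_left _ _).trans (Matrix.rank_mul_le_right _ _)

lemma Conjugate.pow_rank_eq {α β : Type*} [Fintype α] [Fintype β] [DecidableEq α] [DecidableEq β]
    {A : Mat α K} {B : Mat β K} (h : Conjugate A B) (i : ℕ) : (A ^ i).rank = (B ^ i).rank := by
  refine le_antisymm (h.pow_rank_le i) ?_
  obtain ⟨S, T, h1, h2, h3⟩ := h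
  refine Conjugate.pow_rank_le ⟨T, S, h2, h1, ?_⟩ i
  rw [h3]
  simp only [Matrix.mul_assoc]
  rw [h2, Matrix.mul_one, ← Matrix.mul_assoc, h2, Matrix.one_mul]

lemma conjugate_jordanMatrix_iff {α : Type*} [Fintype α] [DecidableEq α] {A : Mat α K}
    (hA : IsNilpotent A) {n : ℕ} (m : n.Partition) : Conjugate A (jordanMatrix K m) ↔
      ∀ i, (A ^ i).rank = (m.parts.map fun a => a - i).sum := by
  simp only [← rank_jordanMatrix_pow (K := K)]
  exact ⟨fun h i => h.pow_rank_eq i, conjugate_of_rank_eq hA⟩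

end Ranks

section Partitions

lemma sum_sub_add_sum_sub (m : Multiset ℕ) (a : ℕ) : (m.map fun b => b - a).sum + (m.map fun b => b - (a + 2)).sum =
      2 * (m.map fun b => b - (a + 1)).sum + m.count (a + 1) := by
  induction m using Multiset.induction with
  | empty => simp
  | cons b m ih =>
    simp only [Multiset.map_cons, Multiset.sum_cons, Multiset.count_cons]
    split_ifs <;> omega

lemma multiset_eq_of_sum_sub_eq {m m' : Multiset ℕ} (hm : 0 ∉ m) (hm' : 0 ∉ m')
    (h : ∀ i, (m.map fun a => a - i).sum = (m'.map fun a => a - i).sum) : m = m' := by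
  ext a
  cases a with
  | zero => rw [Multiset.count_eq_zero_of_notMem hm, Multiset.count_eq_zero_of_notMem hm']
  | succ a =>
    have h1 := sum_sub_add_sum_sub m a
    have h2 := sum_sub_add_sum_sub m' a
    simp only [h] at h1
    omega

lemma exists_multiset_of_convex {k : ℕ} {r : ℕ → ℕ} (hk : ∀ i, k ≤ i → r i = 0) (hr : ∀ i, 2 * r (i + 1) ≤ r i + r (i + 2)) :
    ∃ m : Multiset ℕ, 0 ∉ m ∧ ∀ i, (m.map fun a => a - i).sum = r i := by
  classical
  let c : ℕ → ℕ := fun a => r a + r (a + 2) - 2 * r (a + 1)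
  let m : Multiset ℕ := ∑ a ∈ range k, Multiset.replicate (c a) (a + 1)
  have hm : ∀ b ∈ m, ∃ a < k, b = a + 1 := fun b hb => by
    obtain ⟨a, ha, hb⟩ := mem_sum.1 hb
    exact ⟨a, mem_range.1 ha, Multiset.eq_of_mem_replicate hb⟩
  have hc : ∀ a < k, m.count (a + 1) = c a := fun a ha => by
    rw [Multiset.count_sum', sum_eq_single a]
    · exact Multiset.count_replicate_self _ _
    · exact fun b _ hb => by rw [Multiset.count_replicate, if_neg (by lia)]
    · exact fun h => (h (mem_range.2 ha)).elim
  have hlarge : ∀ i, k ≤ i → (m.map fun a => a - i).sum = r i := fun i hi => by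
    rw [hk i hi]
    refine Multiset.sum_eq_zero fun x hx => ?_
    obtain ⟨b, hb, rfl⟩ := Multiset.mem_map.1 hx
    obtain ⟨a, ha, rfl⟩ := hm b hb
    omega
  refine ⟨m, fun h => ?_, fun i => ?_⟩
  · obtain ⟨a, -, h⟩ := hm 0 h
    omega
  · rcases le_or_gt k i with hi | hi
    · exact hlarge i hi
    · obtain ⟨t, rfl⟩ : ∃ t, i = k - t := ⟨k - i, by omega⟩
      clear hi
      induction t using Nat.strong_induction_on with
      | _ t ih =>
        rcases Nat.eq_zero_or_pos t with rfl | ht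
        · exact hlarge _ le_rfl
        · rcases lt_or_ge k t with hkt | hkt
          · have := ih k hkt
            rwa [Nat.sub_self, ← Nat.sub_eq_zero_of_le hkt.le] at this
          · have h1 := sum_sub_add_sum_sub m (k - t)
            have h2 := ih (t - 1) (by omega)
            rw [show k - (t - 1) = k - t + 1 by omega] at h2
            have h3 : (m.map fun b => b - (k - t + 2)).sum = r (k - t + 2) := by
              rcases Nat.lt_or_ge 1 t with h | h
              · have := ih (t - 2) (by omega)
                rwa [show k - (t - 2) = k - t + 2 by omega] at this
              · exact hlarge _ (by omega)
            rw [h2, h3, hc _ (by omega)] at h1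
            have := hr (k - t)
            simp only [c] at h1
            omega

lemma exists_partition_of_rankData {k : ℕ} {ν : ℕ → ℕ} {d : ℕ → ℕ → ℕ} (hd : d ∈ rankData k ν) :
    ∃ μ : (∑ i ∈ range k, ν i).Partition, d ∈ rankDataOfType k ν μ.parts := by
  obtain ⟨h0, hz, hle, hconv⟩ := hd
  obtain ⟨m, hm, hm'⟩ := exists_multiset_of_convex (k := k) (r := fun i => ∑ j ∈ range (k - i), d i j) (fun i hi => by
      rw [Nat.sub_eq_zero_of_le hi, Finset.sum_range_zero]) (fun i => by
      rcases lt_or_ge (i + 1) k with hi | hi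
      · obtain ⟨t, ht⟩ : ∃ t, k = i + 2 + t := ⟨k - (i + 2), by omega⟩
        rw [show k - (i + 1) = t + 1 by omega, show k - i = t + 1 + 1 by omega,
          show k - (i + 2) = t by omega]
        have h1 : ∑ j ∈ range t, (d (i + 1) j + d (i + 1) (j + 1)) ≤ ∑ j ∈ range t, (d (i + 2) j + d i (j + 1)) :=
          Finset.sum_le_sum fun j hj => hconv i j (by have := mem_range.1 hj; omega)
        rw [Finset.sum_add_distrib, Finset.sum_add_distrib] at h1
        have h2 := sum_range_succ (fun j => d (i + 1) j) t
        have h3 := sum_range_succ' (fun j => d (i + 1) j) t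
        have h4 := sum_range_succ' (fun j => d i j) (t + 1)
        have h5 := sum_range_succ (fun j => d i (j + 1)) t
        have h6 := (hle i 0).trans (min_le_left _ _)
        have h7 := (hle i t).trans (min_le_right _ _)
        omega
      · rw [Nat.sub_eq_zero_of_le hi]
        simp)
  refine ⟨⟨m, fun {a} ha => Nat.pos_of_ne_zero fun h => hm (h ▸ ha), ?_⟩, ⟨h0, hz, hle, hconv⟩, fun i => (hm' i).symm⟩
  have h1 := hm' 0
  simp only [Nat.sub_zero, Multiset.map_id'] at h1
  rw [h1]
  exact sum_congr rfl fun j hj => h0 j (mem_range.1 hj)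

end Partitions

section ChainRank

variable {K : Type*} [Field K] {k : ℕ} {ν : ℕ → ℕ}

lemma chainProd_succ_left {S : Type*} [CommRing S] (N : ∀ i : ℕ, Matrix (Fin (ν i)) (Fin (ν (i + 1))) S) (j i : ℕ) :
    chainProd N j (i + 1) = (N j * chainProd N (j + 1) i).submatrix id (Fin.cast (congrArg ν (by omega))) := by
  have key : ∀ {m b c : ℕ} (h : b = c) (M : Matrix (Fin m) (Fin (ν c)) S), M.submatrix id (Fin.cast (congrArg ν h)) * N b =
      (M * N c).submatrix id (Fin.cast (congrArg ν (congrArg Nat.succ h))) := by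
    rintro m b _ rfl M
    rfl
  induction i with
  | zero =>
    change (1 : Mat (Fin (ν j)) S) * N j = (N j * (1 : Matrix (Fin (ν (j + 1))) (Fin (ν (j + 1))) S)).submatrix id id
    rw [Matrix.one_mul, Matrix.mul_one, Matrix.submatrix_id_id]
  | succ i ih =>
    rw [chainProd, ih, key (by omega), chainProd, Matrix.mul_assoc]

lemma rank_chainProd_succ (N : ∀ i : ℕ, Matrix (Fin (ν i)) (Fin (ν (i + 1))) K) (j i : ℕ) :
    (chainProd N j (i + 1)).rank = (N j * chainProd N (j + 1) i).rank := by
  rw [chainProd_succ_left]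
  exact Matrix.rank_submatrix _ (Equiv.refl _) (finCongr (congrArg ν (by omega)))

/-- The ranks of the products of the matrices of a tuple. -/
def chainRank (y : ChainVar k ν → K) (i j : ℕ) : ℕ :=
  if j + i < k then (chainProd (matN y) j i).rank else 0

lemma chainRank_mem (y : ChainVar k ν → K) : chainRank y ∈ rankData k ν := by
  refine ⟨fun j hj => ?_, fun i j h => if_neg (by omega), fun i j => ?_, fun i j h => ?_⟩
  · rw [chainRank, if_pos (by omega), chainProd, Matrix.rank_one, card_fin]
  · simp only [chainRank]
    split_ifs with h1 h2 h3 h3 <;> try omega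
    rw [le_min_iff]
    refine ⟨rank_mul_le_left _ _, ?_⟩
    rw [rank_chainProd_succ]
    exact Matrix.rank_mul_le_right _ _
  · simp only [chainRank]
    rw [if_pos (by omega), if_pos (by omega), if_pos (by omega), if_pos (by omega),
      rank_chainProd_succ, rank_chainProd_succ _ j (i + 1)]
    exact rank_mul_add_rank_mul_le _ _ _

lemma forall_rank_eq_iff {y : ChainVar k ν → K} {P : ℕ → ℕ → ℕ} (hP : P ∈ rankData k ν) :
    (∀ i j, j + i < k → (chainProd (matN y) j i).rank = P i j) ↔ chainRank y = P := by
  refine ⟨fun h => ?_, ?_⟩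
  · ext i j
    rw [chainRank]
    split_ifs with hij
    exacts [h i j hij, (hP.2.1 i j (by lia)).symm]
  · rintro rfl i j hij
    rw [chainRank, if_pos hij]

end ChainRank

namespace FrobeniusBlocks

open Module Submodule

variable {F : Type*} [Field F] {q n : ℕ} {Φ : Mat (Fin n) F} (B : FrobeniusBlocks q Φ)

lemma blk_nmat_pow_eq_zero {S : Type*} [CommRing S] (y : B.AllVar → S) (a : ℕ) {s t : B.Lab}
    (h : ¬ (s.1 = t.1 ∧ (t.2 : ℕ) = s.2 + a)) : blk (B.nmat y ^ a) s t = 0 := by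
  induction a generalizing t with
  | zero =>
    rw [pow_zero]
    refine blk_one_ne fun hst => h ?_
    subst hst
    exact ⟨rfl, rfl⟩
  | succ a ih =>
    rw [pow_succ, blk_mul]
    refine sum_eq_zero fun u _ => ?_
    by_cases hu : s.1 = u.1 ∧ (u.2 : ℕ) = s.2 + a
    · rw [B.blk_nmat_eq_zero y (fun hut => h ⟨hu.1.trans hut.1, by have := hut.2; omega⟩), Matrix.mul_zero]
    · rw [ih hu, Matrix.zero_mul]

lemma blk_nmat_pow {S : Type*} [CommRing S] (y : B.AllVar → S) (α : Fin B.d) (i a : ℕ) (h : i + a < B.k α) :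
    blk (B.nmat y ^ a) ⟨α, ⟨i, by omega⟩⟩ ⟨α, ⟨i + a, h⟩⟩ = chainProd (matN fun v => y (inl ⟨α, v⟩)) i a := by
  induction a with
  | zero =>
    rw [pow_zero]
    exact blk_one_self _
  | succ a ih =>
    rw [pow_succ, blk_mul, sum_eq_single ⟨α, ⟨i + a, by omega⟩⟩, ih (by omega), chainProd]
    · exact congrArg (fun M => chainProd _ i a * M) (B.blk_nmat_next y α (i + a) h)
    · rintro ⟨β, j⟩ - hu
      rw [B.blk_nmat_pow_eq_zero y a, Matrix.zero_mul]
      rintro ⟨h1, h2⟩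
      dsimp only at h1 h2
      subst h1
      exact hu (by congr 1; exact Fin.ext h2)
    · exact fun h => (h (mem_univ _)).elim

section Field

variable {K : Type*} [Field K] (y : B.AllVar → K)

/-- The ranks attached to a tuple. -/
def ranks (α : Fin B.d) : ℕ → ℕ → ℕ := chainRank fun v => y (inl ⟨α, v⟩)

/-- The component of index `s` of the image of `N ^ a`. -/
def filt (s : B.Lab) (a : ℕ) : Submodule K (Fin (B.ν s.1 s.2) → K) := ((B.nmat y ^ a).mulVecLin.range).map (projBlock s)

lemma finrank_filt (s : B.Lab) (a : ℕ) : finrank K (B.filt y s a) = B.ranks y s.1 a s.2 := by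
  obtain ⟨α, ⟨i, hi⟩⟩ := s
  rw [ranks, chainRank]
  dsimp only
  split_ifs with h
  · rw [filt, map_projBlock_range (t := ⟨α, ⟨i + a, h⟩⟩), B.blk_nmat_pow y α i a h]
    · rfl
    · rintro ⟨β, j⟩ ht
      refine B.blk_nmat_pow_eq_zero y a ?_
      rintro ⟨h1, h2⟩
      dsimp only at h1 h2
      subst h1
      exact ht (by congr 1; exact Fin.ext h2)
  · have h1 : ∀ t, blk (B.nmat y ^ a) ⟨α, ⟨i, hi⟩⟩ t = 0 := by
      rintro ⟨β, j⟩
      refine B.blk_nmat_pow_eq_zero y a ?_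
      rintro ⟨h1, h2⟩
      dsimp only at h1 h2
      subst h1
      have := j.2
      omega
    rw [filt, map_projBlock_range (t := ⟨α, ⟨i, hi⟩⟩) fun t _ => h1 t, h1]
    simp

lemma rank_nmat_pow (i : ℕ) : (B.nmat y ^ i).rank = ∑ α, ∑ j ∈ range (B.k α - i), B.ranks y α i j := by
  rw [rank_eq_sum_finrank fun p p' c h h' => ?_]
  · change ∑ s, finrank K (B.filt y s i) = _
    simp only [B.finrank_filt, sum_sigma]
    refine sum_congr rfl fun α _ => ?_
    rw [← Finset.sum_range fun j => B.ranks y α i j]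
    refine (Finset.sum_subset (Finset.range_mono (Nat.sub_le _ _)) fun j hj hj' => ?_).symm
    rw [mem_range] at hj hj'
    exact if_neg (by omega)
  · have key : ∀ p, (B.nmat y ^ i) p c ≠ 0 → p.1.1 = c.1.1 ∧ (c.1.2 : ℕ) = p.1.2 + i := fun p hp => by
      by_contra hcon
      exact hp (congrFun (congrFun (B.blk_nmat_pow_eq_zero y i hcon) p.2) c.2)
    obtain ⟨⟨α, a⟩, _⟩ := p
    obtain ⟨⟨β, b⟩, _⟩ := p'
    have h1 := key _ h
    have h2 := key _ h'
    have h3 : α = β := h1.1.trans h2.1.symm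
    subst h3
    have h4 : a = b := Fin.ext (by have := h1.2; have := h2.2; dsimp only at *; omega)
    subst h4
    rfl

/-- The preceding label. -/
def prev (s : B.Lab) : B.Lab := ⟨s.1, ⟨s.2 - 1, by have := s.2.2; omega⟩⟩

lemma eq_prev {s t : B.Lab} (h : B.Next s t) : s = B.prev t := by
  obtain ⟨α, i⟩ := s
  obtain ⟨β, j⟩ := t
  obtain ⟨h1, h2⟩ := h
  dsimp only at h1 h2
  subst h1
  rw [prev]
  congr 1
  exact Fin.ext (by dsimp only; omega)

variable {y} in
/-- Tuples with the same ranks are conjugate. -/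
lemma exists_conj {y' : B.AllVar → K} (h : B.ranks y = B.ranks y') :
    ∃ g g' : Mat B.Ix K, IsBlockDiag g ∧ IsBlockDiag g' ∧ g * g' = 1 ∧ g' * g = 1 ∧ B.nmat y * g = g * B.nmat y' := by
  have hnext : ∀ s : B.Lab, (s.2 : ℕ) ≠ 0 → ∀ t ≠ s, ¬ B.Next (B.prev s) t := by
    rintro ⟨α, i⟩ hi ⟨β, j⟩ ht ⟨h1, h2⟩
    dsimp only [prev] at h1 h2 hi
    subst h1
    exact ht (by congr 1; exact Fin.ext (by omega))
  have hmap : ∀ (z : B.AllVar → K) (s : B.Lab), (s.2 : ℕ) ≠ 0 → ∀ a,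
      (B.filt z s a).map (blk (B.nmat z) (B.prev s) s).mulVecLin = B.filt z (B.prev s) (a + 1) := by
    intro z s hs a
    rw [filt, filt, ← map_range_matrix_pow, ← map_comp, ← map_comp]
    congr 1
    refine LinearMap.ext fun w => ?_
    exact (projBlock_mulVec (fun t ht => B.blk_nmat_eq_zero z (hnext s hs t ht)) w).symm
  have h0 : ∀ (z : B.AllVar → K) s, B.filt z s 0 = ⊤ := by
    intro z s
    rw [filt, pow_zero, Matrix.mulVecLin_one, LinearMap.range_id, Submodule.map_top, LinearMap.range_eq_top]
    exact LinearMap.funLeft_surjective_of_injective K K _ sigma_mk_injective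
  obtain ⟨e, he⟩ := exists_graded_equiv (ι := B.Lab) (V := fun s => Fin (B.ν s.1 s.2) → K)
    (V' := fun s => Fin (B.ν s.1 s.2) → K) (p := B.prev) (N := fun s => (blk (B.nmat y') (B.prev s) s).mulVecLin)
    (N' := fun s => (blk (B.nmat y) (B.prev s) s).mulVecLin) (F := B.filt y') (F' := B.filt y)
    (M := n) (h0 y') (h0 y) (fun s => by rw [filt, B.nmat_pow]; simp) (fun s a => Submodule.map_mono (range_matrix_pow_le _ a))
    (fun s a => Submodule.map_mono (range_matrix_pow_le _ a)) (fun s => by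
      by_cases hs : (s.2 : ℕ) = 0
      · left
        have h1 : ¬ B.Next (B.prev s) s := fun h1 => by
          have := h1.2
          simp only [prev] at this
          omega
        rw [B.blk_nmat_eq_zero y h1, B.blk_nmat_eq_zero y' h1]
        simp
      · exact Or.inr fun a => ⟨hmap y' s hs a, hmap y s hs a⟩) (fun s a => by rw [finrank_filt, finrank_filt, h])
  let G : ∀ s : B.Lab, Mat (Fin (B.ν s.1 s.2)) K := fun s =>
    toMatrix' (e s).toLinearMap
  let G' : ∀ s : B.Lab, Mat (Fin (B.ν s.1 s.2)) K := fun s =>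
    toMatrix' (e s).symm.toLinearMap
  have hbd : ∀ M : ∀ s : B.Lab, Mat (Fin (B.ν s.1 s.2)) K, IsBlockDiag (blockDiagonal' M) := fun M s t hst => by
    ext a b
    exact blockDiagonal'_apply_ne M a b hst
  have hself : ∀ (M : ∀ s : B.Lab, Mat (Fin (B.ν s.1 s.2)) K) s, blk (blockDiagonal' M) s s = M s := fun M s => by
    ext a b
    exact Matrix.blockDiagonal'_apply_eq M s a b
  refine ⟨blockDiagonal' G, blockDiagonal' G', hbd G, hbd G', ?_, ?_, ?_⟩
  · rw [← Matrix.blockDiagonal'_mul, ← Matrix.blockDiagonal'_one]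
    congr 1
    ext1 s
    rw [← toMatrix'_comp, comp_symm, toMatrix'_id]
    rfl
  · rw [← Matrix.blockDiagonal'_mul, ← Matrix.blockDiagonal'_one]
    congr 1
    ext1 s
    rw [← toMatrix'_comp, symm_comp, toMatrix'_id]
    rfl
  · refine blk_ext fun s t => ?_
    rw [(hbd G).blk_mul_right, (hbd G).blk_mul_left, hself, hself]
    by_cases hst : B.Next s t
    · obtain rfl := B.eq_prev hst
      have h1 : (blk (B.nmat y) (B.prev t) t).mulVecLin ∘ₗ (e t).toLinearMap =
          (e (B.prev t)).toLinearMap ∘ₗ (blk (B.nmat y') (B.prev t) t).mulVecLin := LinearMap.ext (he t)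
      have h2 := congrArg toMatrix' h1
      rw [toMatrix'_comp, toMatrix'_comp, ← toLin'_apply', ← toLin'_apply', toMatrix'_toLin', toMatrix'_toLin'] at h2
      exact h2
    · rw [B.blk_nmat_eq_zero y hst, B.blk_nmat_eq_zero y' hst, Matrix.zero_mul, Matrix.mul_zero]

end Field

end FrobeniusBlocks

section UnipotentType

variable {p : ℕ} [Fact p.Prime] {ℓ : ℕ} [Fact ℓ.Prime] {L : Type v} [Field L] [Algebra ℚ_[p] L]
  [FinDim ℚ_[p] L] {φ : GalGroup L} {σ : inertia p L}

lemma IsArithFrobenius.exists_degree (hφ : IsArithFrobenius p L φ) :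
    ∃ deg : weilGroup p L φ →* Multiplicative ℤ, ∀ (w : weilGroup p L φ) (k : ℤ) (u : inertia p L),
      (w : GalGroup L) = φ ^ k * u → deg w = ofAdd k := by
  have hn := inertia_normal p (L := L)
  have h1 : ∀ w : weilGroup p L φ, ∃ (k : ℤ) (u : inertia p L), (w : GalGroup L) = φ ^ k * u := by
    intro w
    obtain ⟨y, hy, _, ⟨k, rfl⟩, h⟩ := Subgroup.mem_sup_of_normal_left.1 w.2
    exact ⟨k, ⟨_, hn.conj_mem y hy (φ ^ k)⁻¹⟩, by rw [← h]; group⟩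
  have h2 : ∀ {k l : ℤ} {u u' : inertia p L}, φ ^ k * (u : GalGroup L) = φ ^ l * u' → k = l := by
    intro k l u u' h
    refine sub_eq_zero.1 (hφ.zpow_mem_inertia p ?_)
    have h3 : φ ^ (k - l) = φ ^ l * (u' * (u : GalGroup L)⁻¹) * (φ ^ l)⁻¹ := by
      rw [← mul_assoc, ← h, mul_inv_cancel_right, ← zpow_neg, ← zpow_add, sub_eq_add_neg]
    rw [h3]
    exact hn.conj_mem _ (mul_mem u'.2 (inv_mem u.2)) _
  choose k u hku using h1
  have h3 : ∀ w w', k (w * w') = k w + k w' := fun w w' => by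
    refine h2 (u := u (w * w')) (u' := ⟨_, mul_mem (hn.conj_mem _ (u w).2 (φ ^ k w')⁻¹) (u w').2⟩) ?_
    rw [← hku, coe_mul, hku w, hku w', zpow_add]
    group
  exact ⟨MonoidHom.mk' (fun w => ofAdd (k w)) fun w w' => by
    rw [h3, ofAdd_add], fun w l u' h => congrArg ofAdd (h2 ((hku w).symm.trans h))⟩

lemma matrix_pow_eq_zero {K : Type*} [Field K] {n : ℕ} {N : Mat (Fin n) K} (h : IsNilpotent N) : N ^ n = 0 := by
  have h1 := (Matrix.isNilpotent_charpoly_sub_pow_of_isNilpotent h).eq_zero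
  have h2 := N.aeval_self_charpoly
  rw [sub_eq_zero.1 h1] at h2
  simpa using h2

variable {K : Type*} [Field K] [CharZero K] [Algebra ℚ_[ℓ] K] {n : ℕ}

lemma hasUnipotentType_iff (hφ : IsArithFrobenius p L φ) (hσ : IsTameGenerator p L ℓ σ)
    {t : inertia p L →* Multiplicative ℤ_[ℓ]} (ht : Continuous t) (hsurj : Surjective t)
    (htσ : t σ = ofAdd 1) {ρ : GalGroup L →* GL (Fin n) K}
    {N : Mat (Fin n) K} (hN : N ^ n = 0) (hρ : ∀ u : inertia p L, (ρ u : Mat (Fin n) K) =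
      nilpExp (amap ℚ_[ℓ] K ((t u).toAdd : ℤ_[ℓ]) • N)) (hφN : (ρ φ : Mat (Fin n) K) * N = (residueCard p L : K) • (N * ρ φ))
    (m : n.Partition) : HasUnipotentType (p := p) φ ℓ ρ m ↔ Conjugate N (jordanMatrix K m) := by
  have hn : IsUnit (n.factorial : K) := (cast_ne_zero.2 n.factorial_ne_zero).isUnit
  constructor
  · rintro ⟨t', ht', hsurj', D, hD, hD1, hD2⟩
    have hσW : (σ : GalGroup L) ∈ weilGroup p L φ := Subgroup.mem_sup_left σ.2
    have h1 := hD ⟨σ, hσW⟩ 0 σ (by simp)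
    rw [hD1 _ σ.2, val_one, one_mul, nilpExp_eq_truncExp] at h1
    have h2 := hρ σ
    rw [htσ, toAdd_ofAdd, PadicInt.coe_one, map_one, one_smul, nilpExp_eq_truncExp] at h2
    set c : K := amap ℚ_[ℓ] K ((t' σ).toAdd : ℤ_[ℓ]) with hc
    have hDn := matrix_pow_eq_zero D.nilpotent_N
    have h3 : N = c • D.N := by
      rw [← truncLog_truncExp hn (N := N) (by rw [pow_succ, hN, zero_mul]),
        ← truncLog_truncExp hn (N := c • D.N) (by rw [smul_pow, pow_succ D.N, hDn, zero_mul, smul_zero]), ← h2, ← h1]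
    have hc0 : c ≠ 0 := by
      intro h0
      rw [hc, map_eq_zero] at h0
      refine hσ.ne_one p ht' hsurj' ?_
      have : (t' σ).toAdd = 0 := Subtype.ext h0
      rw [← ofAdd_toAdd (t' σ), this, ofAdd_zero]
    rw [conjugate_jordanMatrix_iff ⟨n, hN⟩]
    intro i
    rw [← (conjugate_jordanMatrix_iff D.nilpotent_N m).1 hD2 i, h3, smul_pow,
      Matrix.rank_smul_of_mem_nonZeroDivisors _ (mem_nonZeroDivisors_of_ne_zero (pow_ne_zero i hc0))]
  · intro h
    obtain ⟨deg, hdeg⟩ := hφ.exists_degree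
    have hdegI : ∀ w : weilGroup p L φ, (w : GalGroup L) ∈ inertia p L → (zpowersHom _ (ρ φ)).comp deg w = 1 := fun w hw => by
      rw [comp_apply, hdeg w 0 ⟨w, hw⟩ (by simp)]
      simp
    let D : WeilDeligneRep p L φ n K :=
      { r := (zpowersHom _ (ρ φ)).comp deg
        N := N
        continuous_r := ⟨⊤, isOpen_univ, fun w hw _ => hdegI w hw⟩
        nilpotent_N := ⟨n, hN⟩
        inertia_comm := fun w hw => by rw [hdegI w hw, val_one, one_mul, mul_one]
        frobenius_comm := fun w hw => by
          rw [comp_apply, hdeg w 1 1 (by simp [hw])]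
          simpa using hφN }
    refine ⟨t, ht, hsurj, D, fun w k u hw => ?_, hdegI, h⟩
    rw [hw, map_mul, val_mul, hρ, map_zpow]
    congr 2
    rw [show D.r w = zpowersHom _ (ρ φ) (deg w) from rfl, hdeg w k u hw]
    simp

end UnipotentType

section UniversalInertia

variable {p : ℕ} [Fact p.Prime] {ℓ : ℕ} [Fact ℓ.Prime] {L : Type v} [Field L] [Algebra ℚ_[p] L]
  [FinDim ℚ_[p] L] {O : Type u} [CommRing O] [IsLocalRing O] {n : ℕ}
  {φ : GalGroup L} {σ : inertia p L}
  {rbar : GalGroup L →* GL (Fin n) (ResF O)}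
  {B : FrobeniusBlocks (residueCard p L) (rbar φ : Mat (Fin n) (ResF O))}
  {R : Type u} [CommRing R] [IsLocalRing R] [Algebra O R] [IsLocalHom (amap O R)]

lemma isOpen_ker_toZModPow {t : inertia p L →* Multiplicative ℤ_[ℓ]} (ht : Continuous t) (s : ℕ) :
    IsOpen (((toMultiplicative (toZModPow (p := ℓ) s).toAddMonoidHom).comp t).ker : Set (inertia p L)) := by
  have h1 : IsOpen {z : ℤ_[ℓ] | toZModPow s z = 0} := by
    have : {z : ℤ_[ℓ] | toZModPow s z = 0} = Metric.closedBall 0 ((ℓ : ℝ) ^ (-(s : ℤ))) := by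
      ext z
      rw [Set.mem_ofPred_eq, ← RingHom.mem_ker, ker_toZModPow, mem_closedBall_zero_iff, PadicInt.norm_le_pow_iff_mem_span_pow]
    rw [this]
    exact IsUltrametricDist.isOpen_closedBall _ (zpow_ne_zero _ (cast_ne_zero.2 (Fact.out : ℓ.Prime).ne_zero))
  exact h1.preimage ht

/-- The action of inertia through a lift with values in a finite ring. -/
lemma IsTameResidual.inertia_mul_frame_of_finite (H : IsTameResidual ℓ φ σ rbar) (C : B.Lift)
    [Finite R] (hm : IsNilpotent (maxId R)) (ι : ℤ_[ℓ] →+* R)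
    {t : inertia p L →* Multiplicative ℤ_[ℓ]} (ht : Continuous t) (htσ : t σ = ofAdd 1) {y : B.AllVar → R}
    {r : GalGroup L →* GL (Fin n) R} (hr : OpenKer r) (hres : mapGL (residue R) r = mapGL (Res(O, R)) rbar)
    (h : C.Matches σ r y) (u : inertia p L) : (r u : Mat (Fin n) R) * C.frame y =
      C.frame y * truncExp R n (ι (t u).toAdd • B.nmat y) := by
  obtain ⟨a, ha⟩ := H.ell_pow hm
  obtain ⟨b, hb⟩ := H.exists_pow_of_lift hm hres σ.2
  have hab : r σ ^ (ℓ ^ (a + b)) = 1 := by rw [add_comm, pow_add, pow_mul, hb, one_pow]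
  have h1 := H.tame.apply_eq_pow p (f := r.comp (inertia p L).subtype) (hr.preimage continuous_subtype_val)
    (fun g hg => mem_ker.2 (H.wild_of_lift hm hr hres g hg)) hab (isOpen_ker_toZModPow ht (a + b)) (by
      rw [comp_apply, htσ]
      change ofAdd (toZModPow (a + b) (1 : ℤ_[ℓ])) = _
      rw [map_one]) u
  obtain ⟨c, hc⟩ : ∃ c : ℕ, c = (toZModPow (a + b) (t u).toAdd).val := ⟨_, rfl⟩
  change r u = r σ ^ (toZModPow (a + b) (t u).toAdd).val at h1
  rw [← hc] at h1
  have h2 : ι (t u).toAdd = (c : R) := by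
    have : NeZero (ℓ ^ (a + b)) := ⟨pow_ne_zero _ (Fact.out : ℓ.Prime).ne_zero⟩
    have h3 : (t u).toAdd - (c : ℤ_[ℓ]) ∈ ker (toZModPow (p := ℓ) (a + b)) := by
      rw [RingHom.mem_ker, map_sub, map_natCast, hc, ZMod.natCast_zmod_val, sub_self]
    rw [ker_toZModPow, Ideal.mem_span_singleton] at h3
    obtain ⟨e, he⟩ := h3
    have h4 := congrArg ι he
    rw [map_sub, map_natCast, map_mul, map_pow, map_natCast, pow_add, ha, zero_mul, zero_mul, sub_eq_zero] at h4
    exact h4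
  have hN1 : B.nmat y ^ (n + 1) = 0 := by rw [pow_succ, B.nmat_pow, zero_mul]
  rw [h2, truncExp_natCast_smul H.factorial_algebra hN1, h1, val_pow_eq_pow_val]
  clear hc h1 h2
  induction c with
  | zero => rw [pow_zero, pow_zero, Matrix.one_mul, Matrix.mul_one]
  | succ c ih => rw [pow_succ, Matrix.mul_assoc, h.2, ← Matrix.mul_assoc, ih, Matrix.mul_assoc, pow_succ]

/-- The action of inertia through the universal lift. -/
lemma IsTameResidual.inertia_mul_frame (H : IsTameResidual ℓ φ σ rbar) (C : B.Lift)
    {ρ : GalGroup L →* GL (Fin n) R} (hR : IsFramedDeformationRing rbar R ρ)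
    (ι : ℤ_[ℓ] →+* R) {t : inertia p L →* Multiplicative ℤ_[ℓ]} (ht : Continuous t)
    (htσ : t σ = ofAdd 1) {y : B.AllVar → R} (h : C.Matches σ ρ y) (u : inertia p L) : (ρ u : Mat (Fin n) R) * C.frame y =
      C.frame y * truncExp R n (ι (t u).toAdd • B.nmat y) := by
  have := hR.noetherian
  have := hR.complete
  have := H.finite
  refine matrix_eq_of_forall_mk_eq fun k => ?_
  have hA := hR.residueField.quotient (maxId R ^ (k + 1))
  have hm := isNilpotent_maximalIdeal_quotient (R := R) k
  have := hA.finite hm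
  let f : R →ₐ[O] R ⧸ maxId R ^ (k + 1) := mkₐ O _
  have h1 := H.inertia_mul_frame_of_finite C hm ((f : R →+* _).comp ι) ht htσ
    (isOpen_ker_mapGL hA hm f hR.lift.2) (residue_mapGL hA f hR.lift.1) (matches_map C H f h) u
  have h2 : (C.frame y).map (modId (maxId R ^ (k + 1))) = C.frame (f ∘ y) := frame_map C f y
  have h4 := ringHom_truncExp (n := n) H.factorial_algebra (f : R →+* R ⧸ maxId R ^ (k + 1))
    (f : R →+* R ⧸ maxId R ^ (k + 1)).mapMatrix (mapMatrix_algebraMap (ι := B.Ix) _) (ι (t u).toAdd • B.nmat y)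
  rw [mapMatrix_apply, mapMatrix_apply, Matrix.map_smul' (f : R →+* R ⧸ maxId R ^ (k + 1)) _ _ (map_mul _), B.nmat_map] at h4
  rw [Matrix.map_mul, Matrix.map_mul, h2]
  exact h1.trans (congrArg _ h4.symm)

end UniversalInertia

section TypeOfPoint

variable {p : ℕ} [Fact p.Prime] {ℓ : ℕ} [Fact ℓ.Prime] {L : Type v} [Field L] [Algebra ℚ_[p] L]
  [FinDim ℚ_[p] L] {O : Type u} [CommRing O] [IsLocalRing O] {n : ℕ}
  {φ : GalGroup L} {σ : inertia p L}
  {rbar : GalGroup L →* GL (Fin n) (ResF O)}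
  {B : FrobeniusBlocks (residueCard p L) (rbar φ : Mat (Fin n) (ResF O))}
  {R : Type u} [CommRing R] [IsLocalRing R] [Algebra O R] [IsLocalHom (amap O R)]
  {K : Type*} [Field K] [CharZero K] [Algebra ℚ_[ℓ] K] [Algebra O K]

/-- The inertial type of a point of the deformation ring is given by the ranks of the powers of the
nilpotent matrix of the point. -/
lemma IsTameResidual.hasUnipotentType_mapGL_iff (H : IsTameResidual ℓ φ σ rbar) (C : B.Lift)
    {ρ : GalGroup L →* GL (Fin n) R} (hR : IsFramedDeformationRing rbar R ρ)
    {ι : ℤ_[ℓ] →+* O} (hι : ∀ z, amap O K (ι z) = amap ℚ_[ℓ] K z) {y : B.AllVar → R}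
    (hy : FrobeniusBlocks.Lift.Reduces (basePoint B σ) y) (hch : Chain(B, y)) (h : C.Matches σ ρ y) (x : R →ₐ[O] K)
    (m : n.Partition) : HasUnipotentType (p := p) φ ℓ (mapGL (x : R →+* K) ρ) m ↔
      ∀ i, (B.nmat (x ∘ y) ^ i).rank = (m.parts.map fun a => a - i).sum := by
  obtain ⟨t, ht, hsurj, htσ⟩ := H.frob.exists_tameChar p H.ne H.tame
  have hunit : IsUnit (1 + B.tmat y) := by
    refine FrobeniusBlocks.isUnit_of_residue_eq_one ?_
    have h1 : (B.tmat y).map (residue R) = 0 := by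
      ext i j; exact (residue_eq_zero_iff _).2 (hy.tmat_mem i j)
    rw [← mapMatrix_apply, map_add, map_one, mapMatrix_apply, h1, add_zero]
  obtain ⟨v, hv⟩ := hunit
  set P := C.frame (x ∘ y) with hP
  set Pi : Matrix B.Ix (Fin n) K := ((↑v⁻¹ : Mat B.Ix R) * C.Tinv.map (amap O R)).map x with hPi
  have h1 : P * Pi = 1 := by
    rw [hP, ← frame_map C x y, hPi, ← Matrix.map_mul, FrobeniusBlocks.Lift.frame, ← hv,
      Matrix.mul_assoc, ← Matrix.mul_assoc (v : Mat B.Ix R), Units.mul_inv, Matrix.one_mul,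
      T_mul_Tinv_map, Matrix.map_one _ (map_zero _) (map_one _)]
  have h2 : Pi * P = 1 := by
    rw [hP, ← frame_map C x y, hPi, ← Matrix.map_mul, Matrix.mul_assoc, Tinv_mul_frame, ← hv,
      inv_mul, Matrix.map_one _ (map_zero _) (map_one _)]
  let c : Mat B.Ix K →ₐ[K] Mat (Fin n) K := ofLinearMap
    { toFun := fun Y => P * Y * Pi
      map_add' := fun Y Y' => by rw [Matrix.mul_add, Matrix.add_mul]
      map_smul' := fun a Y => by rw [Matrix.mul_smul, smul_mul, id_apply] } (by simp [h1]) (fun Y Y' => by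
      change P * (Y * Y') * Pi = P * Y * Pi * (P * Y' * Pi)
      simp only [Matrix.mul_assoc]
      rw [← Matrix.mul_assoc Pi, h2, Matrix.one_mul])
  have hc : ∀ {M : Mat (Fin n) K} {Y : Mat B.Ix K}, M * P = P * Y → M = c Y := by
    intro M Y hM
    change M = P * Y * Pi
    rw [← hM, Matrix.mul_assoc, h1, Matrix.mul_one]
  have hm := matches_map C H x h
  have hnil : c (B.nmat (x ∘ y)) ^ n = 0 := by rw [← map_pow, B.nmat_pow, map_zero]
  have hch' : Chain(B, (x ∘ y)) := by
    have := congrArg (fun M : Mat B.Ix R => M.map (x : R →+* K)) hch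
    simp only [Matrix.map_mul, B.xmat_map, B.nmat_map] at this
    exact this
  rw [hasUnipotentType_iff H.frob H.tame ht hsurj htσ hnil (fun u => ?_) ?_, conjugate_jordanMatrix_iff ⟨n, hnil⟩]
  · refine forall_congr' fun i => ?_
    have h5 : Conjugate (c (B.nmat (x ∘ y))) (B.nmat (x ∘ y)) := ⟨P, Pi, h1, h2, rfl⟩
    rw [h5.pow_rank_eq]
  · rw [mapGL, hc hm.1, ← map_mul, ← map_mul, ← map_smul, (C.mul_nmat_iff H.q_ne_zero _).2 hch']
  · rw [nilpExp_eq_truncExp, ← map_smul, ← map_truncExp]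
    refine hc ?_
    have h3 := H.inertia_mul_frame C hR ((amap O R).comp ι) ht htσ h u
    have h4 := congrArg (fun M : Matrix (Fin n) B.Ix R => M.map x) h3
    have h5 := ringHom_truncExp (n := n) H.factorial_algebra (x : R →+* K)
      (x : R →+* K).mapMatrix (mapMatrix_algebraMap (ι := B.Ix) _) ((amap O R).comp ι (t u).toAdd • B.nmat y)
    rw [mapMatrix_apply, mapMatrix_apply, Matrix.map_smul' (x : R →+* K) _ _ (map_mul _), B.nmat_map] at h5
    have h6 : (x : R →+* K) ((amap O R).comp ι (t u).toAdd) = amap ℚ_[ℓ] K ((t u).toAdd : ℤ_[ℓ]) := (x.commutes _).trans (hι _)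
    rw [h6] at h5
    simp only [Matrix.map_mul, frame_map] at h4
    exact h4.trans (congrArg _ h5)

end TypeOfPoint

/-- The ideal of polynomials over `O` that vanish on a set of `K`-points. -/
def vanIdeal (O : Type*) [CommRing O] {V K : Type*} [Field K] [Algebra O K] (Z : Set (V → K)) :
    Ideal (MvPoly V O) := ⨅ y ∈ Z, ker (aeval (R := O) y)

lemma mem_vanIdeal {O : Type*} [CommRing O] {V K : Type*} [Field K] [Algebra O K]
    {Z : Set (V → K)} {p : MvPoly V O} : p ∈ vanIdeal O Z ↔ ∀ y ∈ Z, aeval y p = 0 := by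
  simp only [vanIdeal, mem_iInf, RingHom.mem_ker]

namespace FrobeniusBlocks

variable {F : Type*} [Field F] {q n : ℕ} {Φ : Mat (Fin n) F} (B : FrobeniusBlocks q Φ)

variable {B} in
lemma isBlockDiag_of_mul {S : Type*} [CommRing S] [IsDomain S] {g g' : Mat B.Ix S} {d : S}
    (hg : IsBlockDiag g) (hd : d ≠ 0) (h1 : g * g' = d • 1) (h2 : g' * g = d • 1) : IsBlockDiag g' := by
  intro s t hst
  let D : Mat B.Ix S := Matrix.diagonal fun p => if p.1 = s then 1 else 0
  have h3 : D * g = g * D := by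
    ext a b
    rw [diagonal_mul, mul_diagonal]
    by_cases h : a.1 = b.1
    · rw [h, mul_comm]
    · rw [show g a b = 0 from congrFun (congrFun (hg _ _ h) a.2) b.2, mul_zero, zero_mul]
  have h4 : d • (g' * D) = d • (D * g') := by
    rw [← mul_one (g' * D), ← mul_smul_comm, ← h1, ← mul_assoc, mul_assoc g', h3, ← mul_assoc, h2,
      smul_mul_assoc, smul_mul_assoc, one_mul]
  have h5 := smul_right_injective _ hd h4
  ext a b
  have h6 := congrFun (congrFun h5 ⟨s, a⟩) ⟨t, b⟩
  rw [diagonal_mul, mul_diagonal, if_pos rfl, if_neg hst.symm, mul_zero, one_mul] at h6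
  exact h6.symm

variable {K : Type*} [Field K]

/-- The points of the chain scheme with given ranks. -/
def stratum (c : Fin B.d → ℕ → ℕ → ℕ) : Set (B.AllVar → K) :=
  {y | Chain(B, y) ∧ B.ranks y = c}

variable {B} in
lemma ranks_eq_of_conj {y y' : B.AllVar → K} {g g' : Mat B.Ix K} {c : K} (hc : c ≠ 0) (hg : IsBlockDiag g) (h : g * g' = 1)
    (hN : B.nmat y * g = c • (g * B.nmat y')) : B.ranks y = B.ranks y' := by
  have hpow : ∀ a, B.nmat y ^ a * g = c ^ a • (g * B.nmat y' ^ a) := fun a => by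
    induction a with
    | zero => simp
    | succ a ih => rw [pow_succ, mul_assoc, hN, mul_smul_comm, ← mul_assoc, ih, smul_mul_assoc,
        mul_assoc, ← pow_succ, smul_smul, ← pow_succ']
  have hu : ∀ s, IsUnit (blk g s s).det := fun s => by
    rw [← Matrix.isUnit_iff_isUnit_det]
    refine of_mul_eq_one (blk g' s s) ?_
    rw [← hg.blk_mul_left, h, blk_one_self]
  funext α i j
  rw [ranks, ranks, chainRank, chainRank]
  split_ifs with hij
  · rw [← B.blk_nmat_pow y α j i hij, ← B.blk_nmat_pow y' α j i hij]
    have h1 := congrArg (fun M => blk M ⟨α, ⟨j, by omega⟩⟩ ⟨α, ⟨j + i, hij⟩⟩) (hpow i)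
    simp only [blk_smul, hg.blk_mul_left, hg.blk_mul_right] at h1
    rw [← Matrix.rank_mul_eq_left_of_isUnit_det _ _ (hu _)]
    refine (congrArg Matrix.rank h1).trans ?_
    rw [Matrix.rank_smul_of_mem_nonZeroDivisors _ (mem_nonZeroDivisors_of_ne_zero (pow_ne_zero _ hc)),
      Matrix.rank_mul_eq_right_of_isUnit_det _ _ (hu _)]
  · rfl

variable {B} in
lemma exists_param [IsAlgClosed K] (y₀ : B.AllVar → K) : ∃ (r : ℕ) (ψ : B.AllVar → MvPoly (B.AllVar ⊕ Fin r) K)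
      (h : MvPoly (B.AllVar ⊕ Fin r) K), h ≠ 0 ∧ (∀ w, eval w h ≠ 0 → (fun v => eval w (ψ v)) ∈ B.stratum (B.ranks y₀)) ∧
      ∀ y ∈ B.stratum (B.ranks y₀), ∃ w, y = fun v => eval w (ψ v) := by
  classical
  let W : Submodule K (Mat B.Ix K) :=
    { carrier := {X | IsBlockDiag X ∧ X * B.nmat y₀ = B.nmat y₀ * X}
      add_mem' := fun {X Y} hX hY => ⟨fun s t h => by rw [blk_add, hX.1 s t h, hY.1 s t h, add_zero],
        by rw [add_mul, mul_add, hX.2, hY.2]⟩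
      zero_mem' := ⟨fun _ _ _ => rfl, by rw [zero_mul, mul_zero]⟩
      smul_mem' := fun c X hX => ⟨fun s t h => by rw [blk_smul, hX.1 s t h, smul_zero],
        by rw [smul_mul_assoc, hX.2, mul_smul_comm]⟩ }
  let b := finBasis K W
  let P := MvPoly (B.AllVar ⊕ Fin (Module.finrank K W)) K
  let cC : Mat B.Ix K → Mat B.Ix P := fun M => M.map mvC
  let u : B.AllVar → P := fun v => .X (.inl v)
  let g : Mat B.Ix P := B.xmat u
  let X' : Mat B.Ix P := ∑ j, (mvX (.inr j) : P) • cC (b j).1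
  have hev : ∀ (w) (M : Mat B.Ix K), (cC M).map (eval w) = M := fun w M => by
    ext; simp [cC]
  have hgw : ∀ w, g.map (eval w) = B.xmat fun v => w (.inl v) := fun w => by
    rw [B.xmat_map]; congr 1; ext v; exact MvPolynomial.eval_X _
  have hXw : ∀ w, X'.map (eval w) = ∑ j, w (.inr j) • (b j).1 := fun w => by
    ext a c
    simp [X', Matrix.sum_apply, cC]
  have hcarr : ∀ w, X'.map (eval w) ∈ W := fun w => by
    rw [hXw]
    exact sum_mem fun j _ => W.smul_mem _ (b j).2
  have hadjw : ∀ w, g.adjugate.map (eval w) = (g.map (eval w)).adjugate := fun w => RingHom.map_adjugate _ _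
  have hsurj : ∀ X t G : Mat B.Ix K, X ∈ W → (∀ s, blk t s s = 0) → IsBlockDiag G →
      ∃ w, g.map (eval w) = G ∧ X'.map (eval w) = X ∧ (B.tmat u).map (eval w) = t := by
    intro X t G hX ht hG
    obtain ⟨z, hz1, -, hz2⟩ := B.exists_point (N := 0) hG (fun _ _ _ => rfl) ht
    refine ⟨elim z (b.repr ⟨X, hX⟩), by rw [hgw, ← hz1]; rfl, ?_, ?_⟩
    · rw [hXw]
      have := congrArg Subtype.val (b.sum_repr ⟨X, hX⟩)
      rwa [coe_finsetSum] at this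
    · rw [B.tmat_map, ← hz2]; congr 1; ext v; exact MvPolynomial.eval_X _
  have hone : IsBlockDiag (1 : Mat B.Ix K) := fun _ _ h => blk_one_ne h
  have hh : g.det ≠ 0 := fun h0 => by
    obtain ⟨w, hw, -, -⟩ := hsurj 0 0 1 W.zero_mem (fun _ => rfl) hone
    have := map_det (eval w) g
    rw [h0, map_zero, mapMatrix_apply, hw, det_one] at this
    exact zero_ne_one this
  have hgb : IsBlockDiag g := B.isBlockDiag_xmat _
  have hgb' : IsBlockDiag g.adjugate := isBlockDiag_of_mul hgb hh (Matrix.mul_adjugate g) (adjugate_mul g)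
  have hcb : ∀ {M : Mat B.Ix K} {s t}, blk M s t = 0 → blk (cC M) s t = 0 := fun h => by
    refine Matrix.ext fun a c => ?_
    exact (congrArg mvC (congrFun (congrFun h a) c)).trans (map_zero _)
  have hXb : IsBlockDiag X' := fun s t hst => by
    refine Matrix.ext fun a c => ?_
    refine (Matrix.sum_apply (⟨s, a⟩ : B.Ix) (⟨t, c⟩ : B.Ix) univ fun j =>
      (mvX (.inr j) : P) • cC (b j).1).trans (sum_eq_zero fun j _ => ?_)
    exact (congrArg ((mvX (.inr j) : P) • ·) (congrFun (congrFun (hcb ((b j).2.1 s t hst)) a) c)).trans (smul_zero _)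
  obtain ⟨ψ, hψX, hψN, hψt⟩ := B.exists_point (X := g * X' * g.adjugate) (N := g * cC (B.nmat y₀) * g.adjugate) (t := B.tmat u)
    (fun s t hst => by rw [hgb'.blk_mul_right, hgb.blk_mul_left, hXb s t hst, Matrix.mul_zero, Matrix.zero_mul])
    (fun s t hst => by rw [hgb'.blk_mul_right, hgb.blk_mul_left,
      hcb (B.blk_nmat_eq_zero y₀ hst), Matrix.mul_zero, Matrix.zero_mul]) (B.blk_tmat_self u)
  have hx : ∀ w, B.xmat (fun v => eval w (ψ v)) = g.map (eval w) * X'.map (eval w) * (g.map (eval w)).adjugate := fun w => by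
    rw [← hadjw, ← Matrix.map_mul, ← Matrix.map_mul, ← hψX, B.xmat_map]; rfl
  have hn : ∀ w, B.nmat (fun v => eval w (ψ v)) = g.map (eval w) * B.nmat y₀ * (g.map (eval w)).adjugate := fun w => by
    rw [← hadjw, ← hev w (B.nmat y₀), ← Matrix.map_mul, ← Matrix.map_mul, ← hψN, B.nmat_map]; rfl
  have ht : ∀ w, B.tmat (fun v => eval w (ψ v)) = (B.tmat u).map (eval w) := fun w => by rw [← hψt, B.tmat_map]; rfl
  refine ⟨_, ψ, g.det, hh, fun w hw => ?_, fun y hy => ?_⟩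
  · rw [map_det, mapMatrix_apply] at hw
    have hGb : IsBlockDiag (g.map (eval w)) := by rw [hgw]; exact B.isBlockDiag_xmat _
    specialize hx w
    specialize hn w
    generalize g.map (eval w) = G at hx hn hw hGb
    have hm : G.adjugate * G = G.det • 1 := adjugate_mul G
    have hmul : ∀ X Y : Mat B.Ix K, G * X * G.adjugate * (G * Y * G.adjugate) =
        G.det • (G * (X * Y) * G.adjugate) := fun X Y => by
      rw [mul_assoc (G * X), ← mul_assoc G.adjugate, ← mul_assoc G.adjugate, hm, smul_mul_assoc,
        one_mul, smul_mul_assoc, mul_smul_comm]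
      simp only [mul_assoc]
    exact ⟨by rw [hx, hn, hmul, hmul, (hcarr w).2], ranks_eq_of_conj hw hGb
      (Matrix.mul_nonsing_inv _ hw.isUnit) (by rw [hn, mul_assoc, hm, mul_smul_comm, mul_one])⟩
  · obtain ⟨G, G', hG, hG', h1, h2, h3⟩ := B.exists_conj hy.2
    have hd : G.det ≠ 0 := fun h0 => by
      have := congrArg Matrix.det h1
      rw [Matrix.det_mul, h0, zero_mul, det_one] at this
      exact zero_ne_one this
    obtain ⟨c, hc⟩ : ∃ c : K, c ^ card B.Ix * G.det = 1 := by
      rcases Nat.eq_zero_or_pos (card B.Ix) with h | h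
      · have := Fintype.card_eq_zero_iff.1 h
        exact ⟨1, by rw [Matrix.det_isEmpty, one_pow, one_mul]⟩
      · obtain ⟨c, hc⟩ := IsAlgClosed.exists_pow_nat_eq G.det⁻¹ h
        exact ⟨c, by rw [hc, inv_mul_cancel₀ hd]⟩
    have hcne : c ≠ 0 ∨ IsEmpty B.Ix := by
      by_contra! hcon
      obtain ⟨rfl, h4⟩ := hcon
      rw [zero_pow Fintype.card_ne_zero, zero_mul] at hc
      exact zero_ne_one hc
    have hGG' : G' * B.nmat y = B.nmat y₀ * G' := by
      rw [← mul_one (B.nmat y), ← h1, ← mul_assoc, ← mul_assoc, mul_assoc G', h3, ← mul_assoc, h2, one_mul]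
    obtain ⟨w, hw1, hw2, hw3⟩ := hsurj (G' * B.xmat y * G) (B.tmat y) (c • G)
      ⟨fun s t hst => by rw [hG.blk_mul_right, hG'.blk_mul_left, B.isBlockDiag_xmat y s t hst,
        Matrix.mul_zero, Matrix.zero_mul], by
        rw [mul_assoc, ← h3, mul_assoc, ← mul_assoc (B.xmat y), hy.1, mul_assoc, ← mul_assoc, hGG']
        simp only [mul_assoc]⟩ (B.blk_tmat_self y) (fun s t h => by rw [blk_smul, hG s t h, smul_zero])
    have hadj : ∀ M : Mat B.Ix K, c • G * M * (c • G).adjugate = G * M * G' := fun M => by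
      rcases hcne with hc0 | hE
      · have : (c • G).adjugate = c⁻¹ • G' := by
          have h5 : (c • G).adjugate * (c • G) = 1 := by
            rw [adjugate_mul, Matrix.det_smul, hc, one_smul]
          rw [← one_mul (c⁻¹ • G'), ← h5, mul_assoc, smul_mul_smul_comm, h1, mul_inv_cancel₀ hc0, one_smul, mul_one]
        rw [this, mul_smul_comm, smul_mul_assoc, smul_mul_assoc, smul_smul, inv_mul_cancel₀ hc0, one_smul]
      · exact Subsingleton.elim _ _
    refine ⟨w, B.point_ext ?_ ?_ (by rw [ht, hw3])⟩
    · rw [hx, hw1, hw2, hadj, mul_assoc, mul_assoc, mul_assoc, h1, ← mul_assoc, ← mul_assoc, h1, one_mul, mul_one]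
    · rw [hn, hw1, hadj, ← h3, mul_assoc, h1, mul_one]

section Disc

variable {ℓ : ℕ} [Fact ℓ.Prime] {E : Type u} [Field E] [Algebra ℚ_[ℓ] E] [FinDim ℚ_[ℓ] E]
  {x : B.AllVar → ResF (integers ℓ E)} {f : DiscRing x}

lemma mem_map_vanIdeal_stratum (c : Fin B.d → ℕ → ℕ → ℕ) (hf : ∀ e : DiscRing x →ₐ[integers ℓ E] AC E,
      (fun v => e (toDisc x (.X v))) ∈ B.stratum c → e f = 0) :
    f ∈ (vanIdeal (integers ℓ E) (B.stratum (K := AC E) c)).map (toDisc x) := by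
  rcases (B.stratum (K := AC E) c).eq_empty_or_nonempty with h | ⟨y₀, -, rfl⟩
  · rw [h, show vanIdeal _ ∅ = ⊤ by simp [vanIdeal], Ideal.map_top]
    trivial
  obtain ⟨r, ψ, h, hh, h1, h2⟩ := exists_param y₀
  obtain ⟨ϖ, hϖ0, hϖ⟩ := exists_uniformizer ℓ E
  refine map_mono (fun p hp => mem_vanIdeal.2 fun y hy => ?_)
    (mem_map_ker_aeval_of_vanishing (F := E) (isValuedClosure_padicAbs ℓ E (AC E))
      (algebraMap_injective _ _) (sub_C_mem_ptIdeal x) hϖ0 hϖ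
      (C_mem_ptIdeal x (hϖ ▸ mem_span_singleton_self ϖ)) ψ h hh f fun e w hw he =>
      hf e ((congrArg (· ∈ B.stratum (B.ranks y₀)) (funext he)).mpr (h1 w hw)))
  obtain ⟨w, rfl⟩ := h2 y hy
  have := congrArg (aeval (R := AC E) w) (show aeval ψ p = 0 from hp)
  rw [map_zero] at this
  rw [← this]
  exact (cfun (comp_aeval (R := integers ℓ E) ψ ((aeval (R := AC E) w).restrictScalars (integers ℓ E))) p).symm

/-- A function on the completion at `x` that vanishes at the points of a union of strata is in the
ideal generated by the polynomials with this property. -/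
lemma mem_map_vanIdeal (Q : (Fin B.d → ℕ → ℕ → ℕ) → Prop) (hf : ∀ (e : DiscRing x →ₐ[integers ℓ E] AC E) (y : B.AllVar → AC E),
      (∀ v, y v = e (toDisc x (.X v))) → Chain(B, y) → Q (B.ranks y) → e f = 0) :
    f ∈ (vanIdeal (integers ℓ E) {y : B.AllVar → AC E | Chain(B, y) ∧ Q (B.ranks y)}).map (toDisc x) := by
  let ι := ∀ (α : Fin B.d) (_ j : Fin (B.k α)), Fin (B.ν α j + 1)
  let ext : ι → Fin B.d → ℕ → ℕ → ℕ := fun c α i j =>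
    if h : j + i < B.k α then c α ⟨i, by omega⟩ ⟨j, by omega⟩ else 0
  have := flat_of_isNoetherian (ptIdeal x)
  refine map_mono (fun p hp => mem_vanIdeal.2 fun y hy => ?_) (mem_map_iInf_of_flat (ι := {c // Q (ext c)})
    (fun c => vanIdeal (integers ℓ E) (B.stratum (K := AC E) (ext c.1)))
    fun c => B.mem_map_vanIdeal_stratum (ext c.1) fun e he => hf e _ (fun _ => rfl) he.1 (by
      rw [he.2]; exact c.2))
  let c : ι := fun α i j => ⟨B.ranks y α i j, by
    rw [ranks, chainRank, lt_succ_iff]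
    split_ifs
    · exact Matrix.rank_le_height _
    · exact Nat.zero_le _⟩
  have hc : B.ranks y = ext c := by
    funext α i j
    by_cases h : j + i < B.k α
    · simp only [ext, dif_pos h, c]
    · simp only [ext, dif_neg h]
      exact if_neg h
  have h1 := hy.2
  rw [hc] at h1
  exact mem_vanIdeal.1 ((mem_iInf.1 hp) ⟨c, h1⟩) y ⟨hy.1, hc⟩

end Disc

end FrobeniusBlocks

section Descent

variable {O : Type*} [CommRing O] [IsDomain O] (E : Type*) [Field E] [Algebra O E]
  [IsFractionRing O E] {K : Type*} [Field K] [Algebra O K] [Algebra E K] [IsScalarTower O E K] [IsGalois E K] [FaithfulSMul O K]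

lemma eq_zero_of_forall_sum_eq_zero {W J : Type*} [Fintype J] {Z : Set (W → K)}
    (hZ : ∀ τ : K ≃ₐ[E] K, ∀ z ∈ Z, τ ∘ z ∈ Z) {c : J → MvPoly W O}
    (hc : LinearIndependent O fun j => modId (vanIdeal O Z) (c j)) (r : J → K)
    (hr : ∀ z ∈ Z, ∑ j, r j * aeval z (c j) = 0) : r = 0 := by
  classical
  obtain ⟨N, hN⟩ : ∃ N, (univ.filter fun j => r j ≠ 0).card ≤ N := ⟨_, le_rfl⟩
  induction N generalizing r with
  | zero => simpa [funext_iff, Finset.filter_eq_empty_iff] using hN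
  | succ N ih =>
    by_contra h0
    obtain ⟨i, hi⟩ := Function.ne_iff.1 h0
    have hfix : ∀ (τ : K ≃ₐ[E] K) j, τ (r j / r i) = r j / r i := fun τ j => by
      rw [← sub_eq_zero]
      refine congrFun (ih (fun j => τ (r j / r i) - r j / r i) (fun z hz => ?_) ?_) j
      · have h1 := congrArg (fun t => τ (t / r i)) (hr _ (hZ τ.symm z hz))
        simp only [Finset.sum_div, zero_div, map_zero, map_sum, mul_div_right_comm _ _ (r i), map_mul] at h1
        have h2 := congrArg (· / r i) (hr z hz)
        simp only [Finset.sum_div, zero_div, mul_div_right_comm _ _ (r i)] at h2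
        have h3 : ∀ j, τ (aeval (τ.symm ∘ z) (c j)) = aeval z (c j) := fun j => by
            have := cfun (comp_aeval (τ.symm ∘ z) ((τ : K →ₐ[E] K).restrictScalars O)) (c j)
            refine this.trans (congrArg (fun y => aeval y (c j)) ?_)
            ext v
            exact τ.apply_symm_apply _
        simp only [h3] at h1
        simp only [sub_mul, Finset.sum_sub_distrib, h1, h2, sub_zero]
      · refine lt_succ_iff.1 (lt_of_lt_of_le (Finset.card_lt_card ?_) hN)
        refine ⟨fun j hj => ?_, fun h => ?_⟩
        · rw [mem_filter] at hj ⊢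
          refine ⟨hj.1, fun hj0 => hj.2 ?_⟩
          rw [hj0, zero_div, map_zero, sub_zero]
        · have := h (mem_filter.2 ⟨mem_univ i, hi⟩)
          rw [mem_filter, div_self hi, map_one, sub_self] at this
          exact this.2 rfl
    choose e he using fun j => mem_bot.1 ((InfiniteGalois.mem_bot_iff_fixed (r j / r i)).2 fun τ => hfix τ j)
    obtain ⟨b, hb⟩ := IsLocalization.exist_integer_multiples_of_finite (nonZeroDivisors O) e
    choose o ho using hb
    have hob : ∀ j, amap O K (o j) = amap O K b * (r j / r i) := fun j => by
      rw [tower O E K, ho, smul_def, map_mul, he, ← tower]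
    have h1 := Fintype.linearIndependent_iff.1 hc o (by
      rw [← map_zero (modId (vanIdeal O Z)),
        show (∑ j, o j • modId (vanIdeal O Z) (c j)) = modId (vanIdeal O Z) (∑ j, o j • c j) by rw [map_sum]; rfl,
        Ideal.Quotient.eq, sub_zero, mem_vanIdeal]
      intro z hz
      rw [map_sum, ← mul_zero (amap O K b / r i), ← hr z hz, mul_sum]
      refine sum_congr rfl fun j _ => ?_
      rw [map_smul, smul_def, hob]
      ring) i
    have h2 := hob i
    rw [h1, map_zero, div_self hi, mul_one] at h2
    exact nonZeroDivisors.coe_ne_zero b (algebraMap_injective O K (by rw [← h2, map_zero]))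

variable (O) in
lemma isTorsionFree_quotient_vanIdeal {W : Type*} (Z : Set (W → K)) : Module.IsTorsionFree O (MvPoly W O ⧸ vanIdeal O Z) := by
  refine ⟨fun o ho => isSMulRegular_iff_right_eq_zero_of_smul.2 fun a ha => ?_⟩
  obtain ⟨a, rfl⟩ := mk_surjective a
  rw [eq_zero_iff_mem, mem_vanIdeal]
  intro z hz
  have h1 : o • a ∈ vanIdeal O Z := eq_zero_iff_mem.1 ha
  have h2 := mem_vanIdeal.1 h1 z hz
  rw [map_smul, smul_def] at h2
  exact (mul_eq_zero.1 h2).resolve_left fun h =>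
    ho.ne_zero (algebraMap_injective O K (h.trans (map_zero _).symm))

lemma exists_split {V W : Type*} [Finite V] {i : W → V} (hi : Injective i)
    (p : MvPoly V O) : ∃ (a : (V →₀ ℕ) → MvPoly V O) (b : (V →₀ ℕ) → MvPoly W O), p = ∑ s ∈ p.support, a s * rename i (b s) ∧
    ∀ (s) (y : V → K) (z : W → K), aeval (extend i z y) (a s) = aeval y (a s) := by
  classical
  have := ofFinite V
  have := Fintype.ofInjective i hi
  refine ⟨fun s => mvC (p.coeff s) * ∏ v ∈ (univ.image i)ᶜ, .X v ^ s v, fun s => ∏ w, .X w ^ s (i w), ?_, fun s y z => ?_⟩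
  · conv_lhs => rw [← p.support_sum_monomial_coeff]
    refine sum_congr rfl fun s _ => ?_
    rw [MvPolynomial.monomial_eq, Finsupp.prod_fintype _ _ fun _ => pow_zero _, mul_assoc, map_prod]
    simp only [map_pow, rename_X]
    rw [← Finset.prod_image (s := univ) (g := i) (f := fun v => MvPolynomial.X (R := O) v ^ s v)
      (fun _ _ _ _ h => hi h), mul_comm (∏ _ ∈ (_)ᶜ, _), Finset.prod_mul_prod_compl]
  · rw [map_mul, map_mul, map_prod, map_prod, aeval_C, aeval_C]
    congr 1
    refine Finset.prod_congr rfl fun v hv => ?_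
    rw [map_pow, map_pow, aeval_X, aeval_X, extend_apply']
    simpa using hv

variable [IsPrincipalIdealRing O]

lemma exists_coeff {V W : Type*} [Finite V] {i : W → V} (hi : Injective i)
    {Z : Set (W → K)} (hZ : ∀ τ : K ≃ₐ[E] K, ∀ z ∈ Z, τ ∘ z ∈ Z) (p : MvPoly V O) : ∃ (J : Finset (MvPoly V O)),
      p ∈ (vanIdeal O Z).map (rename i) ⊔ span J ∧ ∀ y : V → K, (∀ z ∈ Z, aeval (extend i z y) p = 0) →
        ∀ a ∈ J, aeval y a = 0 := by
  classical
  obtain ⟨a, b, hp, ha⟩ := exists_split (O := O) (K := K) hi p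
  let M := Submodule.span O ((p.support.image fun s => modId (vanIdeal O Z) (b s) :
    Finset _) : Set (MvPoly W O ⧸ vanIdeal O Z))
  have := isTorsionFree_quotient_vanIdeal O Z
  have hfin : Module.Finite O M := Module.Finite.span_finset O _
  let B := Module.Free.chooseBasis O M
  choose c hc using fun j => mk_surjective (B j).1
  have hind : LinearIndependent O fun j => modId (vanIdeal O Z) (c j) := by
    simp only [hc]
    exact B.linearIndependent.map' M.subtype (Submodule.ker_subtype M)
  have hrep : ∀ s, ∃ o : Module.Free.ChooseBasisIndex O M → O, s ∈ p.support → b s - ∑ j, o j • c j ∈ vanIdeal O Z := fun s => by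
    by_cases hs : s ∈ p.support
    · have hm : modId (vanIdeal O Z) (b s) ∈ M := subset_span (by simpa using ⟨s, mem_support_iff.1 hs, rfl⟩)
      refine ⟨B.repr ⟨_, hm⟩, fun _ => ?_⟩
      rw [← Ideal.Quotient.eq, map_sum]
      have h1 := congrArg Subtype.val (B.sum_repr ⟨_, hm⟩)
      rw [coe_finsetSum] at h1
      refine h1.symm.trans (sum_congr rfl fun j _ => ?_)
      rw [Submodule.coe_smul, ← hc]
      rfl
    · exact ⟨0, fun h => absurd h hs⟩
  choose o ho using hrep
  let a' : Module.Free.ChooseBasisIndex O M → MvPoly V O := fun j =>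
    ∑ s ∈ p.support, o s j • a s
  have hsum : p = ∑ s ∈ p.support, a s * rename i (b s - ∑ j, o s j • c j) + ∑ j, a' j * rename i (c j) := by
    conv_lhs => rw [hp]
    simp only [a', Finset.sum_mul]
    rw [Finset.sum_comm, ← Finset.sum_add_distrib]
    refine sum_congr rfl fun s _ => ?_
    rw [map_sub, mul_sub, map_sum, mul_sum]
    simp only [map_smul, mul_smul_comm, smul_mul_assoc, sub_add_cancel]
  refine ⟨univ.image a', ?_, fun y hy => ?_⟩
  · rw [hsum]
    refine Ideal.add_mem _ (Ideal.mem_sup_left (sum_mem fun s hs => mul_mem_left _ _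
      (mem_map_of_mem _ (ho s hs)))) (Ideal.mem_sup_right (sum_mem fun j _ =>
      mul_mem_right _ _ (Ideal.subset_span (by simp))))
  · have h1 := eq_zero_of_forall_sum_eq_zero E hZ hind (fun j => aeval y (a' j)) fun z hz => by
      have h2 := hy z hz
      have hext : extend i z y ∘ i = z := funext (hi.extend_apply z y)
      rw [hsum, map_add, map_sum, map_sum, sum_eq_zero fun s hs => ?_, zero_add] at h2
      · rw [← h2]
        refine sum_congr rfl fun j _ => ?_
        rw [map_mul, aeval_rename, hext]
        congr 1
        simp only [a', map_sum, map_smul, ha]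
      · rw [map_mul, aeval_rename, hext, mem_vanIdeal.1 (ho s hs) z hz, mul_zero]
    intro q hq
    obtain ⟨j, -, rfl⟩ := mem_image.1 hq
    exact congrFun h1 j

/-- The ideal of a product of sets stable under the Galois group. -/
lemma mem_iSup_map_vanIdeal [Infinite K] {V ι : Type*} [Finite V] {W : ι → Type*}
    {i : ∀ α, W α → V} (hi : Injective fun s : Σ α, W α => i s.1 s.2)
    {Z : ∀ α, Set (W α → K)} (hZ : ∀ α, ∀ τ : K ≃ₐ[E] K, ∀ z ∈ Z α, τ ∘ z ∈ Z α) (T : Finset ι)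
    {p : MvPoly V O} (hp : ∀ y : V → K, (∀ α ∈ T, y ∘ i α ∈ Z α) → aeval y p = 0) :
    p ∈ ⨆ α ∈ T, (vanIdeal O (Z α)).map (rename (i α)) := by
  classical
  induction T using induction_on generalizing p with
  | empty =>
    have : p = 0 := map_injective _ (algebraMap_injective O K) (MvPolynomial.funext fun y => by
      rw [map_zero, map_zero, eval_map]
      exact hp y (by simp))
    rw [this]
    exact zero_mem _
  | insert β T hβ ih =>
    have hiβ : Injective (i β) := fun w w' h =>
      eq_of_heq (Sigma.mk.inj (hi (a₁ := ⟨β, w⟩) (a₂ := ⟨β, w'⟩) h)).2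
    obtain ⟨J, hJ, hJ0⟩ := exists_coeff E hiβ (hZ β) p
    rw [Finset.iSup_insert]
    refine sup_le_sup_left (span_le.2 fun a ha => ih fun y hy => hJ0 y (fun z hz => ?_) a ha)
      _ hJ
    refine hp _ fun α hα => ?_
    rcases mem_insert.1 hα with rfl | hα
    · rwa [show extend (i α) z y ∘ i α = z from funext (hiβ.extend_apply z y)]
    · convert hy α hα using 1
      ext w
      refine extend_apply' _ _ _ ?_
      rintro ⟨w', h⟩
      have : β = α := congrArg fst (hi (a₁ := ⟨β, w'⟩) (a₂ := ⟨α, w⟩) h)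
      exact hβ (this ▸ hα)

end Descent

section Model

variable {K : Type u} [Field K]

lemma rank_le_rank_map {m n : ℕ} (τ : K ≃+* K) (M : Matrix (Fin m) (Fin n) K) : M.rank ≤ (M.map τ).rank := by
  let j : M.mulVecLin.range →+ (M.map τ).mulVecLin.range :=
    { toFun := fun v => ⟨τ ∘ v.1, by
        obtain ⟨w, hw⟩ := v.2
        exact ⟨τ ∘ w, by rw [← hw]; exact (funext (RingHom.map_mulVec (τ : K →+* K) M w)).symm⟩⟩
      map_zero' := Subtype.ext (funext fun _ => map_zero τ)
      map_add' := fun _ _ => Subtype.ext (funext fun _ => map_add τ _ _) }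
  have h := rank_le_of_surjective_injective τ j τ.surjective
    (fun v w h => Subtype.ext (funext fun a => τ.injective (congrFun (congrArg Subtype.val h) a)))
    (fun r v => Subtype.ext (funext fun a => map_mul τ _ _))
  exact Cardinal.toNat_le_toNat h (Module.rank_lt_aleph0 _ _)

lemma rank_map_ringEquiv {m n : ℕ} (τ : K ≃+* K) (M : Matrix (Fin m) (Fin n) K) : (M.map τ).rank = M.rank := by
  refine le_antisymm ((rank_le_rank_map τ.symm _).trans_eq ?_) (rank_le_rank_map τ M)
  rw [Matrix.map_map]
  congr 1
  ext
  simp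

variable {k : ℕ} {ν : ℕ → ℕ}

lemma matX_map (τ : K ≃+* K) (y : ChainVar k ν → K) (i : ℕ) : matX (τ ∘ y) i = (matX y i).map τ := by
  ext a b
  simp only [matX, of_apply, map_apply]
  split_ifs <;> simp

lemma matN_map (τ : K ≃+* K) (y : ChainVar k ν → K) (i : ℕ) : matN (τ ∘ y) i = (matN y i).map τ := by
  ext a b
  simp only [matN, of_apply, map_apply]
  split_ifs <;> simp

lemma IsChainPoint.map {y : ChainVar k ν → K} (h : IsChainPoint y) (τ : K ≃+* K) : IsChainPoint (τ ∘ y) := fun i hi => by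
  rw [matX_map, matX_map, matN_map, ← Matrix.map_mul, ← Matrix.map_mul, h i hi]

lemma chainRank_map (τ : K ≃+* K) (y : ChainVar k ν → K) : chainRank (τ ∘ y) = chainRank y := by
  have h : ∀ j i, chainProd (matN (τ ∘ y)) j i = (chainProd (matN y) j i).map τ := fun j i => by
    induction i with
    | zero => exact (Matrix.map_one _ (map_zero τ) (map_one τ)).symm
    | succ i ih => rw [chainProd, chainProd, ih, matN_map, ← Matrix.map_mul]
  funext i j
  simp only [chainRank, h, rank_map_ringEquiv]

variable (O : Type u) [CommRing O] [IsDomain O] [IsPrincipalIdealRing O] [Algebra O K]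
  [FaithfulSMul O K] [Infinite K]

/-- The rank conditions defining the type of a partition. -/
def HasType {d n : ℕ} (k : Fin d → ℕ) (m : n.Partition) (c : Fin d → ℕ → ℕ → ℕ) : Prop :=
  ∀ i, ∑ α, ∑ j ∈ range (k α - i), c α i j = (m.parts.map fun a => a - i).sum

lemma zero_notMem_parts {n : ℕ} (m : n.Partition) : 0 ∉ m.parts := fun h =>
  (m.parts_pos h).ne rfl

lemma sum_map_sum {d : ℕ} (μ : Fin d → Multiset ℕ) (i : ℕ) :
    ((∑ α, μ α).map fun a => a - i).sum = ∑ α, ((μ α).map fun a => a - i).sum := by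
  rw [← Multiset.coe_mapAddMonoidHom, map_sum, Multiset.sum_sum]

lemma modelIdeal_eq (E : Type u) [Field E] [Algebra O E] [IsFractionRing O E] [Algebra E K]
    [IsScalarTower O E K] [IsGalois E K] {d n : ℕ} (k : Fin d → ℕ) (ν : Fin d → ℕ → ℕ) (m : n.Partition) :
    modelIdeal k ν O K m = vanIdeal O {y : ProdVar k ν → K |
      (∀ α, IsChainPoint fun v => y ⟨α, v⟩) ∧ HasType k m fun α => chainRank fun v => y ⟨α, v⟩} := by
  have hmem : ∀ (k : ℕ) (ν : ℕ → ℕ) (m : Multiset ℕ) (q : MvPoly (ChainVar k ν) O),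
      q ∈ chainTypeIdeal k ν O K m ↔ q ∈ vanIdeal O {y : ChainVar k ν → K |
        IsChainPoint y ∧ chainRank y ∈ rankDataOfType k ν m} := fun k ν m q => by
    simp only [chainTypeIdeal, componentIdeal, mem_vanIdeal, mem_iInf, RingHom.mem_ker]
    exact ⟨fun h y hy => h _ hy.2 y ⟨hy.1, (forall_rank_eq_iff hy.2.1).2 rfl⟩, fun h P hP y hy =>
      h y ⟨hy.1, by rwa [(forall_rank_eq_iff hP.1).1 hy.2]⟩⟩
  apply le_antisymm
  · intro p hp
    rw [mem_vanIdeal]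
    intro y hy
    choose μ hμ using fun α => exists_partition_of_rankData (chainRank_mem fun v => y ⟨α, v⟩)
    have h1 : ∑ α, (μ α).parts = m.parts := by
      refine multiset_eq_of_sum_sub_eq (fun h => ?_) (zero_notMem_parts m) fun i => ?_
      · obtain ⟨α, -, h⟩ := mem_sum.1 h
        exact zero_notMem_parts _ h
      · rw [sum_map_sum, ← hy.2 i]
        exact sum_congr rfl fun α _ => ((hμ α).2 i).symm
    have h2 := (mem_iInf.1 ((mem_iInf.1 hp) μ)) h1
    refine (iSup_le fun α => map_le_iff_le_comap.2 fun q hq => ?_ :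
      _ ≤ ker (aeval (R := O) y)) h2
    rw [mem_comap, RingHom.mem_ker, aeval_rename]
    exact mem_vanIdeal.1 ((hmem _ _ _ _).1 hq) _ ⟨hy.1 α, hμ α⟩
  · refine fun p hp => mem_iInf.2 fun μ => mem_iInf.2 fun hμ => ?_
    have h1 := mem_iSup_map_vanIdeal (O := O) E (V := ProdVar k ν) (i := fun α => Sigma.mk α) (fun s t h => by simpa using h)
      (Z := fun α => {y : ChainVar (k α) (ν α) → K | IsChainPoint y ∧ chainRank y ∈ rankDataOfType (k α) (ν α) (μ α).parts})
      (fun α τ z hz => ⟨hz.1.map τ.toRingEquiv, by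
        rw [show chainRank (τ ∘ z) = _ from chainRank_map τ.toRingEquiv z]; exact hz.2⟩)
      univ (p := p) fun y hy => mem_vanIdeal.1 hp y ⟨fun α => (hy α (mem_univ α)).1, fun i => by
          rw [← hμ, sum_map_sum]
          exact sum_congr rfl fun α _ => (hy α (mem_univ α)).2.2 i⟩
    simp only [mem_univ, iSup_pos] at h1
    exact iSup_mono (fun α => map_mono fun q hq => (hmem _ _ _ q).2 hq) h1

/-- The ideal of the points of type `m`. -/
lemma map_modelIdeal_eq (E : Type u) [Field E] [Algebra O E] [IsFractionRing O E] [Algebra E K]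
    [IsScalarTower O E K] [IsGalois E K] {F : Type*} [Field F] {q n : ℕ} {Φ : Mat (Fin n) F}
    (B : FrobeniusBlocks q Φ) (m : n.Partition) : (modelIdeal B.k B.ν O K m).map (rename (inl : _ → B.AllVar)) =
    vanIdeal O {y : B.AllVar → K | Chain(B, y) ∧ HasType B.k m (B.ranks y)} := by
  rw [modelIdeal_eq O E]
  apply le_antisymm
  · refine map_le_iff_le_comap.2 fun q hq => mem_vanIdeal.2 fun y hy => ?_
    rw [aeval_rename]
    exact mem_vanIdeal.1 hq _ ⟨(B.commute_iff_isChainPoint y).1 hy.1, hy.2⟩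
  · intro p hp
    have h1 := mem_iSup_map_vanIdeal (O := O) E (ι := Unit) (V := B.AllVar) (i := fun _ => inl)
      (fun s t h => by simpa [Sigma.ext_iff] using h)
      (Z := fun _ => {y : ProdVar B.k B.ν → K | (∀ α, IsChainPoint fun v => y ⟨α, v⟩) ∧
        HasType B.k m fun α => chainRank fun v => y ⟨α, v⟩}) (fun _ τ z hz => ⟨fun α => (hz.1 α).map τ.toRingEquiv, by
        have := hz.2
        rwa [← funext fun α => chainRank_map τ.toRingEquiv fun v => z ⟨α, v⟩] at this⟩)
      univ (p := p) fun y hy => mem_vanIdeal.1 hp y ⟨(B.commute_iff_isChainPoint y).2 (hy () (mem_univ _)).1,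
          (hy () (mem_univ _)).2⟩
    simpa using h1

end Model

section Quot

variable {S T : Type*} [CommRing S] [IsLocalRing S] [IsNoetherianRing S] [CommRing T] {g : S →+* T}

lemma isHausdorff_of_surjective (hg : Surjective g) {I : Ideal T} (hI : I ≤ (maxId S).map g) : IsHausdorff I T := by
  have := isNoetherianRing_of_surjective S T g hg
  refine .of_le_jacobson I T (hI.trans (le_sInf fun p hp => map_le_iff_le_comap.2 ?_))
  have := hp.2
  rw [eq_maximalIdeal (Ideal.comap_isMaximal_of_surjective g hg (K := p))]

lemma isAdicComplete_of_surjective [IsAdicComplete (maxId S) S] (hg : Surjective g) : IsAdicComplete ((maxId S).map g) T := by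
  have h1 := isHausdorff_of_surjective hg le_rfl
  algebraize [g]
  have h2 : IsPrecomplete (maxId S) T := isPrecomplete_of_surjective (Algebra.linearMap S T) hg
  exact { toIsHausdorff := h1, toIsPrecomplete := map_algebraMap_iff.2 h2 }

end Quot

lemma injective_of_dense {P Q : Type*} [CommRing P] [CommRing Q] {𝔪 J : Ideal P} {i : P →+* Q}
    [IsHausdorff (𝔪.map i) Q] (hi : ∀ u : Q, ∃ p, u - i p ∈ 𝔪.map i) (hJ : J ≤ ker i)
    {β : Q →+* AdicC 𝔪 P ⧸ J.map (amap P (AdicC 𝔪 P))} (hβ : ∀ p, β (i p) = modId _ (amap P _ p)) : Injective β := by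
  have hi' : ∀ r (u : Q), ∃ p, u - i p ∈ 𝔪.map i ^ r := fun r => by
    induction r with
    | zero => exact fun u => ⟨0, by simp⟩
    | succ r ih =>
      intro u
      obtain ⟨p, hp⟩ := ih u
      suffices h : ∀ v ∈ 𝔪.map i ^ r, ∃ p ∈ 𝔪 ^ r, v - i p ∈ 𝔪.map i ^ (r + 1) by
        obtain ⟨p', -, hp'⟩ := h _ hp
        exact ⟨p + p', by rwa [map_add, ← sub_sub]⟩
      rw [← Ideal.map_pow]
      intro v hv
      refine span_induction ?_ ⟨0, zero_mem _, by simp⟩ ?_ ?_ hv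
      · rintro _ ⟨p, hp, rfl⟩
        exact ⟨p, hp, by rw [sub_self]; exact zero_mem _⟩
      · rintro v w - - ⟨p, hp, h⟩ ⟨p', hp', h'⟩
        exact ⟨p + p', add_mem hp hp', by rw [map_add, add_sub_add_comm]; exact add_mem h h'⟩
      · rintro w v - ⟨p, hp, h⟩
        obtain ⟨p', hp'⟩ := hi w
        refine ⟨p' * p, mul_mem_left _ _ hp, ?_⟩
        rw [smul_eq_mul, map_mul, show w * v - i p' * i p = w * (v - i p) + i p * (w - i p') by ring]
        refine add_mem (mul_mem_left _ _ h) ?_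
        rw [pow_succ, ← Ideal.map_pow]
        exact mul_mem_mul (mem_map_of_mem _ hp) hp'
  rw [injective_iff_map_eq_zero]
  refine fun u hu => haus (I := 𝔪.map i) inferInstance u fun r => ?_
  rw [SModEq.zero, smul_eq_mul, mul_top]
  obtain ⟨p, hp⟩ := hi' r u
  let π := modId (J ⊔ 𝔪 ^ r)
  let κ : AdicC 𝔪 P →+* P ⧸ (J ⊔ 𝔪 ^ r) := (factor le_sup_right).comp
    (evalₐ 𝔪 r : AdicC 𝔪 P →+* P ⧸ 𝔪 ^ r)
  have hκ : ∀ p, κ (amap P _ p) = π p := fun p => by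
    exact congrArg (factor le_sup_right) ((evalₐ 𝔪 r).commutes p)
  have hκJ : ∀ a ∈ J.map (amap P (AdicC 𝔪 P)), κ a = 0 := by
    have : J.map (amap P (AdicC 𝔪 P)) ≤ ker κ := map_le_iff_le_comap.2 fun a ha => (hκ a).trans
        (eq_zero_iff_mem.2 (Ideal.mem_sup_left ha))
    exact fun a ha => this ha
  let γ := (Ideal.Quotient.lift _ κ hκJ).comp β
  have hγ : ∀ p, γ (i p) = π p := fun p => by
    change Ideal.Quotient.lift _ κ hκJ (β (i p)) = _
    rw [hβ, Ideal.Quotient.lift_mk, hκ]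
  have hγM : 𝔪.map i ^ r ≤ ker γ := by
    rw [← Ideal.map_pow]
    exact map_le_iff_le_comap.2 fun a ha => (hγ a).trans (eq_zero_iff_mem.2 (Ideal.mem_sup_right ha))
  have h1 : γ (u - i p) = 0 := hγM hp
  rw [map_sub, hγ, show γ u = 0 from (congrArg _ hu).trans (map_zero _), zero_sub, neg_eq_zero, eq_zero_iff_mem] at h1
  have h2 : J ⊔ 𝔪 ^ r ≤ (𝔪.map i ^ r).comap i := sup_le (fun a ha => by rw [mem_comap, show i a = 0 from hJ ha]; exact zero_mem _)
      (by rw [← Ideal.map_pow]; exact Ideal.le_comap_map)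
  rw [← sub_add_cancel u (i p)]
  exact add_mem hp (h2 h1)

section PowerSeries

variable {O : Type u} [CommRing O] [IsLocalRing O] [IsNoetherianRing O] {V D : Type} [Finite V]
  [Finite D] (x : V → ResF O) (M : Ideal (MvPoly V O))

lemma ptIdeal_elim_le : ptIdeal (elim x (0 : D → ResF O)) ≤
    (ptIdeal x).map (rename inl) ⊔ span (Set.range fun d => .X (.inr d)) := by
  intro p hp
  let f : MvPoly (V ⊕ D) O →ₐ[O] MvPoly V O := aeval (elim .X 0)
  have h1 : p - rename inl (f p) ∈ span (Set.range fun d : D => (.X (.inr d) : MvPoly (V ⊕ D) O)) := by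
    rw [← Ideal.Quotient.eq]
    have : mkₐ O (span (Set.range fun d : D =>
        (.X (.inr d) : MvPoly (V ⊕ D) O))) =
        (mkₐ O _).comp ((rename inl).comp f) := by
      refine MvPolynomial.algHom_ext fun v => ?_
      rcases v with v | d
      · simp [f]
      · rw [AlgHom.comp_apply, AlgHom.comp_apply, show f (.X (.inr d)) = 0 from aeval_X _ _, map_zero, map_zero]
        exact eq_zero_iff_mem.2 (Ideal.subset_span ⟨d, rfl⟩)
    exact cfun this p
  rw [← sub_add_cancel p (rename inl (f p))]
  refine add_mem (Ideal.mem_sup_right h1) (Ideal.mem_sup_left (mem_map_of_mem _ ?_))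
  rw [RingHom.mem_ker] at hp ⊢
  rw [← hp]
  have : (aeval x).comp f = aeval (elim x (0 : D → ResF O)) :=
    MvPolynomial.algHom_ext fun v => by rcases v with v | d <;> simp [f]
  exact cfun this p

set_option maxHeartbeats 1000000 in
/-- The completion of `M × 𝔸^D` at the point `(x, 0)` is a power series ring over the completion of
`M` at `x`. -/
lemma nonempty_algEquiv_powerSeries : Nonempty ((DiscRing (elim x (0 : D → ResF O)) ⧸
      (M.map (rename (inl : V → V ⊕ D))).map (toDisc (elim x 0))) ≃ₐ[O] MvPowerSeries D (AdicC ((ptIdeal x).map (modId M))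
        (MvPoly V O ⧸ M))) := by
  set z : V ⊕ D → ResF O := elim x 0 with hz
  set J := M.map (rename (R := O) (inl : V → V ⊕ D)) with hJ
  let C := AdicC ((ptIdeal x).map (modId M)) (MvPoly V O ⧸ M)
  have hCN : IsNoetherianRing C := isNoetherianRing_adicCompletion _
  let nC : Ideal C := ((ptIdeal x).map (modId M)).map (amap _ C)
  have hCc : IsAdicComplete nC C := isAdicComplete_self _ (IsNoetherian.noetherian _)
  let S' := DiscRing z ⧸ J.map (toDisc z)
  let g : DiscRing z →+* S' := modId _
  have hg : Surjective g := mk_surjective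
  let 𝔪' : Ideal S' := (maxId (DiscRing z)).map g
  have hS' : IsAdicComplete 𝔪' S' := isAdicComplete_of_surjective hg
  let gP : MvPoly (V ⊕ D) O →+* S' := g.comp (toDisc z)
  have hgP : ∀ p ∈ ptIdeal z, gP p ∈ 𝔪' := fun p hp =>
    mem_map_of_mem _ (algebraMap_mem_discRing z hp)
  have hinl : ∀ p ∈ ptIdeal x, rename inl p ∈ ptIdeal z := fun p hp => by
    rw [RingHom.mem_ker, aeval_rename]
    exact hp
  have hinr : ∀ d, (.X (.inr d) : MvPoly (V ⊕ D) O) ∈ ptIdeal z := fun d => by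
    rw [RingHom.mem_ker, aeval_X]
    rfl
  let β₀ : MvPoly V O ⧸ M →+* S' := Ideal.Quotient.lift M
    (gP.comp (rename inl : MvPoly V O →ₐ[O] _).toRingHom) fun a ha =>
      eq_zero_iff_mem.2 (mem_map_of_mem _ (mem_map_of_mem _ ha))
  have hβ₀ : (ptIdeal x).map (modId M) ≤ 𝔪'.comap β₀ := map_le_iff_le_comap.2 fun p hp => hgP _ (hinl p hp)
  let β₁ : C →+* S' := completionLift β₀ hβ₀
  let β₂ : MvPoly D C →+* S' := eval₂Hom β₁ fun d => gP (.X (.inr d))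
  have hβ₂ : idealOfVars D C ≤ 𝔪'.comap β₂ := by
    rw [idealOfVars, span_le]
    rintro _ ⟨d, rfl⟩
    change β₂ _ ∈ 𝔪'
    rw [eval₂Hom_X']
    exact hgP _ (hinr d)
  let Q := AdicC (idealOfVars D C) (MvPoly D C)
  have hQN : IsNoetherianRing Q := isNoetherianRing_adicCompletion _
  let IQ : Ideal Q := (idealOfVars D C).map (amap _ Q)
  have hQc : IsAdicComplete IQ Q := isAdicComplete_self _ (IsNoetherian.noetherian _)
  let β : Q →+* S' := completionLift β₂ hβ₂
  let cQ : C →+* Q := (amap (MvPoly D C) Q).comp mvC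
  let aC : MvPoly V O →+* C := (amap _ C).comp (modId M)
  let i : MvPoly (V ⊕ D) O →+* Q := eval₂Hom (cQ.comp (aC.comp mvC))
    (elim (fun v => cQ (aC (.X v))) fun d => amap (MvPoly D C) Q (.X d))
  have hir : ∀ p, i (rename inl p) = cQ (aC p) := fun p => by
    have : i.comp (rename inl : MvPoly V O →ₐ[O] _).toRingHom = cQ.comp aC :=
      ringHom_ext (fun o => by simp [i]) fun v => by simp [i]
    exact cfun this p
  have hiX : ∀ d, i (.X (.inr d)) = amap (MvPoly D C) Q (.X d) := fun d => by simp [i]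
  have hβ₁ : ∀ p, β₁ (aC p) = gP (rename inl p) := fun p =>
    completionLift_algebraMap β₀ hβ₀ _
  have hβc : ∀ c, β (cQ c) = β₁ c := fun c =>
    (completionLift_algebraMap β₂ hβ₂ _).trans (eval₂Hom_C _ _ _)
  have hβX : ∀ d, β (amap (MvPoly D C) Q (.X d)) = gP (.X (.inr d)) := fun d =>
    (completionLift_algebraMap β₂ hβ₂ _).trans (eval₂Hom_X' _ _ _)
  have hβi : ∀ p, β (i p) = gP p := fun p => by
    have : β.comp i = gP := ringHom_ext (fun o => by
        rw [← rename_C (inl : V → V ⊕ D), RingHom.comp_apply, hir, hβc, hβ₁]) fun v => by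
        rcases v with v | d
        · rw [← rename_X, RingHom.comp_apply, hir, hβc, hβ₁]
        · rw [RingHom.comp_apply, hiX, hβX]
    exact cfun this p
  have hQ1 : ∀ u : Q, ∃ c, u - cQ c ∈ IQ := fun u => by
    obtain ⟨q, hq⟩ := exists_sub_mem_pow (idealOfVars_fg D C) u 1
    rw [pow_one] at hq
    refine ⟨q.coeff 0, ?_⟩
    rw [← sub_add_sub_cancel u (amap _ Q q)]
    refine add_mem hq ?_
    rw [RingHom.comp_apply, ← map_sub]
    refine mem_map_of_mem _ ?_
    rw [← pow_one (idealOfVars D C), MvPolynomial.mem_pow_idealOfVars_iff']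
    intro e he
    rw [Nat.lt_one_iff, Finsupp.degree_eq_zero_iff] at he
    simp [he]
  have hC1 : ∀ c : C, ∃ o : O, c - aC (mvC o) ∈ nC := fun c => by
    obtain ⟨a, ha⟩ := exists_sub_mem_pow (IsNoetherian.noetherian ((ptIdeal x).map (modId M))) c 1
    rw [pow_one] at ha
    obtain ⟨p, rfl⟩ := mk_surjective a
    obtain ⟨o, ho⟩ := sub_C_mem_ptIdeal x p
    refine ⟨o, ?_⟩
    rw [← sub_add_sub_cancel c (aC p), ← map_sub aC]
    exact add_mem ha (mem_map_of_mem _ (mem_map_of_mem _ ho))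
  have hnC : nC = (ptIdeal x).map aC := Ideal.map_map _ _
  have hIX : ∀ d, amap (MvPoly D C) Q (.X d) ∈ IQ := fun d =>
    mem_map_of_mem _ (Ideal.subset_span ⟨d, rfl⟩)
  have hIle : ∀ N : Ideal Q, (∀ d, amap (MvPoly D C) Q (.X d) ∈ N) → IQ ≤ N :=
    fun N hN => map_le_iff_le_comap.2 (span_le.2 (Set.range_subset_iff.2 hN))
  have hIQM : IQ ≤ (ptIdeal z).map i := hIle _ fun d => by
    rw [← hiX]
    exact mem_map_of_mem _ (hinr d)
  have hi : ∀ u : Q, ∃ p, u - i p ∈ (ptIdeal z).map i := fun u => by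
    obtain ⟨c, hc⟩ := hQ1 u
    obtain ⟨o, ho⟩ := hC1 c
    refine ⟨rename inl (.C o), ?_⟩
    rw [hir, ← sub_add_sub_cancel u (cQ c), ← map_sub]
    rw [hnC] at ho
    refine add_mem (hIQM hc) ((map_le_iff_le_comap.2 fun p hp => ?_ : (ptIdeal x).map aC ≤ ((ptIdeal z).map i).comap cQ) ho)
    rw [mem_comap, mem_comap, ← hir]
    exact mem_map_of_mem _ (hinl p hp)
  have hHaus : IsHausdorff ((ptIdeal z).map i) Q := by
    refine .of_le_jacobson _ Q (le_sInf fun P hP => ?_)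
    have hPm := hP.2
    have h1 : IQ ≤ P := (le_jacobson_bot IQ).trans (sInf_le hP)
    let fld := Ideal.Quotient.field P
    have h2 : Surjective ((modId P).comp cQ) := fun t => by
      obtain ⟨u, rfl⟩ := mk_surjective t
      obtain ⟨c, hc⟩ := hQ1 u
      exact ⟨c, ((Ideal.Quotient.eq (x := u) (y := cQ c)).2 (h1 hc)).symm⟩
    have h3 := RingHom.ker_isMaximal_of_surjective _ h2
    have h4 : nC ≤ ker ((modId P).comp cQ) := (le_jacobson_bot nC).trans (sInf_le ⟨bot_le, h3⟩)
    refine map_le_iff_le_comap.2 ((ptIdeal_elim_le x).trans (sup_le (map_le_iff_le_comap.2 fun p hp => ?_) (span_le.2 ?_)))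
    · rw [hnC] at h4
      have h5 := h4 (mem_map_of_mem _ hp)
      rw [mem_comap, mem_comap, hir]
      exact eq_zero_iff_mem.1 h5
    · rintro _ ⟨d, rfl⟩
      refine h1 ?_
      rw [hiX]
      exact hIX d
  have hinj : Injective β := injective_of_dense hi (map_le_iff_le_comap.2 fun a ha => by
      rw [mem_comap, RingHom.mem_ker, hir]
      rw [show aC a = 0 from (congrArg (amap _ C) (eq_zero_iff_mem.2 ha)).trans (map_zero _), map_zero]) hβi
  have hIS : IQ.map β ≤ 𝔪' := map_le_iff_le_comap.2 <| hIle _ fun d => by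
    rw [mem_comap, hβX]
    exact hgP _ (hinr d)
  let ω := modId (IQ.map β)
  have hω : Surjective (ω.comp g) := mk_surjective.comp hg
  have hgω : ∀ p, (ω.comp g) (toDisc z p) = ω (gP p) := fun _ => rfl
  have hf1 : Surjective (ω.comp β₁) := by
    have : IsHausdorff (nC.map (ω.comp β₁)) (S' ⧸ IQ.map β) := isHausdorff_of_surjective hω <| by
      rw [hnC]
      refine map_le_iff_le_comap.2 (map_le_iff_le_comap.2 fun p hp => ?_)
      rw [mem_comap, mem_comap, RingHom.comp_apply, hβ₁]
      exact mem_map_of_mem (ω.comp g) (algebraMap_mem_discRing z (hinl p hp))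
    refine surjective_of_mk_map_comp_surjective (ω.comp β₁) (I := nC) fun t => ?_
    obtain ⟨t, rfl⟩ := mk_surjective t
    obtain ⟨s, rfl⟩ := hω t
    obtain ⟨p, hp⟩ := exists_sub_mem_pow (IsNoetherian.noetherian _) s 1
    rw [pow_one] at hp
    obtain ⟨o, ho⟩ := sub_C_mem_ptIdeal z p
    refine ⟨aC (.C o), ?_⟩
    have h2 : (ω.comp β₁) (aC (.C o)) = (ω.comp g) (toDisc z (.C o)) := by
      rw [RingHom.comp_apply, hβ₁, rename_C]
      rfl
    refine (Ideal.Quotient.eq.2 ?_).symm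
    rw [h2, ← map_sub, ← sub_add_sub_cancel s (toDisc z p), ← map_sub (toDisc z)]
    refine (map_le_iff_le_comap.2 ?_ : (ptIdeal z).map (toDisc z) ≤
      (nC.map (ω.comp β₁)).comap (ω.comp g)) (add_mem hp (mem_map_of_mem _ ho))
    refine (ptIdeal_elim_le x).trans (sup_le (map_le_iff_le_comap.2 fun p hp => ?_) (span_le.2 ?_))
    · rw [mem_comap, mem_comap, mem_comap, hgω, ← hβ₁, hnC]
      exact mem_map_of_mem (ω.comp β₁) (mem_map_of_mem aC hp)
    · rintro _ ⟨d, rfl⟩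
      simp only [mem_coe, mem_comap]
      rw [hgω, ← hβX, eq_zero_iff_mem.2]
      · exact zero_mem _
      · exact mem_map_of_mem _ (hIX d)
  have hsurj : Surjective β := by
    have : IsHausdorff (IQ.map β) S' := isHausdorff_of_surjective hg hIS
    refine surjective_of_mk_map_comp_surjective β (I := IQ) fun t => ?_
    obtain ⟨c, hc⟩ := hf1 t
    exact ⟨cQ c, by rw [RingHom.comp_apply, hβc]; exact hc⟩
  refine ⟨(AlgEquiv.ofRingEquiv (f := (toAdicCompletionAlgEquiv D C).toRingEquiv.trans
    (RingEquiv.ofBijective β ⟨hinj, hsurj⟩)) fun o => ?_).symm⟩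
  have h1 : amap O (MvPowerSeries D C) o = amap (MvPoly D C) (MvPowerSeries D C) (.C (aC (.C o))) := by
    rw [MvPowerSeries.algebraMap_apply, MvPowerSeries.algebraMap_apply', MvPolynomial.coe_C, MvPowerSeries.map_C]
    rfl
  rw [h1]
  refine (congrArg β ((toAdicCompletionAlgEquiv D C).commutes _)).trans ?_
  exact (hβc _).trans ((hβ₁ _).trans (congrArg gP (rename_C _ _)))

end PowerSeries

section TypeIdeal

variable {p : ℕ} [Fact p.Prime] {ℓ : ℕ} [Fact ℓ.Prime] {L : Type v} [Field L] [Algebra ℚ_[p] L]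
  [FinDim ℚ_[p] L] {O : Type u} [CommRing O] [IsLocalRing O] {n : ℕ}
  {φ : GalGroup L} {σ : inertia p L}
  {rbar : GalGroup L →* GL (Fin n) (ResF O)}
  {B : FrobeniusBlocks (residueCard p L) (rbar φ : Mat (Fin n) (ResF O))}
  {R R' : Type u} [CommRing R] [IsLocalRing R] [Algebra O R] [IsLocalHom (amap O R)] [CommRing R'] [Algebra O R']
  {K : Type u} [Field K] [CharZero K] [Algebra ℚ_[ℓ] K] [Algebra O K]

lemma IsTameResidual.mem_fixedTypeIdeal_iff (H : IsTameResidual ℓ φ σ rbar) (C : B.Lift)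
    {ρ : GalGroup L →* GL (Fin n) R} (hR : IsFramedDeformationRing rbar R ρ)
    {ι : ℤ_[ℓ] →+* O} (hι : ∀ z, amap O K (ι z) = amap ℚ_[ℓ] K z) {y : B.AllVar → R}
    (hy : IsPointRing σ B R y) (h : C.Matches σ ρ y) (m : n.Partition) (e : R ≃ₐ[O] R')
    {ρ' : GalGroup L →* GL (Fin n) R'} (he : mapGL (e : R →+* R') ρ = ρ') (r : R) : e r ∈ fixedTypeIdeal (p := p) φ ℓ O K ρ' m ↔
      ∀ x : R →ₐ[O] K, HasType B.k m (B.ranks (x ∘ y)) → x r = 0 := by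
  subst he
  have htype : ∀ x : R →ₐ[O] K, HasUnipotentType (p := p) φ ℓ (mapGL (x : R →+* K) ρ) m ↔
      HasType B.k m (B.ranks (x ∘ y)) := fun x => by
    rw [H.hasUnipotentType_mapGL_iff C hR hι hy.reduces hy.chain h x m]
    exact forall_congr' fun i => by rw [B.rank_nmat_pow]
  simp only [fixedTypeIdeal, mem_iInf, RingHom.mem_ker, Set.mem_ofPred_eq, ← htype]
  refine ⟨fun h x hx => ?_, fun h x hx => h (x.comp (e : R →ₐ[O] R')) hx⟩
  have h2 := h (x.comp (e.symm : R' →ₐ[O] R)) (by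
    convert hx using 1
    exact mapGL_ext fun a => Matrix.ext fun i j => congrArg x (e.symm_apply_apply _))
  exact (congrArg x (e.symm_apply_apply _)).symm.trans h2

lemma mem_map_vanIdeal_iff [IsNoetherianRing O] {z : B.AllVar → ResF O} (Q : (Fin B.d → ℕ → ℕ → ℕ) → Prop) (s : DiscRing z)
    (hs : (∀ (x : DiscRing z →ₐ[O] K) (y : B.AllVar → K), (∀ v, y v = x (toDisc z (.X v))) →
      Chain(B, y) → Q (B.ranks y) → x s = 0) → s ∈ (vanIdeal O {y : B.AllVar → K | Chain(B, y) ∧ Q (B.ranks y)}).map (toDisc z)) :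
    (∀ x : (DiscRing z ⧸ (IsTameResidual.chainIdeal B).map (toDisc z)) →ₐ[O] K,
      Q (B.ranks (x ∘ fun v => modId _ (toDisc z (.X v)))) → x (modId _ s) = 0) ↔ s ∈ (vanIdeal O {y : B.AllVar → K |
        Chain(B, y) ∧ Q (B.ranks y)}).map (toDisc z) := by
  set I := (IsTameResidual.chainIdeal B).map (toDisc z)
  have hch : ∀ x : DiscRing z →ₐ[O] K, I ≤ ker (x : DiscRing z →+* K) ↔
      B.xmat (fun v => x (toDisc z (.X v))) * B.nmat (fun v => x (toDisc z (.X v))) =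
      B.nmat (fun v => x (toDisc z (.X v))) * B.xmat fun v => x (toDisc z (.X v)) := fun x =>
    map_le_iff_le_comap.trans (IsTameResidual.chainIdeal_le_ker_iff ((x : DiscRing z →+* K).comp (toDisc z)))
  refine ⟨fun h => hs fun x y hy hc ht => ?_, fun h x hx => ?_⟩
  · obtain rfl : y = _ := funext hy
    exact h (liftₐ I x fun a ha => (hch x).2 hc ha) ht
  · let x' := x.comp (mkₐ O I)
    refine (map_le_iff_le_comap.2 fun q hq => ?_ : _ ≤ ker (x' : DiscRing z →+* K)) h
    refine (algHom_algebraMap x' q).trans (mem_vanIdeal.1 hq _ ⟨(hch x').1 fun a ha => ?_, hx⟩)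
    exact (congrArg x (eq_zero_iff_mem.2 ha)).trans (map_zero x)

end TypeIdeal

/-- Renaming the variables of a power series ring. -/
def powerSeriesCongr (O C : Type*) [CommRing O] [CommRing C] [Algebra O C] {D D' : Type*} (ε : D ≃ D') :
    MvPowerSeries D C ≃ₐ[O] MvPowerSeries D' C := AlgEquiv.ofRingEquiv (f := (renameEquiv C ε).toRingEquiv) fun o => by
    have := (renameEquiv C ε).commutes (amap O C o)
    rw [MvPowerSeries.algebraMap_apply, MvPowerSeries.algebraMap_apply] at this ⊢
    exact this

section Main

variable {p ℓ : ℕ} [Fact p.Prime] [Fact ℓ.Prime] {L : Type v} [Field L] [Algebra ℚ_[p] L]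
  [FinDim ℚ_[p] L] {E : Type u} [Field E] [Algebra ℚ_[ℓ] E] [FinDim ℚ_[ℓ] E]
  {n : ℕ} {φ : GalGroup L} {σ : inertia p L}
  {rbar : GalGroup L →* GL (Fin n) (ResF (integers ℓ E))}

lemma IsBanal.isTameResidual (hbanal : IsBanal ℓ (residueCard p L) n) (hφ : IsArithFrobenius p L φ)
    (hσ : IsTameGenerator p L ℓ σ) (hcont : OpenKer rbar) (hwild : ∀ g ∈ tildeWild p L ℓ, rbar g = 1)
    (hunip : ((rbar σ : Mat (Fin n) (ResF (integers ℓ E))) - 1) ^ n = 0) :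
    IsTameResidual ℓ φ σ rbar := by
  have hchar := charP_residueField ℓ E
  have hℓ : ℓ.Prime := Fact.out
  have hq : ¬ ℓ ∣ residueCard p L := fun h => hbanal.1 (Nat.modEq_zero_iff_dvd.2 h)
  have hmem : ∀ m : ℕ, (m : integers ℓ E) ∈ maxId (integers ℓ E) ↔ ℓ ∣ m := fun m => by
    rw [← residue_eq_zero_iff, map_natCast, CharP.cast_eq_zero_iff _ ℓ]
  refine ⟨hφ, hσ, ?_, hcont, hwild, hunip, ?_, fun i h1 h2 h => ?_, ?_, (hmem ℓ).2 dvd_rfl, inferInstance⟩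
  · rintro rfl
    obtain ⟨f, hf, h⟩ := exists_residueCard_eq p L
    exact hq (h ▸ dvd_pow_self p hf.ne')
  · rwa [Ne, CharP.cast_eq_zero_iff _ ℓ]
  · rw [← Nat.cast_pow, ← Nat.cast_one, CharP.natCast_eq_natCast _ ℓ] at h
    exact hbanal.2 i h1 h2 h
  · by_contra h
    have h1 := (hℓ.dvd_factorial).1 ((hmem _).1 h)
    have h2 := hℓ.two_le
    refine hbanal.2 (ℓ - 1) (by omega) (by omega) ?_
    have := pow_totient ((hℓ.coprime_iff_not_dvd.2 hq).symm)
    rwa [Nat.totient_prime hℓ] at this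

set_option maxHeartbeats 1000000 in
lemma IsTameResidual.exists_algEquiv_powerSeries (H : IsTameResidual ℓ φ σ rbar) (B : FrobeniusBlocks (residueCard p L)
      (rbar φ : Mat (Fin n) (ResF (integers ℓ E)))) (m : n.Partition) :
    (∃ (R : Type u) (_ : CommRing R) (_ : IsLocalRing R) (_ : Algebra (integers ℓ E) R) (_ : IsLocalHom (amap (integers ℓ E) R))
      (ρ : GalGroup L →* GL (Fin n) R), IsFramedDeformationRing rbar R ρ) ∧
    ∀ (R : Type u) [CommRing R] [IsLocalRing R] [Algebra (integers ℓ E) R] [IsLocalHom (amap (integers ℓ E) R)]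
      (ρ : GalGroup L →* GL (Fin n) R), IsFramedDeformationRing rbar R ρ →
      Nonempty ((R ⧸ fixedTypeIdeal (p := p) φ ℓ (integers ℓ E) (AC E) ρ m) ≃ₐ[integers ℓ E] MvPowerSeries (Fin B.numVars)
          (CompleteLocalRing B.k B.ν (integers ℓ E) (AC E) m (B.point (unipLog
            (rbar σ : Mat (Fin n) (ResF (integers ℓ E))))))) := by
  obtain ⟨C⟩ := B.nonempty_lift
  let z := IsTameResidual.basePoint B σ
  let I := (IsTameResidual.chainIdeal B).map (toDisc z)
  obtain ⟨_, _, hPR⟩ := IsTameResidual.exists_isPointRing H C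
  obtain ⟨ρ₀, hR₀, hmatch⟩ := hPR.exists_isFramedDeformationRing H C
  refine ⟨⟨_, _, _, _, _, ρ₀, hR₀⟩, fun R _ _ _ _ ρ hR => ?_⟩
  obtain ⟨e, he⟩ := hR₀.exists_algEquiv hR
  let O := integers ℓ E
  let K := AC E
  let g : DiscRing z →ₐ[O] R := (e : (DiscRing z ⧸ I) →ₐ[O] R).comp (mkₐ O I)
  have hg : Surjective g := e.surjective.comp mk_surjective
  let f : DiscRing z →ₐ[O] R ⧸ fixedTypeIdeal (p := p) φ ℓ O K ρ m :=
    (mkₐ O _).comp g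
  have hf : Surjective f := mk_surjective.comp hg
  have : CharZero K := charZero_algebraicClosure ℓ E
  have : IsGalois E K := isGalois_algebraicClosure ℓ E
  have : FaithfulSMul O K := (faithfulSMul_iff_algebraMap_injective O K).2 ((amap E K).injective.comp val_injective)
  have hker : ker f = ((modelIdeal B.k B.ν O K m).map (rename (inl : _ → B.AllVar))).map (toDisc z) := by
    rw [map_modelIdeal_eq O E]
    ext s
    exact eq_zero_iff_mem.trans ((H.mem_fixedTypeIdeal_iff C hR₀
      (ι := padicIntMap ℓ) (fun _ => rfl) hPR hmatch m e he (modId I s)).trans (mem_map_vanIdeal_iff _ s (B.mem_map_vanIdeal _)))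
  obtain ⟨e'⟩ := nonempty_algEquiv_powerSeries (D := B.OffVar) (B.point (unipLog
    (rbar σ : Mat (Fin n) (ResF (integers ℓ E))))) (modelIdeal B.k B.ν O K m)
  let ε : B.OffVar ≃ Fin B.numVars := Fintype.equivFinOfCardEq B.card_offVar
  exact ⟨((Ideal.quotientKerAlgEquivOfSurjective hf).symm.trans (Ideal.quotientEquivAlgOfEq O hker)).trans
    (e'.trans (powerSeriesCongr O _ ε))⟩

end Main

end BanalModel

open BanalModel IsLocalRing in
theorem mainTheorem5 (p ℓ : ℕ) [Fact p.Prime] [Fact ℓ.Prime]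
    (L : Type v) [Field L] [Algebra ℚ_[p] L] [FiniteDimensional ℚ_[p] L]
    (E : Type u) [Field E] [Algebra ℚ_[ℓ] E] [FiniteDimensional ℚ_[ℓ] E]
    (n : ℕ) (hbanal : IsBanal ℓ (residueCard p L) n)
    (φ : GalGroup L) (hφ : IsArithFrobenius p L φ)
    (σ : inertia p L) (hσ : IsTameGenerator p L ℓ σ)
    (rbar : GalGroup L →* Matrix.GeneralLinearGroup (Fin n) (ResidueField (integers ℓ E)))
    (hcont : IsOpen (rbar.ker : Set (GalGroup L)))
    (hwild : ∀ g ∈ tildeWild p L ℓ, rbar g = 1)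
    (hunip : ((rbar σ : Matrix (Fin n) (Fin n) (ResidueField (integers ℓ E))) - 1) ^ n = 0)
    (B : FrobeniusBlocks (residueCard p L)
      (rbar φ : Matrix (Fin n) (Fin n) (ResidueField (integers ℓ E))))
    (m : n.Partition) :
    (∃ (R : Type u) (_ : CommRing R) (_ : IsLocalRing R) (_ : Algebra (integers ℓ E) R)
      (_ : IsLocalHom (algebraMap (integers ℓ E) R))
      (ρ : GalGroup L →* Matrix.GeneralLinearGroup (Fin n) R),
      IsFramedDeformationRing rbar R ρ) ∧
    ∀ (R : Type u) [CommRing R] [IsLocalRing R] [Algebra (integers ℓ E) R]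
      [IsLocalHom (algebraMap (integers ℓ E) R)]
      (ρ : GalGroup L →* Matrix.GeneralLinearGroup (Fin n) R),
      IsFramedDeformationRing rbar R ρ →
      Nonempty ((R ⧸ fixedTypeIdeal (p := p) φ ℓ (integers ℓ E) (AlgebraicClosure E) ρ m)
        ≃ₐ[integers ℓ E]
        MvPowerSeries (Fin B.numVars)
          (CompleteLocalRing B.k B.ν (integers ℓ E) (AlgebraicClosure E) m
            (B.point (unipLog
              (rbar σ : Matrix (Fin n) (Fin n) (ResidueField (integers ℓ E))))))) := by
  exact (hbanal.isTameResidual hφ hσ hcont hwild hunip).exists_algEquiv_powerSeries B m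

end
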